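/- **Setting.** Let $\mathcal N$ be an exact category (in the sense of Quillen). An acyclic complex in $\mathcal N$ is a bounded complex $(P_*,d)$ whose differentials factor as $d_n\colon P_n\twoheadrightarrow J_{n-1}\rightarrowtail P_{n-1}$ with all $J_n\rightarrowtail P_n\twoheadrightarrow J_{n-1}$ short exact. A binary acyclic complex is a graded object $P_*$ with two differentials $d$ (top) and $d'$ (bottom), each of which makes it an acyclic complex; morphisms are degree $0$ maps commuting with both differentials. For $I\subseteq\mathbb Z$ let $B^q_I\mathcal N$ be the category of binary acyclic complexes supported on $I$; with the degreewise short exact sequences it is again exact, so the construction can be iterated. For $n\ge 0$ let $K_0(\Omega^n_I\mathcal N)$ be the quotient of the Grothendieck group $K_0((B^q_I)^n\mathcal N)$ by the classes of all objects whose top and bottom differentials coincide in at least one of the $n$ directions (so $K_0(\Omega_I^0\mathcal N)=K_0(\mathcal N)$). Write $K_0(\Omega^n\mathcal N)$ for $K_0(\Omega^n_{G}\mathcal N)$, where $G=\mathbb Z$ or $G=[0,\infty)$ (the statement holds for both); this is Grayson's algebraic model of $K_n(\mathcal N)$. **Theorem 1.4.** There are homomorphisms $$s_{n,\mathcal N}\colon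 K_0(\Omega^n\mathcal N)\to K_0(\Omega^n_{[0,7]}\mathcal N)\qquad(n\ge 0,\ \mathcal N\text{ an exact category})$$ that are natural in $\mathcal N$ with respect to exact functors and are sections of the canonical maps: the composite of $s_{n,\mathcal N}$ with $K_0(\Omega^n_{[0,7]}\mathcal N)\to K_0(\Omega^n\mathcal N)$ is the identity. Moreover, for $n=1$ they can be chosen such that the following holds. Let $\mathbb P=(P_*,d,d')$ be a binary acyclic complex supported on $[0,m]$, $m\ge 2$, and let $d_k\colon P_k\twoheadrightarrow J_{k-1}\rightarrowtail P_{k-1}$ and $d'_k\colon P_k\twoheadrightarrow K_{k-1}\rightarrowtail P_{k-1}$ be factorizations as above. There exist objects $A_k,B_k,S_k$ $(k\ge 2)$, zero for $k\ge m$, with short exact sequences $A_k\rightarrowtail J_k\oplus S_k\twoheadrightarrow B_k$ and $A_k\rightarrowtail K_k\oplus S_k\twoheadrightarrow B_k$. For every choice of all these data, $$s_{1,\mathcal N}([\mathbb P])=\sum_{k=2}^{m}(-1)^k[\mathbb S_k]\in K_0(\Omega_{[0,7]}\mathcal N),$$ where $\mathbb S_k$ is the following binary acyclic complex supported on $[0,4]$.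 For $k\ge 3$ its objects in degrees $4,3,2,1,0$ are $$A_k,\quad K_k\oplus S_k\oplus J_k,\quad B_k\oplus P_k\oplus A_{k-1},\quad J_{k-1}\oplus K_{k-1}\oplus S_{k-1},\quad B_{k-1};$$ its top differential is the direct sum of $A_k\rightarrowtail K_k\oplus S_k\twoheadrightarrow B_k$ (degrees $4,3,2$), $J_k\rightarrowtail P_k\twoheadrightarrow J_{k-1}$ (degrees $3,2,1$) and $A_{k-1}\rightarrowtail K_{k-1}\oplus S_{k-1}\twoheadrightarrow B_{k-1}$ (degrees $2,1,0$), and its bottom differential is the direct sum of the analogous sequences with $J$ and $K$ exchanged. The complex $\mathbb S_2$ has the objects $$A_2,\quad K_2\oplus S_2\oplus J_2,\quad B_2\oplus P_2,\quad P_1,\quad P_0,$$ its top differential is the direct sum of $A_2\rightarrowtail K_2\oplus S_2\twoheadrightarrow B_2$ and $J_2\rightarrowtail P_2\xrightarrow{d_2}P_1\xrightarrow{d_1}P_0$, and its bottom differential is the direct sum of $A_2\rightarrowtail J_2\oplus S_2\twoheadrightarrow B_2$ and $K_2\rightarrowtail P_2\xrightarrow{d'_2}P_1\xrightarrow{d'_1}P_0$.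 -/

import Mathlib

open CategoryTheory CategoryTheory.Limits

universe v u

namespace GraysonK

/-! ### Categories with a class of short exact sequences, and exact categories -/

/-- A preadditive category with a distinguished class of short sequences `X₁ ⟶ X₂ ⟶ X₃`
(the "conflations"). This is only the data of an exact category, see `IsExact` for the axioms. -/
structure ConflationCategory : Type (max (u + 1) (v + 1)) where
  carrier : Type (max u v)
  [category : Category.{v} carrier]
  [preadditive : Preadditive carrier]
  IsConflation : ShortComplex carrier → Prop

namespace ConflationCategory

instance : CoeSort ConflationCategory.{v, u} (Type (max u v)) := ⟨carrier⟩

instance (N : ConflationCategory.{v, u}) : Category.{v} N := N.category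

instance (N : ConflationCategory.{v, u}) : Preadditive N := N.preadditive

variable (N : ConflationCategory.{v, u})

/-- `A ⟶ B ⟶ C` is one of the distinguished short exact sequences of `N`. -/
def Confl {A B C : N} (i : A ⟶ B) (p : B ⟶ C) : Prop :=
  ∃ w : i ≫ p = 0, N.IsConflation (ShortComplex.mk i p w)

/-- Admissible monomorphisms. -/
def AdmMono {A B : N} (i : A ⟶ B) : Prop := ∃ (C : N) (p : B ⟶ C), N.Confl i p

/-- Admissible epimorphisms. -/
def AdmEpi {B C : N} (p : B ⟶ C) : Prop := ∃ (A : N) (i : A ⟶ B), N.Confl i p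

/-- Exact categories in the sense of Quillen: an additive category with a class of kernel-cokernel
pairs that is closed under isomorphism, such that identities are admissible monomorphisms and
admissible epimorphisms, these two classes are closed under composition, and admissible
monomorphisms (epimorphisms) are stable under pushouts (pullbacks), which exist. -/
class IsExact : Prop where
  hasZeroObject : HasZeroObject N
  hasBinaryBiproducts : HasBinaryBiproducts N
  of_iso : ∀ {S T : ShortComplex N}, (S ≅ T) → N.IsConflation S → N.IsConflation T
  isKernel : ∀ S : ShortComplex N, N.IsConflation S →
    Nonempty (IsLimit (KernelFork.ofι S.f S.zero))
  isCokernel : ∀ S : ShortComplex N, N.IsConflation S →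
    Nonempty (IsColimit (CokernelCofork.ofπ S.g S.zero))
  admMono_id : ∀ A : N, N.AdmMono (𝟙 A)
  admEpi_id : ∀ A : N, N.AdmEpi (𝟙 A)
  admMono_comp : ∀ {A B C : N} (i : A ⟶ B) (j : B ⟶ C),
    N.AdmMono i → N.AdmMono j → N.AdmMono (i ≫ j)
  admEpi_comp : ∀ {A B C : N} (p : A ⟶ B) (q : B ⟶ C),
    N.AdmEpi p → N.AdmEpi q → N.AdmEpi (p ≫ q)
  pushout : ∀ {A B A' : N} (i : A ⟶ B) (f : A ⟶ A'), N.AdmMono i →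
    ∃ (B' : N) (f' : B ⟶ B') (i' : A' ⟶ B'), IsPushout i f f' i' ∧ N.AdmMono i'
  pullback : ∀ {B C C' : N} (p : B ⟶ C) (g : C' ⟶ C), N.AdmEpi p →
    ∃ (B' : N) (g' : B' ⟶ B) (p' : B' ⟶ C'), IsPullback g' p' p g ∧ N.AdmEpi p'

attribute [instance] IsExact.hasZeroObject IsExact.hasBinaryBiproducts

end ConflationCategory

open ConflationCategory

/-- Exact functors: additive functors preserving the distinguished short exact sequences. -/
structure ExactFunctor (M N : ConflationCategory.{v, u}) where
  functor : M ⥤ N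
  [additive : functor.Additive]
  map_conflation : ∀ S : ShortComplex M, M.IsConflation S → N.IsConflation (S.map functor)

attribute [instance] ExactFunctor.additive

/-- The identity functor. -/
def ExactFunctor.id (M : ConflationCategory.{v, u}) : ExactFunctor M M where
  functor := 𝟭 M
  map_conflation _ h := h

theorem ExactFunctor.map_confl {M N : ConflationCategory.{v, u}} (F : ExactFunctor M N)
    {A B C : M} {i : A ⟶ B} {p : B ⟶ C} (h : M.Confl i p) :
    N.Confl (F.functor.map i) (F.functor.map p) :=
  ⟨_, F.map_conflation _ h.2⟩

/-! ### Binary acyclic complexes -/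

/-- For a graded object `X` with maps `d n : X n ⟶ X (n - 1)`: objects `Z n` and factorizations
`X n ↠ Z (n - 1) ↣ X (n - 1)` of `d n` such that all `Z n ↣ X n ↠ Z (n - 1)` are short exact.
In particular `d` is then a differential. -/
structure AcyclicFactorization (M : ConflationCategory.{v, u}) (X : ℤ → M)
    (d : ∀ n, X n ⟶ X (n - 1)) where
  Z : ℤ → M
  p : ∀ n, X n ⟶ Z (n - 1)
  ι : ∀ n, Z n ⟶ X n
  fac : ∀ n, p n ≫ ι (n - 1) = d n
  confl : ∀ n, M.Confl (ι n) (p n)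

/-- A bounded binary acyclic complex in `M`, supported on `S ⊆ ℤ`: a graded object `X` with top
differential `d` and bottom differential `d'`, both of which make `X` an acyclic complex. -/
structure BinaryAcyclicComplex (S : Set ℤ) (M : ConflationCategory.{v, u}) where
  X : ℤ → M
  d : ∀ n, X n ⟶ X (n - 1)
  d' : ∀ n, X n ⟶ X (n - 1)
  acyclic : Nonempty (AcyclicFactorization M X d)
  acyclic' : Nonempty (AcyclicFactorization M X d')
  bounded : ∃ a b : ℤ, ∀ n, n < a ∨ b < n → IsZero (X n)
  supported : ∀ n, n ∉ S → IsZero (X n)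

namespace BinaryAcyclicComplex

variable {S : Set ℤ} {M : ConflationCategory.{v, u}}

theorem d_comp_d (P : BinaryAcyclicComplex S M) (n : ℤ) :
    P.d n ≫ P.d (n - 1) = 0 ∧ P.d' n ≫ P.d' (n - 1) = 0 := by
  obtain ⟨h⟩ := P.acyclic
  obtain ⟨h'⟩ := P.acyclic'
  constructor
  · obtain ⟨w, -⟩ := h.confl (n - 1)
    rw [← h.fac, ← h.fac, Category.assoc, ← Category.assoc (h.ι (n - 1)), w]
    simp
  · obtain ⟨w, -⟩ := h'.confl (n - 1)
    rw [← h'.fac, ← h'.fac, Category.assoc, ← Category.assoc (h'.ι (n - 1)), w]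
    simp

/-- Morphisms are degree `0` maps that commute with the top and with the bottom differential. -/
@[ext]
structure Hom (P Q : BinaryAcyclicComplex S M) : Type v where
  f : ∀ n, P.X n ⟶ Q.X n
  comm : ∀ n, f n ≫ Q.d n = P.d n ≫ f (n - 1)
  comm' : ∀ n, f n ≫ Q.d' n = P.d' n ≫ f (n - 1)

instance : Category.{v} (BinaryAcyclicComplex S M) where
  Hom P Q := Hom P Q
  id P := ⟨fun n => 𝟙 (P.X n), by simp, by simp⟩
  comp f g := ⟨fun n => f.f n ≫ g.f n,
    fun n => by rw [Category.assoc, g.comm, ← Category.assoc, f.comm, Category.assoc],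
    fun n => by rw [Category.assoc, g.comm', ← Category.assoc, f.comm', Category.assoc]⟩
  id_comp f := by ext n; simp
  comp_id f := by ext n; simp
  assoc f g h := by ext n; simp

@[ext]
theorem hom_ext {P Q : BinaryAcyclicComplex S M} {f g : P ⟶ Q} (h : ∀ n, f.f n = g.f n) :
    f = g := Hom.ext (funext h)

@[simp] theorem id_f (P : BinaryAcyclicComplex S M) (n : ℤ) : Hom.f (𝟙 P) n = 𝟙 (P.X n) := rfl

@[simp] theorem comp_f {P Q R : BinaryAcyclicComplex S M} (f : P ⟶ Q) (g : Q ⟶ R) (n : ℤ) :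
    Hom.f (f ≫ g) n = f.f n ≫ g.f n := rfl

variable {P Q : BinaryAcyclicComplex S M}

instance : Zero (P ⟶ Q) := ⟨⟨fun _ => 0, by simp, by simp⟩⟩

instance : Add (P ⟶ Q) := ⟨fun f g => ⟨fun n => f.f n + g.f n,
  fun n => by simp [f.comm, g.comm], fun n => by simp [f.comm', g.comm']⟩⟩

instance : Neg (P ⟶ Q) := ⟨fun f => ⟨fun n => -f.f n,
  fun n => by simp [f.comm], fun n => by simp [f.comm']⟩⟩

instance : Sub (P ⟶ Q) := ⟨fun f g => ⟨fun n => f.f n - g.f n,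
  fun n => by simp [f.comm, g.comm], fun n => by simp [f.comm', g.comm']⟩⟩

instance : SMul ℕ (P ⟶ Q) := ⟨fun k f => ⟨fun n => k • f.f n,
  fun n => by simp [f.comm], fun n => by simp [f.comm']⟩⟩

instance : SMul ℤ (P ⟶ Q) := ⟨fun k f => ⟨fun n => k • f.f n,
  fun n => by simp [f.comm], fun n => by simp [f.comm']⟩⟩

theorem f_injective : Function.Injective (fun f : P ⟶ Q => f.f) := fun _ _ h => Hom.ext h

instance : AddCommGroup (P ⟶ Q) :=
  f_injective.addCommGroup _ rfl (fun _ _ => rfl) (fun _ => rfl) (fun _ _ => rfl)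
    (fun _ _ => rfl) (fun _ _ => rfl)

@[simp] theorem zero_f (n : ℤ) : Hom.f (0 : P ⟶ Q) n = 0 := rfl

@[simp] theorem add_f (f g : P ⟶ Q) (n : ℤ) : Hom.f (f + g) n = f.f n + g.f n := rfl

instance : Preadditive (BinaryAcyclicComplex S M) where
  add_comp _ _ _ f g h := by ext n; simp
  comp_add _ _ _ f g h := by ext n; simp

/-- The part in degree `n` of a short sequence of binary acyclic complexes. -/
def shortComplexAt (T : ShortComplex (BinaryAcyclicComplex S M)) (n : ℤ) : ShortComplex M :=
  ShortComplex.mk (T.f.f n) (T.g.f n) (by rw [← comp_f, T.zero, zero_f])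

end BinaryAcyclicComplex

/-- `B^q_S M`: the category of bounded binary acyclic complexes in `M` supported on `S`. A sequence
is short exact if it is so in every degree. -/
def Bq (S : Set ℤ) (M : ConflationCategory.{v, u}) : ConflationCategory.{v, u} where
  carrier := BinaryAcyclicComplex S M
  IsConflation T := ∀ n, M.IsConflation (BinaryAcyclicComplex.shortComplexAt T n)

/-- The exact functor `B^q_S M ⟶ B^q_T N` induced by an exact functor `M ⟶ N` and an
inclusion `S ⊆ T`: it is applied degreewise. -/
def Bq.map {S T : Set ℤ} (h : S ⊆ T) {M N : ConflationCategory.{v, u}} (F : ExactFunctor M N) :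
    ExactFunctor (Bq S M) (Bq T N) :=
  let onFac {X : ℤ → M} {d : ∀ n, X n ⟶ X (n - 1)} (A : AcyclicFactorization M X d) :
      AcyclicFactorization N (fun n => F.functor.obj (X n)) (fun n => F.functor.map (d n)) :=
    { Z := fun n => F.functor.obj (A.Z n)
      p := fun n => F.functor.map (A.p n)
      ι := fun n => F.functor.map (A.ι n)
      fac := fun n => by rw [← F.functor.map_comp, A.fac]
      confl := fun n => F.map_confl (A.confl n) }
  let functor : BinaryAcyclicComplex S M ⥤ BinaryAcyclicComplex T N :=
    { obj := fun P =>
        { X := fun n => F.functor.obj (P.X n)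
          d := fun n => F.functor.map (P.d n)
          d' := fun n => F.functor.map (P.d' n)
          acyclic := P.acyclic.map onFac
          acyclic' := P.acyclic'.map onFac
          bounded := by
            obtain ⟨a, b, hab⟩ := P.bounded
            exact ⟨a, b, fun n hn => F.functor.map_isZero (hab n hn)⟩
          supported := fun n hn => F.functor.map_isZero (P.supported n fun hS => hn (h hS)) }
      map := fun f =>
        { f := fun n => F.functor.map (f.f n)
          comm := fun n => by rw [← F.functor.map_comp, f.comm, F.functor.map_comp]
          comm' := fun n => by rw [← F.functor.map_comp, f.comm', F.functor.map_comp] }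
      map_id := fun P => by ext n; exact F.functor.map_id _
      map_comp := fun f g => by ext n; exact F.functor.map_comp _ _ }
  { functor := functor
    additive := ⟨fun {_ _ f g} => by
      apply BinaryAcyclicComplex.hom_ext
      intro n
      exact F.functor.map_add⟩
    map_conflation := fun T hT n => F.map_conflation _ (hT n) }

/-- The `n`-fold iteration `(B^q_S)^n N`, the category of bounded acyclic binary multicomplexes of
dimension `n` in `N`. -/
def iterBq (S : Set ℤ) : ℕ → ConflationCategory.{v, u} → ConflationCategory.{v, u}
  | 0, N => N
  | n + 1, N => Bq S (iterBq S n N)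

/-- The exact functor `(B^q_S)^n M ⟶ (B^q_T)^n N` induced by an exact functor `M ⟶ N` and an
inclusion `S ⊆ T`. -/
def iterBq.map {S T : Set ℤ} (h : S ⊆ T) {M N : ConflationCategory.{v, u}}
    (F : ExactFunctor M N) : (n : ℕ) → ExactFunctor (iterBq S n M) (iterBq T n N)
  | 0 => F
  | n + 1 => Bq.map h (iterBq.map h F n)

/-- The top and the bottom differential of the multicomplex `P` in the direction `k` coincide. -/
def IsDiagonal (S : Set ℤ) (N : ConflationCategory.{v, u}) :
    (n : ℕ) → Fin n → iterBq S n N → Prop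
  | _ + 1, ⟨0, _⟩, P => BinaryAcyclicComplex.d P = BinaryAcyclicComplex.d' P
  | n + 1, ⟨k + 1, hk⟩, P =>
      ∀ i : ℤ, IsDiagonal S N n ⟨k, Nat.lt_of_succ_lt_succ hk⟩ (BinaryAcyclicComplex.X P i)

theorem IsDiagonal.map {S T : Set ℤ} (h : S ⊆ T) {M N : ConflationCategory.{v, u}}
    (F : ExactFunctor M N) : ∀ (n : ℕ) (k : Fin n) (P : iterBq S n M),
    IsDiagonal S M n k P → IsDiagonal T N n k ((iterBq.map h F n).functor.obj P)
  | n + 1, ⟨0, _⟩, P, hP => by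
      have hP' : BinaryAcyclicComplex.d P = BinaryAcyclicComplex.d' P := hP
      funext i
      exact congrArg (fun e => (iterBq.map h F n).functor.map e) (congrFun hP' i)
  | n + 1, ⟨k + 1, hk⟩, P, hP => fun i =>
      IsDiagonal.map h F n ⟨k, Nat.lt_of_succ_lt_succ hk⟩ (BinaryAcyclicComplex.X P i) (hP i)

/-! ### Class groups -/

/-- The relations `[X₂] - [X₁] - [X₃]`, one for each short exact sequence. -/
def exactRelations (M : ConflationCategory.{v, u}) : AddSubgroup (FreeAbelianGroup M) :=
  AddSubgroup.closure {x | ∃ T : ShortComplex M, M.IsConflation T ∧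
    x = FreeAbelianGroup.of T.X₂ - FreeAbelianGroup.of T.X₁ - FreeAbelianGroup.of T.X₃}

/-- `K₀(M)`: the abelian group generated by the objects of `M`, with the relation
`[X₂] = [X₁] + [X₃]` for each short exact sequence `X₁ ⟶ X₂ ⟶ X₃`. -/
abbrev K0 (M : ConflationCategory.{v, u}) : Type (max u v) :=
  FreeAbelianGroup M ⧸ exactRelations M

/-- The class `[X]` in `K₀(M)`. -/
def K0.of {M : ConflationCategory.{v, u}} (X : M) : K0 M :=
  QuotientAddGroup.mk (FreeAbelianGroup.of X)

/-- The homomorphism `K₀(M) → K₀(N)`, `[X] ↦ [F X]`. -/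
def K0.map {M N : ConflationCategory.{v, u}} (F : ExactFunctor M N) : K0 M →+ K0 N :=
  QuotientAddGroup.map (exactRelations M) (exactRelations N)
    (FreeAbelianGroup.map F.functor.obj) (by
      rw [exactRelations, AddSubgroup.closure_le]
      rintro x ⟨T, hT, rfl⟩
      apply AddSubgroup.subset_closure
      exact ⟨T.map F.functor, F.map_conflation T hT, by simp⟩)

theorem K0.map_of {M N : ConflationCategory.{v, u}} (F : ExactFunctor M N) (X : M) :
    K0.map F (K0.of X) = K0.of (F.functor.obj X) := by
  simp [K0.map, K0.of]

/-- The subgroup generated by the classes of the multicomplexes that are diagonal in some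
direction. -/
def diagonalRelations (n : ℕ) (S : Set ℤ) (N : ConflationCategory.{v, u}) :
    AddSubgroup (K0 (iterBq S n N)) :=
  AddSubgroup.closure {x | ∃ (k : Fin n) (P : iterBq S n N), IsDiagonal S N n k P ∧ x = K0.of P}

/-- `K₀(Ω_S^n N)`: the quotient of `K₀((B^q_S)^n N)` by the classes of all multicomplexes that are
in the image of the diagonal functor `Δ` in one of the `n` directions. This is `π₀` of the total
homotopy cofiber of the `n`-cube of `K`-theory spectra given by the diagonal functors. -/
abbrev K0Omega (n : ℕ) (S : Set ℤ) (N : ConflationCategory.{v, u}) : Type (max u v) :=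
  K0 (iterBq S n N) ⧸ diagonalRelations n S N

/-- The class of an acyclic binary multicomplex. -/
def K0Omega.of {n : ℕ} {S : Set ℤ} {N : ConflationCategory.{v, u}} (P : iterBq S n N) :
    K0Omega n S N := QuotientAddGroup.mk (K0.of P)

/-- The class in `K₀(Ω_S N)` of a binary acyclic complex. -/
def K0Omega.ofBinary {S : Set ℤ} {N : ConflationCategory.{v, u}}
    (P : BinaryAcyclicComplex S N) : K0Omega 1 S N :=
  K0Omega.of (n := 1) (S := S) (N := N) P

/-- The homomorphism `K₀(Ω_S^n M) → K₀(Ω_T^n N)` induced by an exact functor `M ⟶ N` and an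
inclusion `S ⊆ T`. -/
def K0Omega.mapIncl (n : ℕ) {S T : Set ℤ} (h : S ⊆ T) {M N : ConflationCategory.{v, u}}
    (F : ExactFunctor M N) : K0Omega n S M →+ K0Omega n T N :=
  QuotientAddGroup.map (diagonalRelations n S M) (diagonalRelations n T N)
    (K0.map (iterBq.map h F n)) (by
      rw [diagonalRelations, AddSubgroup.closure_le]
      rintro x ⟨k, P, hP, rfl⟩
      apply AddSubgroup.subset_closure
      exact ⟨k, _, hP.map h F n k P, K0.map_of _ _⟩)

/-- Functoriality of `K₀(Ω_S^n N)` in `N`. -/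
def K0Omega.map (n : ℕ) (S : Set ℤ) {M N : ConflationCategory.{v, u}} (F : ExactFunctor M N) :
    K0Omega n S M →+ K0Omega n S N := K0Omega.mapIncl n subset_rfl F

/-- The canonical map `K₀(Ω_S^n N) → K₀(Ω_T^n N)` for `S ⊆ T`. -/
def K0Omega.incl (n : ℕ) {S T : Set ℤ} (h : S ⊆ T) (N : ConflationCategory.{v, u}) :
    K0Omega n S N →+ K0Omega n T N := K0Omega.mapIncl n h (ExactFunctor.id N)

/-! ### Elementary facts on exact categories -/

namespace ConflationCategory

variable {N : ConflationCategory.{v, u}} [N.IsExact]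

theorem confl_of_admEpi {A B C : N} {i : A ⟶ B} {p : B ⟶ C} (hp : N.AdmEpi p) (w : i ≫ p = 0)
    (hi : Nonempty (IsLimit (KernelFork.ofι i w))) : N.Confl i p := by
  obtain ⟨A', i', w', h'⟩ := hp
  obtain ⟨hi⟩ := hi
  obtain ⟨hi'⟩ := IsExact.isKernel _ h'
  refine ⟨w, IsExact.of_iso (S := ShortComplex.mk i' p w') (T := ShortComplex.mk i p w)
    (ShortComplex.isoMk (hi'.conePointUniqueUpToIso hi) (Iso.refl _)
    (Iso.refl _) ?_ ?_) h'⟩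
  · have := hi'.conePointUniqueUpToIso_hom_comp hi WalkingParallelPair.zero
    simpa using this
  · simp

theorem confl_of_admMono {A B C : N} {i : A ⟶ B} {p : B ⟶ C} (h : N.AdmMono i) (w : i ≫ p = 0)
    (hp : Nonempty (IsColimit (CokernelCofork.ofπ p w))) : N.Confl i p := by
  obtain ⟨C', p', w', h'⟩ := h
  obtain ⟨hp⟩ := hp
  obtain ⟨hp'⟩ := IsExact.isCokernel _ h'
  refine ⟨w, IsExact.of_iso (S := ShortComplex.mk i p' w') (T := ShortComplex.mk i p w)
    (ShortComplex.isoMk (Iso.refl _) (Iso.refl _) (hp'.coconePointUniqueUpToIso hp) ?_ ?_) h'⟩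
  · simp
  · have := hp'.comp_coconePointUniqueUpToIso_hom hp WalkingParallelPair.one
    simpa using this.symm

theorem Confl.of_iso {A B C A' B' C' : N} {i : A ⟶ B} {p : B ⟶ C} (h : N.Confl i p)
    {i' : A' ⟶ B'} {p' : B' ⟶ C'} (e : A ≅ A') (f : B ≅ B') (g : C ≅ C')
    (h₁ : e.hom ≫ i' = i ≫ f.hom) (h₂ : f.hom ≫ p' = p ≫ g.hom) : N.Confl i' p' := by
  have w : i' ≫ p' = 0 := by
    rw [← cancel_epi e.hom, ← Category.assoc, h₁, Category.assoc, h₂, ← Category.assoc, h.1]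
    simp
  exact ⟨w, IsExact.of_iso (ShortComplex.isoMk e f g h₁ h₂) h.2⟩

theorem confl_id_zero {A Z : N} (hZ : IsZero Z) (p : A ⟶ Z) : N.Confl (𝟙 A) p := by
  refine confl_of_admMono (IsExact.admMono_id A) (hZ.eq_of_tgt _ _) ⟨?_⟩
  exact CokernelCofork.IsColimit.ofπ _ _ (fun _ _ => 0)
    (fun g hg => by rw [comp_zero, ← hg, Category.id_comp]) (fun _ _ _ _ => hZ.eq_of_src _ _)

theorem confl_zero_id {A Z : N} (hZ : IsZero Z) (i : Z ⟶ A) : N.Confl i (𝟙 A) := by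
  refine confl_of_admEpi (IsExact.admEpi_id A) (hZ.eq_of_src _ _) ⟨?_⟩
  exact KernelFork.IsLimit.ofι _ _ (fun _ _ => 0)
    (fun g hg => by rw [zero_comp, ← hg, Category.comp_id]) (fun _ _ _ _ => hZ.eq_of_tgt _ _)

/-- If `A ⟶ B ⟶ C` is short exact, then so is `A ⟶ B ⊞ D ⟶ C ⊞ D`. -/
theorem Confl.add_right {A B C : N} {i : A ⟶ B} {p : B ⟶ C} (h : N.Confl i p) (D : N) :
    N.Confl (i ≫ (biprod.inl : B ⟶ B ⊞ D)) (biprod.map p (𝟙 D)) := by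
  have hsq : IsPullback (biprod.fst : B ⊞ D ⟶ B) (biprod.map p (𝟙 D)) p biprod.fst := by
    refine ⟨⟨by simp⟩, ⟨PullbackCone.IsLimit.mk _ (fun s => biprod.lift s.fst (s.snd ≫ biprod.snd))
      (fun s => by simp) (fun s => ?_) (fun s m h₁ h₂ => ?_)⟩⟩
    · ext
      · simpa using s.condition
      · simp
    · ext
      · simpa using h₁
      · simp [← h₂]
  obtain ⟨B', g', p', hB', A', i', hp'⟩ := IsExact.pullback p (biprod.fst : C ⊞ D ⟶ C) ⟨A, i, h⟩
  have hadm : N.AdmEpi (biprod.map p (𝟙 D)) :=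
    ⟨A', i' ≫ (hB'.isoIsPullback _ _ hsq).hom, hp'.of_iso (Iso.refl _)
      (hB'.isoIsPullback _ _ hsq) (Iso.refl _) (by simp) (by simp)⟩
  obtain ⟨w, hc⟩ := h
  obtain ⟨hk⟩ := IsExact.isKernel _ hc
  refine confl_of_admEpi hadm (by ext <;> simp [w]) ⟨?_⟩
  have hmono : Mono i := mono_of_isLimit_fork hk
  refine KernelFork.IsLimit.ofι' _ _ (fun {Z} k hk0 => ?_)
  have h1 : (k ≫ biprod.fst) ≫ p = 0 := by
    have := hk0 =≫ biprod.fst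
    simpa using this
  have h2 : k ≫ biprod.snd = 0 := by
    have := hk0 =≫ biprod.snd
    simpa using this
  refine ⟨hk.lift (KernelFork.ofι (k ≫ biprod.fst) h1), ?_⟩
  have h3 : hk.lift (KernelFork.ofι (k ≫ biprod.fst) h1) ≫ i = k ≫ biprod.fst :=
    hk.fac (KernelFork.ofι (k ≫ biprod.fst) h1) WalkingParallelPair.zero
  rw [← Category.assoc, h3]
  ext <;> simp [h2]

/-- If `A ⟶ B ⟶ C` is short exact, then so is `D ⊞ A ⟶ D ⊞ B ⟶ C`. -/
theorem Confl.add_left {A B C : N} {i : A ⟶ B} {p : B ⟶ C} (h : N.Confl i p) (D : N) :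
    N.Confl (biprod.map (𝟙 D) i) ((biprod.snd : D ⊞ B ⟶ B) ≫ p) := by
  have hsq : IsPushout i (biprod.inr : A ⟶ D ⊞ A) (biprod.inr : B ⟶ D ⊞ B)
      (biprod.map (𝟙 D) i) := by
    refine ⟨⟨by simp⟩, ⟨PushoutCocone.IsColimit.mk _
      (fun s => biprod.desc (biprod.inl ≫ s.inr) s.inl)
      (fun s => by simp) (fun s => ?_) (fun s m h₁ h₂ => ?_)⟩⟩
    · ext
      · simp
      · simpa using s.condition
    · ext
      · simp [← h₂]
      · simpa using h₁
  obtain ⟨B', f', i', hB', C', p', hp'⟩ := IsExact.pushout i (biprod.inr : A ⟶ D ⊞ A) ⟨C, p, h⟩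
  have hadm : N.AdmMono (biprod.map (𝟙 D) i) :=
    ⟨C', (hB'.isoIsPushout _ _ hsq).inv ≫ p', hp'.of_iso (Iso.refl _)
      (hB'.isoIsPushout _ _ hsq) (Iso.refl _) (by simp) (by simp)⟩
  obtain ⟨w, hc⟩ := h
  obtain ⟨hk⟩ := IsExact.isCokernel _ hc
  refine confl_of_admMono hadm (by ext <;> simp [w]) ⟨?_⟩
  have hepi : Epi p := epi_of_isColimit_cofork hk
  refine CokernelCofork.IsColimit.ofπ' _ _ (fun {Z} k hk0 => ?_)
  have h1 : i ≫ (biprod.inr ≫ k) = 0 := by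
    have := (biprod.inr : A ⟶ D ⊞ A) ≫= hk0
    simpa using this
  have h2 : biprod.inl ≫ k = 0 := by
    have := (biprod.inl : D ⟶ D ⊞ A) ≫= hk0
    simpa using this
  refine ⟨hk.desc (CokernelCofork.ofπ (biprod.inr ≫ k) h1), ?_⟩
  have h3 : p ≫ hk.desc (CokernelCofork.ofπ (biprod.inr ≫ k) h1) = biprod.inr ≫ k :=
    hk.fac (CokernelCofork.ofπ (biprod.inr ≫ k) h1) WalkingParallelPair.one
  rw [Category.assoc, h3]
  ext <;> simp [h2]

end ConflationCategory

/-! ### Splicing short exact sequences, and the complexes `𝕊ₙ` -/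

section Splice

variable {N : ConflationCategory.{v, u}}

/-- Three short exact sequences `X₄ ⟶ X₃ ⟶ Z₂`, `Z₂ ⟶ X₂ ⟶ Z₁` and `Z₁ ⟶ X₁ ⟶ X₀`. They splice to
an acyclic complex `X₄ ⟶ X₃ ⟶ X₂ ⟶ X₁ ⟶ X₀`. -/
structure Splice (X₀ X₁ X₂ X₃ X₄ : N) where
  {Z₁ Z₂ : N}
  {i₄ : X₄ ⟶ X₃}
  {p₃ : X₃ ⟶ Z₂}
  {i₂ : Z₂ ⟶ X₂}
  {p₂ : X₂ ⟶ Z₁}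
  {i₁ : Z₁ ⟶ X₁}
  {p₁ : X₁ ⟶ X₀}
  confl₃ : N.Confl i₄ p₃
  confl₂ : N.Confl i₂ p₂
  confl₁ : N.Confl i₁ p₁

variable [N.IsExact]

open scoped ZeroObject

/-- The graded object with `X₀, …, X₄` in degrees `0, …, 4` and zero in all other degrees. -/
noncomputable def fiveTerm (X₀ X₁ X₂ X₃ X₄ : N) : ℤ → N
  | .ofNat 0 => X₀
  | .ofNat 1 => X₁
  | .ofNat 2 => X₂
  | .ofNat 3 => X₃
  | .ofNat 4 => X₄
  | .ofNat (_ + 5) => 0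
  | .negSucc _ => 0

theorem fiveTerm_isZero (X₀ X₁ X₂ X₃ X₄ : N) :
    ∀ n : ℤ, n < 0 ∨ 4 < n → IsZero (fiveTerm X₀ X₁ X₂ X₃ X₄ n)
  | .ofNat 0, h => absurd h (by decide)
  | .ofNat 1, h => absurd h (by decide)
  | .ofNat 2, h => absurd h (by decide)
  | .ofNat 3, h => absurd h (by decide)
  | .ofNat 4, h => absurd h (by decide)
  | .ofNat (_ + 5), _ => isZero_zero _
  | .negSucc _, _ => isZero_zero _

variable {X₀ X₁ X₂ X₃ X₄ : N}

/-- The differential of the spliced complex. -/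
noncomputable def Splice.d (s : Splice X₀ X₁ X₂ X₃ X₄) :
    ∀ n : ℤ, fiveTerm X₀ X₁ X₂ X₃ X₄ n ⟶ fiveTerm X₀ X₁ X₂ X₃ X₄ (n - 1)
  | .ofNat 0 => (0 : X₀ ⟶ 0)
  | .ofNat 1 => s.p₁
  | .ofNat 2 => s.p₂ ≫ s.i₁
  | .ofNat 3 => s.p₃ ≫ s.i₂
  | .ofNat 4 => s.i₄
  | .ofNat (_ + 5) => 0
  | .negSucc _ => 0

/-- The objects of cycles of the spliced complex. -/
noncomputable def Splice.Z (s : Splice X₀ X₁ X₂ X₃ X₄) : ℤ → N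
  | .ofNat 0 => X₀
  | .ofNat 1 => s.Z₁
  | .ofNat 2 => s.Z₂
  | .ofNat 3 => X₄
  | .ofNat (_ + 4) => 0
  | .negSucc _ => 0

/-- The admissible epimorphisms onto the cycles of the spliced complex. -/
noncomputable def Splice.p (s : Splice X₀ X₁ X₂ X₃ X₄) :
    ∀ n : ℤ, fiveTerm X₀ X₁ X₂ X₃ X₄ n ⟶ s.Z (n - 1)
  | .ofNat 0 => (0 : X₀ ⟶ 0)
  | .ofNat 1 => s.p₁
  | .ofNat 2 => s.p₂
  | .ofNat 3 => s.p₃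
  | .ofNat 4 => 𝟙 X₄
  | .ofNat (_ + 5) => 0
  | .negSucc _ => 0

/-- The admissible monomorphisms from the cycles of the spliced complex. -/
noncomputable def Splice.ι (s : Splice X₀ X₁ X₂ X₃ X₄) :
    ∀ n : ℤ, s.Z n ⟶ fiveTerm X₀ X₁ X₂ X₃ X₄ n
  | .ofNat 0 => 𝟙 X₀
  | .ofNat 1 => s.i₁
  | .ofNat 2 => s.i₂
  | .ofNat 3 => s.i₄
  | .ofNat (_ + 4) => 0
  | .negSucc _ => 0

theorem Splice.fac (s : Splice X₀ X₁ X₂ X₃ X₄) : ∀ n : ℤ, s.p n ≫ s.ι (n - 1) = s.d n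
  | .ofNat 0 => zero_comp
  | .ofNat 1 => Category.comp_id s.p₁
  | .ofNat 2 => rfl
  | .ofNat 3 => rfl
  | .ofNat 4 => Category.id_comp s.i₄
  | .ofNat (_ + 5) => zero_comp
  | .negSucc _ => zero_comp

theorem Splice.confl (s : Splice X₀ X₁ X₂ X₃ X₄) : ∀ n : ℤ, N.Confl (s.ι n) (s.p n)
  | .ofNat 0 => confl_id_zero (isZero_zero _) _
  | .ofNat 1 => s.confl₁
  | .ofNat 2 => s.confl₂
  | .ofNat 3 => s.confl₃
  | .ofNat 4 => confl_zero_id (isZero_zero _) _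
  | .ofNat (n + 5) => by
      have h : (0 : (0 : N) ⟶ 0) = 𝟙 _ := (isZero_zero N).eq_of_src _ _
      have e : (Int.ofNat (n + 5) - 1) = Int.ofNat (n + 4) := by simp; omega
      have hz : IsZero (s.Z (Int.ofNat (n + 5) - 1)) := by rw [e]; exact isZero_zero _
      exact (confl_id_zero (A := (0 : N)) hz 0).of_iso (Iso.refl _) (Iso.refl _) (Iso.refl _)
        ((isZero_zero N).eq_of_src _ _) (hz.eq_of_tgt _ _)
  | .negSucc n => by
      have e : (Int.negSucc n - 1) = Int.negSucc (n + 1) := by omega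
      have hz : IsZero (s.Z (Int.negSucc n - 1)) := by rw [e]; exact isZero_zero _
      exact (confl_id_zero (A := (0 : N)) hz 0).of_iso (Iso.refl _) (Iso.refl _) (Iso.refl _)
        ((isZero_zero N).eq_of_src _ _) (hz.eq_of_tgt _ _)

theorem Splice.acyclic (s : Splice X₀ X₁ X₂ X₃ X₄) :
    Nonempty (AcyclicFactorization N (fiveTerm X₀ X₁ X₂ X₃ X₄) s.d) :=
  ⟨⟨s.Z, s.p, s.ι, s.fac, s.confl⟩⟩

/-- The binary acyclic complex with objects `X₀, …, X₄` in degrees `0, …, 4` whose top and bottom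
differentials are obtained by splicing. -/
noncomputable def ofSplices (s s' : Splice X₀ X₁ X₂ X₃ X₄) {S : Set ℤ} (hS : Set.Icc 0 4 ⊆ S) :
    BinaryAcyclicComplex S N where
  X := fiveTerm X₀ X₁ X₂ X₃ X₄
  d := s.d
  d' := s'.d
  acyclic := s.acyclic
  acyclic' := s'.acyclic
  bounded := ⟨0, 4, fiveTerm_isZero X₀ X₁ X₂ X₃ X₄⟩
  supported n hn := fiveTerm_isZero X₀ X₁ X₂ X₃ X₄ n (by
    by_contra h
    push Not at h
    exact hn (hS h))

/-- Transport of short exact sequences along isomorphisms of `X₁` and `X₃`. -/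
def Splice.transport {X₁' X₃' : N} (s : Splice X₀ X₁ X₂ X₃ X₄) (e₁ : X₁ ≅ X₁') (e₃ : X₃ ≅ X₃') :
    Splice X₀ X₁' X₂ X₃' X₄ where
  i₄ := s.i₄ ≫ e₃.hom
  p₃ := e₃.inv ≫ s.p₃
  i₂ := s.i₂
  p₂ := s.p₂
  i₁ := s.i₁ ≫ e₁.hom
  p₁ := e₁.inv ≫ s.p₁
  confl₃ := s.confl₃.of_iso (Iso.refl _) e₃ (Iso.refl _) (by simp) (by simp)
  confl₂ := s.confl₂
  confl₁ := s.confl₁.of_iso (Iso.refl _) e₁ (Iso.refl _) (by simp) (by simp)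

/-- The isomorphism `X ⊕ Y ⊕ Z ≅ Z ⊕ Y ⊕ X` that exchanges the first and the third summand. -/
@[simps]
noncomputable def flipOuter (X Y Z : N) : (X ⊞ Y) ⊞ Z ≅ (Z ⊞ Y) ⊞ X where
  hom := biprod.lift (biprod.lift biprod.snd (biprod.fst ≫ biprod.snd)) (biprod.fst ≫ biprod.fst)
  inv := biprod.lift (biprod.lift biprod.snd (biprod.fst ≫ biprod.snd)) (biprod.fst ≫ biprod.fst)

/-- The isomorphism `X ⊕ Y ⊕ Z ≅ Y ⊕ X ⊕ Z` that exchanges the first and the second summand. -/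
@[simps]
noncomputable def flipFirst (X Y Z : N) : X ⊞ (Y ⊞ Z) ≅ Y ⊞ (X ⊞ Z) where
  hom := biprod.lift (biprod.snd ≫ biprod.fst)
    (biprod.lift biprod.fst (biprod.snd ≫ biprod.snd))
  inv := biprod.lift (biprod.snd ≫ biprod.fst)
    (biprod.lift biprod.fst (biprod.snd ≫ biprod.snd))

/-- The acyclic complex
`A ⟶ (K ⊕ S) ⊕ J ⟶ B ⊕ P ⊕ A' ⟶ J' ⊕ (K' ⊕ S') ⟶ B'`, which is the direct sum of the short exact
sequences `A ⟶ K ⊕ S ⟶ B` (degrees 4, 3, 2), `J ⟶ P ⟶ J'` (degrees 3, 2, 1) and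
`A' ⟶ K' ⊕ S' ⟶ B'` (degrees 2, 1, 0). -/
noncomputable def spliceThree {A K S B J P J' A' K' S' B' : N} {a : A ⟶ K ⊞ S} {b : K ⊞ S ⟶ B}
    (h : N.Confl a b) {i : J ⟶ P} {p : P ⟶ J'} (hJ : N.Confl i p) {a' : A' ⟶ K' ⊞ S'}
    {b' : K' ⊞ S' ⟶ B'} (h' : N.Confl a' b') :
    Splice B' (J' ⊞ (K' ⊞ S')) (B ⊞ (P ⊞ A')) ((K ⊞ S) ⊞ J) A where
  confl₃ := h.add_right J
  confl₂ := (hJ.add_right A').add_left B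
  confl₁ := h'.add_left J'

/-- The acyclic complex `A ⟶ (K ⊕ S) ⊕ J ⟶ B ⊕ P ⟶ P₁ ⟶ P₀`, which is the direct sum of the short
exact sequence `A ⟶ K ⊕ S ⟶ B` (degrees 4, 3, 2) and the complex `J ⟶ P ⟶ P₁ ⟶ P₀` obtained from
`J ⟶ P ⟶ J'` and `J' ⟶ P₁ ⟶ P₀`. -/
noncomputable def spliceTwo {A K S B J P J' P₁ P₀ : N} {a : A ⟶ K ⊞ S} {b : K ⊞ S ⟶ B}
    (h : N.Confl a b) {i : J ⟶ P} {p : P ⟶ J'} (hJ : N.Confl i p) {i' : J' ⟶ P₁} {p' : P₁ ⟶ P₀}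
    (hP : N.Confl i' p') : Splice P₀ P₁ (B ⊞ P) ((K ⊞ S) ⊞ J) A where
  confl₃ := h.add_right J
  confl₂ := hJ.add_left B
  confl₁ := hP

end Splice

/-! ### The complexes `𝕊ₙ` -/

section Shortening

variable {N : ConflationCategory.{v, u}} [N.IsExact]

theorem AcyclicFactorization.confl_one {X : ℤ → N} {d : ∀ n, X n ⟶ X (n - 1)}
    (F : AcyclicFactorization N X d) (hX : ∀ n < 0, IsZero (X n)) :
    N.Confl (A := F.Z 1) (B := X 1) (C := X 0) (F.ι 1) (d 1) := by
  have hmono : ∀ n, Mono (F.ι n) := fun n => by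
    obtain ⟨w, h⟩ := F.confl n
    obtain ⟨hk⟩ := IsExact.isKernel _ h
    exact mono_of_isLimit_fork hk
  have hZ : IsZero (F.Z (0 - 1)) := by
    have := hmono (0 - 1)
    exact IsZero.of_mono (F.ι (0 - 1)) (hX (0 - 1) (by norm_num))
  obtain ⟨w, h⟩ := F.confl 0
  obtain ⟨hk⟩ := IsExact.isKernel _ h
  have hiso : IsIso (F.ι 0) := KernelFork.IsLimit.isIso_ι _ hk (hZ.eq_of_tgt _ _)
  exact (F.confl 1).of_iso (Iso.refl _) (Iso.refl _) (asIso (F.ι 0))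
    (by simp) ((Category.id_comp _).trans (F.fac 1).symm)

/-- The choices that enter the construction of the complexes `𝕊ₙ`, for a binary acyclic complex
`P`: factorizations `Pₙ ↠ Jₙ₋₁ ↣ Pₙ₋₁` of the top and `Pₙ ↠ Kₙ₋₁ ↣ Pₙ₋₁` of the bottom
differential, and objects `Aₙ`, `Bₙ`, `Sₙ` with short exact sequences `Aₙ ↣ Jₙ ⊕ Sₙ ↠ Bₙ` and
`Aₙ ↣ Kₙ ⊕ Sₙ ↠ Bₙ` for `n ≥ 2`, where `Aₙ`, `Bₙ`, `Sₙ` are zero for `n ≥ m`. -/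
structure ShorteningData {T : Set ℤ} (P : BinaryAcyclicComplex T N) (m : ℤ) where
  J : AcyclicFactorization N P.X P.d
  K : AcyclicFactorization N P.X P.d'
  A : ℤ → N
  B : ℤ → N
  S : ℤ → N
  a : ∀ n, A n ⟶ J.Z n ⊞ S n
  b : ∀ n, J.Z n ⊞ S n ⟶ B n
  a' : ∀ n, A n ⟶ K.Z n ⊞ S n
  b' : ∀ n, K.Z n ⊞ S n ⟶ B n
  confl : ∀ n, 2 ≤ n → N.Confl (a n) (b n)
  confl' : ∀ n, 2 ≤ n → N.Confl (a' n) (b' n)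
  isZero : ∀ n, m ≤ n → IsZero (A n) ∧ IsZero (B n) ∧ IsZero (S n)

namespace ShorteningData

variable {T : Set ℤ} {P : BinaryAcyclicComplex T N} {m : ℤ} (D : ShorteningData P m)

/-- The complex `𝕊ₙ` for `n ≥ 3`, with objects `Bₙ₋₁`, `Jₙ₋₁ ⊕ Kₙ₋₁ ⊕ Sₙ₋₁`, `Bₙ ⊕ Pₙ ⊕ Aₙ₋₁`,
`Kₙ ⊕ Sₙ ⊕ Jₙ`, `Aₙ` in degrees `0, …, 4`. The top differential is the direct sum of
`Aₙ ↣ Kₙ ⊕ Sₙ ↠ Bₙ`, `Jₙ ↣ Pₙ ↠ Jₙ₋₁` and `Aₙ₋₁ ↣ Kₙ₋₁ ⊕ Sₙ₋₁ ↠ Bₙ₋₁`; the bottom differential is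
the direct sum of `Aₙ ↣ Jₙ ⊕ Sₙ ↠ Bₙ`, `Kₙ ↣ Pₙ ↠ Kₙ₋₁` and `Aₙ₋₁ ↣ Jₙ₋₁ ⊕ Sₙ₋₁ ↠ Bₙ₋₁`. -/
noncomputable def complexGen (n : ℤ) (hn : 3 ≤ n) {U : Set ℤ} (hU : Set.Icc 0 4 ⊆ U) :
    BinaryAcyclicComplex U N :=
  ofSplices
    (spliceThree (D.confl' n (by omega)) (D.J.confl n) (D.confl' (n - 1) (by omega)))
    ((spliceThree (D.confl n (by omega)) (D.K.confl n) (D.confl (n - 1) (by omega))).transport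
      (flipFirst _ _ _) (flipOuter _ _ _)) hU

/-- The complex `𝕊₂`, with objects `P₀`, `P₁`, `B₂ ⊕ P₂`, `K₂ ⊕ S₂ ⊕ J₂`, `A₂` in degrees
`0, …, 4`. The top differential is the direct sum of `A₂ ↣ K₂ ⊕ S₂ ↠ B₂` and
`J₂ ↣ P₂ ⟶ P₁ ↠ P₀`; the bottom differential is the direct sum of `A₂ ↣ J₂ ⊕ S₂ ↠ B₂` and
`K₂ ↣ P₂ ⟶ P₁ ↠ P₀`. -/
noncomputable def complexTwo (hP : ∀ n < 0, IsZero (P.X n)) {U : Set ℤ}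
    (hU : Set.Icc 0 4 ⊆ U) : BinaryAcyclicComplex U N :=
  ofSplices
    (spliceTwo (D.confl' 2 le_rfl) (D.J.confl 2) (D.J.confl_one hP))
    ((spliceTwo (D.confl 2 le_rfl) (D.K.confl 2) (D.K.confl_one hP)).transport
      (Iso.refl _) (flipOuter _ _ _)) hU

/-- The complexes `𝕊ₙ` for `n ≥ 2` (the value for `n < 2` is irrelevant). -/
noncomputable def complex (hP : ∀ n < 0, IsZero (P.X n)) (n : ℤ) {U : Set ℤ}
    (hU : Set.Icc 0 4 ⊆ U) : BinaryAcyclicComplex U N :=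
  if hn : 3 ≤ n then D.complexGen n hn hU else D.complexTwo hP hU

end ShorteningData

end Shortening

theorem Icc_zero_four_subset : Set.Icc (0 : ℤ) 4 ⊆ Set.Icc 0 7 :=
  Set.Icc_subset_Icc_right (by norm_num)

end GraysonK

-- Everything rests on the case n = 1. Let J_k and K_k be the cycles of the top and bottom
-- differential of P. They are stably equivalent in the sense of `StabEq`, that is, there are
-- sequences A ↣ J ⊕ S ↠ B and A ↣ K ⊕ S ↠ B with the same A, B, S. Indeed J_0 ≅ P_0 ≅ K_0, and
-- kernels of admissible epimorphisms from one object onto stably equivalent objects are again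
-- stably equivalent (`StabEq.next`). Such an equivalence in degree 2 allows P to be cut: the
-- spliced complex 𝕊_2, extended by the shift of a shorter complex `tilde`, becomes after a
-- unipotent change of differentials an extension of P by the cone of an identity. The change and
-- the cone have class zero, and a shift changes the sign, so [P] = [𝕊_2] - [tilde]
-- (`AdditiveInvariant.cut`). Iteration gives the alternating sum of the 𝕊_k
-- (`AdditiveInvariant.sum_eq`). Hence the alternating sum defines a section as soon as it is well
-- defined in K₀ of complexes on [0,7].
--
-- The computations are made for an `AdditiveInvariant`, so that they apply to the class groups of
-- short and of long complexes alike. The tool is `AdditiveInvariant.relabel`: if the top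
-- differentials of X and Y are related by isomorphisms τ_n and the bottom ones by σ_n, then c(Y) -
-- c(X) is the alternating sum of the classes of the two-term complexes (τ_n, σ_n). Both sides
-- compute the cone of (τ, σ), filtered in two ways.
--
-- Independence of the stable equivalences is `AdditiveInvariant.exchange`. An equivalence occurs in
-- two neighbouring spliced complexes; placing these side by side and permuting summands exchanges
-- it for another one. The permutations for top and bottom differ by a transposition of class ε(K) +
-- ε(J), which is 2ε(J) = 0. The sum of complexes lives in degrees 0 to 6 and the cone in `relabel`
-- needs one degree more, which is where [0,7] comes from. The sum vanishes on complexes with equal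
-- differentials because it telescopes (`sum_eq_zero_of_diag`), and it changes sign under shifts
-- (`sum_sh`), so that complexes reaching into negative degrees can be treated as well.
--
-- Additivity is deduced from naturality. A short exact sequence of binary complexes is one binary
-- complex in the exact category of short exact sequences, and the three evaluation functors carry
-- its alternating sum to those of the three members (`K0Omega.intSum_add`).
--
-- For n + 1 directions, the outermost direction is shortened with the case of one direction, over
-- the exact category of n-dimensional multicomplexes. The now short direction is moved to the
-- innermost place, the section for n directions is applied to the coefficient category `Bq S N`,
-- and the direction is moved back (`K0Omega.shortenSucc`). Naturality, applied to functors that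
-- make a multicomplex diagonal in one direction, shows that diagonal classes go to zero.

universe w

set_option linter.unusedSectionVars false

namespace GraysonK

namespace ConflationCategory

variable {N : ConflationCategory.{v, u}} [N.IsExact]

/-! ### Consequences of the axioms of an exact category -/

namespace Confl

variable {A B C : N} {i : A ⟶ B} {p : B ⟶ C}

theorem zero (h : N.Confl i p) : i ≫ p = 0 := h.1

theorem mono (h : N.Confl i p) : Mono i := by
  obtain ⟨w, hc⟩ := h
  obtain ⟨hk⟩ := IsExact.isKernel _ hc
  exact mono_of_isLimit_fork hk

theorem epi (h : N.Confl i p) : Epi p := by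
  obtain ⟨w, hc⟩ := h
  obtain ⟨hk⟩ := IsExact.isCokernel _ hc
  exact epi_of_isColimit_cofork hk

theorem admMono (h : N.Confl i p) : N.AdmMono i := ⟨C, p, h⟩

theorem admEpi (h : N.Confl i p) : N.AdmEpi p := ⟨A, i, h⟩

theorem exists_lift (h : N.Confl i p) {T : N} (k : T ⟶ B) (hk : k ≫ p = 0) :
    ∃ l : T ⟶ A, l ≫ i = k := by
  obtain ⟨w, hc⟩ := h
  obtain ⟨hl⟩ := IsExact.isKernel _ hc
  exact ⟨hl.lift (KernelFork.ofι k hk), hl.fac (KernelFork.ofι k hk) WalkingParallelPair.zero⟩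

/-- The lift of a morphism to the kernel. -/
noncomputable def lift (h : N.Confl i p) {T : N} (k : T ⟶ B) (hk : k ≫ p = 0) : T ⟶ A :=
  (h.exists_lift k hk).choose

theorem lift_comp (h : N.Confl i p) {T : N} (k : T ⟶ B) (hk : k ≫ p = 0) :
    h.lift k hk ≫ i = k := (h.exists_lift k hk).choose_spec

theorem exists_desc (h : N.Confl i p) {T : N} (k : B ⟶ T) (hk : i ≫ k = 0) :
    ∃ l : C ⟶ T, p ≫ l = k := by
  obtain ⟨w, hc⟩ := h
  obtain ⟨hl⟩ := IsExact.isCokernel _ hc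
  exact ⟨hl.desc (CokernelCofork.ofπ k hk),
    hl.fac (CokernelCofork.ofπ k hk) WalkingParallelPair.one⟩

/-- The morphism from the cokernel. -/
noncomputable def desc (h : N.Confl i p) {T : N} (k : B ⟶ T) (hk : i ≫ k = 0) : C ⟶ T :=
  (h.exists_desc k hk).choose

theorem comp_desc (h : N.Confl i p) {T : N} (k : B ⟶ T) (hk : i ≫ k = 0) :
    p ≫ h.desc k hk = k := (h.exists_desc k hk).choose_spec

end Confl

theorem confl_of_admEpi' {A B C : N} {i : A ⟶ B} {p : B ⟶ C} (hp : N.AdmEpi p) (w : i ≫ p = 0)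
    [Mono i] (h : ∀ {T : N} (k : T ⟶ B), k ≫ p = 0 → ∃ l : T ⟶ A, l ≫ i = k) :
    N.Confl i p :=
  confl_of_admEpi hp w ⟨KernelFork.IsLimit.ofι' _ _ fun k hk =>
    ⟨(h k hk).choose, (h k hk).choose_spec⟩⟩

theorem confl_of_admMono' {A B C : N} {i : A ⟶ B} {p : B ⟶ C} (hi : N.AdmMono i)
    (w : i ≫ p = 0) [Epi p]
    (h : ∀ {T : N} (k : B ⟶ T), i ≫ k = 0 → ∃ l : C ⟶ T, p ≫ l = k) :
    N.Confl i p :=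
  confl_of_admMono hi w ⟨CokernelCofork.IsColimit.ofπ' _ _ fun k hk =>
    ⟨(h k hk).choose, (h k hk).choose_spec⟩⟩

theorem AdmEpi.of_iso {B B' C : N} {p : B ⟶ C} (h : N.AdmEpi p) {p' : B' ⟶ C} (e : B ≅ B')
    (he : e.hom ≫ p' = p) : N.AdmEpi p' := by
  obtain ⟨A, i, h⟩ := h
  exact ⟨A, i ≫ e.hom, h.of_iso (Iso.refl _) e (Iso.refl _) (by simp) (by simp [he])⟩

theorem admEpi_of_isPullback {B C B' C' : N} {p : B ⟶ C} {g : C' ⟶ C} {g' : B' ⟶ B}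
    {p' : B' ⟶ C'} (h : IsPullback g' p' p g) (hp : N.AdmEpi p) : N.AdmEpi p' := by
  obtain ⟨B₁, g₁, p₁, h₁, hp₁⟩ := IsExact.pullback p g hp
  exact hp₁.of_iso (h₁.isoIsPullback _ _ h) (by simp)

/-- Pullbacks of short exact sequences. -/
theorem Confl.exists_pullback {A B C C' : N} {i : A ⟶ B} {p : B ⟶ C} (h : N.Confl i p)
    (g : C' ⟶ C) : ∃ (D : N) (u : D ⟶ B) (q : D ⟶ C') (j : A ⟶ D),
      IsPullback u q p g ∧ N.Confl j q ∧ j ≫ u = i := by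
  obtain ⟨D, u, q, hD, hq⟩ := IsExact.pullback p g h.admEpi
  have := h.mono
  have hj : hD.lift i (0 : A ⟶ C') (by simp [h.zero]) ≫ u = i := hD.lift_fst _ _ _
  have hj' : hD.lift i (0 : A ⟶ C') (by simp [h.zero]) ≫ q = 0 := hD.lift_snd _ _ _
  refine ⟨D, u, q, _, hD, ?_, hj⟩
  have : Mono (hD.lift i (0 : A ⟶ C') (by simp [h.zero])) := by
    have : Mono (hD.lift i (0 : A ⟶ C') (by simp [h.zero]) ≫ u) := by rw [hj]; infer_instance
    exact mono_of_mono _ u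
  refine confl_of_admEpi' hq hj' fun k hk => ?_
  have h0 : (k ≫ u) ≫ p = 0 := by rw [Category.assoc, hD.w, ← Category.assoc, hk, zero_comp]
  refine ⟨h.lift (k ≫ u) h0, hD.hom_ext ?_ ?_⟩
  · rw [Category.assoc, hj, h.lift_comp]
  · rw [Category.assoc, hj', hk, comp_zero]

theorem Confl.of_isPullback {A B C C' D : N} {i : A ⟶ B} {p : B ⟶ C} (h : N.Confl i p)
    {g : C' ⟶ C} {u : D ⟶ B} {q : D ⟶ C'} (hD : IsPullback u q p g) {j : A ⟶ D}
    (hj : j ≫ u = i) (hj' : j ≫ q = 0) : N.Confl j q := by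
  obtain ⟨D', u', q', j', hD', hc, hi⟩ := h.exists_pullback g
  refine hc.of_iso (Iso.refl _) (hD'.isoIsPullback _ _ hD) (Iso.refl _) ?_ (by simp)
  apply hD.hom_ext <;> simp [hj, hj', hi, hc.zero]

/-- Pushouts of short exact sequences. -/
theorem Confl.exists_pushout {A B C A' : N} {i : A ⟶ B} {p : B ⟶ C} (h : N.Confl i p)
    (f : A ⟶ A') : ∃ (D : N) (u : B ⟶ D) (j : A' ⟶ D) (q : D ⟶ C),
      IsPushout i f u j ∧ N.Confl j q ∧ u ≫ q = p := by
  obtain ⟨D, u, j, hD, hj⟩ := IsExact.pushout i f h.admMono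
  have := h.epi
  have hq : u ≫ hD.desc p (0 : A' ⟶ C) (by simp [h.zero]) = p := hD.inl_desc _ _ _
  have hq' : j ≫ hD.desc p (0 : A' ⟶ C) (by simp [h.zero]) = 0 := hD.inr_desc _ _ _
  refine ⟨D, u, j, _, hD, ?_, hq⟩
  have : Epi (hD.desc p (0 : A' ⟶ C) (by simp [h.zero])) := by
    have : Epi (u ≫ hD.desc p (0 : A' ⟶ C) (by simp [h.zero])) := by rw [hq]; infer_instance
    exact epi_of_epi u _
  refine confl_of_admMono' hj hq' fun k hk => ?_
  have h0 : i ≫ (u ≫ k) = 0 := by rw [← Category.assoc, hD.w, Category.assoc, hk, comp_zero]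
  refine ⟨h.desc (u ≫ k) h0, hD.hom_ext ?_ ?_⟩
  · rw [← Category.assoc, hq, h.comp_desc]
  · rw [← Category.assoc, hq', hk, zero_comp]

/-- The pushout of an admissible epimorphism along an admissible monomorphism. -/
theorem Confl.of_isPushout_comp {A B C A' D K : N} {i : A ⟶ B} {p : B ⟶ C} (h : N.Confl i p)
    {f : A ⟶ A'} {k : K ⟶ A} (hf : N.Confl k f) {u : B ⟶ D} {j : A' ⟶ D}
    (hD : IsPushout i f u j) : N.Confl (k ≫ i) u := by
  have := hf.epi
  have hu : Epi u := by
    refine ⟨fun a b hab => hD.hom_ext hab ?_⟩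
    rw [← cancel_epi f, ← Category.assoc, ← hD.w, Category.assoc, hab, ← Category.assoc, hD.w,
      Category.assoc]
  -- The composite `k ≫ i` is an admissible monomorphism by the axioms, so it suffices that `u` is a
  -- cokernel of it.
  refine confl_of_admMono' (IsExact.admMono_comp _ _ hf.admMono h.admMono)
    (by rw [Category.assoc, hD.w, ← Category.assoc, hf.zero, zero_comp]) fun l hl => ?_
  have hl' : k ≫ (i ≫ l) = 0 := by rw [← Category.assoc, hl]
  exact ⟨hD.desc l (hf.desc (i ≫ l) hl') (hf.comp_desc _ _).symm, hD.inl_desc _ _ _⟩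

/-- The pullback of an admissible monomorphism along an admissible epimorphism. -/
theorem Confl.of_isPullback_comp {A B C C' D Q : N} {i : A ⟶ B} {p : B ⟶ C} (h : N.Confl i p)
    {g : C' ⟶ C} {c : C ⟶ Q} (hg : N.Confl g c) {u : D ⟶ B} {q : D ⟶ C'}
    (hD : IsPullback u q p g) : N.Confl u (p ≫ c) := by
  have := hg.mono
  have hu : Mono u := by
    refine ⟨fun a b hab => hD.hom_ext hab ?_⟩
    rw [← cancel_mono g, Category.assoc, ← hD.w, ← Category.assoc, hab, Category.assoc, hD.w,
      Category.assoc]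
  refine confl_of_admEpi' (IsExact.admEpi_comp _ _ h.admEpi hg.admEpi)
    (by rw [← Category.assoc, hD.w, Category.assoc, hg.zero, comp_zero]) fun l hl => ?_
  have hl' : (l ≫ p) ≫ c = 0 := by rw [Category.assoc, hl]
  exact ⟨hD.lift l (hg.lift (l ≫ p) hl') (hg.lift_comp _ _).symm, hD.lift_fst _ _ _⟩

/-- A morphism of short exact sequences that is the identity on the left is cartesian. -/
theorem isPullback_of_confl {A D C B' C' : N} {j : A ⟶ D} {q : D ⟶ C} (h : N.Confl j q)
    {i' : A ⟶ B'} {p' : B' ⟶ C'} (h' : N.Confl i' p') {δ : D ⟶ B'} {γ : C ⟶ C'}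
    (h₁ : j ≫ δ = i') (h₂ : δ ≫ p' = q ≫ γ) : IsPullback δ q p' γ := by
  have hmi := h'.mono
  have key : ∀ {T : N} (x : T ⟶ D), x ≫ δ = 0 → x ≫ q = 0 → x = 0 := by
    intro T x hx hx'
    have hl := h.lift_comp x hx'
    have : h.lift x hx' = 0 := by
      rw [← cancel_mono i', ← h₁, ← Category.assoc, hl, hx, zero_comp]
    rw [← hl, this, zero_comp]
  have ex : ∀ {T : N} (a : T ⟶ B') (b : T ⟶ C), a ≫ p' = b ≫ γ →
      ∃ l : T ⟶ D, l ≫ δ = a ∧ l ≫ q = b := by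
    intro T a b hab
    -- The lift is constructed on the cover `e : T' ⟶ T` obtained by pulling back `q` along `b`.
    -- There `u` already lifts `b`; its failure to lift `a` comes from `A`, and after subtracting it
    -- the map kills the kernel of `e` and descends to `T`.
    obtain ⟨T', u, e, k, hT', hc, hk⟩ := h.exists_pullback b
    have he := hc.epi
    have h0 : (u ≫ δ - e ≫ a) ≫ p' = 0 := by
      rw [Preadditive.sub_comp, Category.assoc, h₂, Category.assoc, hab, ← Category.assoc, hT'.w,
        Category.assoc, sub_self]
    have hl := h'.lift_comp _ h0
    set l := h'.lift _ h0
    have hw : k ≫ (u - l ≫ j) = 0 := by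
      apply key
      · rw [Category.assoc, Preadditive.sub_comp, Category.assoc, h₁, hl, sub_sub_cancel,
          ← Category.assoc, hc.zero, zero_comp]
      · rw [Category.assoc, Preadditive.sub_comp, Category.assoc, h.zero, comp_zero, sub_zero,
          ← Category.assoc, hk, h.zero]
    refine ⟨hc.desc _ hw, ?_, ?_⟩
    · rw [← cancel_epi e, ← Category.assoc, hc.comp_desc, Preadditive.sub_comp, Category.assoc,
        h₁, hl, sub_sub_cancel]
    · rw [← cancel_epi e, ← Category.assoc, hc.comp_desc, Preadditive.sub_comp, Category.assoc,
        h.zero, comp_zero, sub_zero, hT'.w]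
  refine ⟨⟨h₂⟩, ⟨PullbackCone.IsLimit.mk _
    (fun s => (ex s.fst s.snd s.condition).choose)
    (fun s => (ex s.fst s.snd s.condition).choose_spec.1)
    (fun s => (ex s.fst s.snd s.condition).choose_spec.2) (fun s m hm₁ hm₂ => ?_)⟩⟩
  rw [← sub_eq_zero]
  apply key
  · rw [Preadditive.sub_comp, hm₁, (ex s.fst s.snd s.condition).choose_spec.1, sub_self]
  · rw [Preadditive.sub_comp, hm₂, (ex s.fst s.snd s.condition).choose_spec.2, sub_self]

section ThreeByThree

variable {A B C A' B' C' KA KC : N} {i : A ⟶ B} {p : B ⟶ C} {i' : A' ⟶ B'} {p' : B' ⟶ C'}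
  {α : A ⟶ A'} {β : B ⟶ B'} {γ : C ⟶ C'} {kα : KA ⟶ A} {kγ : KC ⟶ C}

/-- The half of the nine lemma that is needed. The map `β` factors through the pushout `D` of `i`
along `α`. The first factor is an admissible epimorphism with kernel `KA`; the second is a pullback
of `γ`, because both sequences begin with `A'`. For the kernels, `kβ` is the pullback along `u : B ⟶
D` of the kernel `KC` of the second factor, so the sequence of kernels is a pullback of `KA ↣ B ↠
D`. -/
theorem admEpi_and_confl_of_confl (h : N.Confl i p) (h' : N.Confl i' p') (hα : N.Confl kα α)
    (hγ : N.Confl kγ γ) (h₁ : i ≫ β = α ≫ i') (h₂ : β ≫ p' = p ≫ γ) :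
    N.AdmEpi β ∧ ∀ {KB : N} {kβ : KB ⟶ B} {s : KA ⟶ KB} {t : KB ⟶ KC}, N.Confl kβ β →
      s ≫ kβ = kα ≫ i → t ≫ kγ = kβ ≫ p → N.Confl s t := by
  obtain ⟨D, u, j, q, hD, hc, hq⟩ := h.exists_pushout α
  have hu := h.of_isPushout_comp hα hD
  let δ : D ⟶ B' := hD.desc β i' h₁
  have hδ₁ : u ≫ δ = β := hD.inl_desc _ _ _
  have hδ₂ : j ≫ δ = i' := hD.inr_desc _ _ _
  have hδ₃ : δ ≫ p' = q ≫ γ := by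
    apply hD.hom_ext
    · rw [← Category.assoc, hδ₁, h₂, ← Category.assoc, hq]
    · rw [← Category.assoc, hδ₂, h'.zero, ← Category.assoc, hc.zero, zero_comp]
  have hpb := isPullback_of_confl hc h' hδ₂ hδ₃
  have hδ : N.AdmEpi δ := admEpi_of_isPullback hpb.flip hγ.admEpi
  have hl₁ : hpb.lift (0 : KC ⟶ B') kγ (by simp [hγ.zero]) ≫ δ = 0 := hpb.lift_fst _ _ _
  have hl₂ : hpb.lift (0 : KC ⟶ B') kγ (by simp [hγ.zero]) ≫ q = kγ := hpb.lift_snd _ _ _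
  have hl : N.Confl (hpb.lift (0 : KC ⟶ B') kγ (by simp [hγ.zero])) δ :=
    hγ.of_isPullback hpb.flip hl₂ hl₁
  set l := hpb.lift (0 : KC ⟶ B') kγ (by simp [hγ.zero])
  refine ⟨hδ₁ ▸ IsExact.admEpi_comp _ _ hu.admEpi hδ, fun {KB kβ s t} hβ hs ht => ?_⟩
  have hm := hβ.mono
  have hmγ := hγ.mono
  have hml := hl.mono
  have ht' : kβ ≫ u = t ≫ l := by
    have h0 : (kβ ≫ u) ≫ δ = 0 := by rw [Category.assoc, hδ₁, hβ.zero]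
    have h1 := hl.lift_comp _ h0
    have h2 : hl.lift _ h0 = t := by
      rw [← cancel_mono kγ, ht, ← hq, ← Category.assoc, ← hl₂, ← Category.assoc, h1]
    rw [← h1, h2]
  have hsq : IsPullback kβ t u l := by
    refine ⟨⟨ht'⟩, ⟨PullbackCone.IsLimit.mk _
      (fun c => hβ.lift c.fst (by
        rw [← hδ₁, ← Category.assoc, c.condition, Category.assoc, hl.zero, comp_zero]))
      (fun c => hβ.lift_comp _ _) (fun c => ?_) (fun c m hm₁ _ => ?_)⟩⟩
    · rw [← cancel_mono l, Category.assoc, ← ht', ← Category.assoc, hβ.lift_comp, c.condition]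
    · rw [← cancel_mono kβ, hm₁, hβ.lift_comp]
  refine hu.of_isPullback hsq hs ?_
  rw [← cancel_mono kγ, Category.assoc, ht, ← Category.assoc, hs, Category.assoc, h.zero,
    comp_zero, zero_comp]

end ThreeByThree

-- The axioms do not mention split sequences; this one is `A ⟶ A ⟶ 0` with `B` added on the right.
open scoped ZeroObject in
theorem confl_inl_snd (A B : N) : N.Confl (biprod.inl : A ⟶ A ⊞ B) (biprod.snd : A ⊞ B ⟶ B) := by
  have hZ : IsZero (0 : N) := isZero_zero N
  have h := (confl_id_zero (N := N) (A := A) hZ 0).add_right B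
  refine h.of_iso (Iso.refl _) (Iso.refl _)
    ⟨biprod.snd, biprod.inr, ?_, by simp⟩ (by simp) (by simp)
  ext <;> first | exact hZ.eq_of_src _ _ | exact hZ.eq_of_tgt _ _ | simp

theorem confl_inr_fst (A B : N) : N.Confl (biprod.inr : B ⟶ A ⊞ B) (biprod.fst : A ⊞ B ⟶ A) :=
  (confl_inl_snd B A).of_iso (Iso.refl _) (biprod.braiding _ _) (Iso.refl _)
    (by ext <;> simp) (by simp)

/-- The nine lemma, applied to the split sequences on `B ⊞ B'` and `C ⊞ C'`, makes the sum of the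
two epimorphisms admissible; its kernel is then found componentwise. -/
theorem Confl.biprod_map {A B C A' B' C' : N} {i : A ⟶ B} {p : B ⟶ C} (h : N.Confl i p)
    {i' : A' ⟶ B'} {p' : B' ⟶ C'} (h' : N.Confl i' p') :
    N.Confl (biprod.map i i') (biprod.map p p') := by
  have hm := h.mono
  have hm' := h'.mono
  have h1 := admEpi_and_confl_of_confl (confl_inl_snd B B') (confl_inl_snd C C') h h'
    (β := biprod.map p p') (by simp) (by simp)
  have hmono : Mono (biprod.map i i') := by
    refine ⟨fun a b hab => ?_⟩
    ext
    · rw [← cancel_mono i]; simpa using hab =≫ biprod.fst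
    · rw [← cancel_mono i']; simpa using hab =≫ biprod.snd
  refine confl_of_admEpi' h1.1 (by ext <;> simp [h.zero, h'.zero]) fun k hk => ?_
  refine ⟨biprod.lift (h.lift (k ≫ biprod.fst) ?_) (h'.lift (k ≫ biprod.snd) ?_), ?_⟩
  · simpa using hk =≫ biprod.fst
  · simpa using hk =≫ biprod.snd
  · ext <;> simp [lift_comp]

theorem Confl.isZero_left {A B C : N} {i : A ⟶ B} {p : B ⟶ C} (h : N.Confl i p) (hB : IsZero B) :
    IsZero A :=
  have := h.mono
  IsZero.of_mono i hB

theorem Confl.isZero_right {A B C : N} {i : A ⟶ B} {p : B ⟶ C} (h : N.Confl i p)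
    (hB : IsZero B) : IsZero C :=
  have := h.epi
  IsZero.of_epi p hB

theorem Confl.isZero_mid {A B C : N} {i : A ⟶ B} {p : B ⟶ C} (h : N.Confl i p)
    (hA : IsZero A) (hC : IsZero C) : IsZero B := by
  obtain ⟨l, hl⟩ := h.exists_lift (𝟙 B) (hC.eq_of_tgt _ _)
  rw [IsZero.iff_id_eq_zero, ← hl, hA.eq_of_src i 0, comp_zero]

end ConflationCategory


open ConflationCategory

/-! ### Cycles and extensions of acyclic complexes -/

/-- This is how boundedness below enters: statements on cycles are trivial far down and are carried
upwards one degree at a time. -/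
theorem int_induction_of_lt {P : ℤ → Prop} (a : ℤ) (h : ∀ n < a, P n)
    (step : ∀ n, P (n - 1) → P n) (n : ℤ) : P n := by
  rcases lt_or_ge n a with hn | hn
  · exact h n hn
  · induction n, hn using Int.leInduction with
    | base => exact step a (h _ (by omega))
    | succ n _ ih => exact step (n + 1) (by rwa [add_sub_cancel_right])

section Cycles

variable {N : ConflationCategory.{v, u}} [N.IsExact]

namespace AcyclicFactorization

variable {X Y W : ℤ → N} {dX : ∀ n, X n ⟶ X (n - 1)} {dY : ∀ n, Y n ⟶ Y (n - 1)}
  {dW : ∀ n, W n ⟶ W (n - 1)} (FX : AcyclicFactorization N X dX)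
  (FY : AcyclicFactorization N Y dY) (FW : AcyclicFactorization N W dW)

theorem ι_comp_d (n : ℤ) : FX.ι n ≫ dX n = 0 := by
  rw [← FX.fac, ← Category.assoc, (FX.confl n).zero, zero_comp]

theorem exists_lift {T : N} {n : ℤ} (k : T ⟶ X n) (hk : k ≫ dX n = 0) :
    ∃ l : T ⟶ FX.Z n, l ≫ FX.ι n = k := by
  have := (FX.confl (n - 1)).mono
  refine (FX.confl n).exists_lift k ?_
  rw [← cancel_mono (FX.ι (n - 1)), Category.assoc, FX.fac, hk, zero_comp]

theorem isZero_Z {n : ℤ} (h : IsZero (X n)) : IsZero (FX.Z n) := (FX.confl n).isZero_left h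

variable (f : ∀ n, X n ⟶ Y n) (hf : ∀ n, f n ≫ dY n = dX n ≫ f (n - 1))
  (g : ∀ n, Y n ⟶ W n) (hg : ∀ n, g n ≫ dW n = dY n ≫ g (n - 1))

/-- The morphism induced on cycles by a morphism of complexes. -/
noncomputable def mapZ (n : ℤ) : FX.Z n ⟶ FY.Z n :=
  (FY.exists_lift (FX.ι n ≫ f n) (by
    rw [Category.assoc, hf, ← Category.assoc, FX.ι_comp_d, zero_comp])).choose

theorem mapZ_ι (n : ℤ) : FX.mapZ FY f hf n ≫ FY.ι n = FX.ι n ≫ f n :=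
  (FY.exists_lift (FX.ι n ≫ f n) (by
    rw [Category.assoc, hf, ← Category.assoc, FX.ι_comp_d, zero_comp])).choose_spec

theorem p_mapZ (n : ℤ) : FX.p n ≫ FX.mapZ FY f hf (n - 1) = f n ≫ FY.p n := by
  have := (FY.confl (n - 1)).mono
  rw [← cancel_mono (FY.ι (n - 1)), Category.assoc, mapZ_ι, ← Category.assoc, FX.fac,
    Category.assoc, FY.fac, hf]

include hf hg in
/-- Cycles of a short exact sequence of acyclic complexes. -/
theorem confl_mapZ (h : ∀ n, N.Confl (f n) (g n)) {a : ℤ} (ha : ∀ n < a, IsZero (Y n)) (n : ℤ) :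
    N.Confl (FX.mapZ FY f hf n) (FY.mapZ FW g hg n) := by
  refine int_induction_of_lt (P := fun n => N.Confl (FX.mapZ FY f hf n) (FY.mapZ FW g hg n)) a
    (fun n hn => ?_) (fun n ih => ?_) n
  · have h1 := FX.isZero_Z ((h n).isZero_left (ha n hn))
    have h2 := FY.isZero_Z (ha n hn)
    refine (confl_id_zero (A := FX.Z n) (FW.isZero_Z ((h n).isZero_right (ha n hn))) 0).of_iso
      (Iso.refl _) (h1.iso h2) (Iso.refl _) (h1.eq_of_src _ _) (h1.eq_of_src _ _)
  -- The nine lemma, with the maps onto the cycles of degree `n - 1` as vertical arrows; their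
  -- kernels are the cycles of degree `n`.
  · exact (admEpi_and_confl_of_confl (h n) ih (FX.confl n) (FW.confl n)
      (FX.p_mapZ FY f hf n).symm (FY.p_mapZ FW g hg n)).2 (FY.confl n)
      (FX.mapZ_ι FY f hf n) (FY.mapZ_ι FW g hg n)

end AcyclicFactorization

/-- A factorization through cycles can be constructed inductively. -/
theorem exists_kernel_of_confl {A B C ZA Z ZC KA KC : N} {i : A ⟶ B} {p : B ⟶ C}
    (h : N.Confl i p) {i' : ZA ⟶ Z} {p' : Z ⟶ ZC} (h' : N.Confl i' p') {kA : KA ⟶ A}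
    {α : A ⟶ ZA} {kC : KC ⟶ C} {γ : C ⟶ ZC} (hA : N.Confl kA α) (hC : N.Confl kC γ) {β : B ⟶ Z}
    (h₁ : i ≫ β = α ≫ i') (h₂ : β ≫ p' = p ≫ γ) :
    ∃ (K : N) (k : K ⟶ B) (s : KA ⟶ K) (t : K ⟶ KC),
      N.Confl k β ∧ N.Confl s t ∧ s ≫ k = kA ≫ i ∧ t ≫ kC = k ≫ p := by
  obtain ⟨⟨K, k, hk⟩, h3⟩ := admEpi_and_confl_of_confl h h' hA hC h₁ h₂
  have hs : (kA ≫ i) ≫ β = 0 := by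
    rw [Category.assoc, h₁, ← Category.assoc, hA.zero, zero_comp]
  have ht : (k ≫ p) ≫ γ = 0 := by
    rw [Category.assoc, ← h₂, ← Category.assoc, hk.zero, zero_comp]
  exact ⟨K, k, hk.lift _ hs, hC.lift _ ht, hk, h3 hk (hk.lift_comp _ _) (hC.lift_comp _ _),
    hk.lift_comp _ _, hC.lift_comp _ _⟩

section Extension

variable {A B C : ℤ → N} {dA : ∀ n, A n ⟶ A (n - 1)} {dB : ∀ n, B n ⟶ B (n - 1)}
  {dC : ∀ n, C n ⟶ C (n - 1)}

/-- Extensions of acyclic complexes are acyclic. -/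
theorem AcyclicFactorization.of_extension (FA : AcyclicFactorization N A dA)
    (FC : AcyclicFactorization N C dC) {i : ∀ n, A n ⟶ B n} {p : ∀ n, B n ⟶ C n}
    (h : ∀ n, N.Confl (i n) (p n)) (hi : ∀ n, i n ≫ dB n = dA n ≫ i (n - 1))
    (hp : ∀ n, p n ≫ dC n = dB n ≫ p (n - 1)) (hd : ∀ n, dB n ≫ dB (n - 1) = 0) {a : ℤ}
    (ha : ∀ n < a, IsZero (B n)) : Nonempty (AcyclicFactorization N B dB) := by
  -- The kernel of `dB n` is constructed together with its structure as an extension of the cycles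
  -- of `C` by those of `A`. This extra information feeds the nine lemma in the next degree, which
  -- shows that the map onto the preceding kernel is an admissible epimorphism.
  have key : ∀ n, ∃ (Z : N) (ι : Z ⟶ B n) (s : FA.Z n ⟶ Z) (t : Z ⟶ FC.Z n),
      Mono ι ∧ ι ≫ dB n = 0 ∧ (∀ {T : N} (k : T ⟶ B n), k ≫ dB n = 0 → ∃ l, l ≫ ι = k) ∧
      N.Confl s t ∧ s ≫ ι = FA.ι n ≫ i n ∧ t ≫ FC.ι n = ι ≫ p n := by
    refine int_induction_of_lt a (fun n hn => ?_) (fun n ih => ?_)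
    · have hB := ha n hn
      have h1 := FA.isZero_Z ((h n).isZero_left hB)
      have h3 := FC.isZero_Z ((h n).isZero_right hB)
      exact ⟨B n, 𝟙 _, 0, 0, inferInstance, hB.eq_of_src _ _, fun k _ => ⟨k, Category.comp_id k⟩,
        (confl_id_zero (A := FA.Z n) h3 0).of_iso (Iso.refl _) (h1.iso hB) (Iso.refl _)
          (h1.eq_of_src _ _) (h1.eq_of_src _ _), h1.eq_of_src _ _, hB.eq_of_src _ _⟩
    · obtain ⟨Z, ι, s, t, hm, -, hl, hc, hs, ht⟩ := ih
      obtain ⟨q, hq⟩ := hl (dB n) (hd n)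
      have hmA := (FA.confl (n - 1)).mono
      have hmC := (FC.confl (n - 1)).mono
      obtain ⟨K, k, s', t', hk, hc', hs', ht'⟩ := exists_kernel_of_confl (h n) hc (FA.confl n)
        (FC.confl n) (β := q)
        (by rw [← cancel_mono ι, Category.assoc, Category.assoc, hs, hq, hi, ← Category.assoc,
          FA.fac])
        (by rw [← cancel_mono (FC.ι (n - 1)), Category.assoc, Category.assoc, ht, FC.fac,
          ← Category.assoc, hq, hp])
      refine ⟨K, k, s', t', hk.mono, ?_, fun l hl' => hk.exists_lift l ?_, hc', hs', ht'⟩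
      · rw [← hq, ← Category.assoc, hk.zero, zero_comp]
      · rw [← cancel_mono ι, Category.assoc, hq, hl', zero_comp]
  choose Z ι s t hm hz hl hc hs ht using key
  have hq : ∀ n, ∃ q : B n ⟶ Z (n - 1), q ≫ ι (n - 1) = dB n := fun n => hl (n - 1) _ (hd n)
  choose q hq using hq
  refine ⟨⟨Z, q, ι, hq, fun n => ?_⟩⟩
  have hmA := (FA.confl (n - 1)).mono
  have hmC := (FC.confl (n - 1)).mono
  have hm' := hm (n - 1)
  have := hm n
  have hq' := (admEpi_and_confl_of_confl (h n) (hc (n - 1)) (FA.confl n)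
        (FC.confl n) (β := q n)
        (by rw [← cancel_mono (ι (n - 1)), Category.assoc, Category.assoc, hs, hq, hi,
          ← Category.assoc, FA.fac])
        (by rw [← cancel_mono (FC.ι (n - 1)), Category.assoc, Category.assoc, ht, FC.fac,
          ← Category.assoc, hq, hp])).1
  refine confl_of_admEpi' hq' ?_ fun k hk => hl n k ?_
  · rw [← cancel_mono (ι (n - 1)), Category.assoc, hq, hz, zero_comp]
  · rw [← hq, ← Category.assoc, hk, zero_comp]

end Extension

end Cycles

/-! ### The exact structure on binary acyclic complexes -/

namespace BinaryAcyclicComplex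

variable {S : Set ℤ} {N : ConflationCategory.{v, u}}

variable (S N) in
/-- Evaluation in degree `n`. -/
def eval (n : ℤ) : BinaryAcyclicComplex S N ⥤ N where
  obj P := P.X n
  map f := f.f n

instance (n : ℤ) : (eval S N n).Additive where

/-- An isomorphism of binary acyclic complexes from degreewise isomorphisms. -/
def isoMk {P Q : BinaryAcyclicComplex S N} (e : ∀ n, P.X n ≅ Q.X n)
    (h : ∀ n, (e n).hom ≫ Q.d n = P.d n ≫ (e (n - 1)).hom)
    (h' : ∀ n, (e n).hom ≫ Q.d' n = P.d' n ≫ (e (n - 1)).hom) : P ≅ Q where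
  hom := ⟨fun n => (e n).hom, h, h'⟩
  inv := ⟨fun n => (e n).inv, fun n => by simp [Iso.inv_comp_eq, reassoc_of% h],
    fun n => by simp [Iso.inv_comp_eq, reassoc_of% h']⟩
  hom_inv_id := by ext n; simp
  inv_hom_id := by ext n; simp

theorem confl_iff {P Q R : Bq S N} (i : P ⟶ Q) (p : Q ⟶ R) :
    (Bq S N).Confl i p ↔ ∀ n, N.Confl (Hom.f i n) (Hom.f p n) := by
  constructor
  · rintro ⟨w, h⟩ n
    exact ⟨_, h n⟩
  · intro h
    refine ⟨hom_ext fun n => (h n).1, fun n => (h n).2⟩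

theorem isZero_of_forall {P : BinaryAcyclicComplex S N} (h : ∀ n, IsZero (P.X n)) : IsZero P := by
  rw [IsZero.iff_id_eq_zero]
  exact hom_ext fun n => (h n).eq_of_src _ _

theorem mono_of_forall {P Q : BinaryAcyclicComplex S N} (f : P ⟶ Q) (h : ∀ n, Mono (f.f n)) :
    Mono f := by
  refine ⟨fun a b hab => hom_ext fun n => ?_⟩
  have := h n
  rw [← cancel_mono (f.f n), ← comp_f, hab, comp_f]

theorem epi_of_forall {P Q : BinaryAcyclicComplex S N} (f : P ⟶ Q) (h : ∀ n, Epi (f.f n)) :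
    Epi f := by
  refine ⟨fun a b hab => hom_ext fun n => ?_⟩
  have := h n
  rw [← cancel_epi (f.f n), ← comp_f, hab, comp_f]

variable [N.IsExact]

/-- Extensions of binary acyclic complexes. -/
def ofExtension (A C : BinaryAcyclicComplex S N) (X : ℤ → N) (d d' : ∀ n, X n ⟶ X (n - 1))
    (hd : ∀ n, d n ≫ d (n - 1) = 0) (hd' : ∀ n, d' n ≫ d' (n - 1) = 0)
    (i : ∀ n, A.X n ⟶ X n) (p : ∀ n, X n ⟶ C.X n) (h : ∀ n, N.Confl (i n) (p n))
    (hi : ∀ n, i n ≫ d n = A.d n ≫ i (n - 1)) (hi' : ∀ n, i n ≫ d' n = A.d' n ≫ i (n - 1))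
    (hp : ∀ n, p n ≫ C.d n = d n ≫ p (n - 1)) (hp' : ∀ n, p n ≫ C.d' n = d' n ≫ p (n - 1)) :
    BinaryAcyclicComplex S N :=
  have hb : ∃ a b : ℤ, ∀ n, n < a ∨ b < n → IsZero (X n) := by
    obtain ⟨a, b, hA⟩ := A.bounded
    obtain ⟨a', b', hC⟩ := C.bounded
    exact ⟨min a a', max b b', fun n hn =>
      (h n).isZero_mid (hA n (by omega)) (hC n (by omega))⟩
  { X := X
    d := d
    d' := d'
    acyclic := by
      obtain ⟨a, b, hab⟩ := hb
      exact A.acyclic.some.of_extension C.acyclic.some h hi hp hd (a := a)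
        fun n hn => hab n (Or.inl hn)
    acyclic' := by
      obtain ⟨a, b, hab⟩ := hb
      exact A.acyclic'.some.of_extension C.acyclic'.some h hi' hp' hd' (a := a)
        fun n hn => hab n (Or.inl hn)
    bounded := hb
    supported n hn := (h n).isZero_mid (A.supported n hn) (C.supported n hn) }

open scoped ZeroObject

variable (S N) in
/-- The zero complex. -/
noncomputable def zeroComplex : BinaryAcyclicComplex S N where
  X _ := 0
  d _ := 0
  d' _ := 0
  acyclic := ⟨⟨fun _ => 0, fun _ => 0, fun _ => 𝟙 _, fun _ => by simp,
    fun _ => confl_id_zero (isZero_zero _) _⟩⟩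
  acyclic' := ⟨⟨fun _ => 0, fun _ => 0, fun _ => 𝟙 _, fun _ => by simp,
    fun _ => confl_id_zero (isZero_zero _) _⟩⟩
  bounded := ⟨0, 0, fun _ _ => isZero_zero _⟩
  supported _ _ := isZero_zero _

theorem isZero_zeroComplex : IsZero (zeroComplex S N) := isZero_of_forall fun _ => isZero_zero _

/-- The direct sum of two binary acyclic complexes. -/
noncomputable def directSum (P Q : BinaryAcyclicComplex S N) : BinaryAcyclicComplex S N :=
  ofExtension P Q (fun n => P.X n ⊞ Q.X n) (fun n => biprod.map (P.d n) (Q.d n))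
    (fun n => biprod.map (P.d' n) (Q.d' n))
    (fun n => by ext <;> simp [P.d_comp_d, Q.d_comp_d])
    (fun n => by ext <;> simp [P.d_comp_d, Q.d_comp_d])
    (fun _ => biprod.inl) (fun _ => biprod.snd) (fun _ => confl_inl_snd _ _)
    (by simp) (by simp) (by simp) (by simp)

instance : HasBinaryBiproducts (BinaryAcyclicComplex S N) where
  has_binary_biproduct P Q := HasBinaryBiproduct.mk
    { bicone :=
        { pt := directSum P Q
          fst := ⟨fun _ => biprod.fst, fun _ => by simp [directSum, ofExtension],
            fun _ => by simp [directSum, ofExtension]⟩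
          snd := ⟨fun _ => biprod.snd, fun _ => by simp [directSum, ofExtension],
            fun _ => by simp [directSum, ofExtension]⟩
          inl := ⟨fun _ => biprod.inl, fun _ => by simp [directSum, ofExtension],
            fun _ => by simp [directSum, ofExtension]⟩
          inr := ⟨fun _ => biprod.inr, fun _ => by simp [directSum, ofExtension],
            fun _ => by simp [directSum, ofExtension]⟩
          inl_fst := hom_ext fun _ => biprod.inl_fst
          inl_snd := hom_ext fun _ => biprod.inl_snd
          inr_fst := hom_ext fun _ => biprod.inr_fst
          inr_snd := hom_ext fun _ => biprod.inr_snd }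
      isBilimit := isBinaryBilimitOfTotal _ (hom_ext fun _ => biprod.total) }

end BinaryAcyclicComplex

open BinaryAcyclicComplex

/-! ### The axioms of an exact category for binary acyclic complexes -/

section Exact

variable (S : Set ℤ) (N : ConflationCategory.{v, u}) [N.IsExact]

/-- The point is that the degreewise cokernel of `i ≫ j` is again acyclic. It is the pushout of `j`
along the cokernel of `i`, hence an extension of the cokernel of `j` by that of `i`. -/
theorem Bq.admMono_comp {A B C : Bq S N} (i : A ⟶ B) (j : B ⟶ C) (hi : (Bq S N).AdmMono i)
    (hj : (Bq S N).AdmMono j) : (Bq S N).AdmMono (i ≫ j) := by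
  obtain ⟨P, p, hi⟩ := hi
  obtain ⟨Q, q, hj⟩ := hj
  rw [confl_iff] at hi hj
  have key := fun n => (hj n).exists_pushout (Hom.f p n)
  choose D u k r hD hc hr using key
  have hu : ∀ n, N.Confl (Hom.f i n ≫ Hom.f j n) (u n) := fun n =>
    (hj n).of_isPushout_comp (hi n) (hD n)
  have hue := fun n => (hu n).epi
  have hpe := fun n => (hi n).epi
  have hd : ∀ (d : ∀ n, C.X n ⟶ C.X (n - 1)) (dA : ∀ n, A.X n ⟶ A.X (n - 1)),
      (∀ n, (Hom.f i n ≫ Hom.f j n) ≫ d n = dA n ≫ Hom.f i (n - 1) ≫ Hom.f j (n - 1)) →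
      ∀ n, ∃ e : D n ⟶ D (n - 1), u n ≫ e = d n ≫ u (n - 1) := fun d dA h n =>
    (hu n).exists_desc _ (by rw [← Category.assoc, h, Category.assoc, (hu (n - 1)).zero, comp_zero])
  choose e he using hd C.d A.d fun n => by
    rw [Category.assoc, j.comm, ← Category.assoc, i.comm, Category.assoc]
  choose e' he' using hd C.d' A.d' fun n => by
    rw [Category.assoc, j.comm', ← Category.assoc, i.comm', Category.assoc]
  let E : BinaryAcyclicComplex S N := ofExtension P Q D e e'
    (fun n => by
      rw [← cancel_epi (u n), ← Category.assoc, he, Category.assoc, he, ← Category.assoc,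
        (C.d_comp_d n).1, zero_comp, comp_zero])
    (fun n => by
      rw [← cancel_epi (u n), ← Category.assoc, he', Category.assoc, he', ← Category.assoc,
        (C.d_comp_d n).2, zero_comp, comp_zero])
    k r hc
    (fun n => by
      rw [← cancel_epi (Hom.f p n), ← Category.assoc, ← (hD n).w, Category.assoc, he,
        ← Category.assoc, j.comm, Category.assoc, (hD (n - 1)).w, ← Category.assoc, ← p.comm,
        Category.assoc])
    (fun n => by
      rw [← cancel_epi (Hom.f p n), ← Category.assoc, ← (hD n).w, Category.assoc, he',
        ← Category.assoc, j.comm', Category.assoc, (hD (n - 1)).w, ← Category.assoc, ← p.comm',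
        Category.assoc])
    (fun n => by
      rw [← cancel_epi (u n), ← Category.assoc, hr, q.comm, ← Category.assoc, he, Category.assoc,
        hr])
    (fun n => by
      rw [← cancel_epi (u n), ← Category.assoc, hr, q.comm', ← Category.assoc, he',
        Category.assoc, hr])
  exact ⟨E, ⟨u, he, he'⟩, (confl_iff _ _).2 hu⟩

/-- Dually, the degreewise kernel is an extension of the kernel of `q` by the kernel of `p`. -/
theorem Bq.admEpi_comp {A B C : Bq S N} (p : A ⟶ B) (q : B ⟶ C) (hp : (Bq S N).AdmEpi p)
    (hq : (Bq S N).AdmEpi q) : (Bq S N).AdmEpi (p ≫ q) := by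
  obtain ⟨K, k, hp⟩ := hp
  obtain ⟨L, l, hq⟩ := hq
  rw [confl_iff] at hp hq
  have key := fun n => (hp n).exists_pullback (Hom.f l n)
  choose D u r j hD hc hj using key
  have hu : ∀ n, N.Confl (u n) (Hom.f p n ≫ Hom.f q n) := fun n =>
    (hp n).of_isPullback_comp (hq n) (hD n)
  have hum := fun n => (hu n).mono
  have hlm := fun n => (hq n).mono
  have hd : ∀ (d : ∀ n, A.X n ⟶ A.X (n - 1)) (dC : ∀ n, C.X n ⟶ C.X (n - 1)),
      (∀ n, (Hom.f p n ≫ Hom.f q n) ≫ dC n = d n ≫ Hom.f p (n - 1) ≫ Hom.f q (n - 1)) →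
      ∀ n, ∃ e : D n ⟶ D (n - 1), e ≫ u (n - 1) = u n ≫ d n := fun d dC h n =>
    (hu (n - 1)).exists_lift _ (by
      rw [Category.assoc, ← h, ← Category.assoc, (hu n).zero, zero_comp])
  choose e he using hd A.d C.d fun n => by
    rw [Category.assoc, q.comm, ← Category.assoc, p.comm, Category.assoc]
  choose e' he' using hd A.d' C.d' fun n => by
    rw [Category.assoc, q.comm', ← Category.assoc, p.comm', Category.assoc]
  let E : BinaryAcyclicComplex S N := ofExtension K L D e e'
    (fun n => by
      rw [← cancel_mono (u (n - 1 - 1)), Category.assoc, he, ← Category.assoc, he, Category.assoc,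
        (A.d_comp_d n).1, zero_comp, comp_zero])
    (fun n => by
      rw [← cancel_mono (u (n - 1 - 1)), Category.assoc, he', ← Category.assoc, he',
        Category.assoc, (A.d_comp_d n).2, zero_comp, comp_zero])
    j r hc
    (fun n => by
      rw [← cancel_mono (u (n - 1)), Category.assoc, he, ← Category.assoc, hj, k.comm,
        Category.assoc, hj])
    (fun n => by
      rw [← cancel_mono (u (n - 1)), Category.assoc, he', ← Category.assoc, hj, k.comm',
        Category.assoc, hj])
    (fun n => by
      rw [← cancel_mono (Hom.f l (n - 1)), Category.assoc, ← l.comm, ← Category.assoc, ← (hD n).w,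
        Category.assoc, p.comm, ← Category.assoc, ← he, Category.assoc, (hD (n - 1)).w,
        Category.assoc])
    (fun n => by
      rw [← cancel_mono (Hom.f l (n - 1)), Category.assoc, ← l.comm', ← Category.assoc,
        ← (hD n).w, Category.assoc, p.comm', ← Category.assoc, ← he', Category.assoc,
        (hD (n - 1)).w, Category.assoc])
  exact ⟨E, ⟨u, fun n => (he n).symm, fun n => (he' n).symm⟩, (confl_iff _ _).2 hu⟩

/-- The degreewise pushout is acyclic as an extension of the cokernel of `i` by `A'`. -/
theorem Bq.exists_pushout {A B A' : Bq S N} (i : A ⟶ B) (f : A ⟶ A') (hi : (Bq S N).AdmMono i) :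
    ∃ (B' : Bq S N) (f' : B ⟶ B') (i' : A' ⟶ B'),
      IsPushout i f f' i' ∧ (Bq S N).AdmMono i' := by
  obtain ⟨C, p, hi⟩ := hi
  rw [confl_iff] at hi
  have key := fun n => (hi n).exists_pushout (Hom.f f n)
  choose D u j q hD hc hq using key
  have hd : ∀ (d : ∀ n, B.X n ⟶ B.X (n - 1)) (dA : ∀ n, A.X n ⟶ A.X (n - 1))
      (dA' : ∀ n, A'.X n ⟶ A'.X (n - 1)), (∀ n, Hom.f i n ≫ d n = dA n ≫ Hom.f i (n - 1)) →
      (∀ n, Hom.f f n ≫ dA' n = dA n ≫ Hom.f f (n - 1)) →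
      ∀ n, ∃ e : D n ⟶ D (n - 1), u n ≫ e = d n ≫ u (n - 1) ∧ j n ≫ e = dA' n ≫ j (n - 1) :=
    fun d dA dA' h h' n => ⟨(hD n).desc _ _ (by
      rw [← Category.assoc, h, Category.assoc, (hD (n - 1)).w, ← Category.assoc, ← h',
        Category.assoc]), (hD n).inl_desc _ _ _, (hD n).inr_desc _ _ _⟩
  choose e he hj using hd B.d A.d A'.d i.comm f.comm
  choose e' he' hj' using hd B.d' A.d' A'.d' i.comm' f.comm'
  have hp : ∀ n, q n ≫ C.d n = e n ≫ q (n - 1) := fun n => (hD n).hom_ext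
      (by rw [← Category.assoc, hq, p.comm, ← Category.assoc, he, Category.assoc, hq])
      (by rw [← Category.assoc, (hc n).zero, zero_comp, ← Category.assoc, hj, Category.assoc,
        (hc (n - 1)).zero, comp_zero])
  have hp' : ∀ n, q n ≫ C.d' n = e' n ≫ q (n - 1) := fun n => (hD n).hom_ext
      (by rw [← Category.assoc, hq, p.comm', ← Category.assoc, he', Category.assoc, hq])
      (by rw [← Category.assoc, (hc n).zero, zero_comp, ← Category.assoc, hj', Category.assoc,
        (hc (n - 1)).zero, comp_zero])
  let E : BinaryAcyclicComplex S N := ofExtension A' C D e e'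
    (fun n => (hD n).hom_ext
      (by rw [← Category.assoc, he, Category.assoc, he, ← Category.assoc, (B.d_comp_d n).1,
        zero_comp, comp_zero])
      (by rw [← Category.assoc, hj, Category.assoc, hj, ← Category.assoc, (A'.d_comp_d n).1,
        zero_comp, comp_zero]))
    (fun n => (hD n).hom_ext
      (by rw [← Category.assoc, he', Category.assoc, he', ← Category.assoc, (B.d_comp_d n).2,
        zero_comp, comp_zero])
      (by rw [← Category.assoc, hj', Category.assoc, hj', ← Category.assoc, (A'.d_comp_d n).2,
        zero_comp, comp_zero]))
    j q hc hj hj' hp hp'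
  let U : B ⟶ (E : Bq S N) := ⟨u, fun n => he n, fun n => he' n⟩
  let J : A' ⟶ (E : Bq S N) := ⟨j, fun n => hj n, fun n => hj' n⟩
  let Q : (E : Bq S N) ⟶ C := ⟨q, fun n => hp n, fun n => hp' n⟩
  have key : ∀ {W : ℤ → N} {dB : ∀ n, B.X n ⟶ B.X (n - 1)} {dA' : ∀ n, A'.X n ⟶ A'.X (n - 1)}
      {dW : ∀ n, W n ⟶ W (n - 1)} {e : ∀ n, D n ⟶ D (n - 1)} (_ : ∀ n, u n ≫ e n = dB n ≫ u (n - 1))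
      (_ : ∀ n, j n ≫ e n = dA' n ≫ j (n - 1)) {b : ∀ n, B.X n ⟶ W n}
      {a : ∀ n, A'.X n ⟶ W n} (_ : ∀ n, b n ≫ dW n = dB n ≫ b (n - 1))
      (_ : ∀ n, a n ≫ dW n = dA' n ≫ a (n - 1)) (w : ∀ n, Hom.f i n ≫ b n = Hom.f f n ≫ a n)
      (n : ℤ), (hD n).desc (b n) (a n) (w n) ≫ dW n =
        e n ≫ (hD (n - 1)).desc (b (n - 1)) (a (n - 1)) (w (n - 1)) := by
    intro W dB dA' dW e h1 h2 b a h3 h4 w n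
    refine (hD n).hom_ext ?_ ?_
    · rw [← Category.assoc, IsPushout.inl_desc, ← Category.assoc, h1, Category.assoc,
        IsPushout.inl_desc, h3]
    · rw [← Category.assoc, IsPushout.inr_desc, ← Category.assoc, h2, Category.assoc,
        IsPushout.inr_desc, h4]
  refine ⟨E, U, J, ⟨⟨hom_ext fun n => (hD n).w⟩, ⟨PushoutCocone.IsColimit.mk _ (fun s =>
    ⟨fun n => (hD n).desc (s.inl.f n) (s.inr.f n)
      (congrArg (fun k => Hom.f k n) s.condition),
      key he hj s.inl.comm s.inr.comm fun n => congrArg (fun k => Hom.f k n) s.condition,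
      key he' hj' s.inl.comm' s.inr.comm' fun n => congrArg (fun k => Hom.f k n) s.condition⟩)
      ?_ ?_ ?_⟩⟩, C, Q, (confl_iff _ _).2 hc⟩
  · exact fun s => hom_ext fun n => (hD n).inl_desc _ _ _
  · exact fun s => hom_ext fun n => (hD n).inr_desc _ _ _
  · intro s m h1 h2
    refine hom_ext fun n => (hD n).hom_ext ?_ ?_
    · exact ((congrArg (fun k => Hom.f k n) h1).trans ((hD n).inl_desc _ _ _).symm)
    · exact ((congrArg (fun k => Hom.f k n) h2).trans ((hD n).inr_desc _ _ _).symm)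

/-- The degreewise pullback is acyclic as an extension of `C'` by the kernel of `p`. -/
theorem Bq.exists_pullback {B C C' : Bq S N} (p : B ⟶ C) (g : C' ⟶ C) (hp : (Bq S N).AdmEpi p) :
    ∃ (B' : Bq S N) (g' : B' ⟶ B) (p' : B' ⟶ C'),
      IsPullback g' p' p g ∧ (Bq S N).AdmEpi p' := by
  obtain ⟨A, i, hp⟩ := hp
  rw [confl_iff] at hp
  have key := fun n => (hp n).exists_pullback (Hom.f g n)
  choose D u q j hD hc hj using key
  have hd : ∀ (d : ∀ n, B.X n ⟶ B.X (n - 1)) (dC : ∀ n, C.X n ⟶ C.X (n - 1))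
      (dC' : ∀ n, C'.X n ⟶ C'.X (n - 1)), (∀ n, Hom.f p n ≫ dC n = d n ≫ Hom.f p (n - 1)) →
      (∀ n, Hom.f g n ≫ dC n = dC' n ≫ Hom.f g (n - 1)) →
      ∀ n, ∃ e : D n ⟶ D (n - 1), e ≫ u (n - 1) = u n ≫ d n ∧ e ≫ q (n - 1) = q n ≫ dC' n :=
    fun d dC dC' h h' n => ⟨(hD (n - 1)).lift _ _ (by
      rw [Category.assoc, ← h, ← Category.assoc, (hD n).w, Category.assoc, h', Category.assoc]),
      (hD (n - 1)).lift_fst _ _ _, (hD (n - 1)).lift_snd _ _ _⟩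
  choose e he hq using hd B.d C.d C'.d p.comm g.comm
  choose e' he' hq' using hd B.d' C.d' C'.d' p.comm' g.comm'
  have hi : ∀ n, j n ≫ e n = A.d n ≫ j (n - 1) := fun n => (hD (n - 1)).hom_ext
      (by rw [Category.assoc, he, ← Category.assoc, hj, i.comm, Category.assoc, hj])
      (by rw [Category.assoc, hq, ← Category.assoc, (hc n).zero, zero_comp, Category.assoc,
        (hc (n - 1)).zero, comp_zero])
  have hi' : ∀ n, j n ≫ e' n = A.d' n ≫ j (n - 1) := fun n => (hD (n - 1)).hom_ext
      (by rw [Category.assoc, he', ← Category.assoc, hj, i.comm', Category.assoc, hj])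
      (by rw [Category.assoc, hq', ← Category.assoc, (hc n).zero, zero_comp, Category.assoc,
        (hc (n - 1)).zero, comp_zero])
  let E : BinaryAcyclicComplex S N := ofExtension A C' D e e'
    (fun n => (hD (n - 1 - 1)).hom_ext
      (by rw [Category.assoc, he, ← Category.assoc, he, Category.assoc, (B.d_comp_d n).1,
        zero_comp, comp_zero])
      (by rw [Category.assoc, hq, ← Category.assoc, hq, Category.assoc, (C'.d_comp_d n).1,
        zero_comp, comp_zero]))
    (fun n => (hD (n - 1 - 1)).hom_ext
      (by rw [Category.assoc, he', ← Category.assoc, he', Category.assoc, (B.d_comp_d n).2,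
        zero_comp, comp_zero])
      (by rw [Category.assoc, hq', ← Category.assoc, hq', Category.assoc, (C'.d_comp_d n).2,
        zero_comp, comp_zero]))
    j q hc hi hi' (fun n => (hq n).symm) (fun n => (hq' n).symm)
  let U : (E : Bq S N) ⟶ B := ⟨u, fun n => (he n).symm, fun n => (he' n).symm⟩
  let J : A ⟶ (E : Bq S N) := ⟨j, fun n => hi n, fun n => hi' n⟩
  let Q : (E : Bq S N) ⟶ C' := ⟨q, fun n => (hq n).symm, fun n => (hq' n).symm⟩
  have key : ∀ {W : ℤ → N} {dB : ∀ n, B.X n ⟶ B.X (n - 1)} {dC' : ∀ n, C'.X n ⟶ C'.X (n - 1)}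
      {dW : ∀ n, W n ⟶ W (n - 1)} {e : ∀ n, D n ⟶ D (n - 1)} (_ : ∀ n, e n ≫ u (n - 1) = u n ≫ dB n)
      (_ : ∀ n, e n ≫ q (n - 1) = q n ≫ dC' n) {b : ∀ n, W n ⟶ B.X n}
      {c : ∀ n, W n ⟶ C'.X n} (_ : ∀ n, b n ≫ dB n = dW n ≫ b (n - 1))
      (_ : ∀ n, c n ≫ dC' n = dW n ≫ c (n - 1)) (w : ∀ n, b n ≫ Hom.f p n = c n ≫ Hom.f g n)
      (n : ℤ), (hD n).lift (b n) (c n) (w n) ≫ e n =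
        dW n ≫ (hD (n - 1)).lift (b (n - 1)) (c (n - 1)) (w (n - 1)) := by
    intro W dB dC' dW e h1 h2 b c h3 h4 w n
    refine (hD (n - 1)).hom_ext ?_ ?_
    · rw [Category.assoc, Category.assoc, IsPullback.lift_fst, h1, ← Category.assoc,
        IsPullback.lift_fst, h3]
    · rw [Category.assoc, Category.assoc, IsPullback.lift_snd, h2, ← Category.assoc,
        IsPullback.lift_snd, h4]
  refine ⟨E, U, Q, ⟨⟨hom_ext fun n => (hD n).w⟩, ⟨PullbackCone.IsLimit.mk _ (fun s =>
    ⟨fun n => (hD n).lift (s.fst.f n) (s.snd.f n)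
      (congrArg (fun k => Hom.f k n) s.condition),
      key he hq s.fst.comm s.snd.comm fun n => congrArg (fun k => Hom.f k n) s.condition,
      key he' hq' s.fst.comm' s.snd.comm' fun n => congrArg (fun k => Hom.f k n) s.condition⟩)
      ?_ ?_ ?_⟩⟩, A, J, (confl_iff _ _).2 hc⟩
  · exact fun s => hom_ext fun n => (hD n).lift_fst _ _ _
  · exact fun s => hom_ext fun n => (hD n).lift_snd _ _ _
  · intro s m h1 h2
    refine hom_ext fun n => (hD n).hom_ext ?_ ?_
    · exact ((congrArg (fun k => Hom.f k n) h1).trans ((hD n).lift_fst _ _ _).symm)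
    · exact ((congrArg (fun k => Hom.f k n) h2).trans ((hD n).lift_snd _ _ _).symm)

instance Bq.isExact : (Bq S N).IsExact where
  hasZeroObject := ⟨⟨zeroComplex S N, isZero_zeroComplex⟩⟩
  hasBinaryBiproducts := inferInstanceAs (HasBinaryBiproducts (BinaryAcyclicComplex S N))
  of_iso e h n := IsExact.of_iso ((BinaryAcyclicComplex.eval S N n).mapShortComplex.mapIso e) (h n)
  isKernel T h := by
    have hc : ∀ n, N.Confl (Hom.f T.f n) (Hom.f T.g n) := fun n => ⟨_, h n⟩
    have hm := fun n => (hc n).mono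
    have : Mono T.f := mono_of_forall (S := S) (N := N) T.f hm
    have key : ∀ {W : Bq S N} (k : W ⟶ T.X₂), k ≫ T.g = 0 →
        ∃ l : W ⟶ T.X₁, l ≫ T.f = k := fun {W} k hk => by
      choose l hl using fun n => (hc n).exists_lift (Hom.f k n)
        (congrArg (fun x => Hom.f x n) hk)
      refine ⟨⟨l, fun n => ?_, fun n => ?_⟩, hom_ext hl⟩
      · rw [← cancel_mono (Hom.f T.f (n - 1)), Category.assoc, ← T.f.comm, ← Category.assoc, hl,
          k.comm, Category.assoc, hl]
      · rw [← cancel_mono (Hom.f T.f (n - 1)), Category.assoc, ← T.f.comm', ← Category.assoc, hl,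
          k.comm', Category.assoc, hl]
    exact ⟨KernelFork.IsLimit.ofι' _ _ fun k hk => ⟨(key k hk).choose, (key k hk).choose_spec⟩⟩
  isCokernel T h := by
    have hc : ∀ n, N.Confl (Hom.f T.f n) (Hom.f T.g n) := fun n => ⟨_, h n⟩
    have hm := fun n => (hc n).epi
    have : Epi T.g := epi_of_forall (S := S) (N := N) T.g hm
    have key : ∀ {W : Bq S N} (k : T.X₂ ⟶ W), T.f ≫ k = 0 →
        ∃ l : T.X₃ ⟶ W, T.g ≫ l = k := fun {W} k hk => by
      choose l hl using fun n => (hc n).exists_desc (Hom.f k n)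
        (congrArg (fun x => Hom.f x n) hk)
      refine ⟨⟨l, fun n => ?_, fun n => ?_⟩, hom_ext hl⟩
      · rw [← cancel_epi (Hom.f T.g n), ← Category.assoc, hl, k.comm, ← Category.assoc, T.g.comm,
          Category.assoc, hl]
      · rw [← cancel_epi (Hom.f T.g n), ← Category.assoc, hl, k.comm', ← Category.assoc,
          T.g.comm', Category.assoc, hl]
    exact ⟨CokernelCofork.IsColimit.ofπ' _ _ fun k hk =>
      ⟨(key k hk).choose, (key k hk).choose_spec⟩⟩
  admMono_id A := ⟨zeroComplex S N,
    show (show BinaryAcyclicComplex S N from A) ⟶ zeroComplex S N from 0,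
    (confl_iff _ _).2 fun n => confl_id_zero (isZero_zero _) _⟩
  admEpi_id A := ⟨zeroComplex S N,
    show zeroComplex S N ⟶ (show BinaryAcyclicComplex S N from A) from 0,
    (confl_iff _ _).2 fun n => confl_zero_id (isZero_zero _) _⟩
  admMono_comp := Bq.admMono_comp S N
  admEpi_comp := Bq.admEpi_comp S N
  pushout := Bq.exists_pushout S N
  pullback := Bq.exists_pullback S N

instance iterBq.isExact : ∀ n : ℕ, (iterBq S n N).IsExact
  | 0 => inferInstanceAs N.IsExact
  | n + 1 =>
    have := iterBq.isExact n
    Bq.isExact S (iterBq S n N)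

/-- Evaluation in degree `n` is exact. -/
def Bq.eval (n : ℤ) : ExactFunctor (Bq S N) N where
  functor := BinaryAcyclicComplex.eval S N n
  additive := inferInstanceAs (BinaryAcyclicComplex.eval S N n).Additive
  map_conflation _ h := h n

end Exact


open ConflationCategory

/-! ### Binary complexes indexed by natural numbers -/

/-- A graded object indexed by `ℕ` with two families of maps of degree `-1`. -/
structure NatBinary (N : ConflationCategory.{v, u}) where
  X : ℕ → N
  d : ∀ n, X (n + 1) ⟶ X n
  d' : ∀ n, X (n + 1) ⟶ X n

/-- Factorizations of a differential through its cycles, for graded objects indexed by `ℕ`. -/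
structure NatFactorization (N : ConflationCategory.{v, u}) (X : ℕ → N)
    (d : ∀ n, X (n + 1) ⟶ X n) where
  Z : ℕ → N
  p : ∀ n, X (n + 1) ⟶ Z n
  ι : ∀ n, Z n ⟶ X n
  fac : ∀ n, p n ≫ ι n = d n
  confl : ∀ n, N.Confl (ι (n + 1)) (p n)
  isIso : IsIso (ι 0)

variable {N : ConflationCategory.{v, u}} [N.IsExact]

section

namespace NatFactorization

variable {X Y W : ℕ → N} {dX : ∀ n, X (n + 1) ⟶ X n} {dY : ∀ n, Y (n + 1) ⟶ Y n}
  {dW : ∀ n, W (n + 1) ⟶ W n}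

theorem mono_ι (F : NatFactorization N X dX) : ∀ n, Mono (F.ι n)
  | 0 => have := F.isIso; inferInstance
  | n + 1 => (F.confl n).mono

theorem ι_comp_d (F : NatFactorization N X dX) (n : ℕ) : F.ι (n + 1) ≫ dX n = 0 := by
  rw [← F.fac, ← Category.assoc, (F.confl n).zero, zero_comp]

theorem d_comp_p (F : NatFactorization N X dX) (n : ℕ) : dX (n + 1) ≫ F.p n = 0 := by
  rw [← F.fac, Category.assoc, (F.confl n).zero, comp_zero]

theorem d_comp_d (F : NatFactorization N X dX) (n : ℕ) : dX (n + 1) ≫ dX n = 0 := by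
  rw [← F.fac n, ← Category.assoc, F.d_comp_p, zero_comp]

theorem exists_lift (F : NatFactorization N X dX) {n : ℕ} {T : N} (k : T ⟶ X (n + 1))
    (hk : k ≫ dX n = 0) : ∃ l : T ⟶ F.Z (n + 1), l ≫ F.ι (n + 1) = k := by
  have := F.mono_ι n
  refine (F.confl n).exists_lift k ?_
  rw [← cancel_mono (F.ι n), Category.assoc, F.fac, hk, zero_comp]

/-- Transport of a factorization along an isomorphism of complexes. -/
def ofIso (F : NatFactorization N X dX) (e : ∀ n, X n ≅ Y n)
    (h : ∀ n, (e (n + 1)).hom ≫ dY n = dX n ≫ (e n).hom) : NatFactorization N Y dY where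
  Z := F.Z
  p n := (e (n + 1)).inv ≫ F.p n
  ι n := F.ι n ≫ (e n).hom
  fac n := by rw [Category.assoc, ← Category.assoc (F.p n), F.fac, ← h]; simp
  confl n := (F.confl n).of_iso (Iso.refl _) (e (n + 1)) (Iso.refl _) (by simp) (by simp)
  isIso := have := F.isIso; inferInstance

/-- Extensions of acyclic complexes are acyclic. -/
theorem of_extension (FA : NatFactorization N X dX) (FC : NatFactorization N W dW)
    {i : ∀ n, X n ⟶ Y n} {p : ∀ n, Y n ⟶ W n} (h : ∀ n, N.Confl (i n) (p n))
    (hi : ∀ n, i (n + 1) ≫ dY n = dX n ≫ i n) (hp : ∀ n, p (n + 1) ≫ dW n = dY n ≫ p n)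
    (hd : ∀ n, dY (n + 1) ≫ dY n = 0) : Nonempty (NatFactorization N Y dY) := by
  -- The induction for integer degrees again, except that degree zero has no differential: there `ι`
  -- is an isomorphism instead of a kernel. The equation `e` lets one statement cover both cases.
  have key : ∀ n, ∃ (Z : N) (ι : Z ⟶ Y n) (s : FA.Z n ⟶ Z) (t : Z ⟶ FC.Z n),
      Mono ι ∧ (∀ k, n = k + 1 → ∀ {T : N} (x : T ⟶ Y (k + 1)) (e : Y (k + 1) = Y n),
        x ≫ dY k = 0 ↔ ∃ l, l ≫ ι = x ≫ eqToHom e) ∧ (n = 0 → IsIso ι) ∧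
      N.Confl s t ∧ s ≫ ι = FA.ι n ≫ i n ∧ t ≫ FC.ι n = ι ≫ p n := by
    intro n
    induction n with
    | zero =>
      have := FA.isIso
      have := FC.isIso
      refine ⟨Y 0, 𝟙 _, FA.ι 0 ≫ i 0, p 0 ≫ inv (FC.ι 0), inferInstance, fun k hk => by omega,
        fun _ => inferInstance, ?_, by simp, by simp⟩
      exact (h 0).of_iso (asIso (FA.ι 0)).symm (Iso.refl _) (asIso (FC.ι 0)).symm
        (by simp) (by simp)
    | succ n ih =>
      obtain ⟨Z, ι, s, t, hm, hl, h0, hc, hs, ht⟩ := ih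
      have hq : ∃ q, q ≫ ι = dY n := by
        cases n with
        | zero =>
          have := h0 rfl
          exact ⟨dY 0 ≫ inv ι, by simp⟩
        | succ k =>
          obtain ⟨q, hq⟩ := (hl k rfl (dY (k + 1)) rfl).1 (hd k)
          exact ⟨q, by simpa using hq⟩
      obtain ⟨q, hq⟩ := hq
      have hmA := FA.mono_ι n
      have hmC := FC.mono_ι n
      obtain ⟨K, k, s', t', hk, hc', hs', ht'⟩ := exists_kernel_of_confl (h (n + 1)) hc
        (FA.confl n) (FC.confl n) (β := q)
        (by rw [← cancel_mono ι, Category.assoc, Category.assoc, hs, hq, hi, ← Category.assoc,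
          FA.fac])
        (by rw [← cancel_mono (FC.ι n), Category.assoc, Category.assoc, ht, FC.fac,
          ← Category.assoc, hq, hp])
      refine ⟨K, k, s', t', hk.mono, ?_, fun h => by omega, hc', hs', ht'⟩
      rintro k' hk' T x e
      obtain rfl : n = k' := by omega
      simp only [eqToHom_refl, Category.comp_id]
      constructor
      · intro hx
        refine hk.exists_lift x ?_
        rw [← cancel_mono ι, Category.assoc, hq, hx, zero_comp]
      · rintro ⟨l, rfl⟩
        rw [← hq, Category.assoc, ← Category.assoc k, hk.zero, zero_comp, comp_zero]
  choose Z ι s t hm hl h0 hc hs ht using key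
  have hq : ∀ n, ∃ q : Y (n + 1) ⟶ Z n, q ≫ ι n = dY n := fun n => by
    cases n with
    | zero =>
      have := h0 0 rfl
      exact ⟨dY 0 ≫ inv (ι 0), by simp⟩
    | succ k =>
      obtain ⟨q, hq⟩ := (hl (k + 1) k rfl (dY (k + 1)) rfl).1 (hd k)
      exact ⟨q, by simpa using hq⟩
  choose q hq using hq
  refine ⟨⟨Z, q, ι, hq, fun n => ?_, h0 0 rfl⟩⟩
  have hmA := FA.mono_ι n
  have hmC := FC.mono_ι n
  have hm' := hm n
  have := hm (n + 1)
  have hq' := (admEpi_and_confl_of_confl (h (n + 1)) (hc n) (FA.confl n)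
        (FC.confl n) (β := q n)
        (by rw [← cancel_mono (ι n), Category.assoc, Category.assoc, hs, hq, hi,
          ← Category.assoc, FA.fac])
        (by rw [← cancel_mono (FC.ι n), Category.assoc, Category.assoc, ht, FC.fac,
          ← Category.assoc, hq, hp])).1
  refine confl_of_admEpi' hq' ?_ fun k hk => ?_
  · rw [← cancel_mono (ι n), Category.assoc, hq, zero_comp]
    exact (hl (n + 1) n rfl (ι (n + 1)) rfl).2 ⟨𝟙 _, by simp⟩
  · obtain ⟨l, hl'⟩ := (hl (n + 1) n rfl k rfl).1 (by
      rw [← hq, ← Category.assoc, hk, zero_comp])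
    exact ⟨l, by simpa using hl'⟩

end NatFactorization

namespace NatBinary

/-- Morphisms commute with both differentials. -/
structure Hom (P Q : NatBinary N) where
  f : ∀ n, P.X n ⟶ Q.X n
  comm : ∀ n, f (n + 1) ≫ Q.d n = P.d n ≫ f n
  comm' : ∀ n, f (n + 1) ≫ Q.d' n = P.d' n ≫ f n

/-- Both differentials are acyclic, and the objects in degrees `≥ b` vanish. -/
structure IsBin (P : NatBinary N) (b : ℕ) : Prop where
  acyclic : Nonempty (NatFactorization N P.X P.d)
  acyclic' : Nonempty (NatFactorization N P.X P.d')
  isZero : ∀ n, b ≤ n → IsZero (P.X n)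

namespace IsBin

variable {P Q R : NatBinary N} {b : ℕ}

theorem mono (h : P.IsBin b) {b' : ℕ} (hb : b ≤ b') : P.IsBin b' :=
  ⟨h.acyclic, h.acyclic', fun n hn => h.isZero n (hb.trans hn)⟩

theorem d_comp_d (h : P.IsBin b) (n : ℕ) : P.d (n + 1) ≫ P.d n = 0 := h.acyclic.some.d_comp_d n

theorem d'_comp_d' (h : P.IsBin b) (n : ℕ) : P.d' (n + 1) ≫ P.d' n = 0 :=
  h.acyclic'.some.d_comp_d n

theorem of_iso (h : P.IsBin b) (e : ∀ n, P.X n ≅ Q.X n)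
    (he : ∀ n, (e (n + 1)).hom ≫ Q.d n = P.d n ≫ (e n).hom)
    (he' : ∀ n, (e (n + 1)).hom ≫ Q.d' n = P.d' n ≫ (e n).hom) : Q.IsBin b :=
  ⟨⟨h.acyclic.some.ofIso e he⟩, ⟨h.acyclic'.some.ofIso e he'⟩,
    fun n hn => (h.isZero n hn).of_iso (e n).symm⟩

theorem of_extension (hP : P.IsBin b) (hR : R.IsBin b) (f : P.Hom Q) (g : Q.Hom R)
    (h : ∀ n, N.Confl (f.f n) (g.f n)) (hd : ∀ n, Q.d (n + 1) ≫ Q.d n = 0)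
    (hd' : ∀ n, Q.d' (n + 1) ≫ Q.d' n = 0) : Q.IsBin b :=
  ⟨hP.acyclic.some.of_extension hR.acyclic.some h f.comm g.comm hd,
    hP.acyclic'.some.of_extension hR.acyclic'.some h f.comm' g.comm' hd',
    fun n hn => (h n).isZero_mid (hP.isZero n hn) (hR.isZero n hn)⟩

end IsBin

end NatBinary

end

/-- Functions on binary acyclic complexes of length less than `b` that are additive in short exact
sequences and vanish on complexes whose differentials coincide. -/
structure AdditiveInvariant (N : ConflationCategory.{v, u}) (V : Type w) [AddCommGroup V]
    (b : ℕ) where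
  c : NatBinary N → V
  add : ∀ {P Q R : NatBinary N}, P.IsBin b → Q.IsBin b → R.IsBin b → ∀ (f : P.Hom Q)
    (g : Q.Hom R), (∀ n, N.Confl (f.f n) (g.f n)) → c Q = c P + c R
  diag : ∀ {P : NatBinary N}, P.IsBin b → P.d = P.d' → c P = 0

/-! ### Shifts, signs, direct sums and mapping cones -/

open scoped ZeroObject

namespace NatBinary

variable {b : ℕ}

/-- The shift by one. -/
noncomputable def sh (P : NatBinary N) : NatBinary N where
  X
    | 0 => 0
    | n + 1 => P.X n
  d
    | 0 => 0
    | n + 1 => P.d n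
  d'
    | 0 => 0
    | n + 1 => P.d' n

/-- The shift of a factorization. -/
noncomputable def factorizationSh {P : NatBinary N} (F : NatFactorization N P.X P.d) :
    NatFactorization N P.sh.X P.sh.d where
  Z
    | 0 => 0
    | n + 1 => F.Z n
  p
    | 0 => 0
    | n + 1 => F.p n
  ι
    | 0 => 𝟙 0
    | n + 1 => F.ι n
  fac
    | 0 => zero_comp
    | n + 1 => F.fac n
  confl
    | 0 =>
      have := F.isIso
      (confl_id_zero (N := N) (A := P.X 0) (isZero_zero N) 0).of_iso (asIso (F.ι 0)).symm
        (Iso.refl _) (Iso.refl _) (by simp [sh]) ((isZero_zero N).eq_of_tgt _ _)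
    | n + 1 => F.confl n
  isIso := inferInstanceAs (IsIso (𝟙 (0 : N)))

/-- The complex with top and bottom differentials exchanged. -/
def flip (P : NatBinary N) : NatBinary N where
  X := P.X
  d := P.d'
  d' := P.d

/-- The shift of a factorization of the bottom differential. -/
noncomputable def factorizationSh' {P : NatBinary N} (F : NatFactorization N P.X P.d') :
    NatFactorization N P.sh.X P.sh.d' where
  Z
    | 0 => 0
    | n + 1 => F.Z n
  p
    | 0 => 0
    | n + 1 => F.p n
  ι
    | 0 => 𝟙 0
    | n + 1 => F.ι n
  fac
    | 0 => zero_comp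
    | n + 1 => F.fac n
  confl
    | 0 =>
      have := F.isIso
      (confl_id_zero (N := N) (A := P.X 0) (isZero_zero N) 0).of_iso (asIso (F.ι 0)).symm
        (Iso.refl _) (Iso.refl _) (by simp [sh]) ((isZero_zero N).eq_of_tgt _ _)
    | n + 1 => F.confl n
  isIso := inferInstanceAs (IsIso (𝟙 (0 : N)))

theorem IsBin.sh {P : NatBinary N} (h : P.IsBin b) : P.sh.IsBin (b + 1) :=
  ⟨⟨factorizationSh h.acyclic.some⟩, ⟨factorizationSh' h.acyclic'.some⟩, fun n hn => by
    cases n with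
    | zero => exact isZero_zero N
    | succ n => exact h.isZero n (by omega)⟩

/-- The shift of a morphism. -/
noncomputable def Hom.sh {P Q : NatBinary N} (f : P.Hom Q) : P.sh.Hom Q.sh where
  f
    | 0 => 𝟙 0
    | n + 1 => f.f n
  comm
    | 0 => (comp_zero).trans zero_comp.symm
    | n + 1 => f.comm n
  comm'
    | 0 => (comp_zero).trans zero_comp.symm
    | n + 1 => f.comm' n

theorem Hom.confl_sh {P Q R : NatBinary N} {f : P.Hom Q} {g : Q.Hom R}
    (h : ∀ n, N.Confl (f.f n) (g.f n)) : ∀ n, N.Confl (f.sh.f n) (g.sh.f n)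
  | 0 => (confl_id_zero (N := N) (A := 0) (isZero_zero N) 0).of_iso (Iso.refl _) (Iso.refl _)
      (Iso.refl _) ((isZero_zero N).eq_of_src _ _) ((isZero_zero N).eq_of_src _ _)
  | n + 1 => h n

/-- The complex with both differentials multiplied by `-1`. -/
def neg (P : NatBinary N) : NatBinary N where
  X := P.X
  d n := -P.d n
  d' n := -P.d' n

/-- Multiplication by `(-1)^n`. -/
def signIso (X : N) (n : ℕ) : X ≅ X where
  hom := ((-1 : ℤ) ^ n) • 𝟙 X
  inv := ((-1 : ℤ) ^ n) • 𝟙 X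
  hom_inv_id := by
    rw [Preadditive.zsmul_comp, Preadditive.comp_zsmul, smul_smul, ← mul_pow]
    simp
  inv_hom_id := by
    rw [Preadditive.zsmul_comp, Preadditive.comp_zsmul, smul_smul, ← mul_pow]
    simp

/-- The direct sum of two complexes. -/
noncomputable def dsum (P Q : NatBinary N) : NatBinary N where
  X n := P.X n ⊞ Q.X n
  d n := biprod.map (P.d n) (Q.d n)
  d' n := biprod.map (P.d' n) (Q.d' n)

/-- The inclusion of the first summand. -/
noncomputable def dsumInl (P Q : NatBinary N) : P.Hom (P.dsum Q) :=
  ⟨fun _ => biprod.inl, fun _ => by simp [dsum], fun _ => by simp [dsum]⟩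

/-- The projection to the second summand. -/
noncomputable def dsumSnd (P Q : NatBinary N) : (P.dsum Q).Hom Q :=
  ⟨fun _ => biprod.snd, fun _ => by simp [dsum], fun _ => by simp [dsum]⟩

theorem IsBin.dsum {P Q : NatBinary N} (hP : P.IsBin b) (hQ : Q.IsBin b) : (P.dsum Q).IsBin b :=
  hP.of_extension hQ (dsumInl P Q) (dsumSnd P Q) (fun _ => confl_inl_snd _ _)
    (fun n => by
      change biprod.map _ _ ≫ biprod.map _ _ = (0 : P.X (n + 2) ⊞ Q.X (n + 2) ⟶ P.X n ⊞ Q.X n)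
      ext <;> simp [hP.d_comp_d, hQ.d_comp_d])
    (fun n => by
      change biprod.map _ _ ≫ biprod.map _ _ = (0 : P.X (n + 2) ⊞ Q.X (n + 2) ⟶ P.X n ⊞ Q.X n)
      ext <;> simp [hP.d'_comp_d', hQ.d'_comp_d'])

/-- The complex `X ⟶ Y` in degrees `1` and `0` given by two isomorphisms. -/
noncomputable def twoTerm {X Y : N} (t s : X ≅ Y) : NatBinary N where
  X
    | 0 => Y
    | 1 => X
    | _ + 2 => 0
  d
    | 0 => t.hom
    | _ + 1 => 0
  d'
    | 0 => s.hom
    | _ + 1 => 0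

/-- The factorization of a differential of `twoTerm`. -/
noncomputable def factorizationTwoTerm {X Y : N} (t s : X ≅ Y) :
    NatFactorization N (twoTerm t s).X (twoTerm t s).d where
  Z
    | 0 => Y
    | _ + 1 => 0
  p
    | 0 => t.hom
    | _ + 1 => 0
  ι
    | 0 => 𝟙 Y
    | _ + 1 => 0
  fac
    | 0 => Category.comp_id _
    | _ + 1 => zero_comp
  confl
    | 0 => (confl_zero_id (N := N) (A := X) (isZero_zero N) 0).of_iso (Iso.refl _) (Iso.refl _) t
        ((isZero_zero N).eq_of_src _ _) ((Category.id_comp _).trans (Category.id_comp _).symm)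
    | _ + 1 => (confl_zero_id (N := N) (A := 0) (isZero_zero N) 0).of_iso (Iso.refl _)
        (Iso.refl _) (Iso.refl _) ((isZero_zero N).eq_of_src _ _) ((isZero_zero N).eq_of_src _ _)
  isIso := inferInstanceAs (IsIso (𝟙 Y))

theorem isBin_twoTerm {X Y : N} (t s : X ≅ Y) : (twoTerm t s).IsBin 2 :=
  ⟨⟨factorizationTwoTerm t s⟩, ⟨factorizationTwoTerm s t⟩, fun n hn => by
    obtain ⟨n, rfl⟩ := Nat.exists_eq_add_of_le' hn
    exact isZero_zero N⟩

section Cone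

variable (X Y : NatBinary N) (τ σ : ∀ n, X.X n ≅ Y.X n)

/-- The mapping cone of two families of isomorphisms. -/
noncomputable def cone : NatBinary N where
  X
    | 0 => Y.X 0
    | n + 1 => Y.X (n + 1) ⊞ X.X n
  d
    | 0 => biprod.desc (Y.d 0) (τ 0).hom
    | n + 1 => biprod.lift (biprod.desc (Y.d (n + 1)) (τ (n + 1)).hom) (biprod.snd ≫ (-X.d n))
  d'
    | 0 => biprod.desc (Y.d' 0) (σ 0).hom
    | n + 1 => biprod.lift (biprod.desc (Y.d' (n + 1)) (σ (n + 1)).hom) (biprod.snd ≫ (-X.d' n))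

/-- The shear of `A ⊞ B` along `f ≫ e.inv` turns this sequence into the split one. -/
theorem confl_graph {A B C : N} (f : A ⟶ C) (e : B ≅ C) :
    N.Confl (biprod.lift (𝟙 A) (-(f ≫ e.inv))) (biprod.desc f e.hom) := by
  refine (confl_inl_snd A B).of_iso (Iso.refl _)
    ⟨biprod.lift biprod.fst (biprod.snd - biprod.fst ≫ f ≫ e.inv),
      biprod.lift biprod.fst (biprod.snd + biprod.fst ≫ f ≫ e.inv), ?_, ?_⟩ e ?_ ?_
  · ext <;> simp
  · ext <;> simp
  · ext <;> simp
  · ext <;> simp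

variable {X Y τ σ} {dX : ∀ n, X.X (n + 1) ⟶ X.X n}

/-- The factorization of a differential of the mapping cone. -/
noncomputable def factorizationCone (hY : ∀ n, Y.d (n + 1) ≫ Y.d n = 0)
    (h : ∀ n, (τ (n + 1)).hom ≫ Y.d n = X.d n ≫ (τ n).hom) :
    NatFactorization N (cone X Y τ σ).X (cone X Y τ σ).d where
  Z := Y.X
  p n := biprod.desc (Y.d n) (τ n).hom
  ι
    | 0 => 𝟙 _
    | n + 1 => biprod.lift (𝟙 _) (-(Y.d n ≫ (τ n).inv))
  fac
    | 0 => Category.comp_id _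
    | n + 1 => by
      change biprod.desc (Y.d (n + 1)) (τ (n + 1)).hom ≫ _ =
        biprod.lift (biprod.desc (Y.d (n + 1)) (τ (n + 1)).hom) (biprod.snd ≫ (-X.d n))
      ext
      · simp
      · simp [reassoc_of% hY]
      · simp
      · simp [reassoc_of% h]
  confl n := confl_graph (Y.d n) (τ n)
  isIso := inferInstanceAs (IsIso (𝟙 (Y.X 0)))

/-- The cone of an isomorphism is contractible, with `Y.X n` as cycles in degree `n`. So `X` and `Y`
need not be acyclic; it is enough that the differentials of `Y` square to zero. This freedom is
needed for truncated complexes and for `cutW`. -/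
theorem isBin_cone (hY : ∀ n, Y.d (n + 1) ≫ Y.d n = 0) (hY' : ∀ n, Y.d' (n + 1) ≫ Y.d' n = 0)
    (h : ∀ n, (τ (n + 1)).hom ≫ Y.d n = X.d n ≫ (τ n).hom)
    (h' : ∀ n, (σ (n + 1)).hom ≫ Y.d' n = X.d' n ≫ (σ n).hom)
    (hz : ∀ n, b ≤ n → IsZero (Y.X n)) : (cone X Y τ σ).IsBin (b + 1) where
  acyclic := ⟨factorizationCone hY h⟩
  acyclic' := ⟨factorizationCone (X := X.flip) (Y := Y.flip) (τ := σ) (σ := τ) hY' h'⟩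
  isZero n hn := by
    obtain ⟨n, rfl⟩ := Nat.exists_eq_add_of_le' (show 1 ≤ n by omega)
    exact (confl_inl_snd _ _).isZero_mid (hz _ (by omega))
      ((hz n (by omega)).of_iso (τ n))

/-- The complex without its object in degree zero, shifted to the bottom. -/
def drop (X : NatBinary N) : NatBinary N where
  X n := X.X (n + 1)
  d n := X.d (n + 1)
  d' n := X.d' (n + 1)

variable (X Y τ σ)

/-- The part of the cone that involves the objects in degree zero. -/
noncomputable def coneBottom : (twoTerm (τ 0) (σ 0)).Hom (cone X Y τ σ) where
  f
    | 0 => 𝟙 _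
    | 1 => biprod.inr
    | _ + 2 => 0
  comm
    | 0 => (biprod.inr_desc _ _).trans (Category.comp_id _).symm
    | 1 => (isZero_zero N).eq_of_src _ _
    | _ + 2 => (isZero_zero N).eq_of_src _ _
  comm'
    | 0 => (biprod.inr_desc _ _).trans (Category.comp_id _).symm
    | 1 => (isZero_zero N).eq_of_src _ _
    | _ + 2 => (isZero_zero N).eq_of_src _ _

/-- The quotient of the cone by the part that involves the objects in degree zero. -/
noncomputable def coneDrop : (cone X Y τ σ).Hom
    (cone X.drop Y.drop (fun n => τ (n + 1)) (fun n => σ (n + 1))).sh where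
  f
    | 0 => 0
    | 1 => biprod.fst
    | _ + 2 => 𝟙 _
  comm
    | 0 => (isZero_zero N).eq_of_tgt _ _
    | 1 => (Category.id_comp _).trans (biprod.lift_fst _ _).symm
    | _ + 2 => (Category.id_comp _).trans (Category.comp_id _).symm
  comm'
    | 0 => (isZero_zero N).eq_of_tgt _ _
    | 1 => (Category.id_comp _).trans (biprod.lift_fst _ _).symm
    | _ + 2 => (Category.id_comp _).trans (Category.comp_id _).symm

/-- The first filtration of the cone: the two objects of degree zero split off as a two-term
subcomplex, and what remains is again a cone of isomorphisms. -/
theorem confl_coneBottom_coneDrop : ∀ n, N.Confl ((coneBottom X Y τ σ).f n) ((coneDrop X Y τ σ).f n)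
  | 0 => confl_id_zero (isZero_zero N) _
  | 1 => confl_inr_fst _ _
  | _ + 2 => confl_zero_id (isZero_zero N) _

/-- The inclusion into the cone. -/
noncomputable def coneInl : Y.Hom (cone X Y τ σ) where
  f
    | 0 => 𝟙 _
    | _ + 1 => biprod.inl
  comm
    | 0 => (biprod.inl_desc _ _).trans (Category.comp_id _).symm
    | n + 1 => by
      change biprod.inl ≫ biprod.lift (biprod.desc (Y.d (n + 1)) (τ (n + 1)).hom)
        (biprod.snd ≫ (-X.d n)) = Y.d (n + 1) ≫ biprod.inl
      ext <;> simp
  comm'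
    | 0 => (biprod.inl_desc _ _).trans (Category.comp_id _).symm
    | n + 1 => by
      change biprod.inl ≫ biprod.lift (biprod.desc (Y.d' (n + 1)) (σ (n + 1)).hom)
        (biprod.snd ≫ (-X.d' n)) = Y.d' (n + 1) ≫ biprod.inl
      ext <;> simp

/-- The projection from the cone. -/
noncomputable def coneSnd : (cone X Y τ σ).Hom X.neg.sh where
  f
    | 0 => 0
    | _ + 1 => biprod.snd
  comm
    | 0 => (isZero_zero N).eq_of_tgt _ _
    | _ + 1 => (biprod.lift_snd _ _).symm
  comm'
    | 0 => (isZero_zero N).eq_of_tgt _ _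
    | _ + 1 => (biprod.lift_snd _ _).symm

/-- The second filtration: the usual sequence of a mapping cone. -/
theorem confl_coneInl_coneSnd : ∀ n, N.Confl ((coneInl X Y τ σ).f n) ((coneSnd X Y τ σ).f n)
  | 0 => confl_id_zero (isZero_zero N) _
  | _ + 1 => confl_inl_snd _ _

end Cone

end NatBinary

/-! ### Additive invariants under shifts and changes of the differentials -/

namespace AdditiveInvariant

open NatBinary

variable {V : Type w} [AddCommGroup V] {b : ℕ}

/-- An additive invariant restricts to shorter complexes. -/
def restrict (c : AdditiveInvariant N V b) {b' : ℕ} (h : b' ≤ b) : AdditiveInvariant N V b' where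
  c := c.c
  add hP hQ hR := c.add (hP.mono h) (hQ.mono h) (hR.mono h)
  diag hP := c.diag (hP.mono h)

/-- The value of an additive invariant on the shifted complex. -/
noncomputable def shift (c : AdditiveInvariant N V (b + 1)) : AdditiveInvariant N V b where
  c P := c.c P.sh
  add hP hQ hR f g h := c.add hP.sh hQ.sh hR.sh f.sh g.sh (Hom.confl_sh h)
  diag {P} hP h := c.diag hP.sh (by
    funext n
    cases n with
    | zero => rfl
    | succ n => exact congrFun h n)

theorem eq_zero (c : AdditiveInvariant N V b) {P : NatBinary N} (hP : P.IsBin b)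
    (h : ∀ n, IsZero (P.X n)) : c.c P = 0 :=
  c.diag hP (funext fun _ => (h _).eq_of_src _ _)

/-- An isomorphism is a short exact sequence whose kernel is the zero complex, and the zero complex
has value zero by `diag`. -/
theorem congr (c : AdditiveInvariant N V b) {P Q : NatBinary N} (hP : P.IsBin b)
    (e : ∀ n, P.X n ≅ Q.X n) (he : ∀ n, (e (n + 1)).hom ≫ Q.d n = P.d n ≫ (e n).hom)
    (he' : ∀ n, (e (n + 1)).hom ≫ Q.d' n = P.d' n ≫ (e n).hom) : c.c P = c.c Q := by
  let O : NatBinary N := ⟨fun _ => 0, fun _ => 0, fun _ => 0⟩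
  have hO : O.IsBin b := ⟨⟨⟨fun _ => 0, fun _ => 0, fun _ => 𝟙 _, fun _ => by simp [O],
    fun _ => confl_id_zero (N := N) (A := 0) (isZero_zero N) _, inferInstanceAs (IsIso (𝟙 _))⟩⟩,
    ⟨⟨fun _ => 0, fun _ => 0, fun _ => 𝟙 _, fun _ => by simp [O],
    fun _ => confl_id_zero (N := N) (A := 0) (isZero_zero N) _, inferInstanceAs (IsIso (𝟙 _))⟩⟩,
    fun _ _ => isZero_zero N⟩
  have h := c.add hO hP (hP.of_iso e he he') (P := O) ⟨fun _ => 0, by simp [O], by simp [O]⟩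
    ⟨fun n => (e n).hom, he, he'⟩ (fun n => (confl_zero_id (isZero_zero N) (0 : 0 ⟶ P.X n)).of_iso (Iso.refl _)
      (Iso.refl _) (e n) ((isZero_zero N).eq_of_src _ _) (by simp))
  rw [h, c.eq_zero hO fun _ => isZero_zero N, zero_add]

theorem dsum (c : AdditiveInvariant N V b) {P Q : NatBinary N} (hP : P.IsBin b)
    (hQ : Q.IsBin b) : c.c (P.dsum Q) = c.c P + c.c Q :=
  c.add hP (hP.dsum hQ) hQ (dsumInl P Q) (dsumSnd P Q) fun _ => confl_inl_snd _ _

theorem twoTerm_self (c : AdditiveInvariant N V b) (hb : 2 ≤ b) {X Y : N} (t : X ≅ Y) :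
    c.c (twoTerm t t) = 0 := c.diag ((isBin_twoTerm t t).mono hb) rfl

theorem cone_add (c : AdditiveInvariant N V (b + 1)) (hb : 1 ≤ b) {X Y : NatBinary N}
    {τ σ : ∀ n, X.X n ≅ Y.X n}
    (hY : ∀ n, Y.d (n + 1) ≫ Y.d n = 0) (hY' : ∀ n, Y.d' (n + 1) ≫ Y.d' n = 0)
    (h : ∀ n, (τ (n + 1)).hom ≫ Y.d n = X.d n ≫ (τ n).hom)
    (h' : ∀ n, (σ (n + 1)).hom ≫ Y.d' n = X.d' n ≫ (σ n).hom)
    (hz : ∀ n, b ≤ n → IsZero (Y.X n)) :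
    c.c (cone X Y τ σ) = c.c (twoTerm (τ 0) (σ 0)) +
      c.c (cone X.drop Y.drop (fun n => τ (n + 1)) (fun n => σ (n + 1))).sh := by
  obtain ⟨b, rfl⟩ := Nat.exists_eq_add_of_le' hb
  have h1 : (cone X.drop Y.drop (fun n => τ (n + 1)) (fun n => σ (n + 1))).IsBin (b + 1) :=
    isBin_cone (fun n => hY (n + 1)) (fun n => hY' (n + 1)) (fun n => h (n + 1))
      (fun n => h' (n + 1)) fun n hn => hz (n + 1) (by omega)
  exact c.add ((isBin_twoTerm _ _).mono (by omega)) (isBin_cone hY hY' h h' hz) h1.sh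
    (coneBottom X Y τ σ) (coneDrop X Y τ σ) (confl_coneBottom_coneDrop X Y τ σ)

/-- The two differentials of the cone may differ, so `diag` does not apply to it. It applies to the
two-term complexes that remain when the cone is dismantled degree by degree. The length `b` varies
in the induction because each step passes to `c.shift`. -/
theorem cone_self (m : ℕ) : ∀ {b : ℕ} (c : AdditiveInvariant N V (b + 1)) (_ : m ≤ b)
    {X Y : NatBinary N} {τ : ∀ n, X.X n ≅ Y.X n}
    (_ : ∀ n, Y.d (n + 1) ≫ Y.d n = 0) (_ : ∀ n, Y.d' (n + 1) ≫ Y.d' n = 0)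
    (_ : ∀ n, (τ (n + 1)).hom ≫ Y.d n = X.d n ≫ (τ n).hom)
    (_ : ∀ n, (τ (n + 1)).hom ≫ Y.d' n = X.d' n ≫ (τ n).hom)
    (_ : ∀ n, m ≤ n → IsZero (Y.X n)), c.c (cone X Y τ τ) = 0 := by
  induction m with
  | zero =>
    intro b c _ X Y τ hY hY' h h' hz
    refine c.eq_zero (isBin_cone hY hY' h h' fun n _ => hz n (Nat.zero_le n)) fun n => ?_
    cases n with
    | zero => exact hz 0 le_rfl
    | succ n =>
      exact (confl_inl_snd (Y.X (n + 1)) (X.X n)).isZero_mid (hz _ (by omega))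
        ((hz n (by omega)).of_iso (τ n))
  | succ m ih =>
    intro b c hb X Y τ hY hY' h h' hz
    obtain ⟨b, rfl⟩ := Nat.exists_eq_add_of_le' (show 1 ≤ b by omega)
    rw [c.cone_add (by omega) hY hY' h h' fun n hn => hz n (by omega),
      c.twoTerm_self (by omega), zero_add]
    exact ih c.shift (by omega) (fun n => hY (n + 1)) (fun n => hY' (n + 1)) (fun n => h (n + 1))
      (fun n => h' (n + 1)) fun n hn => hz (n + 1) (by omega)

/-- The signs `(-1) ^ n` are an isomorphism from `P` to the complex with negated differentials. -/
theorem c_neg (c : AdditiveInvariant N V b) {P : NatBinary N} (hP : P.IsBin b) :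
    c.c P.neg = c.c P :=
  (c.congr (Q := P.neg) hP (fun n => signIso (P.X n) n) (fun n => by
    simp [signIso, neg, pow_succ]) (fun n => by simp [signIso, neg, pow_succ])).symm

theorem _root_.GraysonK.NatBinary.IsBin.neg {P : NatBinary N} (hP : P.IsBin b) : P.neg.IsBin b :=
  hP.of_iso (fun n => signIso (P.X n) n) (fun n => by
    simp [signIso, NatBinary.neg, pow_succ]) (fun n => by
    simp [signIso, NatBinary.neg, pow_succ])

theorem cone_eq (c : AdditiveInvariant N V (b + 1)) {X Y : NatBinary N} (hX : X.IsBin b)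
    (hY : Y.IsBin b) {τ σ : ∀ n, X.X n ≅ Y.X n}
    (h : ∀ n, (τ (n + 1)).hom ≫ Y.d n = X.d n ≫ (τ n).hom)
    (h' : ∀ n, (σ (n + 1)).hom ≫ Y.d' n = X.d' n ≫ (σ n).hom) :
    c.c (cone X Y τ σ) = c.c Y + c.c X.sh := by
  rw [c.add (hY.mono (Nat.le_succ b)) (isBin_cone hY.d_comp_d hY.d'_comp_d' h h' hY.isZero)
    hX.neg.sh (coneInl X Y τ σ) (coneSnd X Y τ σ) (confl_coneInl_coneSnd X Y τ σ)]
  exact congrArg (c.c Y + ·) (c.shift.c_neg hX)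

/-- The cone of the identity of `P` has value zero, and it is an extension of the negated shift of
`P` by `P`. -/
theorem c_sh (c : AdditiveInvariant N V (b + 1)) {P : NatBinary N} (hP : P.IsBin b) :
    c.c P.sh = -c.c P := by
  have h := c.cone_eq hP hP (τ := fun n => Iso.refl _) (σ := fun n => Iso.refl _)
    (by simp) (by simp)
  rw [c.cone_self b le_rfl hP.d_comp_d hP.d'_comp_d' (by simp) (by simp) hP.isZero] at h
  exact eq_neg_of_add_eq_zero_right h.symm

/-- The two-term complex from degree `n` is reached after `n` shifts, each of which changes the
sign. -/
theorem cone_sum (m : ℕ) (c : AdditiveInvariant N V (b + 1)) (hb : 1 ≤ b) : ∀ (_ : m ≤ b)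
    {X Y : NatBinary N} {τ σ : ∀ n, X.X n ≅ Y.X n}
    (_ : ∀ n, Y.d (n + 1) ≫ Y.d n = 0) (_ : ∀ n, Y.d' (n + 1) ≫ Y.d' n = 0)
    (_ : ∀ n, (τ (n + 1)).hom ≫ Y.d n = X.d n ≫ (τ n).hom)
    (_ : ∀ n, (σ (n + 1)).hom ≫ Y.d' n = X.d' n ≫ (σ n).hom)
    (_ : ∀ n, m ≤ n → IsZero (Y.X n)), c.c (cone X Y τ σ) =
      ∑ n ∈ Finset.range m, (-1 : ℤ) ^ n • c.c (twoTerm (τ n) (σ n)) := by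
  induction m with
  | zero =>
    intro _ X Y τ σ hY hY' h h' hz
    rw [Finset.range_zero, Finset.sum_empty]
    refine c.eq_zero (isBin_cone hY hY' h h' fun n _ => hz n (Nat.zero_le n)) fun n => ?_
    cases n with
    | zero => exact hz 0 le_rfl
    | succ n =>
      exact (confl_inl_snd (Y.X (n + 1)) (X.X n)).isZero_mid (hz _ (by omega))
        ((hz n (by omega)).of_iso (τ n))
  | succ m ih =>
    intro hm X Y τ σ hY hY' h h' hz
    have hd : (cone X.drop Y.drop (fun n => τ (n + 1)) (fun n => σ (n + 1))).IsBin (m + 1) :=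
      isBin_cone (fun n => hY (n + 1)) (fun n => hY' (n + 1)) (fun n => h (n + 1))
        (fun n => h' (n + 1)) fun n hn => hz (n + 1) (by omega)
    have hi := ih (by omega) (X := X.drop) (Y := Y.drop) (τ := fun n => τ (n + 1))
      (σ := fun n => σ (n + 1)) (fun n => hY (n + 1)) (fun n => hY' (n + 1))
      (fun n => h (n + 1)) (fun n => h' (n + 1)) fun n hn => hz (n + 1) (by omega)
    rw [c.cone_add hb hY hY' h h' fun n hn => hz n (by omega), Finset.sum_range_succ',
      c.c_sh (hd.mono hm)]
    refine (congrArg (fun x => _ + -x) hi).trans ?_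
    rw [add_comm, ← Finset.sum_neg_distrib, pow_zero, one_smul]
    congr 1
    refine Finset.sum_congr rfl fun n _ => ?_
    rw [pow_succ, mul_neg_one, neg_smul]
    rfl

/-- The effect on an additive invariant of changing the two differentials by automorphisms of the
underlying graded object. -/
theorem relabel (c : AdditiveInvariant N V (b + 1)) (hb : 1 ≤ b) {X Y : NatBinary N}
    (hX : X.IsBin b) (hY : Y.IsBin b) (τ σ : ∀ n, X.X n ≅ Y.X n)
    (h : ∀ n, (τ (n + 1)).hom ≫ Y.d n = X.d n ≫ (τ n).hom)
    (h' : ∀ n, (σ (n + 1)).hom ≫ Y.d' n = X.d' n ≫ (σ n).hom) :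
    c.c Y = c.c X + ∑ n ∈ Finset.range b, (-1 : ℤ) ^ n • c.c (twoTerm (τ n) (σ n)) := by
  -- Both sides evaluate the cone of `(τ, σ)`, along its two filtrations. The cone has one degree
  -- more than `X` and `Y`; therefore `c` lives on length `b + 1`.
  rw [← c.cone_sum b hb le_rfl hY.d_comp_d hY.d'_comp_d' h h' hY.isZero, c.cone_eq hX hY h h',
    c.c_sh hX]
  abel

section TwoTerm

variable (c : AdditiveInvariant N V b)

theorem twoTerm_add (hb : 2 ≤ b) {A B C A' B' C' : N} {i : A ⟶ B} {p : B ⟶ C} {i' : A' ⟶ B'}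
    {p' : B' ⟶ C'} (hc : N.Confl i p) (hc' : N.Confl i' p') (t s : A ≅ A') (t' s' : B ≅ B')
    (t'' s'' : C ≅ C') (h₁ : i ≫ t'.hom = t.hom ≫ i') (h₂ : i ≫ s'.hom = s.hom ≫ i')
    (h₃ : p ≫ t''.hom = t'.hom ≫ p') (h₄ : p ≫ s''.hom = s'.hom ≫ p') :
    c.c (twoTerm t' s') = c.c (twoTerm t s) + c.c (twoTerm t'' s'') :=
  c.add (P := twoTerm t s) (Q := twoTerm t' s') (R := twoTerm t'' s'')
    ((isBin_twoTerm _ _).mono hb) ((isBin_twoTerm _ _).mono hb)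
    ((isBin_twoTerm _ _).mono hb)
    { f := fun n => match n with
        | 0 => i'
        | 1 => i
        | _ + 2 => 0
      comm := fun n => match n with
        | 0 => h₁
        | _ + 1 => (comp_zero).trans zero_comp.symm
      comm' := fun n => match n with
        | 0 => h₂
        | _ + 1 => (comp_zero).trans zero_comp.symm }
    { f := fun n => match n with
        | 0 => p'
        | 1 => p
        | _ + 2 => 0
      comm := fun n => match n with
        | 0 => h₃
        | _ + 1 => (comp_zero).trans zero_comp.symm
      comm' := fun n => match n with
        | 0 => h₄
        | _ + 1 => (comp_zero).trans zero_comp.symm }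
    fun n => match n with
      | 0 => hc'
      | 1 => hc
      | _ + 2 => (confl_zero_id (N := N) (A := 0) (isZero_zero N) 0).of_iso (Iso.refl _)
        (Iso.refl _) (Iso.refl _) ((isZero_zero N).eq_of_src _ _) ((isZero_zero N).eq_of_src _ _)

/-- This is `relabel` with `t'` and `s'` in degree zero and identities elsewhere. The bound 3 is the
length two of the complexes plus one for the cone. -/
theorem twoTerm_comp (hb : 3 ≤ b) {X Y Z : N} (t s : X ≅ Y) (t' s' : Y ≅ Z) :
    c.c (twoTerm (t ≪≫ t') (s ≪≫ s')) = c.c (twoTerm t s) + c.c (twoTerm t' s') := by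
  have h := (c.restrict hb).relabel (by norm_num) (isBin_twoTerm t s)
    (isBin_twoTerm (t ≪≫ t') (s ≪≫ s'))
    (fun n => match n with
      | 0 => t'
      | 1 => Iso.refl _
      | _ + 2 => Iso.refl _)
    (fun n => match n with
      | 0 => s'
      | 1 => Iso.refl _
      | _ + 2 => Iso.refl _)
    (fun n => match n with
      | 0 => by exact Category.id_comp _
      | 1 => (isZero_zero N).eq_of_src _ _
      | _ + 2 => (isZero_zero N).eq_of_src _ _)
    (fun n => match n with
      | 0 => by exact Category.id_comp _
      | 1 => (isZero_zero N).eq_of_src _ _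
      | _ + 2 => (isZero_zero N).eq_of_src _ _)
  rw [Finset.sum_range_succ, Finset.sum_range_one] at h
  have h0 : c.c (twoTerm (Iso.refl ((twoTerm t s).X 1)) (Iso.refl ((twoTerm t s).X 1))) = 0 :=
    c.twoTerm_self (by omega) (Iso.refl X)
  refine h.trans ?_
  refine (congrArg (fun x => c.c (twoTerm t s) + ((-1 : ℤ) ^ 0 • c.c (twoTerm t' s') +
    (-1 : ℤ) ^ 1 • x)) h0).trans ?_
  simp

/-- The class of the transposition on `X ⊞ X`. -/
noncomputable def ε (X : N) : V := c.c (twoTerm (Iso.refl (X ⊞ X)) (biprod.braiding X X))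

/-- The transposition squares to the identity, and composition becomes addition by `twoTerm_comp`.
-/
theorem ε_add_self (hb : 3 ≤ b) (X : N) : c.ε X + c.ε X = 0 := by
  rw [ε, ← c.twoTerm_comp hb]
  have : biprod.braiding X X ≪≫ biprod.braiding X X = Iso.refl (X ⊞ X) ≪≫ Iso.refl (X ⊞ X) := by
    ext <;> simp
  rw [this, c.twoTerm_self (by omega)]

/-- The transposition is natural, so it respects the sequence `A ⊞ A ⟶ B ⊞ B ⟶ C ⊞ C`. -/
theorem ε_add (hb : 2 ≤ b) {A B C : N} {i : A ⟶ B} {p : B ⟶ C} (h : N.Confl i p) :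
    c.ε B = c.ε A + c.ε C :=
  c.twoTerm_add hb (h.biprod_map h) (h.biprod_map h) _ _ _ _ _ _ (by simp)
    (by ext <;> simp) (by simp) (by ext <;> simp)

theorem ε_biprod (hb : 2 ≤ b) (A B : N) : c.ε (A ⊞ B) = c.ε A + c.ε B :=
  c.ε_add hb (confl_inl_snd A B)

end TwoTerm

end AdditiveInvariant


open ConflationCategory
open scoped ZeroObject

variable {N : ConflationCategory.{v, u}} [N.IsExact]

theorem ConflationCategory.confl_of_split {A B C : N} {i : A ⟶ B} {p : B ⟶ C} (r : B ⟶ A)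
    (s : C ⟶ B) (h₁ : i ≫ r = 𝟙 A) (h₂ : s ≫ p = 𝟙 C) (h₃ : i ≫ p = 0) (h₄ : s ≫ r = 0)
    (h₅ : r ≫ i + p ≫ s = 𝟙 B) : N.Confl i p :=
  (confl_inl_snd A C).of_iso (Iso.refl _)
    ⟨biprod.desc i s, biprod.lift r p, by ext <;> simp [h₁, h₂, h₃, h₄], by
      rw [biprod.lift_desc, h₅]⟩ (Iso.refl _) (by simp) (by
      ext <;> simp [h₂, h₃])

/-! ### Stable equivalences and the spliced complexes -/

/-- Short exact sequences `A ⟶ J ⊞ S ⟶ B` and `A ⟶ K ⊞ S ⟶ B`. -/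
structure StabEq (J K : N) where
  {A B S : N}
  {a : A ⟶ J ⊞ S}
  {b : J ⊞ S ⟶ B}
  {a' : A ⟶ K ⊞ S}
  {b' : K ⊞ S ⟶ B}
  confl : N.Confl a b
  confl' : N.Confl a' b'

namespace StabEq

variable {J K : N}

/-- Adding `J` to one sequence and `K` to the other gives two sequences with the same middle term `J
⊞ (K ⊞ S)` and the same quotient `B`. They form the lower end of a spliced complex whose cycles
there are `J ⊞ A` on top and `K ⊞ A` at the bottom. -/
theorem confl_top (α : StabEq J K) :
    N.Confl (biprod.map (𝟙 J) α.a') ((biprod.snd : J ⊞ (K ⊞ α.S) ⟶ K ⊞ α.S) ≫ α.b') :=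
  α.confl'.add_left J

theorem confl_bot (α : StabEq J K) :
    N.Confl (biprod.lift (biprod.snd ≫ α.a ≫ biprod.fst)
      (biprod.lift biprod.fst (biprod.snd ≫ α.a ≫ biprod.snd)) : K ⊞ α.A ⟶ J ⊞ (K ⊞ α.S))
      (biprod.lift biprod.fst (biprod.snd ≫ biprod.snd) ≫ α.b) :=
  (α.confl.add_left K).of_iso (Iso.refl _) (flipFirst _ _ _) (Iso.refl _)
    (by ext <;> simp) (by
      simp only [flipFirst_hom, Iso.refl_hom, Category.comp_id, ← Category.assoc]
      congr 1
      ext <;> simp)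

end StabEq

/-- The bottom counterpart of `spliceTwo`. -/
noncomputable def spliceTwoBot {J K : N} (β : StabEq J K) {P J' P₁ P₀ : N} {i : K ⟶ P}
    {p : P ⟶ J'} (hK : N.Confl i p) {i' : J' ⟶ P₁} {p' : P₁ ⟶ P₀} (hP : N.Confl i' p') :
    Splice P₀ P₁ (β.B ⊞ P) ((K ⊞ β.S) ⊞ J) β.A where
  i₄ := biprod.lift (biprod.lift 0 (β.a ≫ biprod.snd)) (β.a ≫ biprod.fst)
  p₃ := biprod.lift (biprod.lift biprod.snd (biprod.fst ≫ biprod.snd) ≫ β.b)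
    (biprod.fst ≫ biprod.fst)
  confl₃ := (β.confl.add_right K).of_iso (Iso.refl _) (flipOuter _ _ _) (Iso.refl _)
    (by ext <;> simp) (by
      apply biprod.hom_ext
      · have h : (flipOuter J β.S K).hom ≫
            biprod.lift biprod.snd (biprod.fst ≫ biprod.snd) = biprod.fst := by ext <;> simp
        simp only [Category.assoc, biprod.lift_fst, Iso.refl_hom, Category.comp_id,
          biprod.map_fst]
        rw [← Category.assoc, h]
      · simp)
  confl₂ := hK.add_left β.B
  confl₁ := hP

namespace NatBinary

/-- The binary complex obtained by splicing two triples of short exact sequences. -/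
noncomputable def ofSplices {X₀ X₁ X₂ X₃ X₄ : N} (s s' : Splice X₀ X₁ X₂ X₃ X₄) :
    NatBinary N where
  X
    | 0 => X₀
    | 1 => X₁
    | 2 => X₂
    | 3 => X₃
    | 4 => X₄
    | _ + 5 => 0
  d
    | 0 => s.p₁
    | 1 => s.p₂ ≫ s.i₁
    | 2 => s.p₃ ≫ s.i₂
    | 3 => s.i₄
    | _ + 4 => 0
  d'
    | 0 => s'.p₁
    | 1 => s'.p₂ ≫ s'.i₁
    | 2 => s'.p₃ ≫ s'.i₂
    | 3 => s'.i₄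
    | _ + 4 => 0

/-- The factorization of a spliced differential. -/
noncomputable def factorizationOfSplices {X₀ X₁ X₂ X₃ X₄ : N} (s s' : Splice X₀ X₁ X₂ X₃ X₄) :
    NatFactorization N (ofSplices s s').X (ofSplices s s').d where
  Z
    | 0 => X₀
    | 1 => s.Z₁
    | 2 => s.Z₂
    | 3 => X₄
    | _ + 4 => 0
  p
    | 0 => s.p₁
    | 1 => s.p₂
    | 2 => s.p₃
    | 3 => 𝟙 X₄
    | _ + 4 => 0
  ι
    | 0 => 𝟙 X₀
    | 1 => s.i₁
    | 2 => s.i₂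
    | 3 => s.i₄
    | _ + 4 => 0
  fac
    | 0 => Category.comp_id _
    | 1 => rfl
    | 2 => rfl
    | 3 => Category.id_comp _
    | _ + 4 => zero_comp
  confl
    | 0 => s.confl₁
    | 1 => s.confl₂
    | 2 => s.confl₃
    | 3 => confl_zero_id (isZero_zero N) _
    | _ + 4 => (confl_zero_id (N := N) (A := 0) (isZero_zero N) 0).of_iso (Iso.refl _)
        (Iso.refl _) (Iso.refl _) ((isZero_zero N).eq_of_src _ _) ((isZero_zero N).eq_of_src _ _)
  isIso := inferInstanceAs (IsIso (𝟙 X₀))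

/-- The factorization of the bottom spliced differential. -/
noncomputable def factorizationOfSplices' {X₀ X₁ X₂ X₃ X₄ : N} (s s' : Splice X₀ X₁ X₂ X₃ X₄) :
    NatFactorization N (ofSplices s s').X (ofSplices s s').d' :=
  factorizationOfSplices s' s

theorem isBin_ofSplices {X₀ X₁ X₂ X₃ X₄ : N} (s s' : Splice X₀ X₁ X₂ X₃ X₄) :
    (ofSplices s s').IsBin 5 :=
  ⟨⟨factorizationOfSplices s s'⟩, ⟨factorizationOfSplices' s s'⟩, fun n hn => by
    obtain ⟨n, rfl⟩ := Nat.exists_eq_add_of_le' hn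
    exact isZero_zero N⟩

end NatBinary

/-- The spliced complex `A ⟶ (K ⊞ S) ⊞ J ⟶ B ⊞ P ⟶ P₁ ⟶ P₀`. -/
noncomputable def sComplex {J K : N} (β : StabEq J K) {P J' K' P₁ P₀ : N} {i : J ⟶ P} {p : P ⟶ J'}
    (hJ : N.Confl i p) {i' : K ⟶ P} {p' : P ⟶ K'} (hK : N.Confl i' p') {j : J' ⟶ P₁}
    {q : P₁ ⟶ P₀} (h : N.Confl j q) {j' : K' ⟶ P₁} {q' : P₁ ⟶ P₀} (h' : N.Confl j' q') :
    NatBinary N :=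
  NatBinary.ofSplices (spliceTwo β.confl' hJ h) (spliceTwoBot β hK h')

theorem isBin_sComplex {J K : N} (β : StabEq J K) {P J' K' P₁ P₀ : N} {i : J ⟶ P} {p : P ⟶ J'}
    (hJ : N.Confl i p) {i' : K ⟶ P} {p' : P ⟶ K'} (hK : N.Confl i' p') {j : J' ⟶ P₁}
    {q : P₁ ⟶ P₀} (h : N.Confl j q) {j' : K' ⟶ P₁} {q' : P₁ ⟶ P₀} (h' : N.Confl j' q') :
    (sComplex β hJ hK h h').IsBin 5 := NatBinary.isBin_ofSplices _ _

namespace AdditiveInvariant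

open NatBinary

variable {V : Type w} [AddCommGroup V] {b : ℕ} (c : AdditiveInvariant N V b)

theorem relabel_eq (hb : 2 ≤ b) {b' : ℕ} (hb' : b' + 1 ≤ b) {X Y : NatBinary N}
    (hX : X.IsBin b') (hY : Y.IsBin b') (τ σ : ∀ n, X.X n ≅ Y.X n)
    (h : ∀ n, (τ (n + 1)).hom ≫ Y.d n = X.d n ≫ (τ n).hom)
    (h' : ∀ n, (σ (n + 1)).hom ≫ Y.d' n = X.d' n ≫ (σ n).hom)
    (h0 : ∀ n, c.c (twoTerm (τ n) (σ n)) = 0) : c.c X = c.c Y := by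
  obtain ⟨b, rfl⟩ := Nat.exists_eq_add_of_le' (show 1 ≤ b by omega)
  rw [c.relabel (by omega) (hX.mono (by omega)) (hY.mono (by omega)) τ σ h h']
  simp [h0]

theorem c_sh_sh (hb : 7 ≤ b) {X : NatBinary N} (hX : X.IsBin 5) : c.c X.sh.sh = c.c X := by
  have h1 := (c.restrict (show 6 + 1 ≤ b by omega)).c_sh hX.sh
  have h2 := (c.restrict (show 5 + 1 ≤ b by omega)).c_sh hX
  change c.c X.sh.sh = -c.c X.sh at h1
  change c.c X.sh = -c.c X at h2
  rw [h1, h2, neg_neg]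

/-- By additivity, `c.ε J + c.ε S` and `c.ε K + c.ε S` are both equal to `c.ε A + c.ε B`. -/
theorem ε_eq_of_stabEq (hb : 2 ≤ b) {J K : N} (α : StabEq J K) : c.ε J = c.ε K := by
  have h1 := c.ε_add hb α.confl
  have h2 := c.ε_add hb α.confl'
  rw [c.ε_biprod hb, ← h2, c.ε_biprod hb] at h1
  exact add_right_cancel h1

end AdditiveInvariant

/-! ### Permutations of direct summands -/

section Exchange

/-- Exchange of the summands `K ⊞ S` and `K ⊞ S'`. -/
@[simps]
noncomputable def exchangeTop (J K S S' : N) :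
    ((K ⊞ S) ⊞ J) ⊞ (J ⊞ (K ⊞ S')) ≅ ((K ⊞ S') ⊞ J) ⊞ (J ⊞ (K ⊞ S)) where
  hom := biprod.lift (biprod.lift (biprod.snd ≫ biprod.snd) (biprod.fst ≫ biprod.snd))
    (biprod.lift (biprod.snd ≫ biprod.fst) (biprod.fst ≫ biprod.fst))
  inv := biprod.lift (biprod.lift (biprod.snd ≫ biprod.snd) (biprod.fst ≫ biprod.snd))
    (biprod.lift (biprod.snd ≫ biprod.fst) (biprod.fst ≫ biprod.fst))
  hom_inv_id := by ext <;> simp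
  inv_hom_id := by ext <;> simp

/-- Exchange of the summands `J ⊞ J`, `K ⊞ K`. -/
@[simps]
noncomputable def exchangeMid (J K S S' : N) :
    ((K ⊞ S) ⊞ J) ⊞ (J ⊞ (K ⊞ S')) ≅ ((K ⊞ S) ⊞ J) ⊞ (J ⊞ (K ⊞ S')) where
  hom := biprod.lift (biprod.lift
    (biprod.lift (biprod.snd ≫ biprod.snd ≫ biprod.fst) (biprod.fst ≫ biprod.fst ≫ biprod.snd))
    (biprod.snd ≫ biprod.fst)) (biprod.lift (biprod.fst ≫ biprod.snd)
    (biprod.lift (biprod.fst ≫ biprod.fst ≫ biprod.fst) (biprod.snd ≫ biprod.snd ≫ biprod.snd)))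
  inv := biprod.lift (biprod.lift
    (biprod.lift (biprod.snd ≫ biprod.snd ≫ biprod.fst) (biprod.fst ≫ biprod.fst ≫ biprod.snd))
    (biprod.snd ≫ biprod.fst)) (biprod.lift (biprod.fst ≫ biprod.snd)
    (biprod.lift (biprod.fst ≫ biprod.fst ≫ biprod.fst) (biprod.snd ≫ biprod.snd ≫ biprod.snd)))
  hom_inv_id := by ext <;> simp
  inv_hom_id := by ext <;> simp

/-- Exchange of `B` and `B'` in `(B ⊞ P) ⊞ B'`. -/
@[simps]
noncomputable def exchangeTwo (B P B' : N) : (B ⊞ P) ⊞ B' ≅ (B' ⊞ P) ⊞ B where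
  hom := biprod.lift (biprod.lift biprod.snd (biprod.fst ≫ biprod.snd)) (biprod.fst ≫ biprod.fst)
  inv := biprod.lift (biprod.lift biprod.snd (biprod.fst ≫ biprod.snd)) (biprod.fst ≫ biprod.fst)
  hom_inv_id := by ext <;> simp
  inv_hom_id := by ext <;> simp

/-- Exchange of `A` and `A'` in `A ⊞ (B ⊞ (Q ⊞ A'))`. -/
@[simps]
noncomputable def exchangeFour (A B Q A' : N) : A ⊞ (B ⊞ (Q ⊞ A')) ≅ A' ⊞ (B ⊞ (Q ⊞ A)) where
  hom := biprod.lift (biprod.snd ≫ biprod.snd ≫ biprod.snd) (biprod.lift (biprod.snd ≫ biprod.fst)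
    (biprod.lift (biprod.snd ≫ biprod.snd ≫ biprod.fst) biprod.fst))
  inv := biprod.lift (biprod.snd ≫ biprod.snd ≫ biprod.snd) (biprod.lift (biprod.snd ≫ biprod.fst)
    (biprod.lift (biprod.snd ≫ biprod.snd ≫ biprod.fst) biprod.fst))
  hom_inv_id := by ext <;> simp
  inv_hom_id := by ext <;> simp

namespace AdditiveInvariant

open NatBinary

variable {V : Type w} [AddCommGroup V] {b : ℕ} (c : AdditiveInvariant N V b)

/-- Composing with `exchangeTop` on both sides contributes nothing. What is left, `exchangeMid`, is
the transposition on two copies of `K ⊞ J` and the identity on the complement `S ⊞ S'`. -/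
theorem twoTerm_exchange (hb : 3 ≤ b) (J K S S' : N) :
    c.c (twoTerm (exchangeTop J K S S') (exchangeMid J K S S' ≪≫ exchangeTop J K S S')) =
      c.ε K + c.ε J := by
  have h1 : exchangeTop J K S S' = Iso.refl _ ≪≫ exchangeTop J K S S' := by simp
  rw [← c.ε_biprod (by omega)]
  conv_lhs => rw [h1]
  have h2 : exchangeMid J K S S' ≪≫ Iso.refl _ ≪≫ exchangeTop J K S S' =
      exchangeMid J K S S' ≪≫ exchangeTop J K S S' := by simp
  rw [h2, c.twoTerm_comp hb, c.twoTerm_self (by omega), add_zero]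
  let i : (K ⊞ J) ⊞ (K ⊞ J) ⟶ ((K ⊞ S) ⊞ J) ⊞ (J ⊞ (K ⊞ S')) :=
    biprod.map (biprod.map biprod.inl (𝟙 J)) (biprod.lift biprod.snd (biprod.fst ≫ biprod.inl))
  let p : ((K ⊞ S) ⊞ J) ⊞ (J ⊞ (K ⊞ S')) ⟶ S ⊞ S' :=
    biprod.map (biprod.fst ≫ biprod.snd) (biprod.snd ≫ biprod.snd)
  have hc : N.Confl i p := confl_of_split
    (biprod.map (biprod.map biprod.fst (𝟙 J)) (biprod.lift (biprod.snd ≫ biprod.fst) biprod.fst))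
    (biprod.map (biprod.inr ≫ biprod.inl) (biprod.inr ≫ biprod.inr))
    (by ext <;> simp [i]) (by ext <;> simp [p]) (by ext <;> simp [i, p]) (by ext <;> simp)
    (by ext <;> simp [i, p])
  rw [c.twoTerm_add (by omega) hc hc (Iso.refl _) (biprod.braiding (K ⊞ J) (K ⊞ J)) _ _
    (Iso.refl _) (Iso.refl _) (by simp) (by ext <;> simp [i]) (by simp) (by ext <;> simp [p]),
    c.twoTerm_self (by omega), add_zero, ε]

end AdditiveInvariant

end Exchange


/-! ### Replacing one stable equivalence by another -/

open ConflationCategory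
open scoped ZeroObject

variable {N : ConflationCategory.{v, u}} [N.IsExact]

namespace AdditiveInvariant

open NatBinary

variable {V : Type w} [AddCommGroup V] {b : ℕ} (c : AdditiveInvariant N V b)

section

variable {J K L M Q P J' K' P₁ P₀ : N} {i : J ⟶ P} {p : P ⟶ J'} (hJ : N.Confl i p) {i' : K ⟶ P}
  {p' : P ⟶ K'} (hK : N.Confl i' p') {j : J' ⟶ P₁} {q : P₁ ⟶ P₀} (h : N.Confl j q) {j' : K' ⟶ P₁}
  {q' : P₁ ⟶ P₀} (h' : N.Confl j' q') (α β : StabEq J K) (γ : StabEq L M) {l : L ⟶ Q} {r : Q ⟶ J}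
  (hL : N.Confl l r) {l' : M ⟶ Q} {r' : Q ⟶ K} (hM : N.Confl l' r')

/-- The spliced complex in which `α` occurs on the right and `γ` on the left. -/
noncomputable def _root_.GraysonK.sComplexNext : NatBinary N :=
  sComplex γ (hL.add_right α.A) (hM.add_right α.A) α.confl_top α.confl_bot

theorem _root_.GraysonK.isBin_sComplexNext : (sComplexNext α γ hL hM).IsBin 5 :=
  isBin_sComplex _ _ _ _ _

/-- Two shifts move the degrees 0, 1, 2 of the second complex, where its lower equivalence sits, to
the degrees 2, 3, 4 that the equivalence occupies in the first. Permuting summands then exchanges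
`α` and `β`. For the top differential the parts `K ⊞ S` trade places in degree 3, for the bottom
differential the parts `J ⊞ S`. The discrepancy has class `c.ε K + c.ε J`, which is zero because
`c.ε J = c.ε K` is 2-torsion. The sum has length 7 and `relabel` needs one degree more; this is the
source of the bound 8. -/
theorem exchange_aux (hb : 8 ≤ b) :
    c.c ((sComplex α hJ hK h h').dsum (sComplexNext β γ hL hM).sh.sh) =
      c.c ((sComplex β hJ hK h h').dsum (sComplexNext α γ hL hM).sh.sh) := by
  have hε : c.c (twoTerm (exchangeTop J K α.S β.S)
      (exchangeMid J K α.S β.S ≪≫ exchangeTop J K α.S β.S)) = 0 := by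
    rw [c.twoTerm_exchange (by omega), c.ε_eq_of_stabEq (by omega) α, c.ε_add_self (by omega)]
  have hb2 : 2 ≤ b := by omega
  refine c.relabel_eq hb2 (b' := 7) hb
    (((isBin_sComplex _ _ _ _ _).mono (by omega)).dsum (isBin_sComplex _ _ _ _ _).sh.sh)
    (((isBin_sComplex _ _ _ _ _).mono (by omega)).dsum (isBin_sComplex _ _ _ _ _).sh.sh)
    (fun n => match n with
      | 2 => exchangeTwo α.B P β.B
      | 3 => exchangeTop J K α.S β.S
      | 4 => exchangeFour α.A γ.B Q β.A
      | 0 => Iso.refl _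
      | 1 => Iso.refl _
      | 5 => Iso.refl _
      | 6 => Iso.refl _
      | _ + 7 => Iso.refl _)
    (fun n => match n with
      | 2 => exchangeTwo α.B P β.B
      | 3 => exchangeMid J K α.S β.S ≪≫ exchangeTop J K α.S β.S
      | 4 => exchangeFour α.A γ.B Q β.A
      | 0 => Iso.refl _
      | 1 => Iso.refl _
      | 5 => Iso.refl _
      | 6 => Iso.refl _
      | _ + 7 => Iso.refl _)
    (fun n => ?_) (fun n => ?_) (fun n => ?_)
  · match n with
    | 0 => exact (Category.id_comp _).trans (Category.comp_id _).symm
    | 1 =>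
      change (exchangeTwo α.B P β.B).hom ≫ biprod.map (((biprod.snd : β.B ⊞ P ⟶ P) ≫ p) ≫ j)
        (0 : α.B ⟶ (0 : N)) = biprod.map (((biprod.snd : α.B ⊞ P ⟶ P) ≫ p) ≫ j)
        (0 : β.B ⟶ (0 : N)) ≫ 𝟙 _
      ext <;> simp
    | 2 =>
      change (exchangeTop J K α.S β.S).hom ≫ biprod.map (biprod.map β.b' (𝟙 J) ≫
        biprod.map (𝟙 _) i) (biprod.snd ≫ α.b') = biprod.map (biprod.map α.b' (𝟙 J) ≫
        biprod.map (𝟙 _) i) (biprod.snd ≫ β.b') ≫ (exchangeTwo α.B P β.B).hom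
      ext <;> simp
    | 3 =>
      change (exchangeFour α.A γ.B Q β.A).hom ≫ biprod.map (β.a' ≫ biprod.inl)
        ((biprod.snd ≫ biprod.map r (𝟙 _)) ≫ biprod.map (𝟙 J) α.a') =
        biprod.map (α.a' ≫ biprod.inl) ((biprod.snd ≫ biprod.map r (𝟙 _)) ≫
          biprod.map (𝟙 J) β.a') ≫ (exchangeTop J K α.S β.S).hom
      ext <;> simp
    | 4 =>
      change 𝟙 _ ≫ biprod.map (0 : 0 ⟶ β.A) (biprod.map γ.b' (𝟙 L) ≫ biprod.map (𝟙 _)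
        (l ≫ biprod.inl)) = biprod.map (0 : 0 ⟶ α.A) (biprod.map γ.b' (𝟙 L) ≫ biprod.map (𝟙 _)
        (l ≫ biprod.inl)) ≫ (exchangeFour α.A γ.B Q β.A).hom
      ext <;> simp
    | 5 => exact (Category.id_comp _).trans (Category.comp_id _).symm
    | 6 => exact (Category.id_comp _).trans (Category.comp_id _).symm
    | n + 7 => exact (Category.id_comp _).trans (Category.comp_id _).symm
  · match n with
    | 0 => exact (Category.id_comp _).trans (Category.comp_id _).symm
    | 1 =>
      change (exchangeTwo α.B P β.B).hom ≫ biprod.map (((biprod.snd : β.B ⊞ P ⟶ P) ≫ p') ≫ j')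
        (0 : α.B ⟶ (0 : N)) = biprod.map (((biprod.snd : α.B ⊞ P ⟶ P) ≫ p') ≫ j')
        (0 : β.B ⟶ (0 : N)) ≫ 𝟙 _
      ext <;> simp
    | 2 =>
      have e₁ : (exchangeMid J K α.S β.S ≪≫ exchangeTop J K α.S β.S).hom ≫ biprod.fst ≫
        biprod.lift biprod.snd (biprod.fst ≫ biprod.snd) = biprod.snd ≫
        biprod.lift biprod.fst (biprod.snd ≫ biprod.snd) := by ext <;> simp
      have e₂ : (exchangeMid J K α.S β.S ≪≫ exchangeTop J K α.S β.S).hom ≫ biprod.snd ≫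
        biprod.lift biprod.fst (biprod.snd ≫ biprod.snd) = biprod.fst ≫
        biprod.lift biprod.snd (biprod.fst ≫ biprod.snd) := by ext <;> simp
      change (exchangeMid J K α.S β.S ≪≫ exchangeTop J K α.S β.S).hom ≫
        biprod.map (biprod.lift (biprod.lift biprod.snd (biprod.fst ≫ biprod.snd) ≫ β.b)
          (biprod.fst ≫ biprod.fst) ≫ biprod.map (𝟙 _) i')
          (biprod.lift biprod.fst (biprod.snd ≫ biprod.snd) ≫ α.b) =
        biprod.map (biprod.lift (biprod.lift biprod.snd (biprod.fst ≫ biprod.snd) ≫ α.b)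
          (biprod.fst ≫ biprod.fst) ≫ biprod.map (𝟙 _) i')
          (biprod.lift biprod.fst (biprod.snd ≫ biprod.snd) ≫ β.b) ≫
          (exchangeTwo α.B P β.B).hom
      apply biprod.hom_ext
      · apply biprod.hom_ext
        · have := e₁ =≫ β.b
          simpa using this
        · ext <;> simp
      · have := e₂ =≫ α.b
        simpa using this
    | 3 =>
      change (exchangeFour α.A γ.B Q β.A).hom ≫
        biprod.map (biprod.lift (biprod.lift 0 (β.a ≫ biprod.snd)) (β.a ≫ biprod.fst))
          ((biprod.snd ≫ biprod.map r' (𝟙 _)) ≫ biprod.lift (biprod.snd ≫ α.a ≫ biprod.fst)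
          (biprod.lift biprod.fst (biprod.snd ≫ α.a ≫ biprod.snd))) =
        biprod.map (biprod.lift (biprod.lift 0 (α.a ≫ biprod.snd)) (α.a ≫ biprod.fst))
          ((biprod.snd ≫ biprod.map r' (𝟙 _)) ≫ biprod.lift (biprod.snd ≫ β.a ≫ biprod.fst)
          (biprod.lift biprod.fst (biprod.snd ≫ β.a ≫ biprod.snd))) ≫
          (exchangeMid J K α.S β.S ≪≫ exchangeTop J K α.S β.S).hom
      ext <;> simp
    | 4 =>
      change 𝟙 _ ≫ biprod.map (0 : 0 ⟶ β.A) (biprod.lift (biprod.lift biprod.snd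
          (biprod.fst ≫ biprod.snd) ≫ γ.b) (biprod.fst ≫ biprod.fst) ≫ biprod.map (𝟙 _)
        (l' ≫ biprod.inl)) = biprod.map (0 : 0 ⟶ α.A) (biprod.lift (biprod.lift biprod.snd
          (biprod.fst ≫ biprod.snd) ≫ γ.b) (biprod.fst ≫ biprod.fst) ≫ biprod.map (𝟙 _)
        (l' ≫ biprod.inl)) ≫ (exchangeFour α.A γ.B Q β.A).hom
      ext <;> simp
    | 5 => exact (Category.id_comp _).trans (Category.comp_id _).symm
    | 6 => exact (Category.id_comp _).trans (Category.comp_id _).symm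
    | n + 7 => exact (Category.id_comp _).trans (Category.comp_id _).symm
  · match n with
    | 0 => exact c.twoTerm_self hb2 _
    | 1 => exact c.twoTerm_self hb2 _
    | 2 => exact c.twoTerm_self hb2 _
    | 3 => exact hε
    | 4 => exact c.twoTerm_self hb2 _
    | 5 => exact c.twoTerm_self hb2 _
    | 6 => exact c.twoTerm_self hb2 _
    | n + 7 => exact c.twoTerm_self hb2 _

theorem exchange (hb : 8 ≤ b) :
    c.c (sComplex α hJ hK h h') + c.c (sComplexNext β γ hL hM) =
      c.c (sComplex β hJ hK h h') + c.c (sComplexNext α γ hL hM) := by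
  have h₁ := c.exchange_aux hJ hK h h' α β γ hL hM hb
  have h₂ := isBin_sComplexNext β γ hL hM
  have h₃ := isBin_sComplexNext α γ hL hM
  rwa [c.dsum ((isBin_sComplex _ _ _ _ _).mono (by omega)) (h₂.sh.sh.mono (by omega)),
    c.dsum ((isBin_sComplex _ _ _ _ _).mono (by omega)) (h₃.sh.sh.mono (by omega)),
    c.c_sh_sh (by omega) h₂, c.c_sh_sh (by omega) h₃] at h₁

end

end AdditiveInvariant


/-! ### Systems of stable equivalences and their alternating sums -/

open ConflationCategory
open scoped ZeroObject

variable {N : ConflationCategory.{v, u}} [N.IsExact]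

theorem NatFactorization.confl_bottom {X : ℕ → N} {d : ∀ n, X (n + 1) ⟶ X n}
    (F : NatFactorization N X d) : N.Confl (F.ι 1) (d 0) :=
  have := F.isIso
  (F.confl 0).of_iso (Iso.refl _) (Iso.refl _) (asIso (F.ι 0)) (by simp) (by simp [F.fac])

theorem NatFactorization.exists_iso {X Y : ℕ → N} {dX : ∀ n, X (n + 1) ⟶ X n}
    {dY : ∀ n, Y (n + 1) ⟶ Y n} (F : NatFactorization N X dX) (G : NatFactorization N Y dY)
    (e : ∀ n, X n ≅ Y n) (h : ∀ n, (e (n + 1)).hom ≫ dY n = dX n ≫ (e n).hom) (n : ℕ) :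
    ∃ z : F.Z (n + 1) ≅ G.Z (n + 1), z.hom ≫ G.ι (n + 1) = F.ι (n + 1) ≫ (e (n + 1)).hom := by
  have h' : (e (n + 1)).inv ≫ dX n = dY n ≫ (e n).inv := by
    rw [Iso.inv_comp_eq, ← Category.assoc, h, Category.assoc, Iso.hom_inv_id, Category.comp_id]
  obtain ⟨z, hz⟩ := G.exists_lift (F.ι (n + 1) ≫ (e (n + 1)).hom)
    (by rw [Category.assoc, h, ← Category.assoc, F.ι_comp_d, zero_comp])
  obtain ⟨z', hz'⟩ := F.exists_lift (G.ι (n + 1) ≫ (e (n + 1)).inv)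
    (by rw [Category.assoc, h', ← Category.assoc, G.ι_comp_d, zero_comp])
  have := F.mono_ι (n + 1)
  have := G.mono_ι (n + 1)
  refine ⟨⟨z, z', ?_, ?_⟩, hz⟩
  · rw [← cancel_mono (F.ι (n + 1)), Category.assoc, hz', ← Category.assoc, hz]
    simp
  · rw [← cancel_mono (G.ι (n + 1)), Category.assoc, hz, ← Category.assoc, hz']
    simp

namespace StabEq

variable {J K J' K' : N}

/-- Transport of a stable equivalence along isomorphisms. -/
noncomputable def transport (α : StabEq J K) (e : J ≅ J') (e' : K ≅ K') : StabEq J' K' where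
  a := α.a ≫ biprod.map e.hom (𝟙 α.S)
  b := biprod.map e.inv (𝟙 α.S) ≫ α.b
  a' := α.a' ≫ biprod.map e'.hom (𝟙 α.S)
  b' := biprod.map e'.inv (𝟙 α.S) ≫ α.b'
  confl := α.confl.of_iso (Iso.refl _) (biprod.mapIso e (Iso.refl _)) (Iso.refl _) (by simp)
    (by
      have : biprod.map e.hom (𝟙 α.S) ≫ biprod.map e.inv (𝟙 α.S) = 𝟙 _ := by ext <;> simp
      simp [reassoc_of% this])
  confl' := α.confl'.of_iso (Iso.refl _) (biprod.mapIso e' (Iso.refl _)) (Iso.refl _) (by simp)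
    (by
      have : biprod.map e'.hom (𝟙 α.S) ≫ biprod.map e'.inv (𝟙 α.S) = 𝟙 _ := by ext <;> simp
      simp [reassoc_of% this])

/-- Isomorphic objects are stably equivalent. -/
noncomputable def ofIso (e : J ≅ K) : StabEq J K where
  A := J
  B := 0
  S := 0
  a := biprod.inl
  b := biprod.snd
  a' := e.hom ≫ biprod.inl
  b' := biprod.snd
  confl := confl_inl_snd _ _
  confl' := (confl_inl_snd K (0 : N)).of_iso e.symm (Iso.refl _) (Iso.refl _) (by simp)
    ((isZero_zero N).eq_of_tgt _ _)

/-- Kernels of admissible epimorphisms from one object to stably equivalent objects are stably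
equivalent. -/
noncomputable def next (α : StabEq J' K') {P : N} {i : J ⟶ P} {p : P ⟶ J'} (hJ : N.Confl i p)
    {i' : K ⟶ P} {p' : P ⟶ K'} (hK : N.Confl i' p') : StabEq J K where
  -- The sequence for `J` is the sum of `J ⟶ J ⟶ 0`, of `K ↣ P ↠ K'` and of the sequence of `α` for
  -- `K'` enlarged by `J'`. Exchanging the roles of `J` and `K` leaves the outer terms and the
  -- complement `S` unchanged up to a permutation of summands.
  A := J ⊞ (K ⊞ α.A)
  B := K' ⊞ (α.B ⊞ J')
  S := P ⊞ ((K' ⊞ α.S) ⊞ J')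
  a := _
  b := _
  a' := (flipFirst _ _ _).inv ≫ biprod.map (𝟙 K) (biprod.map i (α.a ≫ biprod.inl)) ≫
    (biprod.mapIso (Iso.refl K) (biprod.mapIso (Iso.refl P) (flipOuter _ _ _))).hom
  b' := (biprod.mapIso (Iso.refl K) (biprod.mapIso (Iso.refl P) (flipOuter _ _ _))).inv ≫
    (biprod.snd ≫ biprod.map p (biprod.map α.b (𝟙 K'))) ≫
    biprod.lift (biprod.snd ≫ biprod.snd) (biprod.lift (biprod.snd ≫ biprod.fst) biprod.fst)
  confl := (hK.biprod_map (α.confl'.add_right J')).add_left J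
  confl' := ((hJ.biprod_map (α.confl.add_right K')).add_left K).of_iso (flipFirst _ _ _)
    (biprod.mapIso (Iso.refl K) (biprod.mapIso (Iso.refl P) (flipOuter _ _ _)))
    ⟨biprod.lift (biprod.snd ≫ biprod.snd) (biprod.lift (biprod.snd ≫ biprod.fst) biprod.fst),
      biprod.lift (biprod.snd ≫ biprod.snd) (biprod.lift (biprod.snd ≫ biprod.fst) biprod.fst),
      by ext <;> simp, by ext <;> simp⟩ (by rw [Iso.hom_inv_id_assoc])
    (by rw [Iso.hom_inv_id_assoc])

theorem isZero_mid (α : StabEq J K) (hJ : IsZero J) (hS : IsZero α.S) :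
    IsZero α.A ∧ IsZero α.B := by
  have h : IsZero (J ⊞ α.S) := (confl_inl_snd J α.S).isZero_mid hJ hS
  exact ⟨α.confl.isZero_left h, α.confl.isZero_right h⟩

end StabEq

/-- Factorizations of both differentials of `P`, and stable equivalences of their cycles. -/
structure StabData (P : NatBinary N) where
  J : NatFactorization N P.X P.d
  K : NatFactorization N P.X P.d'
  α : ∀ n, StabEq (J.Z (n + 2)) (K.Z (n + 2))

namespace StabData

variable {P : NatBinary N}

/-- The spliced complexes that belong to a choice of stable equivalences. -/
noncomputable def term (D : StabData P) : ℕ → NatBinary N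
  | 0 => sComplex (D.α 0) (D.J.confl 1) (D.K.confl 1) D.J.confl_bottom D.K.confl_bottom
  | n + 1 => sComplexNext (D.α n) (D.α (n + 1)) (D.J.confl (n + 2)) (D.K.confl (n + 2))

theorem isBin_term (D : StabData P) : ∀ n, (D.term n).IsBin 5
  | 0 => isBin_sComplex _ _ _ _ _
  | n + 1 => isBin_sComplexNext _ _ (D.J.confl (n + 2)) (D.K.confl (n + 2))

/-- The objects in the choice `D` vanish from degree `L + 2` on. -/
def Bounded (D : StabData P) (L : ℕ) : Prop :=
  ∀ n, L ≤ n → IsZero (P.X (n + 3)) ∧ IsZero (D.α n).A ∧ IsZero (D.α n).B ∧ IsZero (D.α n).S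

theorem Bounded.mono {D : StabData P} {L L' : ℕ} (h : D.Bounded L) (hL : L ≤ L') :
    D.Bounded L' := fun n hn => h n (hL.trans hn)

/-- The induction starts from the isomorphisms of both cycle objects with `P.X 0` and proceeds by
`StabEq.next`. Since `next` never produces zero objects by itself, the equivalence is chosen anew,
from an isomorphism of zero objects, once the cycles vanish. -/
theorem exists_of_factorizations {b L : ℕ} (hb : b ≤ L + 3) (h : P.IsBin b)
    (J : NatFactorization N P.X P.d) (K : NatFactorization N P.X P.d') :
    ∃ D : StabData P, D.J = J ∧ D.K = K ∧ D.Bounded L := by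
  have h0 : ∀ n, Nonempty (StabEq (J.Z n) (K.Z n)) := fun n => by
    induction n with
    | zero =>
      have := J.isIso
      have := K.isIso
      exact ⟨StabEq.ofIso (asIso (J.ι 0) ≪≫ (asIso (K.ι 0)).symm)⟩
    | succ n ih => exact ⟨ih.some.next (J.confl n) (K.confl n)⟩
  have h1 : ∀ n, ∃ α : StabEq (J.Z (n + 2)) (K.Z (n + 2)), L ≤ n →
      IsZero α.A ∧ IsZero α.B ∧ IsZero α.S := fun n => by
    by_cases hn : L ≤ n
    · have hJ : IsZero (J.Z (n + 2)) := (J.confl (n + 2)).isZero_right (h.isZero _ (by omega))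
      have hK : IsZero (K.Z (n + 2)) := (K.confl (n + 2)).isZero_right (h.isZero _ (by omega))
      let α : StabEq (J.Z (n + 2)) (K.Z (n + 2)) := StabEq.ofIso (hJ.iso hK)
      obtain ⟨hA, hB⟩ := α.isZero_mid hJ (isZero_zero N)
      exact ⟨α, fun _ => ⟨hA, hB, isZero_zero N⟩⟩
    · exact ⟨(h0 _).some, fun h => absurd h hn⟩
  choose α hα using h1
  exact ⟨⟨J, K, α⟩, rfl, rfl, fun n hn => ⟨h.isZero _ (by omega), hα n hn⟩⟩

theorem exists_bounded {b L : ℕ} (hb : b ≤ L + 3) (h : P.IsBin b) :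
    ∃ D : StabData P, D.Bounded L := by
  obtain ⟨D, -, -, hD⟩ := exists_of_factorizations hb h h.acyclic.some h.acyclic'.some
  exact ⟨D, hD⟩

theorem Bounded.isZero_J {D : StabData P} {L : ℕ} (h : D.Bounded L) {n : ℕ} (hn : L ≤ n) :
    IsZero (D.J.Z (n + 2)) := (D.J.confl (n + 2)).isZero_right (h n hn).1

theorem Bounded.isZero_K {D : StabData P} {L : ℕ} (h : D.Bounded L) {n : ℕ} (hn : L ≤ n) :
    IsZero (D.K.Z (n + 2)) := (D.K.confl (n + 2)).isZero_right (h n hn).1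

end StabData

theorem ConflationCategory.isZero_biprod {A B : N} (hA : IsZero A) (hB : IsZero B) :
    IsZero (A ⊞ B) :=
  (confl_inl_snd A B).isZero_mid hA hB

namespace AdditiveInvariant

open NatBinary StabData

variable {V : Type w} [AddCommGroup V] {b : ℕ} (c : AdditiveInvariant N V b)

theorem c_sComplexNext_eq_zero (hb : 5 ≤ b) {J K L M Q : N} (α : StabEq J K) (γ : StabEq L M)
    {l : L ⟶ Q} {r : Q ⟶ J} (hL : N.Confl l r) {l' : M ⟶ Q} {r' : Q ⟶ K} (hM : N.Confl l' r')
    (hQ : IsZero Q) (h1 : IsZero α.A ∧ IsZero α.B ∧ IsZero α.S)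
    (h2 : IsZero γ.A ∧ IsZero γ.B ∧ IsZero γ.S) : c.c (sComplexNext α γ hL hM) = 0 := by
  refine c.eq_zero ((isBin_sComplexNext _ _ _ _).mono hb) fun n => ?_
  match n with
  | 0 => exact h1.2.1
  | 1 => exact isZero_biprod (hL.isZero_right hQ) (isZero_biprod (hM.isZero_right hQ) h1.2.2)
  | 2 => exact isZero_biprod h2.2.1 (isZero_biprod hQ h1.1)
  | 3 => exact isZero_biprod (isZero_biprod (hM.isZero_left hQ) h2.2.2) (hL.isZero_left hQ)
  | 4 => exact h2.1
  | _ + 5 => exact isZero_zero N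

/-- The alternating sum of the values on the spliced complexes. -/
noncomputable def sum {P : NatBinary N} (D : StabData P) (M : ℕ) : V :=
  ∑ n ∈ Finset.range M, (-1 : ℤ) ^ n • c.c (D.term n)

theorem sum_succ {P : NatBinary N} (D : StabData P) (M : ℕ) :
    c.sum D (M + 1) = c.sum D M + (-1 : ℤ) ^ M • c.c (D.term M) := Finset.sum_range_succ _ _

/-- The term with index `n + 1` involves the equivalences `n` and `n + 1`, so vanishing starts one
index after the bound. Therefore the sums below have `L + 1` summands. -/
theorem c_term_eq_zero (hb : 5 ≤ b) {P : NatBinary N} {D : StabData P} {L : ℕ}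
    (h : D.Bounded L) {n : ℕ} (hn : L ≤ n) : c.c (D.term (n + 1)) = 0 :=
  c.c_sComplexNext_eq_zero hb _ _ (D.J.confl (n + 2)) (D.K.confl (n + 2)) (h n hn).1 (h n hn).2 (h (n + 1) (by omega)).2

theorem sum_eq_of_le (hb : 5 ≤ b) {P : NatBinary N} {D : StabData P} {L M : ℕ}
    (h : D.Bounded L) (hM : L + 1 ≤ M) : c.sum D M = c.sum D (L + 1) := by
  obtain ⟨k, rfl⟩ := Nat.exists_eq_add_of_le hM
  induction k with
  | zero => rfl
  | succ k ih =>
    rw [← add_assoc, sum_succ, ih (by omega), show L + 1 + k = L + k + 1 by omega,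
      c.c_term_eq_zero hb h (by omega), smul_zero, add_zero]

section Independence

variable {P : NatBinary N} (J : NatFactorization N P.X P.d) (K : NatFactorization N P.X P.d')
  (α β : ∀ n, StabEq (J.Z (n + 2)) (K.Z (n + 2)))

/-- The effect of changing the stable equivalence in one degree only. -/
noncomputable def mixed : ℕ → V
  | 0 => c.c (StabData.term ⟨J, K, α⟩ 0) - c.c (StabData.term ⟨J, K, β⟩ 0)
  | n + 1 => c.c (sComplexNext (β n) (α (n + 1)) (J.confl (n + 2)) (K.confl (n + 2))) -
      c.c (StabData.term ⟨J, K, β⟩ (n + 1))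

/-- The two equivalences in the term are changed one after the other. Changing the upper one is
`mixed (n + 1)` by definition; changing the lower one has, by `exchange`, the same effect as
changing it in the preceding term, where it is the upper one. -/
theorem mixed_add_mixed (hb : 8 ≤ b) : ∀ n, c.c (StabData.term ⟨J, K, α⟩ (n + 1)) -
    c.c (StabData.term ⟨J, K, β⟩ (n + 1)) = c.mixed J K α β n + c.mixed J K α β (n + 1)
  | 0 => by
    have h := c.exchange (J.confl 1) (K.confl 1) J.confl_bottom K.confl_bottom (α 0) (β 0) (α 1)
      (J.confl 2) (K.confl 2) hb
    simp only [mixed, term]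
    rw [← sub_eq_zero] at h ⊢
    rw [← neg_eq_zero, ← h]
    abel
  | n + 1 => by
    have h := c.exchange ((J.confl (n + 2)).add_right (β n).A) ((K.confl (n + 2)).add_right (β n).A)
      (β n).confl_top (β n).confl_bot (α (n + 1)) (β (n + 1)) (α (n + 2))
      (J.confl (n + 3)) (K.confl (n + 3)) hb
    simp only [mixed, term]
    rw [← sub_eq_zero] at h ⊢
    rw [← neg_eq_zero, ← h]
    simp only [sComplexNext]
    abel

/-- With alternating signs, `mixed_add_mixed` telescopes. -/
theorem sum_sub_sum (hb : 8 ≤ b) (M : ℕ) :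
    c.sum ⟨J, K, α⟩ (M + 1) - c.sum ⟨J, K, β⟩ (M + 1) = (-1 : ℤ) ^ M • c.mixed J K α β M := by
  induction M with
  | zero => simp [sum, mixed]
  | succ M ih =>
    have h := c.mixed_add_mixed J K α β hb M
    rw [c.sum_succ _ (M + 1), c.sum_succ _ (M + 1), add_sub_add_comm, ih, ← smul_sub, h, smul_add,
      pow_succ]
    simp

theorem sum_eq_of_bounded (hb : 8 ≤ b) {L : ℕ} (hα : StabData.Bounded ⟨J, K, α⟩ L)
    (hβ : StabData.Bounded ⟨J, K, β⟩ L) :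
    c.sum ⟨J, K, α⟩ (L + 1) = c.sum ⟨J, K, β⟩ (L + 1) := by
  -- One index past the bound the boundary term of the telescope consists of complexes of zero
  -- objects.
  have h : c.mixed J K α β (L + 1) = 0 := by
    change c.c _ - c.c _ = 0
    rw [c.c_term_eq_zero (by omega) hβ le_rfl, sub_zero]
    exact c.c_sComplexNext_eq_zero (by omega) (β L) (α (L + 1)) (J.confl (L + 2))
      (K.confl (L + 2)) (hα L le_rfl).1 (hβ L le_rfl).2 (hα (L + 1) (by omega)).2
  have h' := c.sum_sub_sum J K α β hb (L + 1)
  rw [h, smul_zero, sub_eq_zero, c.sum_eq_of_le (by omega) hα (by omega),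
    c.sum_eq_of_le (by omega) hβ (by omega)] at h'
  exact h'

end Independence

section Iso

theorem c_ofSplices_congr (hb : 5 ≤ b) {X₀ X₁ X₂ X₃ X₄ Y₀ Y₁ Y₂ Y₃ Y₄ : N}
    (s s' : Splice X₀ X₁ X₂ X₃ X₄) (t t' : Splice Y₀ Y₁ Y₂ Y₃ Y₄) (e₀ : X₀ ≅ Y₀) (e₁ : X₁ ≅ Y₁)
    (e₂ : X₂ ≅ Y₂) (e₃ : X₃ ≅ Y₃) (e₄ : X₄ ≅ Y₄)
    (h₀ : e₁.hom ≫ t.p₁ = s.p₁ ≫ e₀.hom)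
    (h₁ : e₂.hom ≫ t.p₂ ≫ t.i₁ = (s.p₂ ≫ s.i₁) ≫ e₁.hom)
    (h₂ : e₃.hom ≫ t.p₃ ≫ t.i₂ = (s.p₃ ≫ s.i₂) ≫ e₂.hom)
    (h₃ : e₄.hom ≫ t.i₄ = s.i₄ ≫ e₃.hom)
    (h₀' : e₁.hom ≫ t'.p₁ = s'.p₁ ≫ e₀.hom)
    (h₁' : e₂.hom ≫ t'.p₂ ≫ t'.i₁ = (s'.p₂ ≫ s'.i₁) ≫ e₁.hom)
    (h₂' : e₃.hom ≫ t'.p₃ ≫ t'.i₂ = (s'.p₃ ≫ s'.i₂) ≫ e₂.hom)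
    (h₃' : e₄.hom ≫ t'.i₄ = s'.i₄ ≫ e₃.hom) :
    c.c (NatBinary.ofSplices s s') = c.c (NatBinary.ofSplices t t') :=
  c.congr ((isBin_ofSplices s s').mono hb)
    (fun n => match n with
      | 0 => e₀
      | 1 => e₁
      | 2 => e₂
      | 3 => e₃
      | 4 => e₄
      | _ + 5 => Iso.refl _)
    (fun n => match n with
      | 0 => h₀
      | 1 => h₁
      | 2 => h₂
      | 3 => h₃
      | _ + 4 => (isZero_zero N).eq_of_src _ _)
    (fun n => match n with
      | 0 => h₀'
      | 1 => h₁'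
      | 2 => h₂'
      | 3 => h₃'
      | _ + 4 => (isZero_zero N).eq_of_src _ _)

theorem c_sComplex_congr (hb : 5 ≤ b) {J K P J' K' P₁ P₀ : N} (β : StabEq J K) {i : J ⟶ P}
    {p : P ⟶ J'} (hJ : N.Confl i p) {i' : K ⟶ P} {p' : P ⟶ K'} (hK : N.Confl i' p')
    {j : J' ⟶ P₁} {q : P₁ ⟶ P₀} (h : N.Confl j q) {j' : K' ⟶ P₁} {q' : P₁ ⟶ P₀}
    (h' : N.Confl j' q') {J₂ K₂ Q J₂' K₂' Q₁ Q₀ : N} {i₂ : J₂ ⟶ Q}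
    {p₂ : Q ⟶ J₂'} (hJ₂ : N.Confl i₂ p₂) {i₂' : K₂ ⟶ Q} {p₂' : Q ⟶ K₂'} (hK₂ : N.Confl i₂' p₂')
    {j₂ : J₂' ⟶ Q₁} {q₂ : Q₁ ⟶ Q₀} (h₂ : N.Confl j₂ q₂) {j₂' : K₂' ⟶ Q₁} {q₂' : Q₁ ⟶ Q₀}
    (h₂' : N.Confl j₂' q₂') (z : J ≅ J₂) (z' : K ≅ K₂) (e : P ≅ Q) (e₁ : P₁ ≅ Q₁) (e₀ : P₀ ≅ Q₀)
    (s₁ : i ≫ e.hom = z.hom ≫ i₂) (s₂ : (p ≫ j) ≫ e₁.hom = e.hom ≫ p₂ ≫ j₂)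
    (s₃ : q ≫ e₀.hom = e₁.hom ≫ q₂)
    (s₁' : i' ≫ e.hom = z'.hom ≫ i₂') (s₂' : (p' ≫ j') ≫ e₁.hom = e.hom ≫ p₂' ≫ j₂')
    (s₃' : q' ≫ e₀.hom = e₁.hom ≫ q₂') :
    c.c (sComplex β hJ hK h h') = c.c (sComplex (β.transport z z') hJ₂ hK₂ h₂ h₂') := by
  refine c.c_ofSplices_congr hb (spliceTwo β.confl' hJ h) (spliceTwoBot β hK h')
    (spliceTwo (β.transport z z').confl' hJ₂ h₂) (spliceTwoBot (β.transport z z') hK₂ h₂') e₀ e₁ (biprod.mapIso (Iso.refl _) e)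
    (biprod.mapIso (biprod.mapIso z' (Iso.refl _)) z) (Iso.refl _) s₃.symm ?_ ?_ ?_ s₃'.symm ?_ ?_ ?_
  · change biprod.map (𝟙 β.B) e.hom ≫ (biprod.snd ≫ p₂) ≫ j₂ =
      ((biprod.snd ≫ p) ≫ j) ≫ e₁.hom
    rw [Category.assoc] at s₂
    simp [s₂]
  · change biprod.map (biprod.map z'.hom (𝟙 β.S)) z.hom ≫
      biprod.map (biprod.map z'.inv (𝟙 β.S) ≫ β.b') (𝟙 J₂) ≫ biprod.map (𝟙 β.B) i₂ =
      (biprod.map β.b' (𝟙 J) ≫ biprod.map (𝟙 β.B) i) ≫ biprod.map (𝟙 β.B) e.hom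
    ext <;> simp [s₁]
  · change 𝟙 β.A ≫ (β.a' ≫ biprod.map z'.hom (𝟙 β.S)) ≫ biprod.inl =
      (β.a' ≫ biprod.inl) ≫ biprod.map (biprod.map z'.hom (𝟙 β.S)) z.hom
    ext <;> simp
  · change biprod.map (𝟙 β.B) e.hom ≫ (biprod.snd ≫ p₂') ≫ j₂' =
      ((biprod.snd ≫ p') ≫ j') ≫ e₁.hom
    rw [Category.assoc] at s₂'
    simp [s₂']
  · have h0 : biprod.map (biprod.map z'.hom (𝟙 β.S)) z.hom ≫
        biprod.lift biprod.snd (biprod.fst ≫ biprod.snd) ≫ biprod.map z.inv (𝟙 β.S) =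
        biprod.lift biprod.snd (biprod.fst ≫ biprod.snd) := by ext <;> simp
    change biprod.map (biprod.map z'.hom (𝟙 β.S)) z.hom ≫
      biprod.lift (biprod.lift biprod.snd (biprod.fst ≫ biprod.snd) ≫
        biprod.map z.inv (𝟙 β.S) ≫ β.b) (biprod.fst ≫ biprod.fst) ≫ biprod.map (𝟙 β.B) i₂' =
      (biprod.lift (biprod.lift biprod.snd (biprod.fst ≫ biprod.snd) ≫ β.b)
        (biprod.fst ≫ biprod.fst) ≫ biprod.map (𝟙 β.B) i') ≫ biprod.map (𝟙 β.B) e.hom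
    apply biprod.hom_ext
    · have := h0 =≫ β.b
      simpa using this
    · simp [s₁']
  · change 𝟙 β.A ≫ biprod.lift (biprod.lift 0
        ((β.a ≫ biprod.map z.hom (𝟙 β.S)) ≫ biprod.snd))
        ((β.a ≫ biprod.map z.hom (𝟙 β.S)) ≫ biprod.fst) =
      biprod.lift (biprod.lift 0 (β.a ≫ biprod.snd)) (β.a ≫ biprod.fst) ≫
        biprod.map (biprod.map z'.hom (𝟙 β.S)) z.hom
    ext <;> simp

end Iso

end AdditiveInvariant


/-! ### Independence of factorizations and invariance under isomorphism -/

open ConflationCategory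
open scoped ZeroObject

variable {N : ConflationCategory.{v, u}} [N.IsExact]

namespace AdditiveInvariant

open NatBinary StabData

variable {V : Type w} [AddCommGroup V] {b : ℕ} (c : AdditiveInvariant N V b)

theorem c_sComplexNext_congr (hb : 5 ≤ b) {J K L M Q J₂ K₂ L₂ M₂ Q₂ : N} (α : StabEq J K)
    (γ : StabEq L M) {l : L ⟶ Q} {r : Q ⟶ J} (hL : N.Confl l r) {l' : M ⟶ Q} {r' : Q ⟶ K}
    (hM : N.Confl l' r') {l₂ : L₂ ⟶ Q₂} {r₂ : Q₂ ⟶ J₂} (hL₂ : N.Confl l₂ r₂) {l₂' : M₂ ⟶ Q₂}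
    {r₂' : Q₂ ⟶ K₂} (hM₂ : N.Confl l₂' r₂') (z : J ≅ J₂) (z' : K ≅ K₂) (x : L ≅ L₂) (x' : M ≅ M₂)
    (e : Q ≅ Q₂) (s₁ : l ≫ e.hom = x.hom ≫ l₂) (s₂ : r ≫ z.hom = e.hom ≫ r₂)
    (s₁' : l' ≫ e.hom = x'.hom ≫ l₂') (s₂' : r' ≫ z'.hom = e.hom ≫ r₂') :
    c.c (sComplexNext α γ hL hM) =
      c.c (sComplexNext (α.transport z z') (γ.transport x x') hL₂ hM₂) := by
  refine c.c_sComplex_congr hb γ _ _ _ _ _ _ _ _ x x' (biprod.mapIso e (Iso.refl α.A))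
    (biprod.mapIso z (biprod.mapIso z' (Iso.refl α.S))) (Iso.refl _) ?_ ?_ ?_ ?_ ?_ ?_
  · change (l ≫ biprod.inl) ≫ biprod.map e.hom (𝟙 α.A) = x.hom ≫ l₂ ≫ biprod.inl
    rw [← Category.assoc x.hom, ← s₁]
    simp
  · change (biprod.map r (𝟙 α.A) ≫ biprod.map (𝟙 J) α.a') ≫
      biprod.map z.hom (biprod.map z'.hom (𝟙 α.S)) = biprod.map e.hom (𝟙 α.A) ≫
      biprod.map r₂ (𝟙 α.A) ≫ biprod.map (𝟙 J₂) (α.a' ≫ biprod.map z'.hom (𝟙 α.S))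
    ext <;> simp [s₂]
  · have h0 : biprod.map z'.hom (𝟙 α.S) ≫ biprod.map z'.inv (𝟙 α.S) = 𝟙 _ := by ext <;> simp
    change (biprod.snd ≫ α.b') ≫ 𝟙 α.B = biprod.map z.hom (biprod.map z'.hom (𝟙 α.S)) ≫
      biprod.snd ≫ biprod.map z'.inv (𝟙 α.S) ≫ α.b'
    simp [reassoc_of% h0]
  · change (l' ≫ biprod.inl) ≫ biprod.map e.hom (𝟙 α.A) = x'.hom ≫ l₂' ≫ biprod.inl
    rw [← Category.assoc x'.hom, ← s₁']
    simp
  · change (biprod.map r' (𝟙 α.A) ≫ biprod.lift (biprod.snd ≫ α.a ≫ biprod.fst)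
      (biprod.lift biprod.fst (biprod.snd ≫ α.a ≫ biprod.snd))) ≫
      biprod.map z.hom (biprod.map z'.hom (𝟙 α.S)) = biprod.map e.hom (𝟙 α.A) ≫
      biprod.map r₂' (𝟙 α.A) ≫ biprod.lift
        (biprod.snd ≫ (α.a ≫ biprod.map z.hom (𝟙 α.S)) ≫ biprod.fst)
        (biprod.lift biprod.fst (biprod.snd ≫ (α.a ≫ biprod.map z.hom (𝟙 α.S)) ≫ biprod.snd))
    ext <;> simp [s₂']
  · have h0 : biprod.map z.hom (biprod.map z'.hom (𝟙 α.S)) ≫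
        biprod.lift biprod.fst (biprod.snd ≫ biprod.snd) ≫ biprod.map z.inv (𝟙 α.S) =
        biprod.lift biprod.fst (biprod.snd ≫ biprod.snd) := by ext <;> simp
    change (biprod.lift biprod.fst (biprod.snd ≫ biprod.snd) ≫ α.b) ≫ 𝟙 α.B =
      biprod.map z.hom (biprod.map z'.hom (𝟙 α.S)) ≫
      biprod.lift biprod.fst (biprod.snd ≫ biprod.snd) ≫ biprod.map z.inv (𝟙 α.S) ≫ α.b
    have := h0 =≫ α.b
    simpa using this.symm

/-- The isomorphism induces isomorphisms of cycles, along which the equivalences of `D` are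
transported to the factorizations of `E`. This changes no term, and two systems over the same
factorizations have equal sums. For `P = Q` it gives independence of the factorizations. -/
theorem sum_congr_of_bounded (hb : 8 ≤ b) {P Q : NatBinary N} (D : StabData P) (E : StabData Q)
    {L : ℕ} (hD : D.Bounded L) (hE : E.Bounded L) (e : ∀ n, P.X n ≅ Q.X n)
    (he : ∀ n, (e (n + 1)).hom ≫ Q.d n = P.d n ≫ (e n).hom)
    (he' : ∀ n, (e (n + 1)).hom ≫ Q.d' n = P.d' n ≫ (e n).hom) :
    c.sum D (L + 1) = c.sum E (L + 1) := by
  choose z hz using D.J.exists_iso E.J e he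
  choose z' hz' using D.K.exists_iso E.K e he'
  have hp : ∀ n, D.J.p (n + 1) ≫ (z n).hom = (e (n + 2)).hom ≫ E.J.p (n + 1) := fun n => by
    have := E.J.mono_ι (n + 1)
    rw [← cancel_mono (E.J.ι (n + 1)), Category.assoc, hz, ← Category.assoc, D.J.fac,
      Category.assoc, E.J.fac, he]
  have hp' : ∀ n, D.K.p (n + 1) ≫ (z' n).hom = (e (n + 2)).hom ≫ E.K.p (n + 1) := fun n => by
    have := E.K.mono_ι (n + 1)
    rw [← cancel_mono (E.K.ι (n + 1)), Category.assoc, hz', ← Category.assoc, D.K.fac,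
      Category.assoc, E.K.fac, he']
  let E' : StabData Q := ⟨E.J, E.K, fun n => (D.α n).transport (z (n + 1)) (z' (n + 1))⟩
  have h1 : ∀ n, c.c (D.term n) = c.c (E'.term n) := fun n => by
    match n with
    | 0 =>
      exact c.c_sComplex_congr (by omega) (D.α 0) _ _ _ _ _ _ _ _ (z 1) (z' 1) (e 2) (e 1) (e 0)
        (hz 1).symm (by rw [D.J.fac, E.J.fac, he]) (he 0).symm
        (hz' 1).symm (by rw [D.K.fac, E.K.fac, he']) (he' 0).symm
    | n + 1 =>
      exact c.c_sComplexNext_congr (by omega) (D.α n) (D.α (n + 1)) (D.J.confl (n + 2))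
        (D.K.confl (n + 2)) (E.J.confl (n + 2)) (E.K.confl (n + 2)) (z (n + 1))
        (z' (n + 1)) (z (n + 2)) (z' (n + 2)) (e (n + 3)) (hz (n + 2)).symm (hp (n + 1))
        (hz' (n + 2)).symm (hp' (n + 1))
  have hE' : E'.Bounded L := fun n hn => ⟨(hE n hn).1, (hD n hn).2⟩
  have h2 : c.sum D (L + 1) = c.sum E' (L + 1) := by
    simp only [sum, h1]
  exact h2.trans (c.sum_eq_of_bounded E.J E.K _ _ hb hE' hE)

theorem sum_eq_of_bounded_of_bounded (hb : 8 ≤ b) {P Q : NatBinary N} (D : StabData P)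
    (E : StabData Q) {L L' : ℕ} (hD : D.Bounded L) (hE : E.Bounded L') (e : ∀ n, P.X n ≅ Q.X n)
    (he : ∀ n, (e (n + 1)).hom ≫ Q.d n = P.d n ≫ (e n).hom)
    (he' : ∀ n, (e (n + 1)).hom ≫ Q.d' n = P.d' n ≫ (e n).hom) :
    c.sum D (L + 1) = c.sum E (L' + 1) := by
  rw [← c.sum_eq_of_le (by omega) hD (show L + 1 ≤ max L L' + 1 by omega),
    ← c.sum_eq_of_le (by omega) hE (show L' + 1 ≤ max L L' + 1 by omega)]
  exact c.sum_congr_of_bounded hb D E (hD.mono (by omega)) (hE.mono (by omega)) e he he'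

/-! ### Complexes with equal differentials -/

theorem twoTerm_conj (hb : 3 ≤ b) {X Y : N} (e : X ≅ Y) (t s : Y ≅ Y) :
    c.c (twoTerm (e ≪≫ t ≪≫ e.symm) (e ≪≫ s ≪≫ e.symm)) = c.c (twoTerm t s) := by
  rw [c.twoTerm_comp hb, c.twoTerm_comp hb, c.twoTerm_self (by omega), c.twoTerm_self (by omega),
    zero_add, add_zero]

/-- The exchange of the two copies of `J` in `(J ⊞ 0) ⊞ J`. -/
@[simps]
noncomputable def swapThree (J : N) : (J ⊞ (0 : N)) ⊞ J ≅ (J ⊞ (0 : N)) ⊞ J where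
  hom := biprod.lift (biprod.snd ≫ biprod.inl) (biprod.fst ≫ biprod.fst)
  inv := biprod.lift (biprod.snd ≫ biprod.inl) (biprod.fst ≫ biprod.fst)
  hom_inv_id := by ext <;> simp
  inv_hom_id := by ext <;> simp

/-- The exchange of the two copies of `J` in `J ⊞ (J ⊞ 0)`. -/
@[simps]
noncomputable def swapOne (J : N) : J ⊞ (J ⊞ (0 : N)) ≅ J ⊞ (J ⊞ (0 : N)) where
  hom := biprod.lift (biprod.snd ≫ biprod.fst) (biprod.fst ≫ biprod.inl)
  inv := biprod.lift (biprod.snd ≫ biprod.fst) (biprod.fst ≫ biprod.inl)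
  hom_inv_id := by ext <;> simp
  inv_hom_id := by ext <;> simp

theorem twoTerm_swapThree (hb : 3 ≤ b) (J : N) :
    c.c (twoTerm (Iso.refl _) (swapThree J)) = c.ε J := by
  let e : (J ⊞ (0 : N)) ⊞ J ≅ J ⊞ J :=
    ⟨biprod.map biprod.fst (𝟙 J), biprod.map biprod.inl (𝟙 J), by ext <;> simp, by ext <;> simp⟩
  rw [ε, ← c.twoTerm_conj hb e]
  congr 2
  · ext <;> simp [e]
  · ext <;> simp [e]

theorem twoTerm_swapOne (hb : 3 ≤ b) (J : N) :
    c.c (twoTerm (Iso.refl _) (swapOne J)) = c.ε J := by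
  let e : J ⊞ (J ⊞ (0 : N)) ≅ J ⊞ J :=
    ⟨biprod.map (𝟙 J) biprod.fst, biprod.map (𝟙 J) biprod.inl, by ext <;> simp, by ext <;> simp⟩
  rw [ε, ← c.twoTerm_conj hb e]
  congr 2
  · ext <;> simp [e]
  · ext <;> simp [e]

/-- Compared with the complex that has the top differential twice, the bottom differential is
changed by the exchange of two copies of `J` in degree 3 and by `σ` in degree 1. Both degrees are
odd, hence the minus signs. Length 5 plus one for `relabel` gives the bound 6. -/
theorem c_sComplex_diag (hb : 6 ≤ b) {J P J' P₁ P₀ : N} {i : J ⟶ P} {p : P ⟶ J'}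
    (hJ : N.Confl i p) {j : J' ⟶ P₁} {q : P₁ ⟶ P₀} (h : N.Confl j q) {j' : J' ⟶ P₁} {q' : P₁ ⟶ P₀}
    (h' : N.Confl j' q') (σ : P₁ ≅ P₁) (hj : j' = j ≫ σ.hom) (hq : σ.hom ≫ q' = q) :
    c.c (sComplex (StabEq.ofIso (Iso.refl J)) hJ hJ h h') =
      -c.ε J - c.c (twoTerm (Iso.refl P₁) σ) := by
  have hz := (isZero_zero N).eq_of_tgt (biprod.snd : J ⊞ (0 : N) ⟶ 0) 0
  let β : StabEq J J := StabEq.ofIso (Iso.refl J)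
  have hr := (c.restrict hb).relabel (by norm_num)
    (X := NatBinary.ofSplices (spliceTwo β.confl' hJ h) (spliceTwo β.confl' hJ h))
    (Y := sComplex β hJ hJ h h') (isBin_ofSplices _ _) (isBin_ofSplices _ _)
    (fun n => match n with
      | 0 => Iso.refl _
      | 1 => Iso.refl _
      | 2 => Iso.refl _
      | 3 => Iso.refl _
      | 4 => Iso.refl _
      | _ + 5 => Iso.refl _)
    (fun n => match n with
      | 0 => Iso.refl _
      | 1 => σ
      | 2 => Iso.refl _
      | 3 => swapThree J
      | 4 => Iso.refl _
      | _ + 5 => Iso.refl _)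
    (fun n => match n with
      | 0 => (Category.id_comp _).trans (Category.comp_id _).symm
      | 1 => (Category.id_comp _).trans (Category.comp_id _).symm
      | 2 => (Category.id_comp _).trans (Category.comp_id _).symm
      | 3 => (Category.id_comp _).trans (Category.comp_id _).symm
      | _ + 4 => (isZero_zero N).eq_of_src _ _)
    (fun n => by
      match n with
      | 0 => exact hq.trans (Category.comp_id _).symm
      | 1 =>
        change 𝟙 _ ≫ (biprod.snd ≫ p) ≫ j' = ((biprod.snd ≫ p) ≫ j) ≫ σ.hom
        simp [hj]
      | 2 =>
        change (swapThree J).hom ≫ biprod.lift (biprod.lift biprod.snd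
          (biprod.fst ≫ biprod.snd) ≫ biprod.snd) (biprod.fst ≫ biprod.fst) ≫
          biprod.map (𝟙 (0 : N)) i = (biprod.map biprod.snd (𝟙 J) ≫
          biprod.map (𝟙 (0 : N)) i) ≫ 𝟙 _
        have := (isZero_zero N)
        ext <;> simp [hz]
      | 3 =>
        change 𝟙 J ≫ biprod.lift (biprod.lift 0 (biprod.inl ≫ biprod.snd))
          (biprod.inl ≫ biprod.fst) =
          ((𝟙 J ≫ (biprod.inl : J ⟶ J ⊞ (0 : N))) ≫ biprod.inl) ≫ (swapThree J).hom
        ext <;> simp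
      | _ + 4 => exact (isZero_zero N).eq_of_src _ _)
  refine hr.trans ?_
  rw [(c.restrict hb).diag ((isBin_ofSplices _ _).mono (by norm_num)) rfl, zero_add,
    Finset.sum_range_succ, Finset.sum_range_succ, Finset.sum_range_succ, Finset.sum_range_succ,
    Finset.sum_range_one]
  have h0 : ∀ X : N, c.c (twoTerm (Iso.refl X) (Iso.refl X)) = 0 := fun X =>
    c.twoTerm_self (by omega) _
  change (-1 : ℤ) ^ 0 • c.c (twoTerm (Iso.refl P₀) (Iso.refl P₀)) +
    (-1 : ℤ) ^ 1 • c.c (twoTerm (Iso.refl P₁) σ) +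
    (-1 : ℤ) ^ 2 • c.c (twoTerm (Iso.refl ((0 : N) ⊞ P)) (Iso.refl ((0 : N) ⊞ P))) +
    (-1 : ℤ) ^ 3 • c.c (twoTerm (Iso.refl ((J ⊞ (0 : N)) ⊞ J)) (swapThree J)) +
    (-1 : ℤ) ^ 4 • c.c (twoTerm (Iso.refl J) (Iso.refl J)) = _
  rw [h0, h0, h0, c.twoTerm_swapThree (by omega)]
  simp [pow_succ]
  abel

/-- By independence the same cycles and identity equivalences may be used for both differentials.
Each term is then minus the sum of `c.ε` for two consecutive cycle objects, and the alternating sum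
telescopes to `c.ε` of cycles beyond the support of `P`. -/
theorem sum_eq_zero_of_diag (hb : 8 ≤ b) {P : NatBinary N} (hP : P.d = P.d') (D : StabData P)
    {L : ℕ} (hD : D.Bounded L) : c.sum D (L + 1) = 0 := by
  obtain ⟨X, d, d'⟩ := P
  obtain rfl : d = d' := hP
  let E : StabData ⟨X, d, d⟩ := ⟨D.J, D.J, fun n => StabEq.ofIso (Iso.refl _)⟩
  have hE : E.Bounded L := fun n hn => ⟨(hD n hn).1, hD.isZero_J hn, isZero_zero N, isZero_zero N⟩
  -- The lowest term contributes only one `c.ε`: it ends with the maps of `P` itself, where `σ` is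
  -- the identity.
  have hE' : ∀ M, c.sum E (M + 1) = -(-1 : ℤ) ^ M • c.ε (D.J.Z (M + 2)) := fun M => by
    induction M with
    | zero =>
      rw [sum, Finset.sum_range_one]
      have := c.c_sComplex_diag (by omega) (D.J.confl 1) D.J.confl_bottom D.J.confl_bottom
        (Iso.refl _) (by simp) (by simp)
      rw [c.twoTerm_self (by omega), sub_zero] at this
      refine (congrArg (fun x => (-1 : ℤ) ^ 0 • x) this).trans ?_
      simp
    | succ M ih =>
      rw [sum_succ, ih]
      have h1 := c.c_sComplex_diag (by omega) ((D.J.confl (M + 2)).add_right (D.J.Z (M + 2)))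
        (StabEq.ofIso (Iso.refl (D.J.Z (M + 2)))).confl_top
        (StabEq.ofIso (Iso.refl (D.J.Z (M + 2)))).confl_bot (swapOne _) (by
          change biprod.lift (biprod.snd ≫ biprod.inl ≫ biprod.fst)
            (biprod.lift biprod.fst (biprod.snd ≫ biprod.inl ≫ biprod.snd)) =
            biprod.map (𝟙 _) (𝟙 _ ≫ biprod.inl) ≫ (swapOne (D.J.Z (M + 2))).hom
          ext <;> simp) ((isZero_zero N).eq_of_tgt _ _)
      replace h1 := h1.trans (congrArg (fun x => _ - x) (c.twoTerm_swapOne (by omega) _))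
      refine (congrArg (fun x => _ + (-1 : ℤ) ^ (M + 1) • x) h1).trans ?_
      simp only [pow_succ, mul_neg_one, neg_smul, smul_sub, smul_neg, neg_neg]
      abel
  have hz : c.ε (D.J.Z (L + 2)) = 0 := c.eq_zero ((isBin_twoTerm _ _).mono (by omega)) fun n => by
    have := hD.isZero_J le_rfl
    match n with
    | 0 => exact isZero_biprod this this
    | 1 => exact isZero_biprod this this
    | _ + 2 => exact isZero_zero N
  have := c.sum_eq_of_bounded_of_bounded hb D E hD hE (fun _ => Iso.refl _) (by simp) (by simp)
  rw [this, hE', hz, smul_zero]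

end AdditiveInvariant


/-! ### The extension that cuts off the lowest spliced complex -/

open ConflationCategory
open scoped ZeroObject

variable {N : ConflationCategory.{v, u}} [N.IsExact]

namespace NatBinary

variable {b : ℕ}

/-- The extension of `R` by `T` determined by maps `R (n + 1) ⟶ T n`. -/
noncomputable def twist (T R : NatBinary N) (θ θ' : ∀ n, R.X (n + 1) ⟶ T.X n) : NatBinary N where
  X n := T.X n ⊞ R.X n
  d n := biprod.lift (biprod.desc (T.d n) (θ n)) (biprod.snd ≫ R.d n)
  d' n := biprod.lift (biprod.desc (T.d' n) (θ' n)) (biprod.snd ≫ R.d' n)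

/-- The inclusion into the extension. -/
noncomputable def twistInl (T R : NatBinary N) (θ θ' : ∀ n, R.X (n + 1) ⟶ T.X n) :
    T.Hom (twist T R θ θ') where
  f _ := biprod.inl
  comm n := by
    change biprod.inl ≫ biprod.lift (biprod.desc (T.d n) (θ n)) (biprod.snd ≫ R.d n) =
      T.d n ≫ (biprod.inl : T.X n ⟶ T.X n ⊞ R.X n)
    apply biprod.hom_ext <;> simp
  comm' n := by
    change biprod.inl ≫ biprod.lift (biprod.desc (T.d' n) (θ' n)) (biprod.snd ≫ R.d' n) =
      T.d' n ≫ (biprod.inl : T.X n ⟶ T.X n ⊞ R.X n)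
    apply biprod.hom_ext <;> simp

/-- The projection from the extension. -/
noncomputable def twistSnd (T R : NatBinary N) (θ θ' : ∀ n, R.X (n + 1) ⟶ T.X n) :
    (twist T R θ θ').Hom R where
  f _ := biprod.snd
  comm _ := (biprod.lift_snd _ _).symm
  comm' _ := (biprod.lift_snd _ _).symm

theorem isBin_twist {T R : NatBinary N} {θ θ' : ∀ n, R.X (n + 1) ⟶ T.X n} (hT : T.IsBin b)
    (hR : R.IsBin b) (h : ∀ n, θ (n + 1) ≫ T.d n + R.d (n + 1) ≫ θ n = 0)
    (h' : ∀ n, θ' (n + 1) ≫ T.d' n + R.d' (n + 1) ≫ θ' n = 0) : (twist T R θ θ').IsBin b :=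
  hT.of_extension hR (twistInl T R θ θ') (twistSnd T R θ θ') (fun _ => confl_inl_snd _ _)
    (fun n => by
      change biprod.lift (biprod.desc (T.d (n + 1)) (θ (n + 1))) (biprod.snd ≫ R.d (n + 1)) ≫
        biprod.lift (biprod.desc (T.d n) (θ n)) (biprod.snd ≫ R.d n) = 0
      have := h n
      have := hT.d_comp_d n
      have := hR.d_comp_d n
      ext <;> simp [*])
    (fun n => by
      change biprod.lift (biprod.desc (T.d' (n + 1)) (θ' (n + 1))) (biprod.snd ≫ R.d' (n + 1)) ≫
        biprod.lift (biprod.desc (T.d' n) (θ' n)) (biprod.snd ≫ R.d' n) = 0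
      have := h' n
      have := hT.d'_comp_d' n
      have := hR.d'_comp_d' n
      ext <;> simp [*])

/-- The complex whose differentials are conjugated by automorphisms of the graded object. -/
def conj (E : NatBinary N) (τ σ : ∀ n, E.X n ≅ E.X n) : NatBinary N where
  X := E.X
  d n := (τ (n + 1)).inv ≫ E.d n ≫ (τ n).hom
  d' n := (σ (n + 1)).inv ≫ E.d' n ≫ (σ n).hom

theorem isBin_conj {E : NatBinary N} (hE : E.IsBin b) (τ σ : ∀ n, E.X n ≅ E.X n) :
    (E.conj τ σ).IsBin b :=
  ⟨⟨hE.acyclic.some.ofIso τ fun n => by simp [conj]⟩,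
    ⟨hE.acyclic'.some.ofIso σ fun n => by simp [conj]⟩, hE.isZero⟩

end NatBinary

theorem AdditiveInvariant.c_conj {V : Type w} [AddCommGroup V] {b : ℕ}
    (c : AdditiveInvariant N V b) (hb : 2 ≤ b) {b' : ℕ} (hb' : b' + 1 ≤ b) {E : NatBinary N}
    (hE : E.IsBin b') (τ σ : ∀ n, E.X n ≅ E.X n)
    (h0 : ∀ n, c.c (NatBinary.twoTerm (τ n) (σ n)) = 0) : c.c (E.conj τ σ) = c.c E :=
  (c.relabel_eq hb hb' hE (NatBinary.isBin_conj hE τ σ) τ σ (fun n => by simp [NatBinary.conj])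
    (fun n => by simp [NatBinary.conj]) h0).symm

namespace StabData

variable {P : NatBinary N} (D : StabData P)

/-- The complex obtained from `P` by cutting off `D.term 0`. -/
noncomputable def tilde : NatBinary N where
  -- The part of `P` above degree 2 ends in different objects, `J₂` on top and `K₂` at the bottom.
  -- The sequences `confl_top` and `confl_bot` have the common middle term `J₂ ⊞ (K₂ ⊞ S)` and the
  -- common end `B`, and so close the complex for both differentials at once.
  X
    | 0 => (D.α 0).B
    | 1 => D.J.Z 2 ⊞ (D.K.Z 2 ⊞ (D.α 0).S)
    | 2 => P.X 3 ⊞ (D.α 0).A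
    | n + 3 => P.X (n + 4)
  d
    | 0 => biprod.snd ≫ (D.α 0).b'
    | 1 => biprod.map (D.J.p 2) (𝟙 _) ≫ biprod.map (𝟙 _) (D.α 0).a'
    | 2 => D.J.p 3 ≫ D.J.ι 3 ≫ biprod.inl
    | n + 3 => P.d (n + 4)
  d'
    | 0 => biprod.lift biprod.fst (biprod.snd ≫ biprod.snd) ≫ (D.α 0).b
    | 1 => biprod.map (D.K.p 2) (𝟙 _) ≫ biprod.lift (biprod.snd ≫ (D.α 0).a ≫ biprod.fst)
        (biprod.lift biprod.fst (biprod.snd ≫ (D.α 0).a ≫ biprod.snd))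
    | 2 => D.K.p 3 ≫ D.K.ι 3 ≫ biprod.inl
    | n + 3 => P.d' (n + 4)

/-- The induced data for the complex `D.tilde`. -/
noncomputable def tildeData : StabData D.tilde where
  J :=
    { Z := fun n => match n with
        | 0 => (D.α 0).B
        | 1 => D.J.Z 2 ⊞ (D.α 0).A
        | n + 2 => D.J.Z (n + 3)
      p := fun n => match n with
        | 0 => biprod.snd ≫ (D.α 0).b'
        | 1 => biprod.map (D.J.p 2) (𝟙 _)
        | n + 2 => D.J.p (n + 3)
      ι := fun n => match n with
        | 0 => 𝟙 _
        | 1 => biprod.map (𝟙 _) (D.α 0).a'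
        | 2 => D.J.ι 3 ≫ biprod.inl
        | n + 3 => D.J.ι (n + 4)
      fac := fun n => match n with
        | 0 => Category.comp_id _
        | 1 => rfl
        | 2 => rfl
        | n + 3 => D.J.fac (n + 4)
      confl := fun n => match n with
        | 0 => (D.α 0).confl_top
        | 1 => (D.J.confl 2).add_right (D.α 0).A
        | n + 2 => D.J.confl (n + 3)
      isIso := inferInstanceAs (IsIso (𝟙 (D.α 0).B)) }
  K :=
    { Z := fun n => match n with
        | 0 => (D.α 0).B
        | 1 => D.K.Z 2 ⊞ (D.α 0).A
        | n + 2 => D.K.Z (n + 3)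
      p := fun n => match n with
        | 0 => biprod.lift biprod.fst (biprod.snd ≫ biprod.snd) ≫ (D.α 0).b
        | 1 => biprod.map (D.K.p 2) (𝟙 _)
        | n + 2 => D.K.p (n + 3)
      ι := fun n => match n with
        | 0 => 𝟙 _
        | 1 => biprod.lift (biprod.snd ≫ (D.α 0).a ≫ biprod.fst)
          (biprod.lift biprod.fst (biprod.snd ≫ (D.α 0).a ≫ biprod.snd))
        | 2 => D.K.ι 3 ≫ biprod.inl
        | n + 3 => D.K.ι (n + 4)
      fac := fun n => match n with
        | 0 => Category.comp_id _
        | 1 => rfl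
        | 2 => rfl
        | n + 3 => D.K.fac (n + 4)
      confl := fun n => match n with
        | 0 => (D.α 0).confl_bot
        | 1 => (D.K.confl 2).add_right (D.α 0).A
        | n + 2 => D.K.confl (n + 3)
      isIso := inferInstanceAs (IsIso (𝟙 (D.α 0).B)) }
  α n := D.α (n + 1)

/-- The truncated complex keeps all the other spliced complexes, with index lowered by one; this
drives the induction in `sum_eq`. -/
theorem term_tildeData : ∀ n, D.tildeData.term n = D.term (n + 1)
  | 0 => rfl
  | _ + 1 => rfl

theorem isBin_tilde {b : ℕ} (hb : 4 ≤ b) (hP : P.IsBin b) : D.tilde.IsBin (b - 1) :=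
  ⟨⟨D.tildeData.J⟩, ⟨D.tildeData.K⟩, fun n hn => by
    obtain ⟨n, rfl⟩ := Nat.exists_eq_add_of_le' (show 3 ≤ n by omega)
    exact hP.isZero (n + 4) (by omega)⟩

/-- The components of the top differential of the extension `cutExt`. -/
noncomputable def cutTheta : ∀ n, (D.term 0).X (n + 1) ⟶ D.tilde.sh.X n
  | 0 => 0
  | 1 => (biprod.fst : (D.α 0).B ⊞ P.X 2 ⟶ (D.α 0).B)
  | 2 => -(biprod.braiding (D.K.Z 2 ⊞ (D.α 0).S) (D.J.Z 2)).hom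
  | 3 => (biprod.inr : (D.α 0).A ⟶ P.X 3 ⊞ (D.α 0).A)
  | _ + 4 => 0

/-- The extension of `D.term 0` by the shift of `D.tilde`. -/
noncomputable def cutExt : NatBinary N :=
  NatBinary.twist D.tilde.sh (D.term 0) D.cutTheta D.cutTheta

/-- The map `cutTheta` identifies the copies of `B`, `J₂ ⊞ (K₂ ⊞ S)` and `A` in `D.term 0` with
those in the shift of `D.tilde`. The sign in its middle component makes the squares anticommute, as
a twist of the differential requires. -/
theorem isBin_cutExt {b : ℕ} (hb : 5 ≤ b) (hP : P.IsBin b) : D.cutExt.IsBin b := by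
  refine NatBinary.isBin_twist ((D.isBin_tilde (by omega) hP).sh.mono (by omega))
    ((D.isBin_term 0).mono hb) (fun n => ?_) (fun n => ?_)
  · match n with
    | 0 => exact (isZero_zero N).eq_of_tgt _ _
    | 1 =>
      change (-(biprod.braiding (D.K.Z 2 ⊞ (D.α 0).S) (D.J.Z 2)).hom) ≫ biprod.snd ≫ (D.α 0).b' +
        (biprod.map (D.α 0).b' (𝟙 _) ≫ biprod.map (𝟙 _) (D.J.ι 2)) ≫ biprod.fst = 0
      simp
    | 2 =>
      change biprod.inr ≫ biprod.map (D.J.p 2) (𝟙 _) ≫ biprod.map (𝟙 _) (D.α 0).a' +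
        ((D.α 0).a' ≫ biprod.inl) ≫
          (-(biprod.braiding (D.K.Z 2 ⊞ (D.α 0).S) (D.J.Z 2)).hom) = 0
      apply biprod.hom_ext <;> simp
    | _ + 3 => exact (isZero_zero N).eq_of_src _ _
  · match n with
    | 0 => exact (isZero_zero N).eq_of_tgt _ _
    | 1 =>
      have h0 : (biprod.braiding (D.K.Z 2 ⊞ (D.α 0).S) (D.J.Z 2)).hom ≫
          biprod.lift biprod.fst (biprod.snd ≫ biprod.snd) =
          biprod.lift biprod.snd (biprod.fst ≫ biprod.snd) := by ext <;> simp
      change (-(biprod.braiding (D.K.Z 2 ⊞ (D.α 0).S) (D.J.Z 2)).hom) ≫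
        biprod.lift biprod.fst (biprod.snd ≫ biprod.snd) ≫ (D.α 0).b +
        (biprod.lift (biprod.lift biprod.snd (biprod.fst ≫ biprod.snd) ≫ (D.α 0).b)
          (biprod.fst ≫ biprod.fst) ≫ biprod.map (𝟙 _) (D.K.ι 2)) ≫ biprod.fst = 0
      have := h0 =≫ (D.α 0).b
      rw [Category.assoc] at this
      rw [Preadditive.neg_comp, this]
      simp only [Category.assoc, biprod.map_fst, Category.comp_id, biprod.lift_fst]
      simp
    | 2 =>
      change biprod.inr ≫ biprod.map (D.K.p 2) (𝟙 _) ≫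
        biprod.lift (biprod.snd ≫ (D.α 0).a ≫ biprod.fst)
        (biprod.lift biprod.fst (biprod.snd ≫ (D.α 0).a ≫ biprod.snd)) +
        biprod.lift (biprod.lift 0 ((D.α 0).a ≫ biprod.snd)) ((D.α 0).a ≫ biprod.fst) ≫
          (-(biprod.braiding (D.K.Z 2 ⊞ (D.α 0).S) (D.J.Z 2)).hom) = 0
      ext <;> simp
    | _ + 3 => exact (isZero_zero N).eq_of_src _ _

/-- A unipotent automorphism of `cutExt` in degree two. -/
@[simps]
noncomputable def unipotent {J W B P : N} (i : J ⟶ P) (w : W ⟶ J) :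
    W ⊞ (B ⊞ P) ≅ W ⊞ (B ⊞ P) where
  hom := biprod.lift biprod.fst (biprod.lift (biprod.snd ≫ biprod.fst)
    (biprod.snd ≫ biprod.snd + biprod.fst ≫ w ≫ i))
  inv := biprod.lift biprod.fst (biprod.lift (biprod.snd ≫ biprod.fst)
    (biprod.snd ≫ biprod.snd - biprod.fst ≫ w ≫ i))
  hom_inv_id := by ext <;> simp
  inv_hom_id := by ext <;> simp

/-- The graded automorphism of `cutExt` for the top differential. -/
noncomputable def cutIso : ∀ n, D.cutExt.X n ≅ D.cutExt.X n
  | 2 => unipotent (B := (D.α 0).B) (D.J.ι 2)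
      (biprod.fst : D.J.Z 2 ⊞ (D.K.Z 2 ⊞ (D.α 0).S) ⟶ D.J.Z 2)
  | 0 => Iso.refl _
  | 1 => Iso.refl _
  | _ + 3 => Iso.refl _

/-- The graded automorphism of `cutExt` for the bottom differential. -/
noncomputable def cutIso' : ∀ n, D.cutExt.X n ≅ D.cutExt.X n
  | 2 => unipotent (B := (D.α 0).B) (D.K.ι 2)
      (biprod.snd ≫ biprod.fst : D.J.Z 2 ⊞ (D.K.Z 2 ⊞ (D.α 0).S) ⟶ D.K.Z 2)
  | 0 => Iso.refl _
  | 1 => Iso.refl _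
  | _ + 3 => Iso.refl _

/-- The complex `A ⟶ J ⊞ (K ⊞ S) ⟶ B` in degrees `3`, `2` and `1`. -/
noncomputable def cutW : NatBinary N where
  X
    | 0 => 0
    | 1 => (D.α 0).B
    | 2 => D.J.Z 2 ⊞ (D.K.Z 2 ⊞ (D.α 0).S)
    | 3 => (D.α 0).A
    | _ + 4 => 0
  d
    | 0 => 0
    | 1 => biprod.snd ≫ (D.α 0).b'
    | 2 => (D.α 0).a' ≫ biprod.inr
    | _ + 3 => 0
  d'
    | 0 => 0
    | 1 => biprod.lift biprod.fst (biprod.snd ≫ biprod.snd) ≫ (D.α 0).b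
    | 2 => biprod.lift ((D.α 0).a ≫ biprod.fst) (biprod.lift 0 ((D.α 0).a ≫ biprod.snd))
    | _ + 3 => 0

theorem cutW_d : ∀ n, D.cutW.d (n + 1) ≫ D.cutW.d n = 0
  | 0 => (isZero_zero N).eq_of_tgt _ _
  | 1 => by
    change ((D.α 0).a' ≫ biprod.inr) ≫ biprod.snd ≫ (D.α 0).b' = 0
    simp [(D.α 0).confl'.zero]
  | _ + 2 => (isZero_zero N).eq_of_src _ _

theorem cutW_d' : ∀ n, D.cutW.d' (n + 1) ≫ D.cutW.d' n = 0
  | 0 => (isZero_zero N).eq_of_tgt _ _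
  | 1 => by
    have : biprod.lift ((D.α 0).a ≫ biprod.fst) (biprod.lift (0 : (D.α 0).A ⟶ D.K.Z 2)
      ((D.α 0).a ≫ biprod.snd)) ≫ biprod.lift biprod.fst (biprod.snd ≫ biprod.snd) =
      (D.α 0).a := by ext <;> simp
    change biprod.lift ((D.α 0).a ≫ biprod.fst) (biprod.lift (0 : (D.α 0).A ⟶ D.K.Z 2)
      ((D.α 0).a ≫ biprod.snd)) ≫ biprod.lift biprod.fst (biprod.snd ≫ biprod.snd) ≫
      (D.α 0).b = 0
    rw [← Category.assoc, this, (D.α 0).confl.zero]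
  | _ + 2 => (isZero_zero N).eq_of_src _ _

/-- The cone of the identity of `cutW`. -/
noncomputable def cutCone : NatBinary N :=
  NatBinary.cone D.cutW D.cutW (fun _ => Iso.refl _) (fun _ => Iso.refl _)

/-- `cutW` itself is in general not acyclic, since `J₂` on top and `K₂` at the bottom survive as
homology. The cone of its identity is acyclic all the same. -/
theorem isBin_cutCone : D.cutCone.IsBin 5 :=
  NatBinary.isBin_cone D.cutW_d D.cutW_d' (by simp) (by simp) fun n hn => by
    obtain ⟨n, rfl⟩ := Nat.exists_eq_add_of_le' hn
    exact isZero_zero N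

section

variable (A B P W X Y : N)

theorem confl_cut_one : N.Confl (biprod.map (𝟙 B) (0 : (0 : N) ⟶ P)) biprod.snd :=
  confl_of_split (biprod.map (𝟙 B) (0 : P ⟶ (0 : N))) biprod.inr (by ext; simp) (by simp)
    (by simp) (by simp) (by ext <;> simp)

theorem confl_cut_two : N.Confl (biprod.map (𝟙 W) (biprod.inl : B ⟶ B ⊞ P))
    (biprod.snd ≫ biprod.snd) :=
  confl_of_split (biprod.map (𝟙 W) (biprod.fst : B ⊞ P ⟶ B)) (biprod.inr ≫ biprod.inr)
    (by ext <;> simp) (by simp) (by simp) (by simp) (by ext <;> simp)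

theorem confl_cut_three :
    N.Confl (biprod.map (biprod.inr : A ⟶ P ⊞ A) (-(biprod.braiding X Y).hom))
      (biprod.fst ≫ biprod.fst) :=
  confl_of_split (biprod.map (biprod.snd : P ⊞ A ⟶ A) (-(biprod.braiding Y X).hom))
    (biprod.inl ≫ biprod.inl) (by ext <;> simp) (by simp) (by simp) (by simp) (by ext <;> simp)

theorem confl_cut_four : N.Confl (biprod.map (0 : (0 : N) ⟶ P) (𝟙 A)) biprod.fst :=
  confl_of_split (biprod.map (0 : P ⟶ (0 : N)) (𝟙 A)) biprod.inl (by ext; simp) (by simp)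
    (by simp) (by simp) (by ext <;> simp)

end

/-- The inclusion of the cone into the conjugate of `cutExt`. -/
noncomputable def cutF : ∀ n, D.cutCone.X n ⟶ D.cutExt.X n
  | 0 => (biprod.inl : (0 : N) ⟶ 0 ⊞ P.X 0)
  | 1 => biprod.map (𝟙 (D.α 0).B) (0 : (0 : N) ⟶ P.X 1)
  | 2 => biprod.map (𝟙 (D.J.Z 2 ⊞ (D.K.Z 2 ⊞ (D.α 0).S)))
      (biprod.inl : (D.α 0).B ⟶ (D.α 0).B ⊞ P.X 2)
  | 3 => biprod.map (biprod.inr : (D.α 0).A ⟶ P.X 3 ⊞ (D.α 0).A)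
      (-(biprod.braiding (D.J.Z 2) (D.K.Z 2 ⊞ (D.α 0).S)).hom)
  | 4 => biprod.map (0 : (0 : N) ⟶ P.X 4) (𝟙 (D.α 0).A)
  | n + 5 => biprod.map (0 : (0 : N) ⟶ P.X (n + 5)) (𝟙 (0 : N))

/-- The projection from the conjugate of `cutExt` to `P`. -/
noncomputable def cutG : ∀ n, D.cutExt.X n ⟶ P.X n
  | 0 => (biprod.snd : (0 : N) ⊞ P.X 0 ⟶ P.X 0)
  | 1 => (biprod.snd : (D.α 0).B ⊞ P.X 1 ⟶ P.X 1)
  | 2 => (biprod.snd ≫ biprod.snd :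
      (D.J.Z 2 ⊞ (D.K.Z 2 ⊞ (D.α 0).S)) ⊞ ((D.α 0).B ⊞ P.X 2) ⟶ P.X 2)
  | 3 => (biprod.fst ≫ biprod.fst :
      (P.X 3 ⊞ (D.α 0).A) ⊞ ((D.K.Z 2 ⊞ (D.α 0).S) ⊞ D.J.Z 2) ⟶ P.X 3)
  | 4 => (biprod.fst : P.X 4 ⊞ (D.α 0).A ⟶ P.X 4)
  | n + 5 => (biprod.fst : P.X (n + 5) ⊞ (0 : N) ⟶ P.X (n + 5))

/-- In each degree the summands that `D.term 0` and the shift of `D.tilde` have in common make up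
the cone, and the remaining summand is the object of `P`. -/
theorem confl_cut : ∀ n, N.Confl (D.cutF n) (D.cutG n)
  | 0 => confl_inl_snd _ _
  | 1 => confl_cut_one _ _
  | 2 => confl_cut_two _ _ _
  | 3 => confl_cut_three _ _ _ _
  | 4 => confl_cut_four _ _
  | _ + 5 => confl_cut_four _ _

end StabData


/-! ### The class of a complex as an alternating sum -/

open ConflationCategory
open scoped ZeroObject

variable {N : ConflationCategory.{v, u}} [N.IsExact]

namespace StabData

variable {P : NatBinary N} (D : StabData P)

/-- The inclusion of the cone into the conjugate of `cutExt`. -/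
noncomputable def cutInl : D.cutCone.Hom (D.cutExt.conj D.cutIso D.cutIso') where
  f := D.cutF
  comm n := by
    have h1 := (D.J.confl 1).zero
    match n with
    | 0 =>
      change biprod.map (𝟙 (D.α 0).B) (0 : (0 : N) ⟶ P.X 1) ≫ 𝟙 _ ≫
        biprod.lift (biprod.desc (0 : (D.α 0).B ⟶ (0 : N)) (0 : P.X 1 ⟶ (0 : N)))
        (biprod.snd ≫ P.d 0) ≫ 𝟙 _ = biprod.desc (0 : (D.α 0).B ⟶ (0 : N)) (𝟙 (0 : N)) ≫ biprod.inl
      ext; simp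
    | 1 =>
      change biprod.map (𝟙 (D.J.Z 2 ⊞ (D.K.Z 2 ⊞ (D.α 0).S)))
        (biprod.inl : (D.α 0).B ⟶ (D.α 0).B ⊞ P.X 2) ≫ (unipotent (D.J.ι 2) biprod.fst).inv ≫
        biprod.lift (biprod.desc (biprod.snd ≫ (D.α 0).b') biprod.fst)
          (biprod.snd ≫ (biprod.snd ≫ D.J.p 1) ≫ D.J.ι 1) ≫ 𝟙 ((D.α 0).B ⊞ P.X 1) =
        biprod.lift (biprod.desc (biprod.snd ≫ (D.α 0).b') (𝟙 (D.α 0).B))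
          (biprod.snd ≫ (-(0 : (D.α 0).B ⟶ (0 : N)))) ≫ biprod.map (𝟙 _) 0
      ext <;> simp [reassoc_of% h1]
    -- The component `J₂ ⟶ P₂` of the differential leads out of the cone; conjugation by the
    -- unipotent automorphism cancels it. For the bottom differential the same happens with `K₂`.
    | 2 =>
      change biprod.map (biprod.inr : (D.α 0).A ⟶ P.X 3 ⊞ (D.α 0).A)
        (-(biprod.braiding (D.J.Z 2) (D.K.Z 2 ⊞ (D.α 0).S)).hom) ≫ 𝟙 _ ≫
        biprod.lift (biprod.desc (biprod.map (D.J.p 2) (𝟙 _) ≫ biprod.map (𝟙 _) (D.α 0).a')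
          (-(biprod.braiding (D.K.Z 2 ⊞ (D.α 0).S) (D.J.Z 2)).hom))
          (biprod.snd ≫ biprod.map (D.α 0).b' (𝟙 _) ≫ biprod.map (𝟙 _) (D.J.ι 2)) ≫
          (unipotent (B := (D.α 0).B) (D.J.ι 2) biprod.fst).hom =
        biprod.lift (biprod.desc ((D.α 0).a' ≫ biprod.inr) (𝟙 _))
          (biprod.snd ≫ (-(biprod.snd ≫ (D.α 0).b'))) ≫ biprod.map (𝟙 _) biprod.inl
      ext <;> simp
    | 3 =>
      change biprod.map (0 : (0 : N) ⟶ P.X 4) (𝟙 (D.α 0).A) ≫ 𝟙 _ ≫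
        biprod.lift (biprod.desc (D.J.p 3 ≫ D.J.ι 3 ≫ biprod.inl) biprod.inr)
          (biprod.snd ≫ (D.α 0).a' ≫ (biprod.inl : _ ⟶ (D.K.Z 2 ⊞ (D.α 0).S) ⊞ D.J.Z 2)) ≫ 𝟙 _ =
        biprod.lift (biprod.desc (0 : (0 : N) ⟶ (D.α 0).A) (𝟙 (D.α 0).A))
          (biprod.snd ≫ (-((D.α 0).a' ≫ biprod.inr))) ≫ biprod.map biprod.inr
          (-(biprod.braiding (D.J.Z 2) (D.K.Z 2 ⊞ (D.α 0).S)).hom)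
      ext <;> simp
    | _ + 4 => exact (isZero_biprod (isZero_zero N) (isZero_zero N)).eq_of_src _ _
  comm' n := by
    have h1 := (D.K.confl 1).zero
    match n with
    | 0 =>
      change biprod.map (𝟙 (D.α 0).B) (0 : (0 : N) ⟶ P.X 1) ≫ 𝟙 _ ≫
        biprod.lift (biprod.desc (0 : (D.α 0).B ⟶ (0 : N)) (0 : P.X 1 ⟶ (0 : N)))
        (biprod.snd ≫ P.d' 0) ≫ 𝟙 _ = biprod.desc (0 : (D.α 0).B ⟶ (0 : N)) (𝟙 (0 : N)) ≫ biprod.inl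
      ext; simp
    | 1 =>
      change biprod.map (𝟙 (D.J.Z 2 ⊞ (D.K.Z 2 ⊞ (D.α 0).S)))
        (biprod.inl : (D.α 0).B ⟶ (D.α 0).B ⊞ P.X 2) ≫
        (unipotent (D.K.ι 2) (biprod.snd ≫ biprod.fst)).inv ≫
        biprod.lift (biprod.desc
          (biprod.lift biprod.fst (biprod.snd ≫ biprod.snd) ≫ (D.α 0).b) biprod.fst)
          (biprod.snd ≫ (biprod.snd ≫ D.K.p 1) ≫ D.K.ι 1) ≫ 𝟙 ((D.α 0).B ⊞ P.X 1) =
        biprod.lift (biprod.desc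
          (biprod.lift biprod.fst (biprod.snd ≫ biprod.snd) ≫ (D.α 0).b) (𝟙 (D.α 0).B))
          (biprod.snd ≫ (-(0 : (D.α 0).B ⟶ (0 : N)))) ≫ biprod.map (𝟙 _) 0
      ext <;> simp [reassoc_of% h1]
    | 2 =>
      have h0 : (biprod.braiding (D.J.Z 2) (D.K.Z 2 ⊞ (D.α 0).S)).hom ≫
        biprod.lift biprod.snd (biprod.fst ≫ biprod.snd) =
        biprod.lift biprod.fst (biprod.snd ≫ biprod.snd) := by ext <;> simp
      replace h0 := h0 =≫ (D.α 0).b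
      change biprod.map (biprod.inr : (D.α 0).A ⟶ P.X 3 ⊞ (D.α 0).A)
        (-(biprod.braiding (D.J.Z 2) (D.K.Z 2 ⊞ (D.α 0).S)).hom) ≫ 𝟙 _ ≫
        biprod.lift (biprod.desc (biprod.map (D.K.p 2) (𝟙 _) ≫
          biprod.lift (biprod.snd ≫ (D.α 0).a ≫ biprod.fst)
            (biprod.lift biprod.fst (biprod.snd ≫ (D.α 0).a ≫ biprod.snd)))
          (-(biprod.braiding (D.K.Z 2 ⊞ (D.α 0).S) (D.J.Z 2)).hom))
          (biprod.snd ≫ biprod.lift (biprod.lift biprod.snd (biprod.fst ≫ biprod.snd) ≫ (D.α 0).b)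
            (biprod.fst ≫ biprod.fst) ≫ biprod.map (𝟙 _) (D.K.ι 2)) ≫
          (unipotent (B := (D.α 0).B) (D.K.ι 2) (biprod.snd ≫ biprod.fst)).hom =
        biprod.lift (biprod.desc (biprod.lift ((D.α 0).a ≫ biprod.fst)
          (biprod.lift 0 ((D.α 0).a ≫ biprod.snd))) (𝟙 _))
          (biprod.snd ≫ (-(biprod.lift biprod.fst (biprod.snd ≫ biprod.snd) ≫ (D.α 0).b))) ≫
          biprod.map (𝟙 _) biprod.inl
      apply biprod.hom_ext'
      · ext <;> simp
      · apply biprod.hom_ext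
        · ext <;> simp
        · apply biprod.hom_ext
          · simpa using congrArg (fun x => -x) h0
          · ext <;> simp
    | 3 =>
      change biprod.map (0 : (0 : N) ⟶ P.X 4) (𝟙 (D.α 0).A) ≫ 𝟙 _ ≫
        biprod.lift (biprod.desc (D.K.p 3 ≫ D.K.ι 3 ≫ biprod.inl) biprod.inr)
          (biprod.snd ≫ biprod.lift (biprod.lift (0 : (D.α 0).A ⟶ D.K.Z 2)
            ((D.α 0).a ≫ biprod.snd)) ((D.α 0).a ≫ biprod.fst)) ≫ 𝟙 _ =
        biprod.lift (biprod.desc (0 : (0 : N) ⟶ (D.α 0).A) (𝟙 (D.α 0).A))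
          (biprod.snd ≫ (-(biprod.lift ((D.α 0).a ≫ biprod.fst)
          (biprod.lift 0 ((D.α 0).a ≫ biprod.snd))))) ≫ biprod.map biprod.inr
          (-(biprod.braiding (D.J.Z 2) (D.K.Z 2 ⊞ (D.α 0).S)).hom)
      ext <;> simp
    | _ + 4 => exact (isZero_biprod (isZero_zero N) (isZero_zero N)).eq_of_src _ _

/-- The projection from the conjugate of `cutExt` to `P`. -/
noncomputable def cutSnd : (D.cutExt.conj D.cutIso D.cutIso').Hom P where
  f := D.cutG
  comm n := by
    have h1 := (D.J.confl 1).zero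
    match n with
    | 0 =>
      change biprod.snd ≫ P.d 0 = (𝟙 _ ≫
        biprod.lift (biprod.desc (0 : (D.α 0).B ⟶ (0 : N)) (0 : P.X 1 ⟶ (0 : N)))
        (biprod.snd ≫ P.d 0) ≫ 𝟙 _) ≫ biprod.snd
      simp
    | 1 =>
      change (biprod.snd ≫ biprod.snd) ≫ P.d 1 = ((unipotent (D.J.ι 2)
        (biprod.fst : D.J.Z 2 ⊞ (D.K.Z 2 ⊞ (D.α 0).S) ⟶ D.J.Z 2)).inv ≫
        biprod.lift (biprod.desc (biprod.snd ≫ (D.α 0).b') biprod.fst)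
          (biprod.snd ≫ (biprod.snd ≫ D.J.p 1) ≫ D.J.ι 1) ≫ 𝟙 ((D.α 0).B ⊞ P.X 1)) ≫ biprod.snd
      rw [← D.J.fac]
      ext <;> simp [reassoc_of% h1]
    | 2 =>
      change (biprod.fst ≫ biprod.fst) ≫ P.d 2 = (𝟙 _ ≫
        biprod.lift (biprod.desc (biprod.map (D.J.p 2) (𝟙 _) ≫ biprod.map (𝟙 _) (D.α 0).a')
          (-(biprod.braiding (D.K.Z 2 ⊞ (D.α 0).S) (D.J.Z 2)).hom))
          (biprod.snd ≫ biprod.map (D.α 0).b' (𝟙 _) ≫ biprod.map (𝟙 _) (D.J.ι 2)) ≫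
          (unipotent (B := (D.α 0).B) (D.J.ι 2) biprod.fst).hom) ≫ biprod.snd ≫ biprod.snd
      rw [← D.J.fac]
      ext <;> simp
    | 3 =>
      change biprod.fst ≫ P.d 3 = (𝟙 _ ≫
        biprod.lift (biprod.desc (D.J.p 3 ≫ D.J.ι 3 ≫ biprod.inl) biprod.inr)
          (biprod.snd ≫ (D.α 0).a' ≫ (biprod.inl : _ ⟶ (D.K.Z 2 ⊞ (D.α 0).S) ⊞ D.J.Z 2)) ≫ 𝟙 _) ≫
          biprod.fst ≫ biprod.fst
      rw [← D.J.fac]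
      ext <;> simp
    | 4 =>
      change biprod.fst ≫ P.d 4 = (𝟙 _ ≫ biprod.lift (biprod.desc (P.d 4) (0 : (0 : N) ⟶ P.X 4))
        (biprod.snd ≫ (0 : (0 : N) ⟶ (D.α 0).A)) ≫ 𝟙 _) ≫ biprod.fst
      ext; simp
    | n + 5 =>
      change biprod.fst ≫ P.d (n + 5) = (𝟙 _ ≫
        biprod.lift (biprod.desc (P.d (n + 5)) (0 : (0 : N) ⟶ P.X (n + 5)))
        (biprod.snd ≫ (0 : (0 : N) ⟶ (0 : N))) ≫ 𝟙 _) ≫ biprod.fst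
      ext; simp
  comm' n := by
    have h1 := (D.K.confl 1).zero
    match n with
    | 0 =>
      change biprod.snd ≫ P.d' 0 = (𝟙 _ ≫
        biprod.lift (biprod.desc (0 : (D.α 0).B ⟶ (0 : N)) (0 : P.X 1 ⟶ (0 : N)))
        (biprod.snd ≫ P.d' 0) ≫ 𝟙 _) ≫ biprod.snd
      simp
    | 1 =>
      change (biprod.snd ≫ biprod.snd) ≫ P.d' 1 = ((unipotent (D.K.ι 2)
        (biprod.snd ≫ biprod.fst : D.J.Z 2 ⊞ (D.K.Z 2 ⊞ (D.α 0).S) ⟶ D.K.Z 2)).inv ≫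
        biprod.lift (biprod.desc
          (biprod.lift biprod.fst (biprod.snd ≫ biprod.snd) ≫ (D.α 0).b) biprod.fst)
          (biprod.snd ≫ (biprod.snd ≫ D.K.p 1) ≫ D.K.ι 1) ≫ 𝟙 ((D.α 0).B ⊞ P.X 1)) ≫ biprod.snd
      rw [← D.K.fac]
      ext <;> simp [reassoc_of% h1]
    | 2 =>
      change (biprod.fst ≫ biprod.fst) ≫ P.d' 2 = (𝟙 _ ≫
        biprod.lift (biprod.desc (biprod.map (D.K.p 2) (𝟙 _) ≫
          biprod.lift (biprod.snd ≫ (D.α 0).a ≫ biprod.fst)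
            (biprod.lift biprod.fst (biprod.snd ≫ (D.α 0).a ≫ biprod.snd)))
          (-(biprod.braiding (D.K.Z 2 ⊞ (D.α 0).S) (D.J.Z 2)).hom))
          (biprod.snd ≫ biprod.lift (biprod.lift biprod.snd (biprod.fst ≫ biprod.snd) ≫ (D.α 0).b)
            (biprod.fst ≫ biprod.fst) ≫ biprod.map (𝟙 _) (D.K.ι 2)) ≫
          (unipotent (B := (D.α 0).B) (D.K.ι 2) (biprod.snd ≫ biprod.fst)).hom) ≫
          biprod.snd ≫ biprod.snd
      rw [← D.K.fac]
      ext <;> simp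
    | 3 =>
      change biprod.fst ≫ P.d' 3 = (𝟙 _ ≫
        biprod.lift (biprod.desc (D.K.p 3 ≫ D.K.ι 3 ≫ biprod.inl) biprod.inr)
          (biprod.snd ≫ biprod.lift (biprod.lift (0 : (D.α 0).A ⟶ D.K.Z 2)
            ((D.α 0).a ≫ biprod.snd)) ((D.α 0).a ≫ biprod.fst)) ≫ 𝟙 _) ≫
          biprod.fst ≫ biprod.fst
      rw [← D.K.fac]
      ext <;> simp
    | 4 =>
      change biprod.fst ≫ P.d' 4 = (𝟙 _ ≫ biprod.lift (biprod.desc (P.d' 4) (0 : (0 : N) ⟶ P.X 4))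
        (biprod.snd ≫ (0 : (0 : N) ⟶ (D.α 0).A)) ≫ 𝟙 _) ≫ biprod.fst
      ext; simp
    | n + 5 =>
      change biprod.fst ≫ P.d' (n + 5) = (𝟙 _ ≫
        biprod.lift (biprod.desc (P.d' (n + 5)) (0 : (0 : N) ⟶ P.X (n + 5)))
        (biprod.snd ≫ (0 : (0 : N) ⟶ (0 : N))) ≫ 𝟙 _) ≫ biprod.fst
      ext; simp

end StabData

namespace AdditiveInvariant

open NatBinary StabData

variable {V : Type w} [AddCommGroup V] {b : ℕ} (c : AdditiveInvariant N V b)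

/-- Both automorphisms are the identity on the subobject `P` and on the quotient `W ⊞ B`. -/
theorem twoTerm_unipotent (hb : 2 ≤ b) {J K W B P : N} (i : J ⟶ P) (w : W ⟶ J) (i' : K ⟶ P)
    (w' : W ⟶ K) :
    c.c (twoTerm (unipotent (B := B) i w) (unipotent (B := B) i' w')) = 0 := by
  have h : N.Confl (biprod.inr ≫ biprod.inr : P ⟶ W ⊞ (B ⊞ P))
      (biprod.lift biprod.fst (biprod.snd ≫ biprod.fst) : W ⊞ (B ⊞ P) ⟶ W ⊞ B) :=
    confl_of_split (biprod.snd ≫ biprod.snd) (biprod.map (𝟙 W) biprod.inl) (by simp)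
      (by ext <;> simp) (by ext <;> simp) (by ext <;> simp) (by ext <;> simp)
  rw [c.twoTerm_add hb h h (Iso.refl _) (Iso.refl _) _ _ (Iso.refl _) (Iso.refl _)
    (by ext <;> simp) (by ext <;> simp) (by ext <;> simp) (by ext <;> simp),
    c.twoTerm_self hb, c.twoTerm_self hb, add_zero]

/-- `cutExt` is evaluated twice. It is an extension of `D.term 0` by the shift of `D.tilde`; after
conjugation, which does not change its value, it is an extension of `P` by the cone of an identity.
-/
theorem cut (hb : 6 ≤ b) {b' : ℕ} (hb' : b' + 1 ≤ b) {P : NatBinary N} (hP : P.IsBin b')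
    (D : StabData P) : c.c P = c.c (D.term 0) - c.c D.tilde := by
  -- `cutExt` contains `D.term 0`, so it has length at least 5 even if `P` is shorter.
  obtain ⟨k, hk, hbk, hP⟩ : ∃ k, k + 1 ≤ b ∧ 5 ≤ k ∧ P.IsBin k :=
    ⟨max b' 5, by omega, by omega, hP.mono (by omega)⟩
  have h1 : c.c D.cutExt = c.c D.tilde.sh + c.c (D.term 0) :=
    c.add ((D.isBin_tilde (by omega) hP).sh.mono (by omega))
      ((D.isBin_cutExt hbk hP).mono (by omega)) ((D.isBin_term 0).mono (by omega))
      (NatBinary.twistInl _ _ _ _) (NatBinary.twistSnd _ _ _ _) fun _ => confl_inl_snd _ _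
  have h2 : c.c D.tilde.sh = -c.c D.tilde :=
    (c.restrict (show k - 1 + 1 ≤ b by omega)).c_sh (D.isBin_tilde (by omega) hP)
  have h3 : c.c (D.cutExt.conj D.cutIso D.cutIso') = c.c D.cutExt :=
    c.c_conj (by omega) hk (D.isBin_cutExt hbk hP) _ _ fun n => match n with
      | 0 => c.twoTerm_self (by omega) _
      | 1 => c.twoTerm_self (by omega) _
      | 2 => c.twoTerm_unipotent (by omega) _ _ _ _
      | _ + 3 => c.twoTerm_self (by omega) _
  have h4 : c.c (D.cutExt.conj D.cutIso D.cutIso') = c.c D.cutCone + c.c P :=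
    c.add (D.isBin_cutCone.mono (by omega))
      ((isBin_conj (D.isBin_cutExt hbk hP) _ _).mono (by omega)) (hP.mono (by omega))
      D.cutInl D.cutSnd D.confl_cut
  have h5 : c.c D.cutCone = 0 :=
    (c.restrict (show 4 + 1 ≤ b by omega)).cone_self 4 le_rfl D.cutW_d D.cutW_d' (by simp)
      (by simp) fun n hn => by
        obtain ⟨n, rfl⟩ := Nat.exists_eq_add_of_le' hn
        exact isZero_zero N
  rw [h5, zero_add, h3, h1, h2] at h4
  rw [← h4]
  abel

theorem sum_tildeData {P : NatBinary N} (D : StabData P) (M : ℕ) :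
    c.sum D (M + 1) = c.c (D.term 0) - c.sum D.tildeData M := by
  rw [sum, sum, Finset.sum_range_succ', add_comm, sub_eq_add_neg, ← Finset.sum_neg_distrib,
    pow_zero, one_smul]
  congr 1
  refine Finset.sum_congr rfl fun n _ => ?_
  rw [term_tildeData, pow_succ, mul_neg_one, neg_smul]

theorem _root_.GraysonK.StabData.Bounded.tildeData {P : NatBinary N} {D : StabData P} {L : ℕ}
    (h : D.Bounded (L + 1)) : D.tildeData.Bounded L := fun n hn =>
  h (n + 1) (by omega)

/-- Induction on the bound, with `cut` as the step. Here `c` has to be defined on complexes longer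
than `P`. This is why the formula holds in the large group only, whereas the sum itself makes sense
in the group of short complexes. -/
theorem sum_eq {b' : ℕ} (hb' : 5 ≤ b') (hb : b' + 1 ≤ b) (L : ℕ) : ∀ {P : NatBinary N}
    (_ : P.IsBin b') (D : StabData P) (_ : D.Bounded L), c.sum D (L + 1) = c.c P := by
  induction L with
  | zero =>
    intro P hP D hD
    have h0 := hD 0 le_rfl
    have h1 : c.c D.tilde = 0 := c.eq_zero
      ((D.isBin_tilde (by omega) hP).mono (by omega)) fun n => match n with
      | 0 => h0.2.2.1
      | 1 => isZero_biprod (hD.isZero_J le_rfl) (isZero_biprod (hD.isZero_K le_rfl) h0.2.2.2)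
      | 2 => isZero_biprod h0.1 h0.2.1
      | n + 3 => (hD (n + 1) (Nat.zero_le _)).1
    rw [c.cut (by omega) hb hP D, h1, sub_zero, sum, Finset.sum_range_one, pow_zero, one_smul]
  | succ L ih =>
    intro P hP D hD
    rw [c.sum_tildeData, c.cut (by omega) hb hP D,
      ih ((D.isBin_tilde (by omega) hP).mono (by omega)) D.tildeData hD.tildeData]

/-! ### The alternating sum of a shifted complex -/

section Shift

variable {P : NatBinary N}

theorem _root_.GraysonK.NatFactorization.nonempty_stabEq {X : ℕ → N} {d d' : ∀ n, X (n + 1) ⟶ X n}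
    (J : NatFactorization N X d) (K : NatFactorization N X d') (n : ℕ) :
    Nonempty (StabEq (J.Z n) (K.Z n)) := by
  induction n with
  | zero =>
    have := J.isIso
    have := K.isIso
    exact ⟨StabEq.ofIso (asIso (J.ι 0) ≪≫ (asIso (K.ι 0)).symm)⟩
  | succ n ih => exact ⟨ih.some.next (J.confl n) (K.confl n)⟩

/-- The data for the shifted complex. -/
noncomputable def _root_.GraysonK.StabData.shData (D : StabData P)
    (β : StabEq (D.J.Z 1) (D.K.Z 1)) : StabData P.sh where
  J := factorizationSh D.J
  K := factorizationSh' D.K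
  α
    | 0 => β
    | n + 1 => D.α n

/-- Data for the shift of the complex `D.term 0`. -/
noncomputable def _root_.GraysonK.StabData.shTermData (D : StabData P)
    (β : StabEq (D.J.Z 1) (D.K.Z 1)) : StabData (D.term 0).sh where
  J := factorizationSh (factorizationOfSplices (spliceTwo (D.α 0).confl' (D.J.confl 1)
    D.J.confl_bottom) (spliceTwoBot (D.α 0) (D.K.confl 1) D.K.confl_bottom))
  K := factorizationSh' (factorizationOfSplices' (spliceTwo (D.α 0).confl' (D.J.confl 1)
    D.J.confl_bottom) (spliceTwoBot (D.α 0) (D.K.confl 1) D.K.confl_bottom))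
  α
    | 0 => β
    -- Only the equivalence with index zero enters `term 0` and `tilde`, so the others may be
    -- arbitrary.
    | _ + 1 => Classical.choice (NatFactorization.nonempty_stabEq _ _ _)

theorem _root_.GraysonK.StabEq.transport_refl {J K : N} (β : StabEq J K) :
    β.transport (Iso.refl J) (Iso.refl K) = β := by
  have h : ∀ X Y : N, biprod.map (𝟙 X) (𝟙 Y) = 𝟙 (X ⊞ Y) := fun X Y => by ext <;> simp
  cases β
  simp [StabEq.transport, h]

/-- After a shift the cycles of degree one also need an equivalence `β`, and the lowest spliced
complex is replaced by two. The relation between the three is `cut` for the shift of `D.term 0`: the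
remaining complex is the second of the two, up to associativity of a direct sum. -/
theorem c_term_zero_of_shData (hb : 8 ≤ b) (D : StabData P) (β : StabEq (D.J.Z 1) (D.K.Z 1)) :
    c.c (D.term 0) = c.c ((D.shData β).term 1) - c.c ((D.shData β).term 0) := by
  have h1 := c.cut (by omega) (b' := 6) (by omega) (D.isBin_term 0).sh (D.shTermData β)
  have h2 : c.c (D.term 0).sh = -c.c (D.term 0) :=
    (c.restrict (show 5 + 1 ≤ b by omega)).c_sh (D.isBin_term 0)
  have h3 : c.c ((D.shData β).term 0) = c.c ((D.shTermData β).term 0) := by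
    have := D.J.isIso
    have := D.K.isIso
    have h := c.c_sComplex_congr (by omega) β (D.J.confl 0) (D.K.confl 0)
      (D.shData β).J.confl_bottom (D.shData β).K.confl_bottom
      D.J.confl_bottom D.K.confl_bottom (D.shTermData β).J.confl_bottom
      (D.shTermData β).K.confl_bottom (Iso.refl _) (Iso.refl _) (Iso.refl _) (Iso.refl _)
      (Iso.refl _) (by simp) (by
        refine (Category.comp_id _).trans ?_
        refine (D.J.fac 0).trans ?_
        refine Eq.trans ?_ (Category.id_comp _).symm
        exact (Category.comp_id _).symm) ((isZero_zero N).eq_of_tgt _ _) (by simp) (by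
        refine (Category.comp_id _).trans ?_
        refine (D.K.fac 0).trans ?_
        refine Eq.trans ?_ (Category.id_comp _).symm
        exact (Category.comp_id _).symm) ((isZero_zero N).eq_of_tgt _ _)
    rw [StabEq.transport_refl] at h
    exact h
  have h4 : c.c (D.shTermData β).tilde = c.c ((D.shData β).term 1) := by
    refine c.congr ((isBin_tilde _ (b := 6) (by omega) (D.isBin_term 0).sh).mono (by omega))
      (fun n => match n with
      | 0 => Iso.refl _
      | 1 => Iso.refl _
      | 2 => biprod.associator (D.α 0).B (P.X 2) β.A
      | 3 => Iso.refl _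
      | 4 => Iso.refl _
      | _ + 5 => Iso.refl _) (fun n => ?_) (fun n => ?_)
    · match n with
      | 0 => exact (Category.id_comp _).trans (Category.comp_id _).symm
      | 1 =>
        change (biprod.associator (D.α 0).B (P.X 2) β.A).hom ≫
          (biprod.snd ≫ biprod.map (D.J.p 1) (𝟙 _)) ≫ biprod.map (𝟙 _) β.a' =
          (biprod.map (biprod.snd ≫ D.J.p 1) (𝟙 _) ≫ biprod.map (𝟙 _) β.a') ≫ 𝟙 _
        ext <;> simp
      | 2 =>
        change 𝟙 _ ≫ biprod.map (D.α 0).b' (𝟙 _) ≫ biprod.map (𝟙 _) (D.J.ι 2 ≫ biprod.inl) =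
          (biprod.map (D.α 0).b' (𝟙 _) ≫ biprod.map (𝟙 _) (D.J.ι 2) ≫ biprod.inl) ≫
          (biprod.associator (D.α 0).B (P.X 2) β.A).hom
        ext <;> simp
      | 3 => exact (Category.id_comp _).trans (Category.comp_id _).symm
      | _ + 4 => exact (isZero_zero N).eq_of_src _ _
    · match n with
      | 0 => exact (Category.id_comp _).trans (Category.comp_id _).symm
      | 1 =>
        change (biprod.associator (D.α 0).B (P.X 2) β.A).hom ≫
          (biprod.snd ≫ biprod.map (D.K.p 1) (𝟙 _)) ≫ biprod.lift (biprod.snd ≫ β.a ≫ biprod.fst)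
            (biprod.lift biprod.fst (biprod.snd ≫ β.a ≫ biprod.snd)) =
          (biprod.map (biprod.snd ≫ D.K.p 1) (𝟙 _) ≫ biprod.lift (biprod.snd ≫ β.a ≫ biprod.fst)
            (biprod.lift biprod.fst (biprod.snd ≫ β.a ≫ biprod.snd))) ≫ 𝟙 _
        ext <;> simp
      | 2 =>
        change 𝟙 _ ≫ biprod.lift (biprod.lift biprod.snd (biprod.fst ≫ biprod.snd) ≫ (D.α 0).b)
            (biprod.fst ≫ biprod.fst) ≫ biprod.map (𝟙 _) (D.K.ι 2 ≫ biprod.inl) =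
          (biprod.lift (biprod.lift biprod.snd (biprod.fst ≫ biprod.snd) ≫ (D.α 0).b)
            (biprod.fst ≫ biprod.fst) ≫ biprod.map (𝟙 _) (D.K.ι 2) ≫ biprod.inl) ≫
          (biprod.associator (D.α 0).B (P.X 2) β.A).hom
        ext <;> simp
      | 3 => exact (Category.id_comp _).trans (Category.comp_id _).symm
      | _ + 4 => exact (isZero_zero N).eq_of_src _ _
  rw [h2, ← h3, h4] at h1
  rw [← neg_sub, ← h1, neg_neg]

theorem _root_.GraysonK.StabData.Bounded.shData {D : StabData P} {L : ℕ} (h : D.Bounded L)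
    (β : StabEq (D.J.Z 1) (D.K.Z 1)) : (D.shData β).Bounded (L + 1) := fun n hn => by
  obtain ⟨n, rfl⟩ := Nat.exists_eq_add_of_le' (show 1 ≤ n by omega)
  exact h n (by omega)

theorem sum_sh (hb : 8 ≤ b) (D : StabData P) (E : StabData P.sh) {L L' : ℕ} (hD : D.Bounded L)
    (hE : E.Bounded L') : c.sum E (L' + 1) = -c.sum D (L + 1) := by
  let β : StabEq (D.J.Z 1) (D.K.Z 1) := Classical.choice (NatFactorization.nonempty_stabEq _ _ _)
  rw [c.sum_eq_of_bounded_of_bounded hb E (D.shData β) hE (hD.shData β) (fun _ => Iso.refl _)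
    (by simp) (by simp), sum, sum, Finset.sum_range_succ', Finset.sum_range_succ',
    Finset.sum_range_succ', c.c_term_zero_of_shData hb D β]
  -- All higher terms agree by definition, with the index moved by one and therefore with the
  -- opposite sign.
  have h : ∀ n, c.c ((D.shData β).term (n + 1 + 1)) = c.c (D.term (n + 1)) := fun n => rfl
  simp only [h, pow_succ, mul_neg_one, neg_smul, Finset.sum_neg_distrib, neg_neg, pow_zero,
    one_smul]
  abel

end Shift

end AdditiveInvariant


/-! ### Compatibility of the spliced complexes with exact functors -/

open ConflationCategory
open scoped ZeroObject

variable {M N : ConflationCategory.{v, u}} [M.IsExact] [N.IsExact]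

namespace ExactFunctor

/-- Exact functors preserve direct sums. -/
@[simps]
noncomputable def biprodIso (F : ExactFunctor M N) (X Y : M) :
    F.functor.obj (X ⊞ Y) ≅ F.functor.obj X ⊞ F.functor.obj Y where
  hom := biprod.lift (F.functor.map biprod.fst) (F.functor.map biprod.snd)
  inv := biprod.desc (F.functor.map biprod.inl) (F.functor.map biprod.inr)
  hom_inv_id := by
    rw [biprod.lift_desc, ← F.functor.map_comp, ← F.functor.map_comp, ← F.functor.map_add,
      biprod.total, F.functor.map_id]
  inv_hom_id := by
    ext <;> simp [← F.functor.map_comp]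

/-- The image of a binary complex. -/
def mapNat (F : ExactFunctor M N) (P : NatBinary M) : NatBinary N where
  X n := F.functor.obj (P.X n)
  d n := F.functor.map (P.d n)
  d' n := F.functor.map (P.d' n)

/-- The image of a factorization. -/
def mapFactorization (F : ExactFunctor M N) {X : ℕ → M} {d : ∀ n, X (n + 1) ⟶ X n}
    (J : NatFactorization M X d) :
    NatFactorization N (fun n => F.functor.obj (X n)) (fun n => F.functor.map (d n)) where
  Z n := F.functor.obj (J.Z n)
  p n := F.functor.map (J.p n)
  ι n := F.functor.map (J.ι n)
  fac n := by rw [← F.functor.map_comp, J.fac]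
  confl n := F.map_confl (J.confl n)
  isIso := have := J.isIso; inferInstance

theorem isBin_mapNat (F : ExactFunctor M N) {P : NatBinary M} {b : ℕ} (h : P.IsBin b) :
    (F.mapNat P).IsBin b :=
  ⟨⟨F.mapFactorization h.acyclic.some⟩, ⟨F.mapFactorization h.acyclic'.some⟩,
    fun n hn => F.functor.map_isZero (h.isZero n hn)⟩

/-- The image of a stable equivalence. -/
noncomputable def mapStabEq (F : ExactFunctor M N) {J K : M} (α : StabEq J K) :
    StabEq (F.functor.obj J) (F.functor.obj K) where
  A := F.functor.obj α.A
  B := F.functor.obj α.B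
  S := F.functor.obj α.S
  a := F.functor.map α.a ≫ (F.biprodIso _ _).hom
  b := (F.biprodIso _ _).inv ≫ F.functor.map α.b
  a' := F.functor.map α.a' ≫ (F.biprodIso _ _).hom
  b' := (F.biprodIso _ _).inv ≫ F.functor.map α.b'
  confl := (F.map_confl α.confl).of_iso (Iso.refl _) (F.biprodIso _ _) (Iso.refl _)
    (Category.id_comp _) (by rw [Iso.hom_inv_id_assoc]; exact (Category.comp_id _).symm)
  confl' := (F.map_confl α.confl').of_iso (Iso.refl _) (F.biprodIso _ _) (Iso.refl _)
    (Category.id_comp _) (by rw [Iso.hom_inv_id_assoc]; exact (Category.comp_id _).symm)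

/-- The image of a choice of data. -/
noncomputable def mapStabData (F : ExactFunctor M N) {P : NatBinary M} (D : StabData P) :
    StabData (F.mapNat P) where
  J := F.mapFactorization D.J
  K := F.mapFactorization D.K
  α n := F.mapStabEq (D.α n)

theorem bounded_mapStabData (F : ExactFunctor M N) {P : NatBinary M} {D : StabData P} {L : ℕ}
    (h : D.Bounded L) : (F.mapStabData D).Bounded L := fun n hn =>
  ⟨F.functor.map_isZero (h n hn).1, F.functor.map_isZero (h n hn).2.1,
    F.functor.map_isZero (h n hn).2.2.1, F.functor.map_isZero (h n hn).2.2.2⟩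

end ExactFunctor

namespace AdditiveInvariant

open NatBinary StabData

variable {V : Type w} [AddCommGroup V] {b : ℕ} (c : AdditiveInvariant N V b)

/-- An exact functor preserves direct sums only up to `biprodIso`, so the two complexes are
isomorphic but not equal; for the values of `c` this is enough. -/
theorem c_mapNat_sComplex (hb : 5 ≤ b) (F : ExactFunctor M N) {J K P J' K' P₁ P₀ : M}
    (β : StabEq J K) {i : J ⟶ P} {p : P ⟶ J'} (hJ : M.Confl i p) {i' : K ⟶ P} {p' : P ⟶ K'}
    (hK : M.Confl i' p') {j : J' ⟶ P₁} {q : P₁ ⟶ P₀} (h : M.Confl j q) {j' : K' ⟶ P₁}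
    {q' : P₁ ⟶ P₀} (h' : M.Confl j' q') :
    c.c (F.mapNat (sComplex β hJ hK h h')) = c.c (sComplex (F.mapStabEq β) (F.map_confl hJ)
      (F.map_confl hK) (F.map_confl h) (F.map_confl h')) := by
  refine c.congr (F.isBin_mapNat ((isBin_sComplex _ _ _ _ _).mono hb))
    (fun n => match n with
      | 0 => Iso.refl _
      | 1 => Iso.refl _
      | 2 => F.biprodIso _ _
      | 3 => F.biprodIso _ _ ≪≫ biprod.mapIso (F.biprodIso _ _) (Iso.refl _)
      | 4 => Iso.refl _
      | _ + 5 => (F.functor.map_isZero (isZero_zero M)).iso (isZero_zero N))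
    (fun n => ?_) (fun n => ?_)
  · match n with
    | 0 => exact (Category.id_comp _).trans (Category.comp_id _).symm
    | 1 =>
      change (F.biprodIso β.B P).hom ≫ (biprod.snd ≫ F.functor.map p) ≫ F.functor.map j =
        F.functor.map ((biprod.snd ≫ p) ≫ j) ≫ 𝟙 _
      simp
    | 2 =>
      change (F.biprodIso (K ⊞ β.S) J ≪≫ biprod.mapIso (F.biprodIso K β.S) (Iso.refl _)).hom ≫
        biprod.map ((F.biprodIso K β.S).inv ≫ F.functor.map β.b') (𝟙 _) ≫
          biprod.map (𝟙 _) (F.functor.map i) =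
        F.functor.map (biprod.map β.b' (𝟙 J) ≫ biprod.map (𝟙 β.B) i) ≫ (F.biprodIso β.B P).hom
      rw [F.functor.map_comp]
      apply biprod.hom_ext
      · simp only [Iso.trans_hom, biprod.mapIso_hom, Category.assoc, biprod.map_fst,
          Category.comp_id, biprod.map_fst_assoc, Iso.hom_inv_id_assoc]
        simp [← Functor.map_comp]
      · simp [← Functor.map_comp]
    | 3 =>
      change 𝟙 _ ≫ (F.functor.map β.a' ≫ (F.biprodIso K β.S).hom) ≫ biprod.inl =
        F.functor.map (β.a' ≫ biprod.inl) ≫ (F.biprodIso (K ⊞ β.S) J ≪≫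
          biprod.mapIso (F.biprodIso K β.S) (Iso.refl _)).hom
      ext <;> simp [← Functor.map_comp, ← Functor.map_comp_assoc]
    | _ + 4 => exact (F.functor.map_isZero (isZero_zero M)).eq_of_src _ _
  · match n with
    | 0 => exact (Category.id_comp _).trans (Category.comp_id _).symm
    | 1 =>
      change (F.biprodIso β.B P).hom ≫ (biprod.snd ≫ F.functor.map p') ≫ F.functor.map j' =
        F.functor.map ((biprod.snd ≫ p') ≫ j') ≫ 𝟙 _
      simp
    | 2 =>
      have h0 : (F.biprodIso (K ⊞ β.S) J ≪≫ biprod.mapIso (F.biprodIso K β.S) (Iso.refl _)).hom ≫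
          biprod.lift biprod.snd (biprod.fst ≫ biprod.snd) ≫ (F.biprodIso J β.S).inv =
          F.functor.map (biprod.lift biprod.snd (biprod.fst ≫ biprod.snd)) := by
        rw [← Category.assoc, Iso.comp_inv_eq]
        ext <;> simp [← Functor.map_comp]
      replace h0 := h0 =≫ F.functor.map β.b
      change (F.biprodIso (K ⊞ β.S) J ≪≫ biprod.mapIso (F.biprodIso K β.S) (Iso.refl _)).hom ≫
        biprod.lift (biprod.lift biprod.snd (biprod.fst ≫ biprod.snd) ≫
          (F.biprodIso J β.S).inv ≫ F.functor.map β.b) (biprod.fst ≫ biprod.fst) ≫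
          biprod.map (𝟙 _) (F.functor.map i') =
        F.functor.map (biprod.lift (biprod.lift biprod.snd (biprod.fst ≫ biprod.snd) ≫ β.b)
          (biprod.fst ≫ biprod.fst) ≫ biprod.map (𝟙 β.B) i') ≫ (F.biprodIso β.B P).hom
      apply biprod.hom_ext
      · rw [Category.assoc, Category.assoc] at h0
        simp only [Category.assoc, biprod.map_fst, Category.comp_id, biprod.lift_fst, h0]
        simp [← Functor.map_comp]
      · simp [← Functor.map_comp]
    | 3 =>
      change 𝟙 _ ≫ biprod.lift (biprod.lift 0 ((F.functor.map β.a ≫ (F.biprodIso J β.S).hom) ≫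
          biprod.snd)) ((F.functor.map β.a ≫ (F.biprodIso J β.S).hom) ≫ biprod.fst) =
        F.functor.map (biprod.lift (biprod.lift 0 (β.a ≫ biprod.snd)) (β.a ≫ biprod.fst)) ≫
          (F.biprodIso (K ⊞ β.S) J ≪≫ biprod.mapIso (F.biprodIso K β.S) (Iso.refl _)).hom
      ext <;> simp [← Functor.map_comp, ← Functor.map_comp_assoc]
    | _ + 4 => exact (F.functor.map_isZero (isZero_zero M)).eq_of_src _ _

theorem c_mapNat_sComplexNext (hb : 5 ≤ b) (F : ExactFunctor M N) {J K L O Q : M}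
    (α : StabEq J K) (γ : StabEq L O) {l : L ⟶ Q} {r : Q ⟶ J} (hL : M.Confl l r) {l' : O ⟶ Q}
    {r' : Q ⟶ K} (hO : M.Confl l' r') :
    c.c (F.mapNat (sComplexNext α γ hL hO)) = c.c (sComplexNext (F.mapStabEq α) (F.mapStabEq γ)
      (F.map_confl hL) (F.map_confl hO)) := by
  have h1 : (F.functor.map (biprod.map r (𝟙 α.A)) ≫ F.functor.map (biprod.map (𝟙 J) α.a')) ≫
      (F.biprodIso J (K ⊞ α.S)).hom ≫ biprod.map (𝟙 _) (F.biprodIso K α.S).hom =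
      (F.biprodIso Q α.A).hom ≫ biprod.map (F.functor.map r) (𝟙 _) ≫
      biprod.map (𝟙 _) (F.functor.map α.a' ≫ (F.biprodIso K α.S).hom) := by
    ext <;> simp [← Functor.map_comp, ← Functor.map_comp_assoc]
  have h2 : F.functor.map (biprod.snd ≫ α.b') ≫ 𝟙 _ = ((F.biprodIso J (K ⊞ α.S)).hom ≫
      biprod.map (𝟙 _) (F.biprodIso K α.S).hom) ≫ biprod.snd ≫ (F.biprodIso K α.S).inv ≫
      F.functor.map α.b' := by
    simp only [Category.assoc, biprod.map_snd_assoc, Iso.hom_inv_id_assoc]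
    simp
  have h1' : (F.functor.map (biprod.map r' (𝟙 α.A)) ≫ F.functor.map
        (biprod.lift (biprod.snd ≫ α.a ≫ biprod.fst)
        (biprod.lift biprod.fst (biprod.snd ≫ α.a ≫ biprod.snd)))) ≫
      (F.biprodIso J (K ⊞ α.S)).hom ≫ biprod.map (𝟙 _) (F.biprodIso K α.S).hom =
      (F.biprodIso Q α.A).hom ≫ biprod.map (F.functor.map r') (𝟙 _) ≫ biprod.lift
        (biprod.snd ≫ (F.functor.map α.a ≫ (F.biprodIso J α.S).hom) ≫ biprod.fst)
        (biprod.lift biprod.fst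
          (biprod.snd ≫ (F.functor.map α.a ≫ (F.biprodIso J α.S).hom) ≫ biprod.snd)) := by
    ext <;> simp [← Functor.map_comp, ← Functor.map_comp_assoc]
  have h0 : ((F.biprodIso J (K ⊞ α.S)).hom ≫ biprod.map (𝟙 _) (F.biprodIso K α.S).hom) ≫
      biprod.lift biprod.fst (biprod.snd ≫ biprod.snd) =
      F.functor.map (biprod.lift biprod.fst (biprod.snd ≫ biprod.snd)) ≫
        (F.biprodIso J α.S).hom := by
    ext <;> simp [← Functor.map_comp]
  have h2' : F.functor.map (biprod.lift biprod.fst (biprod.snd ≫ biprod.snd) ≫ α.b) ≫ 𝟙 _ =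
      ((F.biprodIso J (K ⊞ α.S)).hom ≫ biprod.map (𝟙 _) (F.biprodIso K α.S).hom) ≫
      biprod.lift biprod.fst (biprod.snd ≫ biprod.snd) ≫ (F.biprodIso J α.S).inv ≫
      F.functor.map α.b := by
    rw [Category.assoc, reassoc_of% h0, Iso.hom_inv_id_assoc]
    simp
  have h := c.c_sComplex_congr hb (F.mapStabEq γ) (F.map_confl (hL.add_right α.A))
    (F.map_confl (hO.add_right α.A)) (F.map_confl α.confl_top) (F.map_confl α.confl_bot)
    ((F.map_confl hL).add_right (F.functor.obj α.A)) ((F.map_confl hO).add_right (F.functor.obj α.A))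
    (F.mapStabEq α).confl_top (F.mapStabEq α).confl_bot (Iso.refl _) (Iso.refl _)
    (F.biprodIso Q α.A)
    (F.biprodIso J (K ⊞ α.S) ≪≫ biprod.mapIso (Iso.refl _) (F.biprodIso K α.S)) (Iso.refl _)
    (by ext <;> simp [← Functor.map_comp]) h1 h2
    (by ext <;> simp [← Functor.map_comp]) h1' h2'
  rw [StabEq.transport_refl] at h
  exact (c.c_mapNat_sComplex hb F _ _ _ _ _).trans h

theorem c_mapNat_term (hb : 5 ≤ b) (F : ExactFunctor M N) {P : NatBinary M} (D : StabData P) :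
    ∀ n, c.c (F.mapNat (D.term n)) = c.c ((F.mapStabData D).term n)
  | 0 => by
    have h := c.c_sComplex_congr hb (F.mapStabEq (D.α 0)) (F.map_confl (D.J.confl 1))
      (F.map_confl (D.K.confl 1)) (F.map_confl D.J.confl_bottom) (F.map_confl D.K.confl_bottom)
      ((F.mapStabData D).J.confl 1) ((F.mapStabData D).K.confl 1) (F.mapStabData D).J.confl_bottom
      (F.mapStabData D).K.confl_bottom (Iso.refl _) (Iso.refl _) (Iso.refl _) (Iso.refl _)
      (Iso.refl _) ((Category.comp_id _).trans (Category.id_comp _).symm)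
      ((Category.comp_id _).trans (Category.id_comp _).symm)
      ((Category.comp_id _).trans (Category.id_comp _).symm)
      ((Category.comp_id _).trans (Category.id_comp _).symm)
      ((Category.comp_id _).trans (Category.id_comp _).symm)
      ((Category.comp_id _).trans (Category.id_comp _).symm)
    refine ((c.c_mapNat_sComplex hb F _ _ _ _ _).trans h).trans ?_
    exact congrArg (fun β => c.c (sComplex β ((F.mapStabData D).J.confl 1)
      ((F.mapStabData D).K.confl 1) (F.mapStabData D).J.confl_bottom
      (F.mapStabData D).K.confl_bottom)) (StabEq.transport_refl (F.mapStabEq (D.α 0)))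
  | n + 1 => c.c_mapNat_sComplexNext hb F (D.α n) (D.α (n + 1)) (D.J.confl (n + 2))
      (D.K.confl (n + 2))

end AdditiveInvariant


open ConflationCategory
open scoped ZeroObject

variable {M N : ConflationCategory.{v, u}} [M.IsExact] [N.IsExact]

/-! ### Complexes indexed by natural numbers as complexes indexed by integers -/

section ExtendByZero

/-- Extension of a family of objects by zero. -/
noncomputable def extObj (X : ℕ → N) : ℤ → N
  | .ofNat n => X n
  | .negSucc _ => 0

/-- Extension of a family of morphisms of degree `0` by zero. -/
noncomputable def extHom {X Y : ℕ → N} (φ : ∀ n, X n ⟶ Y n) : ∀ z, extObj X z ⟶ extObj Y z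
  | .ofNat n => φ n
  | .negSucc _ => 0

theorem ofNat_succ_sub_one (n : ℕ) : Int.ofNat (n + 1) - 1 = Int.ofNat n := by
  simp

/-- Extension of a family of morphisms of degree `-1` by zero. -/
noncomputable def extDiff {X Y : ℕ → N} (φ : ∀ n, X (n + 1) ⟶ Y n) :
    ∀ z, extObj X z ⟶ extObj Y (z - 1)
  | .ofNat 0 => 0
  | .ofNat (n + 1) => φ n ≫ eqToHom (congrArg (extObj Y) (ofNat_succ_sub_one n).symm)
  | .negSucc _ => 0

variable {X Y W : ℕ → N}

theorem eqToHom_comp_extHom (φ : ∀ n, X n ⟶ Y n) {z w : ℤ} (h : z = w) :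
    eqToHom (congrArg (extObj X) h) ≫ extHom φ w =
      extHom φ z ≫ eqToHom (congrArg (extObj Y) h) := by
  subst h
  simp

theorem extDiff_comp_extHom (φ : ∀ n, X (n + 1) ⟶ Y n) (ψ : ∀ n, Y n ⟶ W n) :
    ∀ z, extDiff φ z ≫ extHom ψ (z - 1) = extDiff (fun n => φ n ≫ ψ n) z
  | .ofNat 0 => zero_comp
  | .ofNat (n + 1) => by
    have h := eqToHom_comp_extHom ψ (ofNat_succ_sub_one n).symm
    change (φ n ≫ eqToHom _) ≫ extHom ψ _ = (φ n ≫ ψ n) ≫ eqToHom _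
    exact (Category.assoc _ _ _).trans
      ((congrArg (φ n ≫ ·) h).trans (Category.assoc _ _ _).symm)
  | .negSucc _ => zero_comp

theorem extHom_comp_extDiff (ψ : ∀ n, X n ⟶ Y n) (φ : ∀ n, Y (n + 1) ⟶ W n) :
    ∀ z, extHom ψ z ≫ extDiff φ z = extDiff (fun n => ψ (n + 1) ≫ φ n) z
  | .ofNat 0 => comp_zero
  | .ofNat (n + 1) => (Category.assoc (ψ (n + 1)) (φ n) _).symm
  | .negSucc _ => comp_zero

theorem isZero_extObj {b : ℕ} (h : ∀ n, b ≤ n → IsZero (X n)) :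
    ∀ z : ℤ, z < 0 ∨ (b : ℤ) ≤ z → IsZero (extObj X z)
  | .ofNat n, hz => h n (by simp at hz; omega)
  | .negSucc _, _ => isZero_zero N

theorem confl_extHom {φ : ∀ n, X n ⟶ Y n} {ψ : ∀ n, Y n ⟶ W n}
    (h : ∀ n, N.Confl (φ n) (ψ n)) : ∀ z, N.Confl (extHom φ z) (extHom ψ z)
  | .ofNat n => h n
  | .negSucc _ => (confl_id_zero (N := N) (A := 0) (isZero_zero N) 0).of_iso (Iso.refl _)
      (Iso.refl _) (Iso.refl _) ((isZero_zero N).eq_of_src _ _) ((isZero_zero N).eq_of_src _ _)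

/-- The factorization of the extension of a differential by zero. -/
noncomputable def NatFactorization.ext {d : ∀ n, X (n + 1) ⟶ X n} (F : NatFactorization N X d) :
    AcyclicFactorization N (extObj X) (extDiff d) where
  Z := extObj F.Z
  p := extDiff F.p
  ι := extHom F.ι
  fac z := by
    rw [extDiff_comp_extHom]
    exact congrArg (fun φ => extDiff φ z) (funext F.fac)
  confl
    | .ofNat 0 =>
      have := F.isIso
      (confl_id_zero (N := N) (A := X 0) (isZero_zero N) 0).of_iso (asIso (F.ι 0)).symm
        (Iso.refl _) (Iso.refl _) (by
          change inv (F.ι 0) ≫ F.ι 0 = 𝟙 _ ≫ 𝟙 _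
          simp) ((isZero_zero N).eq_of_tgt _ _)
    | .ofNat (n + 1) => (F.confl n).of_iso (Iso.refl _) (Iso.refl _)
        (eqToIso (congrArg (extObj F.Z) (ofNat_succ_sub_one n).symm))
        ((Category.id_comp _).trans (Category.comp_id _).symm) (Category.id_comp _)
    | .negSucc _ => (confl_id_zero (N := N) (A := 0) (isZero_zero N) 0).of_iso (Iso.refl _)
        (Iso.refl _) (Iso.refl _) ((isZero_zero N).eq_of_src _ _)
        ((isZero_zero N).eq_of_src _ _)

end ExtendByZero

namespace NatBinary

variable {b : ℕ} {S : Set ℤ}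

/-- The complex indexed by integers that belongs to a complex indexed by natural numbers. -/
noncomputable def toInt (P : NatBinary N) (h : P.IsBin b) (hS : Set.Ico 0 (b : ℤ) ⊆ S) :
    BinaryAcyclicComplex S N where
  X := extObj P.X
  d := extDiff P.d
  d' := extDiff P.d'
  acyclic := h.acyclic.map NatFactorization.ext
  acyclic' := h.acyclic'.map NatFactorization.ext
  bounded := ⟨0, b, fun z hz => isZero_extObj h.isZero z (by omega)⟩
  supported z hz := isZero_extObj h.isZero z (by
    by_contra hz'
    push Not at hz'
    exact hz (hS hz'))

/-- The morphism of complexes indexed by integers that belongs to a morphism of complexes indexed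
by natural numbers. -/
noncomputable def Hom.toInt {P Q : NatBinary N} (f : P.Hom Q) (hP : P.IsBin b) (hQ : Q.IsBin b)
    (hS : Set.Ico 0 (b : ℤ) ⊆ S) : P.toInt hP hS ⟶ Q.toInt hQ hS where
  f := extHom f.f
  comm z := by
    refine (extHom_comp_extDiff _ _ z).trans (Eq.trans ?_ (extDiff_comp_extHom _ _ z).symm)
    exact congrArg (fun φ => extDiff φ z) (funext f.comm)
  comm' z := by
    refine (extHom_comp_extDiff _ _ z).trans (Eq.trans ?_ (extDiff_comp_extHom _ _ z).symm)
    exact congrArg (fun φ => extDiff φ z) (funext f.comm')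

end NatBinary

/-! ### The Grothendieck group of binary acyclic complexes -/

theorem K0.of_eq_add {M : ConflationCategory.{v, u}} {A B C : M} {i : A ⟶ B} {p : B ⟶ C}
    (h : M.Confl i p) : K0.of B = K0.of A + K0.of C := by
  rw [← sub_eq_zero, ← sub_sub]
  refine (QuotientAddGroup.eq_zero_iff _).2 (AddSubgroup.subset_closure ?_)
  exact ⟨_, h.2, rfl⟩

theorem K0.of_eq_zero {M : ConflationCategory.{v, u}} [M.IsExact] {Z : M} (h : IsZero Z) :
    K0.of Z = 0 := by
  simpa using K0.of_eq_add (confl_id_zero (A := Z) h (𝟙 Z))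

theorem K0.of_eq_of_iso {M : ConflationCategory.{v, u}} [M.IsExact] {A B : M} (e : A ≅ B) :
    K0.of A = K0.of B := by
  have h : M.Confl e.hom (0 : B ⟶ 0) := (confl_id_zero (A := B) (isZero_zero M) 0).of_iso
    e.symm (Iso.refl _) (Iso.refl _) (by simp) (by simp)
  rw [K0.of_eq_add h, K0.of_eq_zero (isZero_zero M), add_zero]

/-- The homomorphism on `K₀` given by a function that is additive on short exact sequences. -/
def K0.lift {M : ConflationCategory.{v, u}} {V : Type w} [AddCommGroup V] (φ : M → V)
    (h : ∀ {A B C : M} (i : A ⟶ B) (p : B ⟶ C), M.Confl i p → φ B = φ A + φ C) : K0 M →+ V :=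
  QuotientAddGroup.lift (exactRelations M) (FreeAbelianGroup.lift φ) (by
    rw [exactRelations, AddSubgroup.closure_le]
    rintro x ⟨T, hT, rfl⟩
    simp [h T.f T.g ⟨T.zero, hT⟩])

theorem K0.lift_of {M : ConflationCategory.{v, u}} {V : Type w} [AddCommGroup V] (φ : M → V)
    (h : ∀ {A B C : M} (i : A ⟶ B) (p : B ⟶ C), M.Confl i p → φ B = φ A + φ C) (X : M) :
    K0.lift φ h (K0.of X) = φ X := by
  simp [K0.lift, K0.of]

theorem K0.hom_ext {M : ConflationCategory.{v, u}} {V : Type w} [AddCommGroup V]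
    {φ ψ : K0 M →+ V} (h : ∀ X, φ (K0.of X) = ψ (K0.of X)) : φ = ψ := by
  apply QuotientAddGroup.addMonoidHom_ext
  ext X
  exact h X

namespace K0Omega

variable {n : ℕ} {S : Set ℤ}

theorem of_eq_of_iso {P Q : iterBq S n N} (e : P ≅ Q) : (of P : K0Omega n S N) = of Q :=
  congrArg (QuotientAddGroup.mk' _) (K0.of_eq_of_iso e)

theorem of_eq_add {P Q R : iterBq S n N} {i : P ⟶ Q} {p : Q ⟶ R} (h : (iterBq S n N).Confl i p) :
    (of Q : K0Omega n S N) = of P + of R :=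
  congrArg (QuotientAddGroup.mk' _) (K0.of_eq_add h)

theorem of_eq_zero {k : Fin n} {P : iterBq S n N} (h : IsDiagonal S N n k P) :
    (of P : K0Omega n S N) = 0 :=
  (QuotientAddGroup.eq_zero_iff _).2 (AddSubgroup.subset_closure ⟨k, P, h, rfl⟩)

/-- The homomorphism on `K₀(Ωⁿ)` given by a function that is additive on short exact sequences and
vanishes on diagonal multicomplexes. -/
def lift {V : Type w} [AddCommGroup V] (φ : K0 (iterBq S n N) →+ V)
    (h : ∀ (k : Fin n) (P : iterBq S n N), IsDiagonal S N n k P → φ (K0.of P) = 0) :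
    K0Omega n S N →+ V :=
  QuotientAddGroup.lift _ φ (by
    rw [diagonalRelations, AddSubgroup.closure_le]
    rintro x ⟨k, P, hP, rfl⟩
    exact h k P hP)

theorem hom_ext {V : Type w} [AddCommGroup V] {φ ψ : K0Omega n S N →+ V}
    (h : ∀ P : iterBq S n N, φ (of P) = ψ (of P)) : φ = ψ := by
  apply QuotientAddGroup.addMonoidHom_ext
  exact K0.hom_ext h

theorem mapIncl_of {T : Set ℤ} (h : S ⊆ T) (F : ExactFunctor M N) (P : iterBq S n M) :
    mapIncl n h F (of P) = of ((iterBq.map h F n).functor.obj P) :=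
  congrArg (QuotientAddGroup.mk' _) (K0.map_of _ P)

theorem ofBinary_eq_of_iso {P Q : BinaryAcyclicComplex S N} (e : P ≅ Q) :
    ofBinary P = ofBinary Q := of_eq_of_iso (n := 1) e

theorem ofBinary_eq_add {P Q R : BinaryAcyclicComplex S N} {i : P ⟶ Q} {p : Q ⟶ R}
    (h : ∀ n, N.Confl (i.f n) (p.f n)) : ofBinary Q = ofBinary P + ofBinary R :=
  of_eq_add (n := 1) ((BinaryAcyclicComplex.confl_iff (S := S) (N := N) i p).2 h)

theorem ofBinary_eq_zero {P : BinaryAcyclicComplex S N} (h : P.d = P.d') : ofBinary P = 0 :=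
  of_eq_zero (n := 1) (k := 0) h

theorem ofBinary_hom_ext {V : Type w} [AddCommGroup V] {φ ψ : K0Omega 1 S N →+ V}
    (h : ∀ P, φ (ofBinary P) = ψ (ofBinary P)) : φ = ψ := hom_ext h

/-- The homomorphism on `K₀(Ω)` given by a function that is additive on short exact sequences and
vanishes on complexes with equal differentials. -/
def liftBinary {V : Type w} [AddCommGroup V] (φ : BinaryAcyclicComplex S N → V)
    (h : ∀ {P Q R : BinaryAcyclicComplex S N} (i : P ⟶ Q) (p : Q ⟶ R),
      (∀ n, N.Confl (i.f n) (p.f n)) → φ Q = φ P + φ R)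
    (h' : ∀ P : BinaryAcyclicComplex S N, P.d = P.d' → φ P = 0) : K0Omega 1 S N →+ V :=
  lift (n := 1) (K0.lift (M := Bq S N) φ fun i p hip =>
    h i p ((BinaryAcyclicComplex.confl_iff i p).1 hip))
    fun k P hP => (K0.lift_of (M := Bq S N) _ _ P).trans (h' P (by
      obtain rfl := Subsingleton.elim k 0
      exact hP))

theorem liftBinary_ofBinary {V : Type w} [AddCommGroup V] (φ : BinaryAcyclicComplex S N → V)
    (h : ∀ {P Q R : BinaryAcyclicComplex S N} (i : P ⟶ Q) (p : Q ⟶ R),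
      (∀ n, N.Confl (i.f n) (p.f n)) → φ Q = φ P + φ R)
    (h' : ∀ P : BinaryAcyclicComplex S N, P.d = P.d' → φ P = 0) (P : BinaryAcyclicComplex S N) :
    liftBinary φ h h' (ofBinary P) = φ P :=
  K0.lift_of (M := Bq S N) φ (fun i p hip =>
    h i p ((BinaryAcyclicComplex.confl_iff i p).1 hip)) P

end K0Omega

open Classical in
/-- The class in `K₀(Ω)` as a function on complexes indexed by natural numbers. -/
noncomputable def K0Omega.invariant (N : ConflationCategory.{v, u}) [N.IsExact] {b : ℕ} {S : Set ℤ}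
    (hS : Set.Ico 0 (b : ℤ) ⊆ S) : AdditiveInvariant N (K0Omega 1 S N) b where
  c P := if h : P.IsBin b then K0Omega.ofBinary (P.toInt h hS) else 0
  add {P Q R} hP hQ hR f g h := by
    rw [dif_pos hP, dif_pos hQ, dif_pos hR]
    exact K0Omega.ofBinary_eq_add (i := f.toInt hP hQ hS) (p := g.toInt hQ hR hS) (confl_extHom h)
  diag {P} h hd := by
    rw [dif_pos h]
    exact K0Omega.ofBinary_eq_zero (congrArg extDiff hd)

theorem K0Omega.invariant_c {b : ℕ} {S : Set ℤ} (hS : Set.Ico 0 (b : ℤ) ⊆ S) {P : NatBinary N}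
    (h : P.IsBin b) : (K0Omega.invariant N hS).c P = K0Omega.ofBinary (P.toInt h hS) :=
  dif_pos h


/-! ### From complexes in integer degrees to complexes in natural degrees -/

open ConflationCategory
open scoped ZeroObject

variable {M N : ConflationCategory.{v, u}} [M.IsExact] [N.IsExact] {S : Set ℤ}

theorem AcyclicFactorization.eqToHom_comp_ι {X : ℤ → N} {d : ∀ n, X n ⟶ X (n - 1)}
    (F : AcyclicFactorization N X d) {z w : ℤ} (h : z = w) :
    eqToHom (congrArg F.Z h) ≫ F.ι w = F.ι z ≫ eqToHom (congrArg X h) := by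
  subst h
  simp

theorem AcyclicFactorization.isIso_ι {X : ℤ → N} {d : ∀ n, X n ⟶ X (n - 1)}
    (F : AcyclicFactorization N X d) {z : ℤ} (h : IsZero (X (z - 1))) : IsIso (F.ι z) :=
  KernelFork.IsLimit.isIso_ι _ (IsExact.isKernel _ (F.confl z).2).some
    ((F.isZero_Z h).eq_of_tgt _ _)

/-- The restriction of a factorization to a sequence of consecutive degrees. -/
noncomputable def AcyclicFactorization.toNat {X : ℤ → N} {d : ∀ n, X n ⟶ X (n - 1)}
    (F : AcyclicFactorization N X d) (f : ℕ → ℤ) (hf : ∀ n, f (n + 1) - 1 = f n)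
    (h : IsZero (X (f 0 - 1))) :
    NatFactorization N (fun n => X (f n)) (fun n => d (f (n + 1)) ≫ eqToHom (congrArg X (hf n))) where
  Z n := F.Z (f n)
  p n := F.p (f (n + 1)) ≫ eqToHom (congrArg F.Z (hf n))
  ι n := F.ι (f n)
  fac n := by rw [Category.assoc, F.eqToHom_comp_ι (hf n), ← Category.assoc, F.fac]
  confl n := (F.confl (f (n + 1))).of_iso (Iso.refl _) (Iso.refl _)
    (eqToIso (congrArg F.Z (hf n))) (by simp) (by simp)
  isIso := F.isIso_ι h

namespace BinaryAcyclicComplex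

/-- The restriction of a complex to a sequence of consecutive degrees. -/
def toNat (P : BinaryAcyclicComplex S N) (f : ℕ → ℤ) (hf : ∀ n, f (n + 1) - 1 = f n) :
    NatBinary N where
  X n := P.X (f n)
  d n := P.d (f (n + 1)) ≫ eqToHom (congrArg P.X (hf n))
  d' n := P.d' (f (n + 1)) ≫ eqToHom (congrArg P.X (hf n))

theorem isBin_toNat (P : BinaryAcyclicComplex S N) (f : ℕ → ℤ) (hf : ∀ n, f (n + 1) - 1 = f n)
    (h : IsZero (P.X (f 0 - 1))) {b : ℕ} (hb : ∀ n, b ≤ n → IsZero (P.X (f n))) :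
    (P.toNat f hf).IsBin b :=
  ⟨P.acyclic.map fun F => F.toNat f hf h, P.acyclic'.map fun F => F.toNat f hf h, hb⟩

theorem sub_succ (j : ℤ) (n : ℕ) : (((n + 1 : ℕ) : ℤ) - j) - 1 = (n : ℤ) - j := by
  push_cast
  ring

/-- The restriction of a complex to the degrees `≥ -j`. -/
abbrev natFrom (P : BinaryAcyclicComplex S N) (j : ℤ) : NatBinary N :=
  P.toNat (fun n => (n : ℤ) - j) (sub_succ j)

theorem exists_isBin_natFrom (P : BinaryAcyclicComplex S N) {j : ℤ}
    (h : ∀ z < -j, IsZero (P.X z)) : ∃ b, (P.natFrom j).IsBin b := by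
  obtain ⟨a, b, hab⟩ := P.bounded
  refine ⟨(b + j + 1).toNat, P.isBin_toNat _ _ (h _ (by omega)) fun n hn => hab _ (Or.inr ?_)⟩
  omega

theorem exists_stabData_natFrom (P : BinaryAcyclicComplex S N) {j : ℤ}
    (h : ∀ z < -j, IsZero (P.X z)) : ∃ (D : StabData (P.natFrom j)) (L : ℕ), D.Bounded L := by
  obtain ⟨b, hb⟩ := P.exists_isBin_natFrom h
  obtain ⟨D, hD⟩ := StabData.exists_bounded (L := b) (by omega) hb
  exact ⟨D, b, hD⟩

theorem exists_isZero_of_lt_neg (P : BinaryAcyclicComplex S N) :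
    ∃ j : ℕ, ∀ z < -(j : ℤ), IsZero (P.X z) := by
  obtain ⟨a, b, hab⟩ := P.bounded
  exact ⟨(-a).toNat, fun z hz => hab z (Or.inl (by omega))⟩

theorem eqToHom_comp_d (P : BinaryAcyclicComplex S N) {z w : ℤ} (h : z = w) :
    eqToHom (congrArg P.X h) ≫ P.d w =
      P.d z ≫ eqToHom (congrArg (fun t => P.X (t - 1)) h) := by
  subst h
  simp

theorem eqToHom_comp_d' (P : BinaryAcyclicComplex S N) {z w : ℤ} (h : z = w) :
    eqToHom (congrArg P.X h) ≫ P.d' w =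
      P.d' z ≫ eqToHom (congrArg (fun t => P.X (t - 1)) h) := by
  subst h
  simp

/-- Enlarging the range of degrees shifts the complex. -/
noncomputable def natFromSuccIso (P : BinaryAcyclicComplex S N) {j : ℤ}
    (h : ∀ z < -j, IsZero (P.X z)) : ∀ n, (P.natFrom (j + 1)).X n ≅ (P.natFrom j).sh.X n
  | 0 => (h (((0 : ℕ) : ℤ) - (j + 1)) (by omega)).iso (isZero_zero N)
  | n + 1 => eqToIso (congrArg P.X (by push_cast; ring))

theorem natFromSuccIso_comp_d (P : BinaryAcyclicComplex S N) {j : ℤ}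
    (h : ∀ z < -j, IsZero (P.X z)) : ∀ n, (P.natFromSuccIso h (n + 1)).hom ≫
      (P.natFrom j).sh.d n = (P.natFrom (j + 1)).d n ≫ (P.natFromSuccIso h n).hom
  | 0 => (isZero_zero N).eq_of_tgt _ _
  | n + 1 => by
    have e : ((n + 1 + 1 : ℕ) : ℤ) - (j + 1) = ((n + 1 : ℕ) : ℤ) - j := by push_cast; ring
    have := P.eqToHom_comp_d e
    have e' : ((n + 1 : ℕ) : ℤ) - (j + 1) = (n : ℤ) - j := by push_cast; ring
    change eqToHom (congrArg P.X e) ≫ P.d _ ≫ eqToHom (congrArg P.X (sub_succ j n)) =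
      (P.d _ ≫ eqToHom (congrArg P.X (sub_succ (j + 1) (n + 1)))) ≫ eqToHom (congrArg P.X e')
    rw [← Category.assoc, this, Category.assoc, Category.assoc, eqToHom_trans, eqToHom_trans]

theorem natFromSuccIso_comp_d' (P : BinaryAcyclicComplex S N) {j : ℤ}
    (h : ∀ z < -j, IsZero (P.X z)) : ∀ n, (P.natFromSuccIso h (n + 1)).hom ≫
      (P.natFrom j).sh.d' n = (P.natFrom (j + 1)).d' n ≫ (P.natFromSuccIso h n).hom
  | 0 => (isZero_zero N).eq_of_tgt _ _
  | n + 1 => by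
    have e : ((n + 1 + 1 : ℕ) : ℤ) - (j + 1) = ((n + 1 : ℕ) : ℤ) - j := by push_cast; ring
    have := P.eqToHom_comp_d' e
    have e' : ((n + 1 : ℕ) : ℤ) - (j + 1) = (n : ℤ) - j := by push_cast; ring
    change eqToHom (congrArg P.X e) ≫ P.d' _ ≫ eqToHom (congrArg P.X (sub_succ j n)) =
      (P.d' _ ≫ eqToHom (congrArg P.X (sub_succ (j + 1) (n + 1)))) ≫ eqToHom (congrArg P.X e')
    rw [← Category.assoc, this, Category.assoc, Category.assoc, eqToHom_trans, eqToHom_trans]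

end BinaryAcyclicComplex

namespace AdditiveInvariant

open BinaryAcyclicComplex

variable {V : Type w} [AddCommGroup V] {b : ℕ} (c : AdditiveInvariant N V b)

/-- As `P` vanishes below `-j`, starting one degree lower only shifts the restricted complex, and
`sum_sh` gives the sign. -/
theorem sum_natFrom_succ (hb : 8 ≤ b) (P : BinaryAcyclicComplex S N) {j : ℤ}
    (h : ∀ z < -j, IsZero (P.X z)) (D : StabData (P.natFrom j)) (E : StabData (P.natFrom (j + 1)))
    {L L' : ℕ} (hD : D.Bounded L) (hE : E.Bounded L') :
    c.sum E (L' + 1) = -c.sum D (L + 1) := by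
  obtain ⟨b', hb'⟩ := P.exists_isBin_natFrom h
  obtain ⟨E', hE'⟩ := StabData.exists_bounded (L := b' + 1) (by omega) hb'.sh
  rw [← c.sum_sh hb D E' hD hE']
  exact c.sum_eq_of_bounded_of_bounded hb E E' hE hE' (P.natFromSuccIso h)
    (P.natFromSuccIso_comp_d h) (P.natFromSuccIso_comp_d' h)

theorem sum_natFrom_add (hb : 8 ≤ b) (P : BinaryAcyclicComplex S N) {j : ℤ}
    (h : ∀ z < -j, IsZero (P.X z)) (D : StabData (P.natFrom j)) {L : ℕ} (hD : D.Bounded L)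
    (i : ℕ) : ∀ (k : ℤ) (_ : k = j + i) (E : StabData (P.natFrom k)) {L' : ℕ} (_ : E.Bounded L'),
      c.sum E (L' + 1) = (-1 : ℤ) ^ i • c.sum D (L + 1) := by
  induction i with
  | zero =>
    rintro k hk E L' hE
    obtain rfl : k = j := by simpa using hk
    rw [pow_zero, one_smul]
    exact c.sum_eq_of_bounded_of_bounded hb E D hE hD (fun _ => Iso.refl _)
      (fun _ => (Category.id_comp _).trans (Category.comp_id _).symm)
      (fun _ => (Category.id_comp _).trans (Category.comp_id _).symm)
  | succ i ih =>
    rintro k hk E L' hE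
    obtain rfl : k = j + i + 1 := by push_cast at hk; omega
    have h' : ∀ z < -(j + i), IsZero (P.X z) := fun z hz => h z (by omega)
    obtain ⟨D', L'', hD'⟩ := P.exists_stabData_natFrom h'
    rw [c.sum_natFrom_succ hb P h' D' E hD' hE, ih _ rfl D' hD', pow_succ]
    simp

theorem sum_natFrom_eq (hb : 8 ≤ b) (P : BinaryAcyclicComplex S N) {j k : ℕ}
    (hj : ∀ z < -(j : ℤ), IsZero (P.X z)) (hk : ∀ z < -(k : ℤ), IsZero (P.X z))
    (D : StabData (P.natFrom j)) (E : StabData (P.natFrom k)) {L L' : ℕ} (hD : D.Bounded L)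
    (hE : E.Bounded L') :
    (-1 : ℤ) ^ j • c.sum D (L + 1) = (-1 : ℤ) ^ k • c.sum E (L' + 1) := by
  rcases le_total j k with h | h
  · obtain ⟨i, rfl⟩ := Nat.exists_eq_add_of_le h
    rw [c.sum_natFrom_add hb P hj D hD i _ (by push_cast; rfl) E hE, smul_smul, ← pow_add,
      add_assoc, pow_add, Even.neg_one_pow ⟨i, rfl⟩, mul_one]
  · obtain ⟨i, rfl⟩ := Nat.exists_eq_add_of_le h
    rw [c.sum_natFrom_add hb P hk E hE i _ (by push_cast; rfl) D hD, smul_smul, ← pow_add,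
      add_assoc, pow_add, Even.neg_one_pow ⟨i, rfl⟩, mul_one]

/-- Weighted with `(-1) ^ j`, the alternating sum depends neither on the starting degree nor on the
data or their bound, so it is a function of `P` alone. -/
theorem exists_intSum (hb : 8 ≤ b) (P : BinaryAcyclicComplex S N) :
    ∃ x : V, ∀ (j : ℕ) (_ : ∀ z < -(j : ℤ), IsZero (P.X z)) (D : StabData (P.natFrom j)) (L : ℕ)
      (_ : D.Bounded L), x = (-1 : ℤ) ^ j • c.sum D (L + 1) := by
  obtain ⟨j, hj⟩ := P.exists_isZero_of_lt_neg
  obtain ⟨D, L, hD⟩ := P.exists_stabData_natFrom hj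
  exact ⟨_, fun k hk E L' hE => c.sum_natFrom_eq hb P hj hk D E hD hE⟩

/-- The alternating sum of the values on the spliced complexes that belong to a binary acyclic
complex. -/
noncomputable def intSum (hb : 8 ≤ b) (P : BinaryAcyclicComplex S N) : V :=
  (c.exists_intSum hb P).choose

theorem intSum_eq (hb : 8 ≤ b) (P : BinaryAcyclicComplex S N) {j : ℕ}
    (hj : ∀ z < -(j : ℤ), IsZero (P.X z)) (D : StabData (P.natFrom j)) {L : ℕ}
    (hD : D.Bounded L) : c.intSum hb P = (-1 : ℤ) ^ j • c.sum D (L + 1) :=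
  (c.exists_intSum hb P).choose_spec j hj D L hD

theorem intSum_eq_zero (hb : 8 ≤ b) {P : BinaryAcyclicComplex S N} (h : P.d = P.d') :
    c.intSum hb P = 0 := by
  obtain ⟨j, hj⟩ := P.exists_isZero_of_lt_neg
  obtain ⟨D, L, hD⟩ := P.exists_stabData_natFrom hj
  rw [c.intSum_eq hb P hj D hD, c.sum_eq_zero_of_diag hb ?_ D hD, smul_zero]
  funext n
  exact congrArg (· ≫ eqToHom _) (congrFun h _)

end AdditiveInvariant


open ConflationCategory
open scoped ZeroObject

variable {M N : ConflationCategory.{v, u}} [M.IsExact] [N.IsExact] {S T : Set ℤ}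

/-! ### Naturality of the alternating sums -/

section ExtendByZero

variable {b : ℕ}

/-- Exact functors commute with extension by zero. -/
noncomputable def ExactFunctor.mapExtObj (F : ExactFunctor M N) (X : ℕ → M) :
    ∀ z, F.functor.obj (extObj X z) ≅ extObj (fun n => F.functor.obj (X n)) z
  | .ofNat _ => Iso.refl _
  | .negSucc _ => (F.functor.map_isZero (isZero_zero M)).iso (isZero_zero N)

theorem ExactFunctor.mapExtObj_comp_extDiff (F : ExactFunctor M N) {X : ℕ → M}
    (d : ∀ n, X (n + 1) ⟶ X n) : ∀ z, (F.mapExtObj X z).hom ≫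
      extDiff (X := fun n => F.functor.obj (X n)) (Y := fun n => F.functor.obj (X n))
        (fun n => F.functor.map (d n)) z =
      F.functor.map (extDiff d z) ≫ (F.mapExtObj X (z - 1)).hom
  | .ofNat 0 => (isZero_zero N).eq_of_tgt _ _
  | .ofNat (n + 1) => by
    have h : ∀ {w : ℤ} (hw : Int.ofNat n = w),
        F.functor.map (eqToHom (congrArg (extObj X) hw)) ≫ (F.mapExtObj X w).hom =
          eqToHom (congrArg (extObj fun n => F.functor.obj (X n)) hw) := by
      rintro _ rfl
      rw [eqToHom_refl, F.functor.map_id, Category.id_comp]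
      rfl
    refine (Category.id_comp _).trans ?_
    have h1 := F.functor.map_comp (d n) (eqToHom (congrArg (extObj X) (ofNat_succ_sub_one n).symm))
    refine Eq.trans ?_ (congrArg (· ≫ (F.mapExtObj X _).hom) h1).symm
    exact (congrArg (F.functor.map (d n) ≫ ·) (h (ofNat_succ_sub_one n).symm)).symm.trans
      (Category.assoc _ _ _).symm
  | .negSucc _ => (F.functor.map_isZero (isZero_zero M)).eq_of_src _ _

theorem K0Omega.map_invariant_c (F : ExactFunctor M N) (hS : Set.Ico 0 (b : ℤ) ⊆ S)
    {P : NatBinary M} (h : P.IsBin b) :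
    K0Omega.map 1 S F ((K0Omega.invariant M hS).c P) =
      (K0Omega.invariant N hS).c (F.mapNat P) := by
  rw [invariant_c hS h, invariant_c hS (F.isBin_mapNat h)]
  refine (mapIncl_of (n := 1) subset_rfl F _).trans (ofBinary_eq_of_iso ?_)
  exact BinaryAcyclicComplex.isoMk (F.mapExtObj P.X) (F.mapExtObj_comp_extDiff P.d)
    (F.mapExtObj_comp_extDiff P.d')

theorem K0Omega.map_sum (hb : 5 ≤ b) (F : ExactFunctor M N) (hS : Set.Ico 0 (b : ℤ) ⊆ S)
    {P : NatBinary M} (D : StabData P) (m : ℕ) :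
    K0Omega.map 1 S F ((K0Omega.invariant M hS).sum D m) =
      (K0Omega.invariant N hS).sum (F.mapStabData D) m := by
  simp only [AdditiveInvariant.sum, _root_.map_sum, map_zsmul]
  refine Finset.sum_congr rfl fun n _ => ?_
  rw [K0Omega.map_invariant_c F hS ((D.isBin_term n).mono hb),
    (K0Omega.invariant N hS).c_mapNat_term hb F D n]

/-- The image of a system of data for `P` is one for the image of `P`, and `intSum` may be computed
from any system. The supports `T` and `U` play no role in the value. -/
theorem K0Omega.map_intSum (hb : 8 ≤ b) (F : ExactFunctor M N) (hS : Set.Ico 0 (b : ℤ) ⊆ S)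
    {U : Set ℤ} (h : T ⊆ U) (P : BinaryAcyclicComplex T M) :
    K0Omega.map 1 S F ((K0Omega.invariant M hS).intSum hb P) =
      (K0Omega.invariant N hS).intSum hb ((Bq.map h F).functor.obj P) := by
  obtain ⟨j, hj⟩ := P.exists_isZero_of_lt_neg
  obtain ⟨D, L, hD⟩ := P.exists_stabData_natFrom hj
  have hj' : ∀ z < -(j : ℤ), IsZero (BinaryAcyclicComplex.X ((Bq.map h F).functor.obj P) z) :=
    fun z hz => F.functor.map_isZero (hj z hz)
  obtain ⟨E, L', hE⟩ := BinaryAcyclicComplex.exists_stabData_natFrom _ hj'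
  rw [AdditiveInvariant.intSum_eq _ hb P hj D hD, AdditiveInvariant.intSum_eq _ hb _ hj' E hE,
    map_zsmul, K0Omega.map_sum (by omega) F hS]
  congr 1
  refine AdditiveInvariant.sum_eq_of_bounded_of_bounded _ hb _ E (F.bounded_mapStabData hD) hE
    (fun n => Iso.refl _) (fun n => ?_) (fun n => ?_)
  · refine (Category.id_comp _).trans (Eq.trans ?_ (Category.comp_id _).symm)
    exact ((F.functor.map_comp _ _).trans (congrArg (F.functor.map _ ≫ ·)
      (eqToHom_map F.functor _))).symm
  · refine (Category.id_comp _).trans (Eq.trans ?_ (Category.comp_id _).symm)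
    exact ((F.functor.map_comp _ _).trans (congrArg (F.functor.map _ ≫ ·)
      (eqToHom_map F.functor _))).symm

end ExtendByZero

/-! ### Short exact sequences as binary acyclic complexes -/

namespace NatBinary

/-- A short exact sequence, as a complex with equal differentials. -/
noncomputable def threeTerm {A B C : N} (i : A ⟶ B) (p : B ⟶ C) : NatBinary N where
  X
    | 0 => C
    | 1 => B
    | 2 => A
    | _ + 3 => 0
  d
    | 0 => p
    | 1 => i
    | _ + 2 => 0
  d'
    | 0 => p
    | 1 => i
    | _ + 2 => 0

theorem isBin_threeTerm {A B C : N} {i : A ⟶ B} {p : B ⟶ C} (h : N.Confl i p) :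
    (threeTerm i p).IsBin 3 := by
  have F : NatFactorization N (threeTerm i p).X (threeTerm i p).d :=
    { Z := fun
        | 0 => C
        | 1 => A
        | _ + 2 => 0
      p := fun
        | 0 => p
        | 1 => 𝟙 A
        | _ + 2 => 0
      ι := fun
        | 0 => 𝟙 C
        | 1 => i
        | _ + 2 => 0
      fac := fun
        | 0 => Category.comp_id _
        | 1 => Category.id_comp _
        | _ + 2 => zero_comp
      confl := fun
        | 0 => h
        | 1 => confl_zero_id (isZero_zero N) _
        | _ + 2 => (confl_zero_id (N := N) (A := 0) (isZero_zero N) 0).of_iso (Iso.refl _)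
          (Iso.refl _) (Iso.refl _) ((isZero_zero N).eq_of_src _ _)
          ((isZero_zero N).eq_of_src _ _)
      isIso := inferInstanceAs (IsIso (𝟙 C)) }
  exact ⟨⟨F⟩, ⟨F⟩, fun
    | 0, h | 1, h | 2, h => by omega
    | _ + 3, _ => isZero_zero N⟩

/-- A morphism of short exact sequences, as a morphism of complexes. -/
noncomputable def threeTermHom {A B C A' B' C' : N} {i : A ⟶ B} {p : B ⟶ C} {i' : A' ⟶ B'}
    {p' : B' ⟶ C'} (a : A ⟶ A') (b : B ⟶ B') (c : C ⟶ C') (h : a ≫ i' = i ≫ b)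
    (h' : b ≫ p' = p ≫ c) : (threeTerm i p).Hom (threeTerm i' p') where
  f
    | 0 => c
    | 1 => b
    | 2 => a
    | _ + 3 => 0
  comm
    | 0 => h'
    | 1 => h
    | _ + 2 => (isZero_zero N).eq_of_src _ _
  comm'
    | 0 => h'
    | 1 => h
    | _ + 2 => (isZero_zero N).eq_of_src _ _

end NatBinary

open NatBinary

theorem Ico_zero_three_subset : Set.Ico 0 ((3 : ℕ) : ℤ) ⊆ Set.Icc 0 2 := fun z hz => by
  simp only [Set.mem_Ico, Set.mem_Icc] at hz ⊢
  omega

/-- A short exact sequence, as a binary acyclic complex with equal differentials. -/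
noncomputable abbrev sesComplex {A B C : N} {i : A ⟶ B} {p : B ⟶ C} (h : N.Confl i p) :
    Bq (Set.Icc 0 2) N :=
  (threeTerm i p).toInt (isBin_threeTerm h) Ico_zero_three_subset

section

variable {A B C A' B' C' : N} {i : A ⟶ B} {p : B ⟶ C} {i' : A' ⟶ B'} {p' : B' ⟶ C'}

/-- A morphism of short exact sequences, as a morphism of binary acyclic complexes. -/
noncomputable def sesHom (hc : N.Confl i p) (hc' : N.Confl i' p')
    (a : A ⟶ A') (b : B ⟶ B') (c : C ⟶ C') (h : a ≫ i' = i ≫ b)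
    (h' : b ≫ p' = p ≫ c) : sesComplex hc ⟶ sesComplex hc' :=
  Hom.toInt (threeTermHom a b c h h') _ _ _

variable {A'' B'' C'' : N} {i'' : A'' ⟶ B''} {p'' : B'' ⟶ C''}

theorem sesHom_comp_sesHom (hc : N.Confl i p) (hc' : N.Confl i' p') (hc'' : N.Confl i'' p'')
    {a : A ⟶ A'} {b : B ⟶ B'} {c : C ⟶ C'} (h₁ : a ≫ i' = i ≫ b) (h₁' : b ≫ p' = p ≫ c)
    {a' : A' ⟶ A''} {b' : B' ⟶ B''} {c' : C' ⟶ C''} (h₂ : a' ≫ i'' = i' ≫ b')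
    (h₂' : b' ≫ p'' = p' ≫ c') {a'' : A ⟶ A''} {b'' : B ⟶ B''} {c'' : C ⟶ C''}
    (h₃ : a'' ≫ i'' = i ≫ b'') (h₃' : b'' ≫ p'' = p ≫ c'') (ha : a ≫ a' = a'')
    (hb : b ≫ b' = b'') (hc₀ : c ≫ c' = c'') :
    sesHom hc hc' a b c h₁ h₁' ≫ sesHom hc' hc'' a' b' c' h₂ h₂' =
      sesHom hc hc'' a'' b'' c'' h₃ h₃' := by
  apply BinaryAcyclicComplex.hom_ext
  rintro (n | n)
  · match n with
    | 0 => exact hc₀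
    | 1 => exact hb
    | 2 => exact ha
    | _ + 3 => exact (isZero_zero N).eq_of_src _ _
  · exact (isZero_zero N).eq_of_src _ _

theorem confl_sesHom (hc : N.Confl i p) (hc' : N.Confl i' p') (hc'' : N.Confl i'' p'')
    {a : A ⟶ A'} {b : B ⟶ B'} {c : C ⟶ C'} (h₁ : a ≫ i' = i ≫ b) (h₁' : b ≫ p' = p ≫ c)
    {a' : A' ⟶ A''} {b' : B' ⟶ B''} {c' : C' ⟶ C''} (h₂ : a' ≫ i'' = i' ≫ b')
    (h₂' : b' ≫ p'' = p' ≫ c') (ha : N.Confl a a') (hb : N.Confl b b') (hc₀ : N.Confl c c') :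
    (Bq (Set.Icc 0 2) N).Confl (sesHom hc hc' a b c h₁ h₁') (sesHom hc' hc'' a' b' c' h₂ h₂') := by
  rw [BinaryAcyclicComplex.confl_iff]
  refine confl_extHom fun n => ?_
  match n with
  | 0 => exact hc₀
  | 1 => exact hb
  | 2 => exact ha
  | _ + 3 =>
    exact (confl_zero_id (N := N) (A := 0) (isZero_zero N) 0).of_iso
      (Iso.refl _) (Iso.refl _) (Iso.refl _) ((isZero_zero N).eq_of_src _ _)
      ((isZero_zero N).eq_of_src _ _)

end

/-- Complexes supported in degrees `0`, `1`, `2` are short exact sequences. -/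
theorem confl_of_Bq (P : Bq (Set.Icc 0 2) N) :
    N.Confl (A := BinaryAcyclicComplex.X P 2) (B := BinaryAcyclicComplex.X P 1)
      (C := BinaryAcyclicComplex.X P 0) (BinaryAcyclicComplex.d P 2)
      (BinaryAcyclicComplex.d P 1) := by
  obtain ⟨F⟩ := BinaryAcyclicComplex.acyclic P
  have h0 : IsIso (F.ι 0) := F.isIso_ι (BinaryAcyclicComplex.supported P _ (by norm_num))
  have h3 : IsZero (F.Z (3 - 1)) :=
    (F.confl 3).isZero_right (BinaryAcyclicComplex.supported P _ (by norm_num))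
  have h2 : IsIso (F.p 2) := CokernelCofork.IsColimit.isIso_π _
    (IsExact.isCokernel _ (F.confl 2).2).some (h3.eq_of_src _ _)
  exact (F.confl 1).of_iso (asIso (F.p 2)).symm (Iso.refl _) (asIso (F.ι 0))
    (by
      have h := F.fac 2
      rw [← h]
      exact (IsIso.inv_hom_id_assoc (F.p 2) _).trans (Category.comp_id _).symm)
    ((Category.id_comp _).trans (F.fac 1).symm)

/-- A short exact sequence of binary acyclic complexes, as a binary acyclic complex of short exact
sequences. -/
noncomputable def BinaryAcyclicComplex.ofConfl {P Q R : BinaryAcyclicComplex S N} (i : P ⟶ Q)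
    (p : Q ⟶ R) (h : ∀ n, N.Confl (i.f n) (p.f n)) :
    BinaryAcyclicComplex S (Bq (Set.Icc 0 2) N) where
  X n := sesComplex (h n)
  d n := sesHom (h n) (h (n - 1)) (P.d n) (Q.d n) (R.d n) (i.comm n).symm (p.comm n).symm
  d' n := sesHom (h n) (h (n - 1)) (P.d' n) (Q.d' n) (R.d' n) (i.comm' n).symm (p.comm' n).symm
  acyclic := by
    obtain ⟨a, b, hab⟩ := Q.bounded
    let FP := P.acyclic.some
    let FQ := Q.acyclic.some
    let FR := R.acyclic.some
    -- For a complex of short exact sequences, the cycles have to be short exact sequences too.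
    have hZ := FP.confl_mapZ FQ FR i.f i.comm p.f p.comm h fun n hn => hab n (Or.inl hn)
    exact ⟨{
      Z n := sesComplex (hZ n)
      p n := sesHom (h n) (hZ (n - 1)) (FP.p n) (FQ.p n) (FR.p n) (FP.p_mapZ FQ _ _ n)
        (FQ.p_mapZ FR _ _ n)
      ι n := sesHom (hZ n) (h n) (FP.ι n) (FQ.ι n) (FR.ι n) (FP.mapZ_ι FQ _ _ n).symm
        (FQ.mapZ_ι FR _ _ n).symm
      fac n := sesHom_comp_sesHom _ _ _ _ _ _ _ _ _ (FP.fac n) (FQ.fac n) (FR.fac n)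
      confl n := confl_sesHom _ _ _ _ _ _ _ (FP.confl n) (FQ.confl n) (FR.confl n) }⟩
  acyclic' := by
    obtain ⟨a, b, hab⟩ := Q.bounded
    let FP := P.acyclic'.some
    let FQ := Q.acyclic'.some
    let FR := R.acyclic'.some
    have hZ := FP.confl_mapZ FQ FR i.f i.comm' p.f p.comm' h fun n hn => hab n (Or.inl hn)
    exact ⟨{
      Z n := sesComplex (hZ n)
      p n := sesHom (h n) (hZ (n - 1)) (FP.p n) (FQ.p n) (FR.p n) (FP.p_mapZ FQ _ _ n)
        (FQ.p_mapZ FR _ _ n)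
      ι n := sesHom (hZ n) (h n) (FP.ι n) (FQ.ι n) (FR.ι n) (FP.mapZ_ι FQ _ _ n).symm
        (FQ.mapZ_ι FR _ _ n).symm
      fac n := sesHom_comp_sesHom _ _ _ _ _ _ _ _ _ (FP.fac n) (FQ.fac n) (FR.fac n)
      confl n := confl_sesHom _ _ _ _ _ _ _ (FP.confl n) (FQ.confl n) (FR.confl n) }⟩
  bounded := by
    obtain ⟨a, b, hab⟩ := Q.bounded
    refine ⟨a, b, fun n hn => isZero_of_forall ?_⟩
    rintro (k | k)
    · match k with
      | 0 => exact (h n).isZero_right (hab n hn)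
      | 1 => exact hab n hn
      | 2 => exact (h n).isZero_left (hab n hn)
      | _ + 3 => exact isZero_zero N
    · exact isZero_zero N
  supported n hn := isZero_of_forall (by
    rintro (k | k)
    · match k with
      | 0 => exact R.supported n hn
      | 1 => exact Q.supported n hn
      | 2 => exact P.supported n hn
      | _ + 3 => exact isZero_zero N
    · exact isZero_zero N)

theorem K0Omega.map_ofBinary (F : ExactFunctor M N) (P : BinaryAcyclicComplex S M) :
    K0Omega.map 1 S F (K0Omega.ofBinary P) =
      K0Omega.ofBinary ((Bq.map subset_rfl F).functor.obj P) :=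
  K0Omega.mapIncl_of (n := 1) _ _ _

/-- The differentials of complexes on `[0, 2]` are short exact sequences, natural in the complex.
Applied in each degree of `P` they yield a short exact sequence of binary complexes formed by the
three evaluations. -/
theorem K0Omega.map_eval_one (x : K0Omega 1 S (Bq (Set.Icc 0 2) N)) :
    K0Omega.map 1 S (Bq.eval (Set.Icc 0 2) N 1) x = K0Omega.map 1 S (Bq.eval (Set.Icc 0 2) N 2) x +
      K0Omega.map 1 S (Bq.eval (Set.Icc 0 2) N 0) x := by
  have h : K0Omega.map 1 S (Bq.eval (Set.Icc 0 2) N 1) =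
      K0Omega.map 1 S (Bq.eval (Set.Icc 0 2) N 2) +
        K0Omega.map 1 S (Bq.eval (Set.Icc 0 2) N 0) := by
    apply K0Omega.ofBinary_hom_ext
    intro P
    rw [AddMonoidHom.add_apply, map_ofBinary, map_ofBinary, map_ofBinary]
    let i : BinaryAcyclicComplex.Hom
        ((Bq.map subset_rfl (Bq.eval (Set.Icc 0 2) N 2)).functor.obj P : BinaryAcyclicComplex S N)
        ((Bq.map subset_rfl (Bq.eval (Set.Icc 0 2) N 1)).functor.obj P) :=
      ⟨fun n => BinaryAcyclicComplex.d (P.X n) 2, fun n => ((P.d n).comm 2).symm,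
        fun n => ((P.d' n).comm 2).symm⟩
    let p : BinaryAcyclicComplex.Hom
        ((Bq.map subset_rfl (Bq.eval (Set.Icc 0 2) N 1)).functor.obj P : BinaryAcyclicComplex S N)
        ((Bq.map subset_rfl (Bq.eval (Set.Icc 0 2) N 0)).functor.obj P) :=
      ⟨fun n => BinaryAcyclicComplex.d (P.X n) 1, fun n => ((P.d n).comm 1).symm,
        fun n => ((P.d' n).comm 1).symm⟩
    exact K0Omega.ofBinary_eq_add (i := i) (p := p) fun n => confl_of_Bq (P.X n)
  exact DFunLike.congr_fun h x


open ConflationCategory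
open scoped ZeroObject

variable {M N : ConflationCategory.{v, u}} [M.IsExact] [N.IsExact] {S T U : Set ℤ}

/-! ### The shortening homomorphism -/

namespace K0Omega

variable {b : ℕ}

/-- No compatible choices for `P`, `Q` and `R` are needed. The short exact sequence is a single
complex over `Bq (Set.Icc 0 2) N`; naturality of `intSum` for the three evaluations expresses the
three values through one class, and `map_eval_one` relates them. -/
theorem intSum_add (hb : 8 ≤ b) (hS : Set.Ico 0 (b : ℤ) ⊆ S) {P Q R : BinaryAcyclicComplex T N}
    (i : P ⟶ Q) (p : Q ⟶ R) (h : ∀ n, N.Confl (i.f n) (p.f n)) :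
    (invariant N hS).intSum hb Q = (invariant N hS).intSum hb P +
      (invariant N hS).intSum hb R := by
  have h0 := map_intSum hb (Bq.eval (Set.Icc 0 2) N 0) hS (subset_refl T) (.ofConfl i p h)
  have h1 := map_intSum hb (Bq.eval (Set.Icc 0 2) N 1) hS (subset_refl T) (.ofConfl i p h)
  have h2 := map_intSum hb (Bq.eval (Set.Icc 0 2) N 2) hS (subset_refl T) (.ofConfl i p h)
  rw [map_eval_one] at h1
  exact h1.symm.trans (congrArg₂ (· + ·) h2 h0)

/-- The homomorphism that maps the class of a binary acyclic complex to the alternating sum of the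
classes of the spliced complexes. -/
noncomputable def shorten (hb : 8 ≤ b) (hS : Set.Ico 0 (b : ℤ) ⊆ S) (T : Set ℤ)
    (N : ConflationCategory.{v, u}) [N.IsExact] : K0Omega 1 T N →+ K0Omega 1 S N :=
  liftBinary (fun P => (invariant N hS).intSum hb P) (fun i p h => intSum_add hb hS i p h)
    fun _ h => AdditiveInvariant.intSum_eq_zero _ hb h

theorem shorten_ofBinary (hb : 8 ≤ b) (hS : Set.Ico 0 (b : ℤ) ⊆ S)
    (P : BinaryAcyclicComplex T N) :
    shorten hb hS T N (ofBinary P) = (invariant N hS).intSum hb P :=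
  liftBinary_ofBinary _ _ _ P

theorem map_shorten (hb : 8 ≤ b) (hS : Set.Ico 0 (b : ℤ) ⊆ S) (F : ExactFunctor M N) :
    (K0Omega.map 1 S F).comp (shorten hb hS T M) =
      (shorten hb hS T N).comp (K0Omega.map 1 T F) := by
  apply ofBinary_hom_ext
  intro P
  rw [AddMonoidHom.comp_apply, AddMonoidHom.comp_apply, map_ofBinary, shorten_ofBinary]
  exact (map_intSum hb F hS subset_rfl P).trans (shorten_ofBinary hb hS _).symm

end K0Omega

/-! ### Shifts of binary acyclic complexes -/

namespace BinaryAcyclicComplex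

/-- The shift by `j`. -/
noncomputable def shift (P : BinaryAcyclicComplex S N) (j : ℤ) (h : ∀ z, z ∉ T → z - j ∉ S) :
    BinaryAcyclicComplex T N where
  X z := P.X (z - j)
  d z := P.d (z - j) ≫ eqToHom (congrArg P.X (sub_right_comm z j 1))
  d' z := P.d' (z - j) ≫ eqToHom (congrArg P.X (sub_right_comm z j 1))
  acyclic := P.acyclic.map fun F =>
    { Z z := F.Z (z - j)
      p z := F.p (z - j) ≫ eqToHom (congrArg F.Z (sub_right_comm z j 1))
      ι z := F.ι (z - j)
      fac z := by
        rw [Category.assoc, F.eqToHom_comp_ι (sub_right_comm z j 1), ← Category.assoc, F.fac]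
      confl z := (F.confl (z - j)).of_iso (Iso.refl _) (Iso.refl _)
        (eqToIso (congrArg F.Z (sub_right_comm z j 1))) (by simp) (by simp) }
  acyclic' := P.acyclic'.map fun F =>
    { Z z := F.Z (z - j)
      p z := F.p (z - j) ≫ eqToHom (congrArg F.Z (sub_right_comm z j 1))
      ι z := F.ι (z - j)
      fac z := by
        rw [Category.assoc, F.eqToHom_comp_ι (sub_right_comm z j 1), ← Category.assoc, F.fac]
      confl z := (F.confl (z - j)).of_iso (Iso.refl _) (Iso.refl _)
        (eqToIso (congrArg F.Z (sub_right_comm z j 1))) (by simp) (by simp) }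
  bounded := by
    obtain ⟨a, b, h⟩ := P.bounded
    exact ⟨a + j, b + j, fun z hz => h _ (by omega)⟩
  supported z hz := P.supported _ (h z hz)

/-- The shift of a morphism. -/
noncomputable def shiftHom {P Q : BinaryAcyclicComplex S N} (f : P ⟶ Q) (j : ℤ)
    (h : ∀ z, z ∉ T → z - j ∉ S) : P.shift j h ⟶ Q.shift j h where
  f z := f.f (z - j)
  comm z := by
    have h : ∀ {z w : ℤ} (h : z = w), eqToHom (congrArg P.X h) ≫ f.f w =
        f.f z ≫ eqToHom (congrArg Q.X h) := by
      rintro z _ rfl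
      simp
    change f.f _ ≫ Q.d _ ≫ eqToHom _ = (P.d _ ≫ eqToHom _) ≫ f.f _
    rw [Category.assoc, h (sub_right_comm z j 1), ← Category.assoc, f.comm, Category.assoc]
  comm' z := by
    have h : ∀ {z w : ℤ} (h : z = w), eqToHom (congrArg P.X h) ≫ f.f w =
        f.f z ≫ eqToHom (congrArg Q.X h) := by
      rintro z _ rfl
      simp
    change f.f _ ≫ Q.d' _ ≫ eqToHom _ = (P.d' _ ≫ eqToHom _) ≫ f.f _
    rw [Category.assoc, h (sub_right_comm z j 1), ← Category.assoc, f.comm', Category.assoc]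

/-- The shift by zero is the identity. -/
noncomputable def shiftZero (P : BinaryAcyclicComplex S N) (h : ∀ z, z ∉ S → z - 0 ∉ S) :
    P.shift 0 h ≅ P :=
  isoMk (fun z => eqToIso (congrArg P.X (sub_zero z)))
    (fun z => by
      change eqToHom (congrArg P.X (sub_zero z)) ≫ P.d z = (P.d (z - 0) ≫
        eqToHom (congrArg P.X (sub_right_comm z 0 1))) ≫ eqToHom (congrArg P.X (sub_zero (z - 1)))
      rw [P.eqToHom_comp_d (sub_zero z), Category.assoc, eqToHom_trans])
    (fun z => by
      change eqToHom (congrArg P.X (sub_zero z)) ≫ P.d' z = (P.d' (z - 0) ≫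
        eqToHom (congrArg P.X (sub_right_comm z 0 1))) ≫ eqToHom (congrArg P.X (sub_zero (z - 1)))
      rw [P.eqToHom_comp_d' (sub_zero z), Category.assoc, eqToHom_trans])

/-- Composition of shifts. -/
noncomputable def shiftShift (P : BinaryAcyclicComplex S N) {i j k : ℤ} (hk : k = i + j)
    (hi : ∀ z, z ∉ T → z - i ∉ S) (hj : ∀ z, z ∉ U → z - j ∉ T) (h : ∀ z, z ∉ U → z - k ∉ S) :
    (P.shift i hi).shift j hj ≅ P.shift k h :=
  have e : ∀ z, z - j - i = z - k := fun z => by omega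
  isoMk (fun z => eqToIso (congrArg P.X (e z)))
    (fun z => by
      change eqToHom (congrArg P.X (e z)) ≫ P.d (z - k) ≫
        eqToHom (congrArg P.X (sub_right_comm z k 1)) =
        ((P.d (z - j - i) ≫ eqToHom (congrArg P.X (sub_right_comm (z - j) i 1))) ≫
          eqToHom (congrArg (fun t => P.X (t - i)) (sub_right_comm z j 1))) ≫
          eqToHom (congrArg P.X (e (z - 1)))
      rw [← Category.assoc, P.eqToHom_comp_d (e z)]
      simp only [Category.assoc, eqToHom_trans])
    (fun z => by
      change eqToHom (congrArg P.X (e z)) ≫ P.d' (z - k) ≫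
        eqToHom (congrArg P.X (sub_right_comm z k 1)) =
        ((P.d' (z - j - i) ≫ eqToHom (congrArg P.X (sub_right_comm (z - j) i 1))) ≫
          eqToHom (congrArg (fun t => P.X (t - i)) (sub_right_comm z j 1))) ≫
          eqToHom (congrArg P.X (e (z - 1)))
      rw [← Category.assoc, P.eqToHom_comp_d' (e z)]
      simp only [Category.assoc, eqToHom_trans])

/-- A complex that vanishes in degrees `< -j` is determined by its restriction to the other
degrees. -/
noncomputable def extObjNatFrom (P : BinaryAcyclicComplex S N) {j : ℤ}
    (hj : ∀ z < -j, IsZero (P.X z)) : ∀ z, extObj (P.natFrom j).X z ≅ P.X (z - j)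
  | .ofNat _ => Iso.refl _
  | .negSucc n => (isZero_zero N).iso (hj _ (by omega))

theorem extObjNatFrom_comp (P : BinaryAcyclicComplex S N) {j : ℤ}
    (hj : ∀ z < -j, IsZero (P.X z)) {δ : ∀ z, P.X z ⟶ P.X (z - 1)} : ∀ z,
      (P.extObjNatFrom hj z).hom ≫
        δ (z - j) ≫ eqToHom (congrArg P.X (sub_right_comm z j 1)) =
      extDiff (X := (P.natFrom j).X) (Y := (P.natFrom j).X)
        (fun n => δ (((n + 1 : ℕ) : ℤ) - j) ≫ eqToHom (congrArg P.X (sub_succ j n))) z ≫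
          (P.extObjNatFrom hj (z - 1)).hom
  | .ofNat 0 => (hj (Int.ofNat 0 - 1 - j) (by simp; omega)).eq_of_tgt _ _
  | .ofNat (n + 1) => by
    have h : ∀ {w : ℤ} (hw : Int.ofNat n = w),
        eqToHom (congrArg (extObj (P.natFrom j).X) hw) ≫ (P.extObjNatFrom hj w).hom =
          eqToHom (congrArg (fun t => P.X (t - j)) hw) := by
      rintro _ rfl
      exact Category.id_comp _
    refine (Category.id_comp _).trans (Eq.trans ?_ (Category.assoc _ _ _).symm)
    refine Eq.trans ?_ (congrArg ((δ (((n + 1 : ℕ) : ℤ) - j) ≫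
      eqToHom (congrArg P.X (sub_succ j n))) ≫ ·) (h (ofNat_succ_sub_one n).symm)).symm
    exact ((Category.assoc _ _ _).trans (congrArg (δ _ ≫ ·) (eqToHom_trans _ _))).symm
  | .negSucc _ => (isZero_zero N).eq_of_src _ _

/-- A complex that vanishes in degrees `< -j` is determined by its restriction to the other
degrees. -/
noncomputable def toIntNatFrom (P : BinaryAcyclicComplex S N) {j : ℤ}
    (hj : ∀ z < -j, IsZero (P.X z)) {b : ℕ} (hb : (P.natFrom j).IsBin b)
    (hT : Set.Ico 0 (b : ℤ) ⊆ T) (h : ∀ z, z ∉ T → z - j ∉ S) :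
    (P.natFrom j).toInt hb hT ≅ P.shift j h :=
  isoMk (P.extObjNatFrom hj) (P.extObjNatFrom_comp hj) (P.extObjNatFrom_comp hj)

end BinaryAcyclicComplex

namespace NatBinary

/-- The shift of a complex indexed by natural numbers. -/
noncomputable def extObjSh (Q : NatBinary N) : ∀ z : ℤ, extObj Q.sh.X (z - -1) ≅ extObj Q.X z
  | .ofNat n => Iso.refl (Q.X n)
  | .negSucc 0 => Iso.refl 0
  | .negSucc (_ + 1) => Iso.refl 0

theorem extObjSh_comp (Q : NatBinary N) {d : ∀ n, Q.X (n + 1) ⟶ Q.X n}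
    {d' : ∀ n, Q.sh.X (n + 1) ⟶ Q.sh.X n} (h : ∀ n, d' (n + 1) = d n) : ∀ z : ℤ,
    (Q.extObjSh z).hom ≫ extDiff d z = (extDiff d' (z - -1) ≫
      eqToHom (congrArg (extObj Q.sh.X) (sub_right_comm z (-1) 1))) ≫ (Q.extObjSh (z - 1)).hom
  | .ofNat 0 => (isZero_zero N).eq_of_tgt _ _
  | .ofNat (n + 1) => by
    have h1 : ∀ {w : ℤ} (hw : Int.ofNat n = w),
        eqToHom (congrArg (fun t => extObj Q.sh.X (t - -1)) hw) ≫ (Q.extObjSh w).hom =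
          eqToHom (congrArg (extObj Q.X) hw) := by
      rintro _ rfl
      exact Category.id_comp _
    refine (Category.id_comp _).trans (Eq.trans ?_ (Category.assoc _ _ _).symm)
    have h2 : eqToHom (congrArg (extObj Q.sh.X) (ofNat_succ_sub_one (n + 1)).symm) ≫
        eqToHom (congrArg (extObj Q.sh.X) (show Int.ofNat (n + 1 + 1) - 1 =
          Int.ofNat (n + 1) - 1 - -1 by simp)) =
        eqToHom (congrArg (fun t => extObj Q.sh.X (t - -1)) (ofNat_succ_sub_one n).symm) :=
      eqToHom_trans _ _
    have h3 := (congrArg (· ≫ (Q.extObjSh _).hom) h2).trans (h1 (ofNat_succ_sub_one n).symm)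
    refine Eq.trans (congrArg₂ (· ≫ ·) (h n).symm h3.symm) ?_
    refine Eq.trans ?_ (Category.assoc _ _ _).symm
    exact congrArg (d' (n + 1) ≫ ·) (Category.assoc _ _ _)
  | .negSucc _ => (isZero_zero N).eq_of_tgt _ _

/-- The shift of a complex indexed by natural numbers. -/
noncomputable def toIntSh (Q : NatBinary N) {b c : ℕ} (h : Q.IsBin b) (h' : Q.sh.IsBin c)
    (hT : Set.Ico 0 (b : ℤ) ⊆ T) (hS : Set.Ico 0 (c : ℤ) ⊆ S) (hST : ∀ z, z ∉ T → z - -1 ∉ S) :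
    (Q.sh.toInt h' hS).shift (-1) hST ≅ Q.toInt h hT :=
  BinaryAcyclicComplex.isoMk Q.extObjSh (Q.extObjSh_comp fun _ => rfl)
    (Q.extObjSh_comp fun _ => rfl)

end NatBinary


open ConflationCategory
open scoped ZeroObject

variable {M N : ConflationCategory.{v, u}} [M.IsExact] [N.IsExact] {S T U : Set ℤ}

/-! ### The shortening homomorphism is a section -/

namespace K0Omega

open BinaryAcyclicComplex

/-- The endomorphism of `K₀(Ω)` induced by the shift. -/
noncomputable def shift (j : ℤ) (N : ConflationCategory.{v, u}) [N.IsExact] :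
    K0Omega 1 Set.univ N →+ K0Omega 1 Set.univ N :=
  liftBinary (fun P => ofBinary (P.shift j fun z hz => absurd (Set.mem_univ z) hz))
    (fun i p h => ofBinary_eq_add (i := shiftHom i j _) (p := shiftHom p j _) fun n => h (n - j))
    fun _ h => ofBinary_eq_zero (funext fun z => congrArg (· ≫ eqToHom _) (congrFun h (z - j)))

theorem shift_ofBinary (j : ℤ) (P : BinaryAcyclicComplex Set.univ N) :
    shift j N (ofBinary P) =
      ofBinary (P.shift j fun z hz => absurd (Set.mem_univ z) hz) :=
  liftBinary_ofBinary (fun P => ofBinary (P.shift j fun z hz => absurd (Set.mem_univ z) hz))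
    (fun i p h => ofBinary_eq_add (i := shiftHom i j _) (p := shiftHom p j _) fun n => h (n - j))
    _ P

/-- Shifting `Q.sh` down gives back `Q`, so the sign for the upward shift in `c_sh` is also the sign
for the downward shift. -/
theorem shift_neg_one_toInt {b : ℕ} {Q : NatBinary N} (h : Q.IsBin b) :
    shift (-1) N (ofBinary (Q.toInt h (Set.subset_univ _))) =
      -ofBinary (Q.toInt h (Set.subset_univ _)) := by
  have h1 := (invariant N (b := b + 1) (Set.subset_univ _)).c_sh h
  rw [invariant_c _ h.sh, invariant_c _ (h.mono (Nat.le_succ b))] at h1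
  have h2 : ofBinary (Q.sh.toInt h.sh (Set.subset_univ _)) =
    -ofBinary (Q.toInt h (Set.subset_univ _)) := h1
  have h3 := shift_ofBinary (-1) (Q.sh.toInt h.sh (Set.subset_univ _))
  rw [h2, map_neg] at h3
  rw [← neg_eq_iff_eq_neg, h3]
  exact ofBinary_eq_of_iso (NatBinary.toIntSh Q h h.sh (Set.subset_univ _) (Set.subset_univ _) _)

theorem shift_neg_toInt {b : ℕ} {Q : NatBinary N} (h : Q.IsBin b) (j : ℕ) :
    shift (-j) N (ofBinary (Q.toInt h (Set.subset_univ _))) =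
      (-1 : ℤ) ^ j • ofBinary (Q.toInt h (Set.subset_univ _)) := by
  induction j with
  | zero =>
    rw [shift_ofBinary, pow_zero, one_smul]
    exact ofBinary_eq_of_iso (BinaryAcyclicComplex.shiftZero _ _)
  | succ j ih =>
    have h1 := congrArg (shift (-1) N) ih
    rw [map_zsmul, shift_neg_one_toInt h, zsmul_neg] at h1
    rw [pow_succ, mul_neg_one, neg_zsmul, ← h1, shift_ofBinary, shift_ofBinary, shift_ofBinary]
    exact (ofBinary_eq_of_iso (shiftShift _ (by push_cast; ring) _ _ _)).symm

/-- Read in integer degrees, `P.natFrom j` is the shift of `P` by `j`. Shifting it back by `j`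
multiplies its class by `(-1) ^ j`. On `[0, ∞)`, where shifting down is not available, `j = 0`
suffices. -/
theorem ofBinary_natFrom (hU : U = Set.univ ∨ U = Set.Ici 0) (P : BinaryAcyclicComplex U N) :
    ∃ j : ℕ, (∀ z < -(j : ℤ), IsZero (P.X z)) ∧ ∀ (b : ℕ) (hb : (P.natFrom j).IsBin b)
      (h : Set.Ico 0 (b : ℤ) ⊆ U),
      (-1 : ℤ) ^ j • ofBinary ((P.natFrom j).toInt hb h) = ofBinary P := by
  rcases hU with rfl | rfl
  · obtain ⟨j, hj⟩ := P.exists_isZero_of_lt_neg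
    refine ⟨j, hj, fun b hb h => ?_⟩
    have h1 := ofBinary_eq_of_iso (P.toIntNatFrom hj hb (Set.subset_univ _)
      fun z hz => absurd (Set.mem_univ z) hz)
    rw [← shift_neg_toInt hb, h1, shift_ofBinary]
    refine (ofBinary_eq_of_iso (shiftShift (k := 0) P (by ring) _ _
      fun z hz => absurd (Set.mem_univ z) hz)).trans ?_
    exact ofBinary_eq_of_iso (shiftZero P _)
  · have hj : ∀ z < -((0 : ℕ) : ℤ), IsZero (P.X z) := fun z hz => P.supported z (by
      simp at hz ⊢
      omega)
    refine ⟨0, hj, fun b hb h => ?_⟩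
    rw [pow_zero, one_smul]
    have h0 : ∀ z, z ∉ Set.Ici (0 : ℤ) → z - ((0 : ℕ) : ℤ) ∉ Set.Ici (0 : ℤ) := by simp
    exact (ofBinary_eq_of_iso (P.toIntNatFrom hj hb h h0)).trans
      (ofBinary_eq_of_iso (shiftZero P _))

theorem incl_ofBinary (h : S ⊆ T) (P : BinaryAcyclicComplex S N) :
    incl 1 h N (ofBinary P) =
      ofBinary ((Bq.map h (ExactFunctor.id N)).functor.obj P) :=
  mapIncl_of (n := 1) _ _ _

theorem incl_sum {b c : ℕ} (hb : 5 ≤ b) (hc : 5 ≤ c) (hS : Set.Ico 0 (b : ℤ) ⊆ S)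
    (hT : Set.Ico 0 (c : ℤ) ⊆ T) (h : S ⊆ T) {P : NatBinary N} (D : StabData P) (m : ℕ) :
    incl 1 h N ((invariant N hS).sum D m) = (invariant N hT).sum D m := by
  simp only [AdditiveInvariant.sum, _root_.map_sum, map_zsmul]
  refine Finset.sum_congr rfl fun n _ => ?_
  rw [invariant_c hS ((D.isBin_term n).mono hb), invariant_c hT ((D.isBin_term n).mono hc),
    incl_ofBinary]
  rfl

/-- `U` has room for invariants of complexes of any length, so that `sum_eq` identifies the
alternating sum with the class of `P.natFrom j`. The spliced complexes themselves are the same in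
both groups. -/
theorem incl_comp_shorten (hU : U = Set.univ ∨ U = Set.Ici 0) {b : ℕ} (hb : 8 ≤ b)
    (hS : Set.Ico 0 (b : ℤ) ⊆ S) (h : S ⊆ U) :
    (incl 1 h N).comp (shorten hb hS U N) = AddMonoidHom.id _ := by
  apply ofBinary_hom_ext
  intro P
  obtain ⟨j, hj, hP⟩ := ofBinary_natFrom hU P
  obtain ⟨c, hc⟩ := P.exists_isBin_natFrom hj
  -- The length is raised to at least 5 because `sum_eq` needs room for the spliced complexes.
  have hc' := hc.mono (le_max_left c 5)
  obtain ⟨D, hD⟩ := StabData.exists_bounded (L := max c 5) (by omega) hc'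
  have hU' : Set.Ico 0 ((max c 5 + 1 : ℕ) : ℤ) ⊆ U := by
    rcases hU with rfl | rfl
    · exact Set.subset_univ _
    · exact fun z hz => hz.1
  rw [AddMonoidHom.comp_apply, shorten_ofBinary, AdditiveInvariant.intSum_eq _ hb P hj D hD,
    map_zsmul, incl_sum (by omega) (by omega) hS hU' h,
    AdditiveInvariant.sum_eq _ (le_max_right c 5) le_rfl _ hc' D hD,
    invariant_c hU' (hc'.mono (Nat.le_succ _)), hP]
  rfl

end K0Omega


open ConflationCategory
open scoped ZeroObject

variable {M N : ConflationCategory.{v, u}} [M.IsExact] [N.IsExact] {S T U : Set ℤ}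

/-! ### The explicit formula -/

section Formula

variable {b : ℕ}

/-- The objects of a spliced complex, indexed by natural numbers or by integers. -/
noncomputable def extObjFiveTerm {X₀ X₁ X₂ X₃ X₄ : N} (s s' : Splice X₀ X₁ X₂ X₃ X₄) :
    ∀ z, extObj (NatBinary.ofSplices s s').X z ≅ fiveTerm X₀ X₁ X₂ X₃ X₄ z
  | .ofNat 0 => Iso.refl X₀
  | .ofNat 1 => Iso.refl X₁
  | .ofNat 2 => Iso.refl X₂
  | .ofNat 3 => Iso.refl X₃
  | .ofNat 4 => Iso.refl X₄
  | .ofNat (_ + 5) => Iso.refl 0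
  | .negSucc _ => Iso.refl 0

theorem extObjFiveTerm_comp {X₀ X₁ X₂ X₃ X₄ : N} (s s' : Splice X₀ X₁ X₂ X₃ X₄) :
    ∀ z, (extObjFiveTerm s s' z).hom ≫ s.d z =
      extDiff (NatBinary.ofSplices s s').d z ≫ (extObjFiveTerm s s' (z - 1)).hom
  | .ofNat 0 => (isZero_zero N).eq_of_tgt _ _
  | .ofNat 1 => ((Category.comp_id _).trans (Category.comp_id _)).trans
      (Category.id_comp _).symm |>.symm
  | .ofNat 2 => ((Category.comp_id _).trans (Category.comp_id _)).trans
      (Category.id_comp _).symm |>.symm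
  | .ofNat 3 => ((Category.comp_id _).trans (Category.comp_id _)).trans
      (Category.id_comp _).symm |>.symm
  | .ofNat 4 => ((Category.comp_id _).trans (Category.comp_id _)).trans
      (Category.id_comp _).symm |>.symm
  | .ofNat (_ + 5) => (isZero_zero N).eq_of_src _ _
  | .negSucc _ => (isZero_zero N).eq_of_src _ _

theorem extObjFiveTerm_comp' {X₀ X₁ X₂ X₃ X₄ : N} (s s' : Splice X₀ X₁ X₂ X₃ X₄) :
    ∀ z, (extObjFiveTerm s s' z).hom ≫ s'.d z =
      extDiff (NatBinary.ofSplices s s').d' z ≫ (extObjFiveTerm s s' (z - 1)).hom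
  | .ofNat 0 => (isZero_zero N).eq_of_tgt _ _
  | .ofNat 1 => ((Category.comp_id _).trans (Category.comp_id _)).trans
      (Category.id_comp _).symm |>.symm
  | .ofNat 2 => ((Category.comp_id _).trans (Category.comp_id _)).trans
      (Category.id_comp _).symm |>.symm
  | .ofNat 3 => ((Category.comp_id _).trans (Category.comp_id _)).trans
      (Category.id_comp _).symm |>.symm
  | .ofNat 4 => ((Category.comp_id _).trans (Category.comp_id _)).trans
      (Category.id_comp _).symm |>.symm
  | .ofNat (_ + 5) => (isZero_zero N).eq_of_src _ _
  | .negSucc _ => (isZero_zero N).eq_of_src _ _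

theorem K0Omega.invariant_c_ofSplices (hb : 5 ≤ b) (hS : Set.Ico 0 (b : ℤ) ⊆ S)
    (h : Set.Icc 0 4 ⊆ S) {X₀ X₁ X₂ X₃ X₄ : N} (s s' : Splice X₀ X₁ X₂ X₃ X₄) :
    (K0Omega.invariant N hS).c (NatBinary.ofSplices s s') =
      K0Omega.ofBinary (ofSplices s s' h) := by
  rw [K0Omega.invariant_c hS ((NatBinary.isBin_ofSplices s s').mono hb)]
  exact K0Omega.ofBinary_eq_of_iso (BinaryAcyclicComplex.isoMk (extObjFiveTerm s s')
    (extObjFiveTerm_comp s s') (extObjFiveTerm_comp' s s'))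

/-- The complexes `sComplex` in terms of `spliceTwo`. -/
theorem AdditiveInvariant.c_sComplex_eq_ofSplices {V : Type w} [AddCommGroup V]
    (c : AdditiveInvariant N V b) (hb : 5 ≤ b) {J K P J' K' P₁ P₁' P₀ : N} (β : StabEq J K)
    {i : J ⟶ P} {p : P ⟶ J'} (hJ : N.Confl i p) {i' : K ⟶ P} {p' : P ⟶ K'} (hK : N.Confl i' p')
    {j : J' ⟶ P₁} {q : P₁ ⟶ P₀} (h : N.Confl j q) {j' : K' ⟶ P₁} {q' : P₁ ⟶ P₀}
    (h' : N.Confl j' q') {j'' : K' ⟶ P₁'} {q'' : P₁' ⟶ P₀} (h'' : N.Confl j'' q'')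
    (e : P₁' ≅ P₁) (he : j'' ≫ e.hom = j') (he' : e.inv ≫ q'' = q') :
    c.c (sComplex β hJ hK h h') = c.c (NatBinary.ofSplices (spliceTwo β.confl' hJ h)
      ((spliceTwo β.confl hK h'').transport e (flipOuter _ _ _))) := by
  have hflip : biprod.lift (biprod.lift biprod.snd (biprod.fst ≫ biprod.snd) ≫ β.b)
      (biprod.fst ≫ biprod.fst) = (flipOuter J β.S K).inv ≫ biprod.map β.b (𝟙 K) := by
    rw [flipOuter_inv]
    apply biprod.hom_ext
    · rw [Category.assoc, biprod.map_fst, biprod.lift_fst, biprod.lift_fst_assoc]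
    · simp
  refine c.c_ofSplices_congr hb _ _ _ _ (Iso.refl _) (Iso.refl _) (Iso.refl _) (Iso.refl _)
    (Iso.refl _) ?_ ?_ ?_ ?_ ?_ ?_ ?_ ?_
  · exact (Category.id_comp _).trans (Category.comp_id _).symm
  · exact (Category.id_comp _).trans (Category.comp_id _).symm
  · exact (Category.id_comp _).trans (Category.comp_id _).symm
  · exact (Category.id_comp _).trans (Category.comp_id _).symm
  · exact ((Category.id_comp _).trans he').trans (Category.comp_id _).symm
  · refine (Category.id_comp _).trans (Eq.trans ?_ (Category.comp_id _).symm)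
    exact congrArg ((biprod.snd ≫ p') ≫ ·) he
  · refine (Category.id_comp _).trans (Eq.trans ?_ (Category.comp_id _).symm)
    exact congrArg (· ≫ biprod.map (𝟙 β.B) i') hflip.symm
  · refine (Category.id_comp _).trans (Eq.trans ?_ (Category.comp_id _).symm)
    change (β.a ≫ biprod.inl) ≫ (flipOuter J β.S K).hom =
      biprod.lift (biprod.lift 0 (β.a ≫ biprod.snd)) (β.a ≫ biprod.fst)
    ext <;> simp

theorem StabEq.map_comp_flipFirst {J K : N} (β : StabEq J K) :
    biprod.map (𝟙 K) β.a ≫ (flipFirst K J β.S).hom =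
      biprod.lift (biprod.snd ≫ β.a ≫ biprod.fst)
        (biprod.lift biprod.fst (biprod.snd ≫ β.a ≫ biprod.snd)) := by
  ext <;> simp

theorem StabEq.flipFirst_comp {J K : N} (β : StabEq J K) :
    (flipFirst K J β.S).inv ≫ biprod.snd ≫ β.b =
      biprod.lift biprod.fst (biprod.snd ≫ biprod.snd) ≫ β.b := by
  rw [flipFirst_inv, ← Category.assoc]
  congr 1
  ext <;> simp

namespace ShorteningData

variable {P : BinaryAcyclicComplex T N} {m : ℤ} (D : ShorteningData P m)

/-- The stable equivalence in degree `k`. -/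
def stabEq (k : ℤ) (hk : 2 ≤ k) : StabEq (D.J.Z k) (D.K.Z k) where
  A := D.A k
  B := D.B k
  S := D.S k
  a := D.a k
  b := D.b k
  a' := D.a' k
  b' := D.b' k
  confl := D.confl k hk
  confl' := D.confl' k hk

/-- The restriction of the data to degrees indexed by natural numbers. -/
noncomputable def toStabData (hneg : ∀ n < 0, IsZero (P.X n)) : StabData (P.natFrom 0) where
  J := D.J.toNat (fun n => (n : ℤ) - 0) (BinaryAcyclicComplex.sub_succ 0) (hneg _ (by norm_num))
  K := D.K.toNat (fun n => (n : ℤ) - 0) (BinaryAcyclicComplex.sub_succ 0) (hneg _ (by norm_num))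
  α n := D.stabEq (((n + 2 : ℕ) : ℤ) - 0) (by omega)

theorem bounded_toStabData (hneg : ∀ n < 0, IsZero (P.X n)) (hm : ∀ n, m < n → IsZero (P.X n)) :
    (D.toStabData hneg).Bounded (m - 2).toNat := fun n hn =>
  ⟨hm _ (by push_cast; omega), D.isZero (((n + 2 : ℕ) : ℤ) - 0) (by omega)⟩

/-- The degree below `k` is a variable `w`, since indices coming from `natFrom` equal `k - 1` only
propositionally. Once `w` is replaced by `k - 1`, the transports become identities. -/
theorem invariant_c_complexGen (hb : 5 ≤ b) (hS : Set.Ico 0 (b : ℤ) ⊆ S) (h : Set.Icc 0 4 ⊆ S)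
    {k : ℤ} (hk : 3 ≤ k) {w : ℤ} (hw : k - 1 = w) (hw2 : 2 ≤ w)
    (hL : N.Confl (D.J.ι k) (D.J.p k ≫ eqToHom (congrArg D.J.Z hw)))
    (hM : N.Confl (D.K.ι k) (D.K.p k ≫ eqToHom (congrArg D.K.Z hw))) :
    (K0Omega.invariant N hS).c (sComplexNext (D.stabEq w hw2) (D.stabEq k (by omega)) hL hM) =
      K0Omega.ofBinary (D.complexGen k hk h) := by
  subst hw
  have key : ∀ {q : P.X k ⟶ D.J.Z (k - 1)} {q' : P.X k ⟶ D.K.Z (k - 1)}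
      (hL : N.Confl (D.J.ι k) q) (hM : N.Confl (D.K.ι k) q') (_ : q = D.J.p k)
      (_ : q' = D.K.p k),
      (K0Omega.invariant N hS).c (sComplexNext (D.stabEq (k - 1) hw2) (D.stabEq k (by omega)) hL
        hM) = K0Omega.ofBinary (D.complexGen k hk h) := by
    rintro _ _ hL hM rfl rfl
    refine Eq.trans ?_ (K0Omega.invariant_c_ofSplices hb hS h _ _)
    refine (K0Omega.invariant N hS).c_sComplex_eq_ofSplices hb _ _ _ _ _
      ((D.confl (k - 1) hw2).add_left (D.K.Z (k - 1))) (flipFirst _ _ _) ?_ ?_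
    · exact (D.stabEq (k - 1) hw2).map_comp_flipFirst
    · exact (D.stabEq (k - 1) hw2).flipFirst_comp
  exact key hL hM (Category.comp_id _) (Category.comp_id _)

theorem invariant_c_term (hb : 5 ≤ b) (hS : Set.Ico 0 (b : ℤ) ⊆ S) (h : Set.Icc 0 4 ⊆ S)
    (hneg : ∀ n < 0, IsZero (P.X n)) : ∀ n : ℕ,
    (K0Omega.invariant N hS).c ((D.toStabData hneg).term n) =
      K0Omega.ofBinary (D.complex hneg (n + 2) h)
  | 0 => by
    have h1 : D.complex hneg ((0 : ℕ) + 2) h = D.complexTwo hneg h := dif_neg (by norm_num)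
    rw [h1]
    refine Eq.trans ?_ (K0Omega.invariant_c_ofSplices hb hS h _ _)
    have h2 := (K0Omega.invariant N hS).c_sComplex_eq_ofSplices hb (D.stabEq 2 le_rfl)
      (D.J.confl 2) (D.K.confl 2) (D.J.confl_one hneg) (D.K.confl_one hneg) (D.K.confl_one hneg)
      (Iso.refl _) (Category.comp_id _) (Category.id_comp _)
    refine Eq.trans ?_ h2
    have key : ∀ {q : P.X 2 ⟶ D.J.Z 1} {q' : P.X 2 ⟶ D.K.Z 1} {r r' : P.X 1 ⟶ P.X 0}
        (hL : N.Confl (D.J.ι 2) q) (hM : N.Confl (D.K.ι 2) q') (hr : N.Confl (D.J.ι 1) r)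
        (hr' : N.Confl (D.K.ι 1) r') (_ : q = D.J.p 2) (_ : q' = D.K.p 2) (_ : r = P.d 1)
        (_ : r' = P.d' 1), (K0Omega.invariant N hS).c (sComplex (D.stabEq 2 le_rfl) hL hM hr hr') =
        (K0Omega.invariant N hS).c (sComplex (D.stabEq 2 le_rfl)
      (D.J.confl 2) (D.K.confl 2) (D.J.confl_one hneg) (D.K.confl_one hneg)) := by
      rintro _ _ _ _ _ _ _ _ rfl rfl rfl rfl
      rfl
    exact key ((D.toStabData hneg).J.confl 1) ((D.toStabData hneg).K.confl 1)
      (D.toStabData hneg).J.confl_bottom (D.toStabData hneg).K.confl_bottom (Category.comp_id _) (Category.comp_id _)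
      (Category.comp_id _) (Category.comp_id _)
  | n + 1 => by
    have e : ((n + 1 : ℕ) : ℤ) + 2 = ((n + 3 : ℕ) : ℤ) - 0 := by push_cast; ring
    have h1 : D.complex hneg ((n + 1 : ℕ) + 2) h =
        D.complexGen (((n + 3 : ℕ) : ℤ) - 0) (by omega) h := by
      rw [e]
      exact dif_pos _
    rw [h1]
    exact D.invariant_c_complexGen hb hS h _ (BinaryAcyclicComplex.sub_succ 0 (n + 2)) (by omega)
      ((D.toStabData hneg).J.confl (n + 2)) ((D.toStabData hneg).K.confl (n + 2))

/-- `P` has no negative degrees, so `j = 0` and no sign from shifting occurs. The summand with index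
`n` is the complex of degree `n + 2`, which has the same parity, and `m - 2` as bound gives the
degrees from 2 to `m`. -/
theorem shorten_ofBinary (hb : 8 ≤ b) (hS : Set.Ico 0 (b : ℤ) ⊆ S) (h : Set.Icc 0 4 ⊆ S)
    (hm2 : 2 ≤ m) (hneg : ∀ n < 0, IsZero (P.X n)) (hm : ∀ n, m < n → IsZero (P.X n)) :
    K0Omega.shorten hb hS T N (K0Omega.ofBinary P) =
      ∑ n ∈ Finset.Icc 2 m, (n.negOnePow : ℤ) • K0Omega.ofBinary (D.complex hneg n h) := by
  have h0 : ∀ z < -((0 : ℕ) : ℤ), IsZero (P.X z) := fun z hz => hneg z (by simpa using hz)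
  rw [K0Omega.shorten_ofBinary, AdditiveInvariant.intSum_eq _ hb P h0 (D.toStabData hneg)
    (D.bounded_toStabData hneg hm), pow_zero, one_smul, AdditiveInvariant.sum]
  refine Finset.sum_bij (fun n _ => (n : ℤ) + 2) (fun n hn => ?_) (fun a _ c _ hac => ?_)
    (fun k hk => ?_) (fun n _ => ?_)
  · simp only [Finset.mem_range, Finset.mem_Icc] at hn ⊢
    omega
  · simpa using hac
  · simp only [Finset.mem_Icc] at hk
    exact ⟨(k - 2).toNat, by simp only [Finset.mem_range]; omega, by omega⟩
  · rw [D.invariant_c_term (by omega) hS h hneg n, Int.negOnePow_add]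
    simp [Int.negOnePow_even 2 even_two, Int.coe_negOnePow_natCast]

/-- As in natural degrees, but the induction starts below zero, where both cycle objects vanish.
From degree `m` on, equivalences between zero objects are taken so that all auxiliary objects
vanish. -/
theorem exists_of_factorizations (J : AcyclicFactorization N P.X P.d)
    (K : AcyclicFactorization N P.X P.d') (hneg : ∀ n < 0, IsZero (P.X n))
    (hm : ∀ n, m < n → IsZero (P.X n)) : ∃ D : ShorteningData P m, D.J = J ∧ D.K = K := by
  have h0 : ∀ n, Nonempty (StabEq (J.Z n) (K.Z n)) := fun n => by
    induction n using int_induction_of_lt 0 with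
    | h n hn => exact ⟨StabEq.ofIso ((J.isZero_Z (hneg n hn)).iso (K.isZero_Z (hneg n hn)))⟩
    | step n ih => exact ⟨ih.some.next (J.confl n) (K.confl n)⟩
  have h1 : ∀ n, ∃ α : StabEq (J.Z n) (K.Z n), m ≤ n →
      IsZero α.A ∧ IsZero α.B ∧ IsZero α.S := fun n => by
    by_cases hn : m ≤ n
    · have hX := hm (n + 1) (by omega)
      have e : n + 1 - 1 = n := by omega
      have hJ : IsZero (J.Z n) := e ▸ (J.confl (n + 1)).isZero_right hX
      have hK : IsZero (K.Z n) := e ▸ (K.confl (n + 1)).isZero_right hX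
      let α : StabEq (J.Z n) (K.Z n) := StabEq.ofIso (hJ.iso hK)
      obtain ⟨hA, hB⟩ := α.isZero_mid hJ (isZero_zero N)
      exact ⟨α, fun _ => ⟨hA, hB, isZero_zero N⟩⟩
    · exact ⟨(h0 n).some, fun h => absurd h hn⟩
  choose α hα using h1
  exact ⟨{
    J := J
    K := K
    A n := (α n).A
    B n := (α n).B
    S n := (α n).S
    a n := (α n).a
    b n := (α n).b
    a' n := (α n).a'
    b' n := (α n).b'
    confl n _ := (α n).confl
    confl' n _ := (α n).confl'
    isZero n hn := hα n hn }, rfl, rfl⟩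

end ShorteningData

end Formula


open ConflationCategory
open scoped ZeroObject

variable {L M N : ConflationCategory.{v, u}} [L.IsExact] [M.IsExact] [N.IsExact]
  {S S' T T' U : Set ℤ}

/-! ### Exchanging directions of multicomplexes -/

/-- The composite of exact functors. -/
def ExactFunctor.comp (F : ExactFunctor L M) (G : ExactFunctor M N) : ExactFunctor L N where
  functor := F.functor ⋙ G.functor
  additive := inferInstance
  map_conflation T hT := G.map_conflation _ (F.map_conflation T hT)

namespace AcyclicFactorization

variable {X Y W : ℤ → N} {dX : ∀ n, X n ⟶ X (n - 1)} {dY : ∀ n, Y n ⟶ Y (n - 1)}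
  {dW : ∀ n, W n ⟶ W (n - 1)} (FX : AcyclicFactorization N X dX)
  (FY : AcyclicFactorization N Y dY) (FW : AcyclicFactorization N W dW)

theorem mono_ι (n : ℤ) : Mono (FX.ι n) := (FX.confl n).mono

theorem mapZ_eq {f : ∀ n, X n ⟶ Y n} (hf : ∀ n, f n ≫ dY n = dX n ≫ f (n - 1)) {n : ℤ}
    {g : FX.Z n ⟶ FY.Z n} (h : g ≫ FY.ι n = FX.ι n ≫ f n) : FX.mapZ FY f hf n = g := by
  have := FY.mono_ι n
  rw [← cancel_mono (FY.ι n), mapZ_ι, h]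

end AcyclicFactorization

namespace BinaryAcyclicComplex

section Cycles

variable (δ : ∀ (P : BinaryAcyclicComplex T N) (t : ℤ), P.X t ⟶ P.X (t - 1))
  (hδ : ∀ {P Q : BinaryAcyclicComplex T N} (f : P ⟶ Q) (t : ℤ),
    f.f t ≫ δ Q t = δ P t ≫ f.f (t - 1))
  (F : ∀ P : BinaryAcyclicComplex T N, AcyclicFactorization N P.X (δ P))

/-- The cycles in degree `t` of one of the differentials, as an exact functor. -/
noncomputable def cycles (t : ℤ) : ExactFunctor (Bq T N) N :=
  let functor : BinaryAcyclicComplex T N ⥤ N :=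
    { obj P := (F P).Z t
      map {P Q} f := (F P).mapZ (F Q) f.f (hδ f) t
      map_id P := AcyclicFactorization.mapZ_eq _ _ _ (by simp)
      map_comp {P Q R} f g := AcyclicFactorization.mapZ_eq _ _ _ (by
        rw [Category.assoc, AcyclicFactorization.mapZ_ι, ← Category.assoc,
          AcyclicFactorization.mapZ_ι, Category.assoc, comp_f]) }
  { functor := functor
    additive := ⟨fun {P Q f g} => AcyclicFactorization.mapZ_eq _ _ (hδ (f + g)) (by
      simp only [functor, Preadditive.add_comp, AcyclicFactorization.mapZ_ι, ← Preadditive.comp_add]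
      rfl)⟩
    map_conflation E hE := by
      obtain ⟨a, b, hab⟩ := BinaryAcyclicComplex.bounded E.X₂
      exact ((F E.X₁).confl_mapZ (F E.X₂) (F E.X₃) E.f.f (hδ E.f) E.g.f (hδ E.g)
        (fun n => ⟨_, hE n⟩) (fun n hn => hab n (Or.inl hn)) t).2 }

include F in
/-- The acyclicity of the second direction, in the category of complexes in the first direction. -/
theorem acyclic_slices (P : BinaryAcyclicComplex S (Bq T N)) :
    Nonempty (AcyclicFactorization (Bq S N)
      (fun t => (Bq.map subset_rfl (Bq.eval T N t)).functor.obj P)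
      (fun t => ⟨fun s => δ (P.X s) t, fun s => (hδ (P.d s) t).symm,
        fun s => (hδ (P.d' s) t).symm⟩)) :=
  -- Taking cycles of the inner complexes is an exact functor, so the cycles still form binary
  -- acyclic complexes in the outer direction.
  ⟨{  Z t := (Bq.map subset_rfl (cycles δ hδ F t)).functor.obj P
      p t := ⟨fun s => (F (P.X s)).p t, fun s => (F _).p_mapZ (F _) _ (hδ (P.d s)) t,
        fun s => (F _).p_mapZ (F _) _ (hδ (P.d' s)) t⟩
      ι t := ⟨fun s => (F (P.X s)).ι t, fun s => ((F _).mapZ_ι (F _) _ (hδ (P.d s)) t).symm,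
        fun s => ((F _).mapZ_ι (F _) _ (hδ (P.d' s)) t).symm⟩
      fac t := hom_ext fun s => (F (P.X s)).fac t
      confl t := (confl_iff _ _).2 fun s => (F (P.X s)).confl t }⟩

end Cycles

/-- The exchange of the two directions of a double complex. -/
def swap (P : BinaryAcyclicComplex S (Bq T N)) : BinaryAcyclicComplex T (Bq S N) where
  X t := (Bq.map subset_rfl (Bq.eval T N t)).functor.obj P
  d t := ⟨fun s => BinaryAcyclicComplex.d (P.X s) t, fun s => ((P.d s).comm t).symm,
    fun s => ((P.d' s).comm t).symm⟩
  d' t := ⟨fun s => BinaryAcyclicComplex.d' (P.X s) t, fun s => ((P.d s).comm' t).symm,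
    fun s => ((P.d' s).comm' t).symm⟩
  acyclic := acyclic_slices (T := T) (N := N) (fun Q => Q.d) (fun f => f.comm)
    (fun Q => Q.acyclic.some) P
  acyclic' := acyclic_slices (T := T) (N := N) (fun Q => Q.d') (fun f => f.comm')
    (fun Q => Q.acyclic'.some) P
  bounded := by
    obtain ⟨a, b, hab⟩ := P.bounded
    have h : ∀ s, ∃ a' b' : ℤ, ∀ t, t < a' ∨ b' < t → IsZero (X (P.X s) t) := fun s =>
      BinaryAcyclicComplex.bounded (P.X s)
    choose a' b' hab' using h
    -- The bounds of the inner complexes depend on the outer degree, but only finitely many outer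
    -- degrees carry nonzero objects.
    obtain ⟨A, hA⟩ := ((Finset.Icc a b).image a').bddBelow
    obtain ⟨B, hB⟩ := ((Finset.Icc a b).image b').bddAbove
    refine ⟨A, B, fun t ht => isZero_of_forall fun s => ?_⟩
    by_cases hs : s ∈ Finset.Icc a b
    · have h1 := hA (Finset.mem_coe.2 (Finset.mem_image_of_mem a' hs))
      have h2 := hB (Finset.mem_coe.2 (Finset.mem_image_of_mem b' hs))
      exact hab' s t (by omega)
    · exact (eval T N t).map_isZero (hab s (by
        simp only [Finset.mem_Icc, not_and_or, not_le] at hs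
        omega))
  supported t ht := isZero_of_forall fun s => BinaryAcyclicComplex.supported (P.X s) t ht

end BinaryAcyclicComplex

/-- The exchange of the two directions of a double complex, as an exact functor. -/
def Bq.swap (S T : Set ℤ) (N : ConflationCategory.{v, u}) [N.IsExact] : ExactFunctor (Bq S (Bq T N)) (Bq T (Bq S N)) :=
  let functor : BinaryAcyclicComplex S (Bq T N) ⥤ BinaryAcyclicComplex T (Bq S N) :=
    { obj P := P.swap
      map f :=
        { f t := (Bq.map subset_rfl (Bq.eval T N t)).functor.map f
          comm t := BinaryAcyclicComplex.hom_ext fun s => (f.f s).comm t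
          comm' t := BinaryAcyclicComplex.hom_ext fun s => (f.f s).comm' t }
      map_id _ := rfl
      map_comp _ _ := rfl }
  { functor := functor
    additive := ⟨rfl⟩
    map_conflation _ h t s := h s t }

/-- Moving the outermost direction of a multicomplex to the innermost place. -/
def iterBq.moveIn (S T : Set ℤ) (N : ConflationCategory.{v, u}) [N.IsExact] :
    (n : ℕ) → ExactFunctor (Bq T (iterBq S n N)) (iterBq S n (Bq T N))
  | 0 => ExactFunctor.id (Bq T N)
  | n + 1 => (Bq.swap T S (iterBq S n N)).comp (Bq.map subset_rfl (iterBq.moveIn S T N n))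

/-- Moving the innermost direction of a multicomplex to the outermost place. -/
def iterBq.moveOut (S T : Set ℤ) (N : ConflationCategory.{v, u}) [N.IsExact] :
    (n : ℕ) → ExactFunctor (iterBq S n (Bq T N)) (Bq T (iterBq S n N))
  | 0 => ExactFunctor.id (Bq T N)
  | n + 1 => (Bq.map subset_rfl (iterBq.moveOut S T N n)).comp (Bq.swap S T (iterBq S n N))

/-- `swap` is a strict involution, so this is an equality of functors and not merely an isomorphism.
The same strictness gives the two compatibilities with `iterBq.map`. -/
theorem iterBq.moveIn_comp_moveOut : ∀ n : ℕ,
    (iterBq.moveIn S T N n).comp (iterBq.moveOut S T N n) = ExactFunctor.id _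
  | 0 => rfl
  | n + 1 => congrArg (fun F => ((Bq.swap T S (iterBq S n N)).comp (Bq.map (subset_refl S) F)).comp
      (Bq.swap S T (iterBq S n N))) (iterBq.moveIn_comp_moveOut n)

theorem iterBq.map_comp_moveIn (F : ExactFunctor M N) : ∀ n : ℕ,
    (Bq.map (subset_refl T) (iterBq.map (subset_refl S) F n)).comp (iterBq.moveIn S T N n) =
      (iterBq.moveIn S T M n).comp (iterBq.map (subset_refl S) (Bq.map (subset_refl T) F) n)
  | 0 => rfl
  | n + 1 => congrArg (fun G => (Bq.swap T S (iterBq S n M)).comp (Bq.map (subset_refl S) G))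
      (iterBq.map_comp_moveIn F n)

theorem iterBq.map_comp_moveOut (h : S ⊆ S') (F : ExactFunctor M N) : ∀ n : ℕ,
    (iterBq.map h (Bq.map (subset_refl T) F) n).comp (iterBq.moveOut S' T N n) =
      (iterBq.moveOut S T M n).comp (Bq.map (subset_refl T) (iterBq.map h F n))
  | 0 => rfl
  | n + 1 => congrArg (fun G => (Bq.map h G).comp (Bq.swap S' T (iterBq S' n N)))
      (iterBq.map_comp_moveOut h F n)

/-! ### Diagonal multicomplexes -/

theorem IsDiagonal.moveIn : ∀ (n : ℕ) (k : Fin n) (P : BinaryAcyclicComplex T (iterBq S n N)),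
    (∀ t, IsDiagonal S N n k (P.X t)) →
      IsDiagonal S (Bq T N) n k ((iterBq.moveIn S T N n).functor.obj P)
  | n + 1, ⟨0, _⟩, P, hP => by
    have h : BinaryAcyclicComplex.d P.swap = BinaryAcyclicComplex.d' P.swap :=
      funext fun s => BinaryAcyclicComplex.hom_ext fun t => congrFun (hP t) s
    exact funext fun s => congrArg (iterBq.moveIn S T N n).functor.map (congrFun h s)
  | n + 1, ⟨k + 1, hk⟩, P, hP => fun s =>
    IsDiagonal.moveIn n ⟨k, Nat.lt_of_succ_lt_succ hk⟩ (P.swap.X s) fun t => hP t s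

theorem IsDiagonal.moveOut : ∀ (n : ℕ) (k : Fin n) (P : iterBq S n (Bq T N)),
    IsDiagonal S (Bq T N) n k P →
      ∀ t, IsDiagonal S N n k
        (BinaryAcyclicComplex.X ((iterBq.moveOut S T N n).functor.obj P) t)
  | n + 1, ⟨0, _⟩, P, hP, t => by
    have h : BinaryAcyclicComplex.d P = BinaryAcyclicComplex.d' P := hP
    exact funext fun s => congrArg (fun f => BinaryAcyclicComplex.Hom.f
      ((iterBq.moveOut S T N n).functor.map f) t) (congrFun h s)
  | n + 1, ⟨k + 1, hk⟩, P, hP, t => fun s =>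
    IsDiagonal.moveOut n ⟨k, Nat.lt_of_succ_lt_succ hk⟩ (BinaryAcyclicComplex.X P s) (hP s) t

/-- The innermost top and bottom differentials of the multicomplex coincide. -/
def IsInnerDiagonal (S T : Set ℤ) (N : ConflationCategory.{v, u}) :
    (n : ℕ) → iterBq S n (Bq T N) → Prop
  | 0, P => BinaryAcyclicComplex.d P = BinaryAcyclicComplex.d' P
  | n + 1, P => ∀ s, IsInnerDiagonal S T N n (BinaryAcyclicComplex.X P s)

theorem IsInnerDiagonal.moveIn : ∀ (n : ℕ) (P : BinaryAcyclicComplex T (iterBq S n N)),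
    P.d = P.d' → IsInnerDiagonal S T N n ((iterBq.moveIn S T N n).functor.obj P)
  | 0, _, hP => hP
  | n + 1, P, hP => fun s => IsInnerDiagonal.moveIn n (P.swap.X s)
      (funext fun t => congrArg (fun f => BinaryAcyclicComplex.Hom.f f s) (congrFun hP t))

theorem IsInnerDiagonal.moveOut : ∀ (n : ℕ) (P : iterBq S n (Bq T N)),
    IsInnerDiagonal S T N n P →
      BinaryAcyclicComplex.d ((iterBq.moveOut S T N n).functor.obj P) =
        BinaryAcyclicComplex.d' ((iterBq.moveOut S T N n).functor.obj P)
  | 0, _, hP => hP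
  | n + 1, P, hP => funext fun t => BinaryAcyclicComplex.hom_ext fun s =>
      congrFun (IsInnerDiagonal.moveOut n (BinaryAcyclicComplex.X P s) (hP s)) t

/-- The exact functor that replaces the bottom differential by the top differential. -/
def Bq.diag (T : Set ℤ) (N : ConflationCategory.{v, u}) : ExactFunctor (Bq T N) (Bq T N) :=
  let functor : BinaryAcyclicComplex T N ⥤ BinaryAcyclicComplex T N :=
    { obj P := { P with d' := P.d, acyclic' := P.acyclic }
      map f := ⟨f.f, f.comm, f.comm⟩
      map_id _ := rfl
      map_comp _ _ := rfl }
  { functor := functor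
    additive := ⟨rfl⟩
    map_conflation _ h := h }

/-- The exact functor that replaces the bottom differential in the direction `k` by the top
differential. -/
def iterBq.diag (S : Set ℤ) (N : ConflationCategory.{v, u}) :
    (n : ℕ) → Fin n → ExactFunctor (iterBq S n N) (iterBq S n N)
  | n + 1, ⟨0, _⟩ => Bq.diag S (iterBq S n N)
  | n + 1, ⟨k + 1, hk⟩ =>
    Bq.map subset_rfl (iterBq.diag S N n ⟨k, Nat.lt_of_succ_lt_succ hk⟩)

theorem isDiagonal_diag : ∀ (n : ℕ) (k : Fin n) (P : iterBq S n N),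
    IsDiagonal S N n k ((iterBq.diag S N n k).functor.obj P)
  | _ + 1, ⟨0, _⟩, _ => rfl
  | n + 1, ⟨k + 1, hk⟩, P => fun s =>
    isDiagonal_diag n ⟨k, Nat.lt_of_succ_lt_succ hk⟩ (BinaryAcyclicComplex.X P s)

theorem isInnerDiagonal_diag : ∀ (n : ℕ) (P : iterBq S n (Bq T N)),
    IsInnerDiagonal S T N n ((iterBq.map (subset_refl S) (Bq.diag T N) n).functor.obj P)
  | 0, _ => rfl
  | n + 1, P => fun s => isInnerDiagonal_diag n (BinaryAcyclicComplex.X P s)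

/-- On the objects with the property `D`, the functor `F` is naturally isomorphic to the
identity. -/
def ExactFunctor.IsIdOn (F : ExactFunctor M M) (D : M → Prop) : Prop :=
  ∃ e : ∀ X, D X → (X ≅ F.functor.obj X), ∀ {X Y : M} (hX : D X) (hY : D Y) (f : X ⟶ Y),
    (e X hX).hom ≫ F.functor.map f = f ≫ (e Y hY).hom

theorem Bq.isIdOn_diag : (Bq.diag T N).IsIdOn
    fun P => BinaryAcyclicComplex.d P = BinaryAcyclicComplex.d' P :=
  ⟨fun P hP => BinaryAcyclicComplex.isoMk (fun n => Iso.refl (BinaryAcyclicComplex.X P n))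
    (fun _ => (Category.id_comp _).trans (Category.comp_id _).symm)
    (fun n => (Category.id_comp _).trans ((congrFun hP n).trans (Category.comp_id _).symm)),
    fun _ _ f => BinaryAcyclicComplex.hom_ext fun n =>
      (Category.id_comp (BinaryAcyclicComplex.Hom.f f n)).trans (Category.comp_id _).symm⟩

/-- The naturality in `IsIdOn` is what makes the isomorphisms in the single degrees commute with the
differentials. -/
theorem ExactFunctor.IsIdOn.map {F : ExactFunctor M M} {D : M → Prop} (h : F.IsIdOn D) :
    (Bq.map (subset_refl S) F).IsIdOn fun P => ∀ n, D (BinaryAcyclicComplex.X P n) := by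
  obtain ⟨e, he⟩ := h
  exact ⟨fun P hP => BinaryAcyclicComplex.isoMk (fun n => e _ (hP n)) (fun n => he _ _ _)
    (fun n => he _ _ _), fun hP hQ f => BinaryAcyclicComplex.hom_ext fun n => he (hP n) (hQ n) _⟩

/-- A diagonal multicomplex is thus isomorphic to its image under an exact functor. This is how
naturality can be used to show that a homomorphism kills diagonal classes. -/
theorem isIdOn_isDiagonal : ∀ (n : ℕ) (k : Fin n),
    (iterBq.diag S N n k).IsIdOn (IsDiagonal S N n k)
  | _ + 1, ⟨0, _⟩ => Bq.isIdOn_diag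
  | n + 1, ⟨k + 1, hk⟩ => (isIdOn_isDiagonal n ⟨k, Nat.lt_of_succ_lt_succ hk⟩).map

theorem isIdOn_isInnerDiagonal : ∀ n : ℕ,
    (iterBq.map (subset_refl S) (Bq.diag T N) n).IsIdOn (IsInnerDiagonal S T N n)
  | 0 => Bq.isIdOn_diag
  | n + 1 => (isIdOn_isInnerDiagonal n).map


open ConflationCategory

variable {M N : ConflationCategory.{v, u}} [M.IsExact] [N.IsExact] {S T G : Set ℤ}

/-! ### Shortening in several directions -/

namespace K0Omega

theorem map_of (n : ℕ) (F : ExactFunctor M N) (P : iterBq S n M) :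
    K0Omega.map n S F (of P) = of ((iterBq.map subset_rfl F n).functor.obj P) :=
  mapIncl_of _ F P

theorem incl_of (n : ℕ) (h : S ⊆ T) (P : iterBq S n N) :
    incl n h N (of P) = of ((iterBq.map h (ExactFunctor.id N) n).functor.obj P) :=
  mapIncl_of h _ P

/-- The canonical homomorphism from `K₀` to `K₀(Ωⁿ)`. -/
def ofK0 (n : ℕ) (S : Set ℤ) (N : ConflationCategory.{v, u}) :
    K0 (iterBq S n N) →+ K0Omega n S N := QuotientAddGroup.mk' _

/-- The class of a complex of multicomplexes. -/
def ofComplex (n : ℕ) (P : Bq S (iterBq S n N)) : K0Omega (n + 1) S N := of (n := n + 1) P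

theorem map_ofComplex (n : ℕ) (F : ExactFunctor M N) (P : Bq S (iterBq S n M)) :
    map (n + 1) S F (ofComplex n P) =
      ofComplex n ((Bq.map subset_rfl (iterBq.map subset_rfl F n)).functor.obj P) :=
  map_of (n + 1) F P

theorem incl_ofComplex (n : ℕ) (h : S ⊆ T) (P : Bq S (iterBq S n N)) :
    incl (n + 1) h N (ofComplex n P) =
      ofComplex n ((Bq.map h (iterBq.map h (ExactFunctor.id N) n)).functor.obj P) :=
  incl_of (n + 1) h P

theorem ofComplex_eq_zero (n : ℕ) {P : Bq S (iterBq S n N)}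
    (h : BinaryAcyclicComplex.d P = BinaryAcyclicComplex.d' P) : ofComplex n P = 0 :=
  of_eq_zero (n := n + 1) (k := 0) h

theorem ofComplex_eq_zero' (n : ℕ) (k : Fin n) {P : Bq S (iterBq S n N)}
    (h : ∀ t, IsDiagonal S N n k (BinaryAcyclicComplex.X P t)) : ofComplex n P = 0 :=
  of_eq_zero (n := n + 1) (k := k.succ) h

/-- The class of a complex, as a homomorphism from `K₀(Ω)`. -/
def ofOmega (S : Set ℤ) (N : ConflationCategory.{v, u}) [N.IsExact] (n : ℕ) :
    K0Omega 1 S (iterBq S n N) →+ K0Omega (n + 1) S N :=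
  lift (n := 1) (N := iterBq S n N) (show K0 (Bq S (iterBq S n N)) →+ K0Omega (n + 1) S N from
    ofK0 (n + 1) S N) fun k P hP => by
      obtain rfl := Subsingleton.elim k 0
      exact ofComplex_eq_zero n (P := P) hP

theorem ofComplex_moveOut_eq_add (h : T ⊆ S) (n : ℕ) {P Q R : iterBq S n (Bq T N)} (i : P ⟶ Q)
    (p : Q ⟶ R) (hip : (iterBq S n (Bq T N)).Confl i p) :
    ofComplex n ((Bq.map h (ExactFunctor.id _)).functor.obj
        ((iterBq.moveOut S T N n).functor.obj Q)) =
      ofComplex n ((Bq.map h (ExactFunctor.id _)).functor.obj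
        ((iterBq.moveOut S T N n).functor.obj P)) +
      ofComplex n ((Bq.map h (ExactFunctor.id _)).functor.obj
        ((iterBq.moveOut S T N n).functor.obj R)) :=
  of_eq_add (n := n + 1) ((Bq.map h (ExactFunctor.id _)).map_confl
    ((iterBq.moveOut S T N n).map_confl hip))

/-- The homomorphism induced by moving the innermost direction to the outermost place. -/
def moveOut (h : T ⊆ S) (N : ConflationCategory.{v, u}) [N.IsExact] (n : ℕ) :
    K0Omega n S (Bq T N) →+ K0Omega (n + 1) S N :=
  lift (K0.lift (fun P => ofComplex n ((Bq.map h (ExactFunctor.id _)).functor.obj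
    ((iterBq.moveOut S T N n).functor.obj P))) (ofComplex_moveOut_eq_add h n)) fun k P hP =>
    (K0.lift_of _ (ofComplex_moveOut_eq_add h n) P).trans
      (ofComplex_eq_zero' n k fun t => IsDiagonal.moveOut n k P hP t)

theorem moveOut_of (h : T ⊆ S) (n : ℕ) (P : iterBq S n (Bq T N)) :
    moveOut h N n (of P) = ofComplex n ((Bq.map h (ExactFunctor.id _)).functor.obj
      ((iterBq.moveOut S T N n).functor.obj P)) :=
  K0.lift_of _ (ofComplex_moveOut_eq_add h n) P

theorem moveOut_map (F : ExactFunctor M N) (n : ℕ) (x : K0Omega n S (Bq S M)) :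
    moveOut subset_rfl N n (map n S (Bq.map subset_rfl F) x) =
      map (n + 1) S F (moveOut subset_rfl M n x) := by
  have h : (moveOut subset_rfl N n).comp (map n S (Bq.map subset_rfl F)) =
      (map (n + 1) S F).comp (moveOut (subset_refl S) M n) := by
    apply hom_ext
    intro P
    rw [AddMonoidHom.comp_apply, AddMonoidHom.comp_apply, map_of, moveOut_of, moveOut_of,
      map_ofComplex]
    exact congrArg (fun E : ExactFunctor _ _ => ofComplex n (E.functor.obj P))
      (iterBq.map_comp_moveOut (T := S) (subset_refl S) F n)
  exact DFunLike.congr_fun h x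

theorem incl_moveOut (h : S ⊆ G) (n : ℕ) (x : K0Omega n S (Bq S N)) :
    incl (n + 1) h N (moveOut subset_rfl N n x) =
      moveOut h N n (incl n h (Bq S N) x) := by
  have h : (incl (n + 1) h N).comp (moveOut subset_rfl N n) =
      (moveOut h N n).comp (incl n h (Bq S N)) := by
    apply hom_ext
    intro P
    rw [AddMonoidHom.comp_apply, AddMonoidHom.comp_apply, incl_of, moveOut_of, moveOut_of,
      incl_ofComplex]
    exact (congrArg (fun E : ExactFunctor _ _ => ofComplex n
      ((Bq.map h (ExactFunctor.id _)).functor.obj (E.functor.obj P)))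
        (iterBq.map_comp_moveOut (T := S) h (ExactFunctor.id N) n)).symm
  exact DFunLike.congr_fun h x

section Step

variable (n : ℕ) (s : ∀ (N : ConflationCategory.{v, u}) [N.IsExact],
  K0Omega n G N →+ K0Omega n S N)

theorem moveOut_moveIn_eq_add {P Q R : Bq S (iterBq G n N)} (i : P ⟶ Q) (p : Q ⟶ R)
    (hip : (Bq S (iterBq G n N)).Confl i p) :
    moveOut subset_rfl N n (s (Bq S N) (of ((iterBq.moveIn G S N n).functor.obj Q))) =
      moveOut subset_rfl N n (s (Bq S N) (of ((iterBq.moveIn G S N n).functor.obj P))) +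
      moveOut subset_rfl N n (s (Bq S N) (of ((iterBq.moveIn G S N n).functor.obj R))) := by
  rw [of_eq_add ((iterBq.moveIn G S N n).map_confl hip), map_add, map_add]

variable
  (hs : ∀ (M N : ConflationCategory.{v, u}) [M.IsExact] [N.IsExact] (F : ExactFunctor M N),
    (map n S F).comp (s M) = (s N).comp (map n G F))

/-- Shortening in the inner directions, for a complex that is short in the outermost direction. -/
noncomputable def shortenInner (N : ConflationCategory.{v, u}) [N.IsExact] :
    K0Omega 1 S (iterBq G n N) →+ K0Omega (n + 1) S N :=
  lift (n := 1) (N := iterBq G n N) (K0.lift (M := Bq S (iterBq G n N))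
    (fun P => moveOut subset_rfl N n (s (Bq S N) (of ((iterBq.moveIn G S N n).functor.obj P))))
    (moveOut_moveIn_eq_add n s)) fun k P hP => by
    obtain rfl := Subsingleton.elim k 0
    -- After the move, equality of the outermost differentials is a property of the coefficients in
    -- `Bq S N`. The class therefore comes from the functor `Bq.diag`, with which `s` commutes, and
    -- `moveOut` kills whatever comes from that functor.
    have h1 : IsInnerDiagonal G S N n ((iterBq.moveIn G S N n).functor.obj P) :=
      IsInnerDiagonal.moveIn n P hP
    obtain ⟨e, -⟩ := isIdOn_isInnerDiagonal (S := G) (T := S) (N := N) n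
    have h2 := (of_eq_of_iso (e _ h1)).trans (map_of n (Bq.diag S N) _).symm
    have h3 : ∀ x, moveOut subset_rfl N n (map n S (Bq.diag S N) x) = 0 := fun x => by
      have : (moveOut subset_rfl N n).comp (map n S (Bq.diag S N)) = 0 := by
        apply hom_ext
        intro Q
        rw [AddMonoidHom.comp_apply, map_of, moveOut_of]
        exact ofComplex_eq_zero n (IsInnerDiagonal.moveOut n _ (isInnerDiagonal_diag n Q))
      exact DFunLike.congr_fun this x
    refine (K0.lift_of (M := Bq S (iterBq G n N)) _ (moveOut_moveIn_eq_add n s) P).trans ?_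
    refine (congrArg (fun x => moveOut subset_rfl N n (s (Bq S N) x)) h2).trans ?_
    exact (congrArg (moveOut subset_rfl N n)
      (DFunLike.congr_fun (hs _ _ (Bq.diag S N)) (of _))).symm.trans (h3 _)

theorem shortenInner_ofBinary (P : Bq S (iterBq G n N)) :
    shortenInner n s hs N (ofBinary P) = moveOut subset_rfl N n
      (s (Bq S N) (of ((iterBq.moveIn G S N n).functor.obj P))) :=
  K0.lift_of (M := Bq S (iterBq G n N)) _ (moveOut_moveIn_eq_add n s) P

theorem shortenInner_map (F : ExactFunctor M N) (x : K0Omega 1 S (iterBq G n M)) :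
    shortenInner n s hs N (map 1 S (iterBq.map subset_rfl F n) x) =
      map (n + 1) S F (shortenInner n s hs M x) := by
  have h : (shortenInner n s hs N).comp (map 1 S (iterBq.map subset_rfl F n)) =
      (map (n + 1) S F).comp (shortenInner n s hs M) := by
    apply ofBinary_hom_ext
    intro P
    rw [AddMonoidHom.comp_apply, AddMonoidHom.comp_apply, map_ofBinary]
    refine (shortenInner_ofBinary n s hs _).trans (Eq.trans ?_ ((moveOut_map F n _).trans
      (congrArg (map (n + 1) S F) (shortenInner_ofBinary n s hs P).symm)))
    refine congrArg (moveOut subset_rfl N n) ?_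
    refine Eq.trans ?_ (DFunLike.congr_fun (hs _ _ (Bq.map (subset_refl S) F)) (of _)).symm
    refine congrArg (s (Bq S N)) (Eq.trans ?_ (map_of n _ _).symm)
    exact congrArg (fun E : ExactFunctor _ _ => of (E.functor.obj P))
      (iterBq.map_comp_moveIn (S := G) (T := S) F n)
  exact DFunLike.congr_fun h x

/-- In the other directions the move preserves diagonality, so the class vanishes before `s` is
applied to it. -/
theorem shortenInner_diag (k : Fin n) (x : K0Omega 1 S (iterBq G n N)) :
    shortenInner n s hs N (map 1 S (iterBq.diag G N n k) x) = 0 := by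
  have h : (shortenInner n s hs N).comp (map 1 S (iterBq.diag G N n k)) = 0 := by
    apply ofBinary_hom_ext
    intro P
    rw [AddMonoidHom.comp_apply, map_ofBinary]
    refine (shortenInner_ofBinary n s hs _).trans ?_
    have h1 := of_eq_zero (IsDiagonal.moveIn (T := S) n k
      ((Bq.map subset_rfl (iterBq.diag G N n k)).functor.obj P)
      fun t => isDiagonal_diag n k (P.X t))
    exact (congrArg (fun x => moveOut subset_rfl N n (s (Bq S N) x)) h1).trans
      (by rw [map_zero, map_zero]; rfl)
  exact DFunLike.congr_fun h x

/-- The hypothesis `hs'` is used for the coefficient category `Bq S N`. It removes `s`, and then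
moving the direction in and out again is the identity. -/
theorem incl_shortenInner (h : S ⊆ G)
    (hs' : ∀ (N : ConflationCategory.{v, u}) [N.IsExact],
      (incl n h N).comp (s N) = AddMonoidHom.id _) (x : K0Omega 1 S (iterBq G n N)) :
    incl (n + 1) h N (shortenInner n s hs N x) =
      ofOmega G N n (incl 1 h (iterBq G n N) x) := by
  have h : (incl (n + 1) h N).comp (shortenInner n s hs N) =
      (ofOmega G N n).comp (incl 1 h (iterBq G n N)) := by
    apply ofBinary_hom_ext
    intro P
    refine (congrArg (incl (n + 1) h N) (shortenInner_ofBinary n s hs P)).trans ?_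
    refine (incl_moveOut h n _).trans (Eq.trans ?_
      (congrArg (ofOmega G N n) (incl_ofBinary h P)).symm)
    refine (congrArg (moveOut h N n) (DFunLike.congr_fun (hs' (Bq S N)) (of _))).trans ?_
    refine (moveOut_of h n _).trans ?_
    exact congrArg (fun E : ExactFunctor _ _ => ofComplex n
      ((Bq.map h (ExactFunctor.id _)).functor.obj (E.functor.obj P)))
        (iterBq.moveIn_comp_moveOut (S := G) (T := S) (N := N) n)
  exact DFunLike.congr_fun h x

variable {b : ℕ} (hb : 8 ≤ b) (hS : Set.Ico 0 (b : ℤ) ⊆ S)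

/-- Shortening in one more direction. -/
noncomputable def shortenSucc (N : ConflationCategory.{v, u}) [N.IsExact] :
    K0Omega (n + 1) G N →+ K0Omega (n + 1) S N :=
  lift (n := n + 1) (show K0 (Bq G (iterBq G n N)) →+ K0Omega (n + 1) S N from
    ((shortenInner n s hs N).comp (shorten hb hS G (iterBq G n N))).comp
      (ofK0 1 G (iterBq G n N))) fun k P hP => by
    change shortenInner n s hs N (shorten hb hS G (iterBq G n N)
      (ofBinary (S := G) (N := iterBq G n N) P)) = 0
    match k, hP with
    | ⟨0, _⟩, hP => rw [ofBinary_eq_zero hP, map_zero, map_zero]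
    | ⟨k + 1, hk⟩, hP =>
      obtain ⟨e, -⟩ := (isIdOn_isDiagonal (S := G) (N := N) n
        ⟨k, Nat.lt_of_succ_lt_succ hk⟩).map (S := G)
      -- In a direction other than the outermost, the diagonal complex is isomorphic to its image
      -- under `iterBq.diag` applied degreewise. Shortening commutes with this functor, which
      -- reduces the claim to `shortenInner_diag`.
      have h1 := DFunLike.congr_fun (map_shorten hb hS (T := G) (iterBq.diag G N n
        ⟨k, Nat.lt_of_succ_lt_succ hk⟩)) (ofBinary P)
      have h2 := (ofBinary_eq_of_iso (e P hP)).trans (map_ofBinary (iterBq.diag G N n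
        ⟨k, Nat.lt_of_succ_lt_succ hk⟩) P).symm
      exact (congrArg (fun x => shortenInner n s hs N (shorten hb hS G (iterBq G n N) x)) h2).trans
        ((congrArg (shortenInner n s hs N) h1.symm).trans (shortenInner_diag n s hs _ _))

theorem shortenSucc_ofComplex (P : Bq G (iterBq G n N)) :
    shortenSucc n s hs hb hS N (ofComplex n P) =
      shortenInner n s hs N (shorten hb hS G (iterBq G n N) (ofBinary P)) := rfl

theorem ofComplex_hom_ext {V : Type w} [AddCommGroup V] {φ ψ : K0Omega (n + 1) G N →+ V}
    (h : ∀ P, φ (ofComplex n P) = ψ (ofComplex n P)) : φ = ψ := hom_ext h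

theorem map_shortenSucc (F : ExactFunctor M N) :
    (map (n + 1) S F).comp (shortenSucc n s hs hb hS M) =
      (shortenSucc n s hs hb hS N).comp (map (n + 1) G F) := by
  apply ofComplex_hom_ext
  intro P
  rw [AddMonoidHom.comp_apply, AddMonoidHom.comp_apply, map_ofComplex, shortenSucc_ofComplex,
    shortenSucc_ofComplex, ← shortenInner_map]
  have h1 := DFunLike.congr_fun (map_shorten hb hS (T := G) (iterBq.map (subset_refl G) F n))
    (ofBinary P)
  exact congrArg (shortenInner n s hs N)
    (h1.trans (congrArg (shorten hb hS G (iterBq G n N)) (map_ofBinary _ P)))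

/-- The inner directions are taken care of by `hs'`, the outermost one by `incl_comp_shorten` over
the category of n-dimensional multicomplexes. -/
theorem incl_comp_shortenSucc (hG : G = Set.univ ∨ G = Set.Ici 0) (h : S ⊆ G)
    (hs' : ∀ (N : ConflationCategory.{v, u}) [N.IsExact],
      (incl n h N).comp (s N) = AddMonoidHom.id _) :
    (incl (n + 1) h N).comp (shortenSucc n s hs hb hS N) = AddMonoidHom.id _ := by
  apply ofComplex_hom_ext
  intro P
  have h1 := DFunLike.congr_fun (incl_comp_shorten (N := iterBq G n N) hG hb hS h) (ofBinary P)
  rw [AddMonoidHom.comp_apply, shortenSucc_ofComplex, incl_shortenInner n s hs h hs']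
  exact congrArg (ofOmega G N n) h1

end Step

/-- Natural sections exist in all dimensions. -/
theorem exists_section (hG : G = Set.univ ∨ G = Set.Ici 0) {b : ℕ} (hb : 8 ≤ b)
    (hS : Set.Ico 0 (b : ℤ) ⊆ S) (h : S ⊆ G) (n : ℕ) :
    ∃ s : ∀ (N : ConflationCategory.{v, u}) [N.IsExact], K0Omega n G N →+ K0Omega n S N,
      (∀ (N : ConflationCategory.{v, u}) [N.IsExact],
        (incl n h N).comp (s N) = AddMonoidHom.id _) ∧
      (∀ (M N : ConflationCategory.{v, u}) [M.IsExact] [N.IsExact] (F : ExactFunctor M N),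
        (map n S F).comp (s M) = (s N).comp (map n G F)) := by
  induction n with
  | zero =>
    -- In dimension zero both groups are `K0 N`, since no direction is left for the support to
    -- restrict; the section is the identity.
    have key (N : ConflationCategory.{v, u}) (k : Fin 0) (P : iterBq G 0 N) :
        IsDiagonal G N 0 k P → ofK0 0 S N (K0.of (M := N) P) = 0 := k.elim0
    refine ⟨fun N _ => lift (n := 0) (S := G) (N := N) (ofK0 0 S N) (key N),
      fun N _ => ?_, fun M N _ _ F => ?_⟩
    · exact hom_ext (n := 0) (S := G) fun P => incl_of (S := S) 0 h P
    · exact hom_ext (n := 0) (S := G) fun P => (map_of (S := S) 0 F P).trans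
        (congrArg (lift (n := 0) (S := G) (N := N) (ofK0 0 S N) (key N))
          (map_of (S := G) 0 F P)).symm
  | succ n ih =>
    obtain ⟨s, hs', hs⟩ := ih
    exact ⟨fun N _ => shortenSucc n s hs hb hS N,
      fun N _ => incl_comp_shortenSucc n s hs hb hS hG h hs',
      fun M N _ _ F => map_shortenSucc n s hs hb hS F⟩

end K0Omega

end GraysonK

theorem theorem1p4 (G : Set ℤ) (hG : G = Set.univ ∨ G = Set.Ici 0)
    (h7 : Set.Icc 0 7 ⊆ G) :
    ∃ s : ∀ (n : ℕ) (N : GraysonK.ConflationCategory.{v, u}) [N.IsExact],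
        GraysonK.K0Omega n G N →+ GraysonK.K0Omega n (Set.Icc 0 7) N,
      (∀ (n : ℕ) (N : GraysonK.ConflationCategory.{v, u}) [N.IsExact],
        (GraysonK.K0Omega.incl n h7 N).comp (s n N) = AddMonoidHom.id _) ∧
      (∀ (n : ℕ) (M N : GraysonK.ConflationCategory.{v, u}) [M.IsExact] [N.IsExact]
        (F : GraysonK.ExactFunctor M N),
        (GraysonK.K0Omega.map n (Set.Icc 0 7) F).comp (s n M) =
          (s n N).comp (GraysonK.K0Omega.map n G F)) ∧
      (∀ (N : GraysonK.ConflationCategory.{v, u}) [N.IsExact]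
        (P : GraysonK.BinaryAcyclicComplex G N) (m : ℤ) (_ : 2 ≤ m)
        (hneg : ∀ n < 0, IsZero (P.X n)) (_ : ∀ n, m < n → IsZero (P.X n)),
        (∀ (J : GraysonK.AcyclicFactorization N P.X P.d)
          (K : GraysonK.AcyclicFactorization N P.X P.d'),
          ∃ D : GraysonK.ShorteningData P m, D.J = J ∧ D.K = K) ∧
        ∀ D : GraysonK.ShorteningData P m,
          s 1 N (GraysonK.K0Omega.ofBinary P) =
            ∑ n ∈ Finset.Icc 2 m,
              (n.negOnePow : ℤ) • GraysonK.K0Omega.ofBinary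
                (D.complex hneg n GraysonK.Icc_zero_four_subset)) := by
  classical
  have hS : Set.Ico 0 ((8 : ℕ) : ℤ) ⊆ Set.Icc 0 7 := fun x hx => ⟨hx.1, by
    have := hx.2
    push_cast at this
    omega⟩
  choose t ht ht' using fun n =>
    GraysonK.K0Omega.exists_section.{v, u} hG (b := 8) le_rfl hS h7 n
  -- Naturality and the section property concern each `n` separately, so for `n = 1` the section may
  -- be `shorten` itself, for which the explicit formula holds.
  refine ⟨fun n N _ => match n with
    | 0 => t 0 N
    | 1 => GraysonK.K0Omega.shorten le_rfl hS G N
    | n + 2 => t (n + 2) N, ?_, ?_, ?_⟩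
  · rintro (_ | _ | n) N _
    · exact ht 0 N
    · exact GraysonK.K0Omega.incl_comp_shorten hG le_rfl hS h7
    · exact ht (n + 2) N
  · rintro (_ | _ | n) M N _ _ F
    · exact ht' 0 M N F
    · exact GraysonK.K0Omega.map_shorten le_rfl hS F
    · exact ht' (n + 2) M N F
  · intro N _ P m hm2 hneg hm
    exact ⟨fun J K => GraysonK.ShorteningData.exists_of_factorizations J K hneg hm,
      fun D => D.shorten_ofBinary le_rfl hS GraysonK.Icc_zero_four_subset hm2 hneg hm⟩
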